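/- Let $n\ge 2$ and let $W=W(D_n)$ be the group of signed permutations of $\{1,\dots,n\}$ with an even number of sign changes, acting on $V=\mathbb R^n$ with standard basis $e_1,\dots,e_n$. Let $\lambda=(\lambda_1\ge\dots\ge\lambda_p>0)$ be a partition of $m<n-1$ ($m=0$ is allowed), let $a_k$ be the number of parts equal to $k$, and put $l=n-m$ and $u_i=l+\sum_{j<i}\lambda_j$. Let $P_\lambda=W(D_l)\times\prod_i\mathfrak S_{\lambda_i}\le W$, where $W(D_l)$ acts on the points $1,\dots,l$ and $\mathfrak S_{\lambda_i}$ acts on the $i$-th block $\{u_i+1,\dots,u_i+\lambda_i\}$. A parabolic subgroup of $W$ has label $\lambda$ if it is conjugate in $W$ to $P_\lambda$. If a reflection group $R$ is normal in a group $G\le \mathrm O(V)$, the Howlett complement of $R$ in $G$ (with respect to a choice of positive roots of $R$) is the group of all $g\in G$ that map the set of positive roots of $R$ to itself. Let $N=N_W(P)$ for a parabolic subgroup $P$ of $W$. The orthogonal complement $Q$ of $P$ in $W$ is the group generated by all reflections of $W$ whose roots are orthogonal to all roots of $P$. Put $X=\mathrm{Fix}_V(P)$, $Y=\mathrm{Fix}_V(Q)$;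 let $D$ be the Howlett complement of $PQ$ in $N$, let $A$ be the subgroup of $D$ fixing $Y^\perp$ pointwise and $B$ the subgroup of $D$ fixing $X\cap Y$ pointwise. **Proposition.** Every conjugate $P$ of $P_\lambda$ in $W$ is parabolic, and for every choice of positive roots of $P$ its Howlett complement in $N_W(P)$ is a complement of $P$ in $N_W(P)$ and is isomorphic to $\prod_{k=1}^m W(B_{a_k})$. More precisely, let $P=P_\lambda$ and let positive roots be those of the form $e_j\pm e_i$ with $i<j$. Then $$N=((P\rtimes A)\times Q)\rtimes B$$ (internal products of subgroups). Define signed permutations as follows. If $\lambda_i=\lambda_{i+1}=k$, then $x_i$ maps $v\mapsto v+k$ for $u_i<v\le u_i+k$, $v\mapsto v-k$ for $u_i+k<v\le u_i+2k$, and fixes all other points. The element $y_i$ maps $v\mapsto-(u_i+u_{i+1}+1-v)$ for $u_i<v\le u_{i+1}:=u_i+\lambda_i$ and fixes all other points; and $z_i$ acts as $y_i$ on the $i$-th block, maps $1\mapsto-1$, and fixes all other points. If $\lambda_i=\lambda_{i+1}$ put $y_i'=x_iy_iy_{i+1}$. If $a_1>1$ put $z_0=z_j$ with $j=\min\{i:\lambda_i=1\}$.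 Below, $y_j$ is taken only for even $\lambda_j$ and $z_j$ only for odd $\lambda_j$. (a) If $a_1\le1$, then * $Q=\langle y_j\mid\lambda_j=2\rangle$ is a reflection group of type $A_1^{a_2}$; * $A=\langle x_i,y_j,z_j\mid\lambda_i=\lambda_{i+1}>2,\ \lambda_j\ne2\rangle$ is of type $B_{a_1}B_{a_3}\cdots B_{a_m}$; * $B=\langle x_i\mid\lambda_i=\lambda_{i+1}=2\rangle\cong\mathfrak S_{a_2}$; * $Q\rtimes B$ is a Coxeter group of type $B_{a_2}$ on $Y^\perp$, and $P\rtimes B$ is a Coxeter group of type $D_lB_{a_2}A_2^{a_3}\cdots A_{m-1}^{a_m}$ on $X^\perp$. (b) If $a_1>1$, then * $Q=\langle x_i,y_i',y_j\mid\lambda_i=\lambda_{i+1}=1,\ \lambda_j=2\rangle$ is a reflection group of type $D_{a_1}A_1^{a_2}$; * $A=\langle x_i,y_j,z_j\mid\lambda_i=\lambda_{i+1}>2,\ \lambda_j>2\rangle$ is of type $B_{a_3}\cdots B_{a_m}$; * $B=\langle x_i,z_0\mid\lambda_i=\lambda_{i+1}=2\rangle\cong\langle z_0\rangle\times\mathfrak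 S_{a_2}$; * $Q\rtimes B$ is a Coxeter group of type $B_{a_1}B_{a_2}$ on $Y^\perp$, and $P\rtimes B$ is a Coxeter group of type $B_lB_{a_2}A_2^{a_3}\cdots A_{m-1}^{a_m}$ on $X^\perp$. In both cases $A$ acts on $X\cap Y$ faithfully as a reflection group, of the type stated for $A$, and $B$ acts as a reflection group on $Y^\perp$ and on $X^\perp$. (Conventions: $B_0$ and $A_0$ are trivial, $B_1=A_1$, $D_2=A_1\times A_1$, $D_3=A_3$. A group is a Coxeter group of type $M$ on a space $U$ if it acts faithfully on $U$ as the group generated by the reflections in linearly independent unit vectors $\alpha_i$ with $\langle\alpha_i,\alpha_j\rangle=-\cos(\pi/M_{ij})$.) -/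

import Mathlib

noncomputable section

namespace ReflGrp

/-! ### Reflection groups, parabolic subgroups, orthogonal complements, Howlett complements

`E` is a finite dimensional Euclidean space, and `E ≃ₗᵢ[ℝ] E` its orthogonal group `O(E)`. -/

section General

variable {E : Type*} [NormedAddCommGroup E] [InnerProductSpace ℝ E] [FiniteDimensional ℝ E]

/-- The reflection `s_α` in the hyperplane orthogonal to `α`. -/
def refl (α : E) : E ≃ₗᵢ[ℝ] E := (Submodule.span ℝ {α})ᗮ.reflection

/-- `t` is a reflection. -/
def IsRefl (t : E ≃ₗᵢ[ℝ] E) : Prop := ∃ α : E, α ≠ 0 ∧ t = refl α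

/-- The fixed point space `Fix(U)`. -/
def fixedSpace (U : Subgroup (E ≃ₗᵢ[ℝ] E)) : Submodule ℝ E where
  carrier := {v | ∀ g ∈ U, g v = v}
  add_mem' := by
    intro a b ha hb g hg
    rw [map_add, ha g hg, hb g hg]
  zero_mem' := by
    intro g _
    exact map_zero g
  smul_mem' := by
    intro c v hv g hg
    rw [map_smul, hv g hg]

/-- The pointwise stabilizer `Z_W(X)`. -/
def pointStab (W : Subgroup (E ≃ₗᵢ[ℝ] E)) (X : Set E) : Subgroup (E ≃ₗᵢ[ℝ] E) where
  carrier := {g | g ∈ W ∧ ∀ v ∈ X, g v = v}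
  mul_mem' := by
    rintro a b ⟨ha, ha'⟩ ⟨hb, hb'⟩
    refine ⟨W.mul_mem ha hb, fun v hv => ?_⟩
    rw [LinearIsometryEquiv.coe_mul, Function.comp_apply, hb' v hv, ha' v hv]
  one_mem' := ⟨W.one_mem, fun _ _ => rfl⟩
  inv_mem' := by
    rintro a ⟨ha, ha'⟩
    refine ⟨W.inv_mem ha, fun v hv => ?_⟩
    rw [LinearIsometryEquiv.inv_def, LinearIsometryEquiv.symm_apply_eq, ha' v hv]

/-- `P` is a parabolic subgroup of `W`: the pointwise stabilizer in `W` of some set of vectors. -/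
def IsParabolic (W P : Subgroup (E ≃ₗᵢ[ℝ] E)) : Prop := ∃ X : Set E, P = pointStab W X

/-- The normalizer `N_W(P)`. -/
def normalizerIn (W P : Subgroup (E ≃ₗᵢ[ℝ] E)) : Subgroup (E ≃ₗᵢ[ℝ] E) :=
  W ⊓ Subgroup.normalizer (P : Set (E ≃ₗᵢ[ℝ] E))

/-- The orthogonal complement of `P` in `W`: the subgroup generated by the reflections `t` of `W`
with `t ⟂ s` for all reflections `s` of `P`.  Here `refl α ⟂ refl β` means that the two reflecting
hyperplanes, equivalently `α` and `β`, are orthogonal. -/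
def orthComplement (W P : Subgroup (E ≃ₗᵢ[ℝ] E)) : Subgroup (E ≃ₗᵢ[ℝ] E) :=
  Subgroup.closure {t | t ∈ W ∧ ∃ β : E, β ≠ 0 ∧ t = refl β ∧
    ∀ α : E, α ≠ 0 → refl α ∈ P → inner ℝ α β = 0}

/-- The (unit) root system of a reflection group `P`. -/
def roots (P : Subgroup (E ≃ₗᵢ[ℝ] E)) : Set E := {α | ‖α‖ = 1 ∧ refl α ∈ P}

/-- `ρ` lies on no reflecting hyperplane of `P`, and so defines a system of positive roots. -/
def IsRegularVec (P : Subgroup (E ≃ₗᵢ[ℝ] E)) (ρ : E) : Prop := ∀ α ∈ roots P, inner ℝ α ρ ≠ 0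

/-- The positive roots of `P` with respect to the regular vector `ρ`. -/
def posRoots (P : Subgroup (E ≃ₗᵢ[ℝ] E)) (ρ : E) : Set E := {α | α ∈ roots P ∧ 0 < inner ℝ α ρ}

/-- The Howlett complement of the normal reflection subgroup `P` of `G`, with respect to the
positive roots defined by `ρ`: the elements of `G` that map the set of positive roots of `P` onto
itself (for finite root systems this is the same as mapping it into itself). -/
def howlettComplement (P G : Subgroup (E ≃ₗᵢ[ℝ] E)) (ρ : E) : Subgroup (E ≃ₗᵢ[ℝ] E) where
  carrier := {g | g ∈ G ∧ ∀ α, g α ∈ posRoots P ρ ↔ α ∈ posRoots P ρ}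
  mul_mem' := by
    rintro a b ⟨ha, ha'⟩ ⟨hb, hb'⟩
    refine ⟨G.mul_mem ha hb, fun α => ?_⟩
    rw [LinearIsometryEquiv.coe_mul, Function.comp_apply, ha', hb']
  one_mem' := ⟨G.one_mem, fun _ => Iff.rfl⟩
  inv_mem' := by
    rintro a ⟨ha, ha'⟩
    refine ⟨G.inv_mem ha, fun α => ?_⟩
    rw [← ha' (a⁻¹ α), LinearIsometryEquiv.inv_def, LinearIsometryEquiv.apply_symm_apply]

/-- The Howlett complement `D` of `P Q` in `N_W(P)`, where `Q` is the orthogonal complement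
of `P`. -/
def groupD (W P : Subgroup (E ≃ₗᵢ[ℝ] E)) (ρ : E) : Subgroup (E ≃ₗᵢ[ℝ] E) :=
  howlettComplement (P ⊔ orthComplement W P) (normalizerIn W P) ρ

/-- The subgroup `A` of `D`: the elements acting trivially on `Yᗮ`, where `Y = Fix(Q)`. -/
def groupA (W P : Subgroup (E ≃ₗᵢ[ℝ] E)) (ρ : E) : Subgroup (E ≃ₗᵢ[ℝ] E) :=
  pointStab (groupD W P ρ) ((fixedSpace (orthComplement W P))ᗮ : Submodule ℝ E)

/-- The subgroup `B` of `D`: the elements acting trivially on `X ∩ Y`, where `X = Fix(P)` and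
`Y = Fix(Q)`. -/
def groupB (W P : Subgroup (E ≃ₗᵢ[ℝ] E)) (ρ : E) : Subgroup (E ≃ₗᵢ[ℝ] E) :=
  pointStab (groupD W P ρ) (fixedSpace P ⊓ fixedSpace (orthComplement W P) : Submodule ℝ E)

/-- The group of isometries of `U` that are restrictions of elements of `G`. -/
def restrictTo (G : Subgroup (E ≃ₗᵢ[ℝ] E)) (U : Submodule ℝ E) : Subgroup (U ≃ₗᵢ[ℝ] U) where
  carrier := {h | ∃ g ∈ G, ∀ u : U, ((h u : U) : E) = g u}
  mul_mem' := by
    rintro a b ⟨g, hg, h1⟩ ⟨k, hk, h2⟩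
    refine ⟨g * k, G.mul_mem hg hk, fun u => ?_⟩
    rw [LinearIsometryEquiv.coe_mul, LinearIsometryEquiv.coe_mul, Function.comp_apply,
      Function.comp_apply, h1, h2]
  one_mem' := ⟨1, G.one_mem, fun _ => rfl⟩
  inv_mem' := by
    rintro a ⟨g, hg, h1⟩
    refine ⟨g⁻¹, G.inv_mem hg, fun u => ?_⟩
    rw [LinearIsometryEquiv.inv_def, LinearIsometryEquiv.inv_def,
      LinearIsometryEquiv.eq_symm_apply, ← h1, LinearIsometryEquiv.apply_symm_apply]

/-- `G` leaves the subspace `U` invariant. -/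
def Stabilizes (G : Subgroup (E ≃ₗᵢ[ℝ] E)) (U : Submodule ℝ E) : Prop :=
  ∀ g ∈ G, ∀ u ∈ U, g u ∈ U

/-- `G` acts on `U` as a reflection group: `U` is `G`-invariant and the group of isometries of `U`
induced by `G` is generated by reflections of `U`. -/
def ActsAsReflectionGroup (G : Subgroup (E ≃ₗᵢ[ℝ] E)) (U : Submodule ℝ E) : Prop :=
  Stabilizes G U ∧ Subgroup.closure {t | t ∈ restrictTo G U ∧ IsRefl t} = restrictTo G U

/-- `G` is a finite reflection group on `E` of Coxeter type `M`: it is generated by the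
reflections in a system of simple roots (linearly independent unit vectors) whose mutual angles
`π - π / M i j` are prescribed by the Coxeter matrix `M`. -/
def IsCoxeterGroupOfType {I : Type*} (G : Subgroup (E ≃ₗᵢ[ℝ] E)) (M : CoxeterMatrix I) : Prop :=
  ∃ α : I → E, LinearIndependent ℝ α ∧
    (∀ i j, inner ℝ (α i) (α j) = -Real.cos (Real.pi / (M i j : ℝ))) ∧
    G = Subgroup.closure (Set.range fun i => refl (α i))

/-- `G` is a Coxeter group of type `M` on `U`: `U` is `G`-invariant, `G` acts faithfully on `U`,
and the group of isometries of `U` induced by `G` is a reflection group of type `M`. -/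
def ActsAsCoxeterGroup {I : Type*} (G : Subgroup (E ≃ₗᵢ[ℝ] E)) (U : Submodule ℝ E)
    (M : CoxeterMatrix I) : Prop :=
  Stabilizes G U ∧ (∀ g ∈ G, (∀ u ∈ U, g u = u) → g = 1) ∧
    IsCoxeterGroupOfType (restrictTo G U) M

end General

/-! ### Internal products of subgroups -/

/-- `N = K ⋊ H` as an internal semidirect product of subgroups. -/
def IsSemidirect {Γ : Type*} [Group Γ] (N K H : Subgroup Γ) : Prop :=
  (∀ h ∈ H, ∀ k ∈ K, h * k * h⁻¹ ∈ K) ∧ K ⊓ H = ⊥ ∧ K ⊔ H = N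

/-- `N = K × H` as an internal direct product of subgroups. -/
def IsDirect {Γ : Type*} [Group Γ] (N K H : Subgroup Γ) : Prop :=
  (∀ h ∈ H, ∀ k ∈ K, h * k = k * h) ∧ K ⊓ H = ⊥ ∧ K ⊔ H = N

/-! ### Coxeter matrices -/

/-- The disjoint union of two Coxeter diagrams. -/
def coxSum {I J : Type*} (M : CoxeterMatrix I) (M' : CoxeterMatrix J) : CoxeterMatrix (I ⊕ J) where
  M := Matrix.fromBlocks M.M (fun _ _ => 2) (fun _ _ => 2) M'.M
  isSymm := Matrix.IsSymm.fromBlocks M.isSymm rfl M'.isSymm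
  diagonal := by
    rintro (i | i)
    · exact M.diagonal i
    · exact M'.diagonal i
  off_diagonal := by
    rintro (i | i) (j | j) h
    · exact M.off_diagonal i j (fun e => h (e ▸ rfl))
    · exact (by decide : (2 : ℕ) ≠ 1)
    · exact (by decide : (2 : ℕ) ≠ 1)
    · exact M'.off_diagonal i j (fun e => h (e ▸ rfl))

open Classical in
/-- The disjoint union of a family of Coxeter diagrams. -/
def coxSigma {ι : Type*} {κ : ι → Type*} (M : ∀ i, CoxeterMatrix (κ i)) :
    CoxeterMatrix (Σ i, κ i) where
  M := Matrix.of fun x y => if h : x.1 = y.1 then M y.1 (h ▸ x.2) y.2 else 2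
  isSymm := by
    ext ⟨i, a⟩ ⟨j, b⟩
    by_cases h : i = j
    · subst h
      simpa using (M i).symmetric b a
    · simp [h, Ne.symm h]
  diagonal := by
    rintro ⟨i, a⟩
    simp
  off_diagonal := by
    rintro ⟨i, a⟩ ⟨j, b⟩ hne
    by_cases h : i = j
    · subst h
      simpa using (M i).off_diagonal a b (fun e => hne (e ▸ rfl))
    · simp [h]

/-- The Coxeter matrix of type `D_n` (for `n ≥ 2`, with `D_2 = A_1 × A_1` and `D_3 = A_3`), with
diagram `1 - 2 - 3 - ⋯ - (n-1)` and one further node `0` joined to `2`.  (`CoxeterMatrix.D` is not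
used since its diagram contains a triangle.) -/
def coxD (n : ℕ) : CoxeterMatrix (Fin n) where
  M := Matrix.of fun i j =>
    if i = j then 1
    else if (1 ≤ i.val ∧ i.val + 1 = j.val) ∨ (1 ≤ j.val ∧ j.val + 1 = i.val) ∨
      (i.val = 0 ∧ j.val = 2) ∨ (j.val = 0 ∧ i.val = 2) then 3
    else 2
  isSymm := by
    ext i j
    simp only [Matrix.transpose_apply, Matrix.of_apply, eq_comm (a := j) (b := i)]
    congr 2
    apply propext
    tauto
  diagonal := by simp
  off_diagonal := by
    intro i j h
    simp only [Matrix.of_apply, if_neg h]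
    split_ifs <;> decide

/-! ### Signed permutations; the groups `W(B_n)` and `W(D_n)` -/

/-- Euclidean space `ℝⁿ`; its coordinates are numbered `0, …, n - 1`; in comments,
the points permuted by signed permutations are numbered `1, …, n`. -/
abbrev Euc (n : ℕ) : Type := EuclideanSpace ℝ (Fin n)

/-- The standard basis vector `e_i`. -/
def eVec {n : ℕ} (i : Fin n) : Euc n := EuclideanSpace.single i 1

/-- Multiplication of real numbers by a sign. -/
def signIsom (s : ℤˣ) : ℝ ≃ₗᵢ[ℝ] ℝ :=
  if s = 1 then LinearIsometryEquiv.refl ℝ ℝ else LinearIsometryEquiv.neg ℝ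

/-- The signed permutation `e_i ↦ ε i • e_(σ i)`. -/
def signedPerm {n : ℕ} (σ : Equiv.Perm (Fin n)) (ε : Fin n → ℤˣ) : Euc n ≃ₗᵢ[ℝ] Euc n :=
  (LinearIsometryEquiv.piLpCongrRight 2 fun i => signIsom (ε i)).trans
    (LinearIsometryEquiv.piLpCongrLeft 2 ℝ ℝ σ)

theorem signIsom_apply (s : ℤˣ) (x : ℝ) : signIsom s x = ((s : ℤ) : ℝ) * x := by
  rcases Int.units_eq_one_or s with rfl | rfl
  · simp [signIsom]
  · simp [signIsom]

theorem signedPerm_apply {n : ℕ} (σ : Equiv.Perm (Fin n)) (ε : Fin n → ℤˣ) (v : Euc n)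
    (j : Fin n) : signedPerm σ ε v j = ((ε (σ.symm j) : ℤ) : ℝ) * v (σ.symm j) := by
  simp [signedPerm, signIsom_apply, LinearIsometryEquiv.piLpCongrLeft_apply,
    Equiv.piCongrLeft']

theorem signedPerm_e {n : ℕ} (σ : Equiv.Perm (Fin n)) (ε : Fin n → ℤˣ) (i : Fin n) :
    signedPerm σ ε (eVec i) = ((ε i : ℤ) : ℝ) • eVec (σ i) := by
  ext j
  rw [signedPerm_apply]
  by_cases h : j = σ i
  · subst h
    simp [eVec]
  · have h' : σ.symm j ≠ i := fun hh => h (by rw [← hh, Equiv.apply_symm_apply])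
    simp [eVec, h, h']

theorem signedPerm_one {n : ℕ} : signedPerm (1 : Equiv.Perm (Fin n)) 1 = 1 := by
  ext v j
  rw [signedPerm_apply]
  have h : (Equiv.symm (1 : Equiv.Perm (Fin n))) j = j := rfl
  simp [h]

theorem signedPerm_mul {n : ℕ} (σ τ : Equiv.Perm (Fin n)) (ε δ : Fin n → ℤˣ) :
    signedPerm σ ε * signedPerm τ δ = signedPerm (σ * τ) (fun i => ε (τ i) * δ i) := by
  ext v j
  rw [LinearIsometryEquiv.coe_mul, Function.comp_apply, signedPerm_apply, signedPerm_apply, signedPerm_apply]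
  have h : (σ * τ).symm j = τ.symm (σ.symm j) := rfl
  rw [h, Equiv.apply_symm_apply]
  push_cast
  ring

theorem signedPerm_inv {n : ℕ} (σ : Equiv.Perm (Fin n)) (ε : Fin n → ℤˣ) :
    (signedPerm σ ε)⁻¹ = signedPerm σ⁻¹ (fun i => ε (σ⁻¹ i)) := by
  rw [inv_eq_iff_mul_eq_one, signedPerm_mul, ← signedPerm_one]
  congr 1
  · simp
  · funext i
    simp

/-- The Coxeter group `W(B_n)`, as the group of signed permutations. -/
def WB (n : ℕ) : Subgroup (Euc n ≃ₗᵢ[ℝ] Euc n) where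
  carrier := {w | ∃ σ ε, w = signedPerm σ ε}
  mul_mem' := by
    rintro _ _ ⟨σ, ε, rfl⟩ ⟨τ, δ, rfl⟩
    exact ⟨_, _, signedPerm_mul σ τ ε δ⟩
  one_mem' := ⟨1, 1, signedPerm_one.symm⟩
  inv_mem' := by
    rintro _ ⟨σ, ε, rfl⟩
    exact ⟨_, _, signedPerm_inv σ ε⟩

/-- The Coxeter group `W(D_n)`, as the group of signed permutations with an even number of
sign changes. -/
def WD (n : ℕ) : Subgroup (Euc n ≃ₗᵢ[ℝ] Euc n) where
  carrier := {w | ∃ (σ : Equiv.Perm (Fin n)) (ε : Fin n → ℤˣ), ∏ i, ε i = 1 ∧ w = signedPerm σ ε}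
  mul_mem' := by
    rintro _ _ ⟨σ, ε, h, rfl⟩ ⟨τ, δ, h', rfl⟩
    refine ⟨_, _, ?_, signedPerm_mul σ τ ε δ⟩
    rw [Finset.prod_mul_distrib, Equiv.prod_comp τ ε, h, h', one_mul]
  one_mem' := ⟨1, 1, by simp, signedPerm_one.symm⟩
  inv_mem' := by
    rintro _ ⟨σ, ε, h, rfl⟩
    exact ⟨_, _, by rw [Equiv.prod_comp σ⁻¹ ε, h], signedPerm_inv σ ε⟩

/-! ### Partitions, the standard parabolic subgroup and the elements `x_i`, `y_i`, `z_i`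

A partition of `m` with `p` parts is an antitone family `lam : Fin p → ℕ` of positive integers with
sum `m`. -/

section Partition

variable (n : ℕ) {p : ℕ} (lam : Fin p → ℕ)

/-- `a_k`, the multiplicity of `k` as a part. -/
def mult (k : ℕ) : ℕ := (Finset.univ.filter fun i => lam i = k).card

/-- `l = n - m`. -/
def coreRank : ℕ := n - ∑ i, lam i

/-- `u_i = l + ∑_{j < i} λ_j`. -/
def offset (i : Fin p) : ℕ := coreRank n lam + ∑ j ∈ Finset.univ.filter (· < i), lam j

/-- The point `v` belongs to the `i`-th block `{u_i + 1, …, u_i + λ_i}`. -/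
def InBlock (i : Fin p) (v : Fin n) : Prop :=
  offset n lam i ≤ v.val ∧ v.val < offset n lam i + lam i

instance (i : Fin p) (v : Fin n) : Decidable (InBlock n lam i v) :=
  inferInstanceAs (Decidable (_ ∧ _))

/-- The standard parabolic subgroup `P = W(D_l) × ∏_i 𝔖_{λ_i}` of `W(D_n)` with label `λ`, where
`W(D_l)` acts on the first `l` points and `𝔖_{λ_i}` on the `i`-th block. -/
def stdP : Subgroup (Euc n ≃ₗᵢ[ℝ] Euc n) :=
  Subgroup.closure
    ({t | ∃ v w : Fin n, v < w ∧ w.val < coreRank n lam ∧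
        (t = refl (eVec w - eVec v) ∨ t = refl (eVec w + eVec v))} ∪
     {t | ∃ (i : Fin p) (v w : Fin n), v < w ∧ InBlock n lam i v ∧ InBlock n lam i w ∧
        t = refl (eVec w - eVec v)})

/-- `P` is a parabolic subgroup of `W(D_n)` with label `λ`, i.e., it is conjugate to the standard
one. -/
def HasLabel (P : Subgroup (Euc n ≃ₗᵢ[ℝ] Euc n)) : Prop :=
  ∃ w ∈ WD n, P = (stdP n lam).map (MulAut.conj w).toMonoidHom

/-- The vector `(1, 2, …, n)`, which defines the standard positive roots
`e_j - e_i`, `e_j + e_i`, `i < j`. -/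
def stdRho : Euc n := WithLp.toLp 2 fun i => (i.val : ℝ) + 1

/-- The permutation of `Fin n` induced by an involution `f` of the natural numbers; it fixes the
points that `f` moves outside. -/
def permOfInvolutive (f : ℕ → ℕ) (hf : Function.Involutive f) : Equiv.Perm (Fin n) :=
  Function.Involutive.toPerm (fun v => if h : f v.val < n then ⟨f v.val, h⟩ else v) (by
    intro v
    by_cases h : f v.val < n
    · simp [h, hf v.val]
    · simp [h])

/-- Interchange the intervals `[u, u + k)` and `[u + k, u + 2 k)`. -/
def swapFun (u k v : ℕ) : ℕ :=
  if u ≤ v ∧ v < u + k then v + k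
  else if u + k ≤ v ∧ v < u + 2 * k then v - k
  else v

theorem swapFun_involutive (u k : ℕ) : Function.Involutive (swapFun u k) := by
  intro v
  unfold swapFun
  split_ifs <;> omega

/-- Reverse the interval `[u, u + k)`. -/
def revFun (u k v : ℕ) : ℕ := if u ≤ v ∧ v < u + k then 2 * u + k - 1 - v else v

theorem revFun_involutive (u k : ℕ) : Function.Involutive (revFun u k) := by
  intro v
  unfold revFun
  split_ifs <;> omega

/-- The involution `x_i` (used when `λ_i = λ_{i+1}`), which interchanges the `i`-th block and the
next one. -/
def xElt (i : Fin p) : Euc n ≃ₗᵢ[ℝ] Euc n :=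
  signedPerm (permOfInvolutive n _ (swapFun_involutive (offset n lam i) (lam i))) 1

/-- The involution `y_i`, with `v ↦ -(u_i + u_{i+1} + 1 - v)` for the points `v = 1, …, n` in the
`i`-th block, fixing all other points. -/
def yElt (i : Fin p) : Euc n ≃ₗᵢ[ℝ] Euc n :=
  signedPerm (permOfInvolutive n _ (revFun_involutive (offset n lam i) (lam i)))
    (fun v => if InBlock n lam i v then -1 else 1)

/-- The involution `z_i`, which acts as `y_i` on the `i`-th block and moreover changes the sign of
the first point. -/
def zElt (i : Fin p) : Euc n ≃ₗᵢ[ℝ] Euc n :=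
  signedPerm (permOfInvolutive n _ (revFun_involutive (offset n lam i) (lam i)))
    (fun v => if v.val = 0 ∨ InBlock n lam i v then -1 else 1)

/-- `z_0 = z_j` for `j = min {i | λ_i = 1}` if `a_1 > 1`, and `z_0 = 1` otherwise. -/
def z0 : Euc n ≃ₗᵢ[ℝ] Euc n :=
  if h : 1 < mult lam 1 then
    zElt n lam ((Finset.univ.filter fun i => lam i = 1).min'
      (Finset.card_pos.mp (lt_trans Nat.zero_lt_one h)))
  else 1

/-- `{x_i ∣ λ_i = λ_{i+1}, λ_i ∈ S}`. -/
def xs (S : Set ℕ) : Set (Euc n ≃ₗᵢ[ℝ] Euc n) :=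
  {g | ∃ i j : Fin p, j.val = i.val + 1 ∧ lam i = lam j ∧ lam i ∈ S ∧ g = xElt n lam i}

/-- `{x_i y_i y_{i+1} ∣ λ_i = λ_{i+1}, λ_i ∈ S}`. -/
def xyys (S : Set ℕ) : Set (Euc n ≃ₗᵢ[ℝ] Euc n) :=
  {g | ∃ i j : Fin p, j.val = i.val + 1 ∧ lam i = lam j ∧ lam i ∈ S ∧
    g = xElt n lam i * yElt n lam i * yElt n lam j}

/-- `{y_j ∣ λ_j even, λ_j ∈ S}`. -/
def ys (S : Set ℕ) : Set (Euc n ≃ₗᵢ[ℝ] Euc n) :=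
  {g | ∃ j : Fin p, Even (lam j) ∧ lam j ∈ S ∧ g = yElt n lam j}

/-- `{z_j ∣ λ_j odd, λ_j ∈ S}`. -/
def zs (S : Set ℕ) : Set (Euc n ≃ₗᵢ[ℝ] Euc n) :=
  {g | ∃ j : Fin p, Odd (lam j) ∧ lam j ∈ S ∧ g = zElt n lam j}

/-- The Coxeter group `∏_{k ∈ S} W(B_{a_k})`. -/
abbrev ProdWB (S : Finset ℕ) : Type := ∀ k : S, WB (mult lam k)

/-- The Coxeter type `∏_{k ∈ S} B_{a_k}`. -/
def typeB (S : Finset ℕ) : CoxeterMatrix (Σ k : S, Fin (mult lam k)) :=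
  coxSigma fun k : S => CoxeterMatrix.B (mult lam k)

/-- The Coxeter type `∏_{k ∈ S} A_{k-1}^{a_k}`. -/
def typeA (S : Finset ℕ) :
    CoxeterMatrix (Σ q : (Σ k : S, Fin (mult lam k)), Fin ((q.1 : ℕ) - 1)) :=
  coxSigma fun q : (Σ k : S, Fin (mult lam k)) => CoxeterMatrix.A ((q.1 : ℕ) - 1)

end Partition

end ReflGrp

end

open ReflGrp

/-!
The normalizer of the standard parabolic subgroup `P` of `W(D_n)` is described by its action on
the blocks. The fixed space `X` of `P` is spanned by the block vectors `f_i`, the sums of the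
basis vectors in the blocks, and `P` is the stabilizer of these vectors (`mem_stdP_iff`). A signed
permutation of the blocks that respects their sizes lifts to a signed permutation of the points:
blocks of equal size are interchanged preserving the order of their points, and a sign at a block
is spread over the block and accompanied by the reversal of its order. If the total number of sign
changes becomes odd, then the sign of the first point of the core `{1, …, l}` is changed as well.
This defines an injective homomorphism `blockIsom` from the group `lamGroup` of these block
permutations, which is isomorphic to the product of the groups `W(B_{a_k})`, into the normalizer.

The elements of the normalizer that preserve the positive roots of `P` are monotone on the core
and, up to sign, on each block; hence the Howlett complement of `P` is the image of `blockIsom`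
(`howlettComplement_stdP`). It is a complement because a finite reflection group is transitive on
its systems of positive roots (`exists_mem_posRoots_eq`): an element of the orbit of a regular
vector that is nearest to a second regular vector lies in the chamber of the latter. The same fact
carries the result over to all conjugates of `P` and all choices of positive roots.

The roots of the orthogonal complement `Q` are the roots of `W(D_n)` that lie in `X`: the vectors
`f_j ± f_i` for different blocks of size one, and the `f_i` for blocks of size two, up to scalars
(`mem_posRoots_stdQ`). So `Yᗮ` is spanned by the vectors of the blocks of size two and, if there
are several blocks of size one, of these. Comparison with the positive roots of `Q` identifies the
Howlett complement `D` of `PQ` with a subgroup of `lamGroup` (`groupD_stdP`). Therefore `A` is the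
group of all signed permutations of the blocks that do not contribute to `Yᗮ` (`groupA_stdP`),
while `B` is generated by the permutations of the blocks of size two and the sign change `z_0` at
the first of several blocks of size one (`groupB_stdP`), and `QB` is the group of all signed
permutations of the blocks that contribute to `Yᗮ` (`stdQ_sup_map_subB`). The decomposition of the
normalizer follows from that of `lamGroup` as a direct product (`isSemidirect_normalizerIn`). The
elements `x_i` are the interchanges of neighbouring blocks, and `y_i` for even and `z_i` for odd
blocks are the sign changes at blocks (`xElt_eq`, `yElt_eq`, `zElt_eq`), which yields the
generators.

On `X`, interchanges and sign changes of blocks act as the reflections in `f_j - f_i` and `f_i`,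
so that groups of signed permutations of blocks are Coxeter groups of type `B`
(`actsAsCoxeterGroup_typeB`). On `Xᗮ`, each block of size two contributes a line, so that its
reflection in `P` and the interchanges of such blocks form a group of type `B_{a_2}`, and `z_0`
acts as the sign change of the first coordinate, which extends `W(D_l)` to `W(B_l)`
(`actsAsCoxeterGroup_stdP_sup_of_le`, `actsAsCoxeterGroup_stdP_sup_of_lt`).
-/

set_option linter.unusedSectionVars false

noncomputable section

namespace ReflGrp

/-! ### Reflections and generation -/

section General

variable {E : Type*} [NormedAddCommGroup E] [InnerProductSpace ℝ E] [FiniteDimensional ℝ E]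

theorem refl_apply (α v : E) : refl α v = v - (2 * inner ℝ α v / ‖α‖ ^ 2) • α := by
  unfold refl
  rw [Submodule.reflection_orthogonal_apply, Submodule.reflection_singleton_apply]
  simp only [RCLike.ofReal_real_eq_id, id_eq, mul_div_assoc, mul_smul,
    two_smul, ofNat_smul_eq_nsmul]
  abel

theorem refl_apply_of_norm_eq_one {α : E} (h : ‖α‖ = 1) (v : E) :
    refl α v = v - (2 * inner ℝ α v) • α := by
  rw [refl_apply, h]; simp

theorem refl_apply_self (α : E) : refl α α = -α :=
  Submodule.reflection_orthogonalComplement_singleton_eq_neg α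

theorem refl_apply_of_inner_eq_zero {α v : E} (h : inner ℝ α v = 0) : refl α v = v := by
  rw [refl_apply, h]; simp

theorem refl_smul {c : ℝ} (hc : c ≠ 0) (α : E) : refl (c • α) = refl α := by
  unfold refl
  congr 2
  rw [Submodule.span_singleton_smul_eq (IsUnit.mk0 c hc)]

theorem inner_eq_zero_of_refl_apply_eq {α v : E} (hα : α ≠ 0) (h : refl α v = v) :
    inner ℝ α v = 0 := by
  rw [refl_apply, sub_eq_self, smul_eq_zero] at h
  have h2 := h.resolve_right hα
  have : ‖α‖ ^ 2 ≠ 0 := by simpa using hα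
  rw [div_eq_zero_iff] at h2
  have := h2.resolve_right this
  linarith

theorem refl_map (w : E ≃ₗᵢ[ℝ] E) (α : E) : refl (w α) = w * refl α * w⁻¹ := by
  ext v
  simp only [LinearIsometryEquiv.coe_mul, Function.comp_apply, LinearIsometryEquiv.inv_def]
  rw [refl_apply, refl_apply, map_sub, map_smul, LinearIsometryEquiv.apply_symm_apply,
    LinearIsometryEquiv.norm_map]
  congr 4
  conv_lhs => rw [← w.apply_symm_apply v]
  rw [LinearIsometryEquiv.inner_map_map]

theorem refl_map_mem {H : Subgroup (E ≃ₗᵢ[ℝ] E)} {w : E ≃ₗᵢ[ℝ] E} (hw : w ∈ H) {α : E}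
    (hα : refl α ∈ H) : refl (w α) ∈ H := by
  rw [refl_map]
  exact H.mul_mem (H.mul_mem hw hα) (H.inv_mem hw)

theorem mem_pointStab {W : Subgroup (E ≃ₗᵢ[ℝ] E)} {X : Set E} {g : E ≃ₗᵢ[ℝ] E} :
    g ∈ pointStab W X ↔ g ∈ W ∧ ∀ v ∈ X, g v = v := Iff.rfl

theorem mem_howlettComplement {P G : Subgroup (E ≃ₗᵢ[ℝ] E)} {ρ : E} {g : E ≃ₗᵢ[ℝ] E} :
    g ∈ howlettComplement P G ρ ↔ g ∈ G ∧ ∀ α, g α ∈ posRoots P ρ ↔ α ∈ posRoots P ρ := Iff.rfl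

theorem mem_fixedSpace_closure {T : Set (E ≃ₗᵢ[ℝ] E)} {v : E} :
    v ∈ fixedSpace (Subgroup.closure T) ↔ ∀ g ∈ T, g v = v := by
  refine ⟨fun h g hg => h g (Subgroup.subset_closure hg), fun h g hg => ?_⟩
  induction hg using Subgroup.closure_induction with
  | mem g hg => exact h g hg
  | one => rfl
  | mul a b _ _ ha hb => rw [LinearIsometryEquiv.coe_mul, Function.comp_apply, hb, ha]
  | inv a _ ha => rw [LinearIsometryEquiv.inv_def, LinearIsometryEquiv.symm_apply_eq, ha]

/-- Invariance of a subspace may be tested on generators; finite dimensionality takes care of the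
inverses. -/
theorem map_mem_of_mem_closure {T : Set (E ≃ₗᵢ[ℝ] E)} {U : Submodule ℝ E}
    (h : ∀ g ∈ T, ∀ u ∈ U, g u ∈ U) : Stabilizes (Subgroup.closure T) U := by
  intro g hg
  have key : ∀ g ∈ Subgroup.closure T, U.map g.toLinearEquiv.toLinearMap = U := by
    intro g hg
    induction hg using Subgroup.closure_induction with
    | mem g hg =>
      apply Submodule.eq_of_le_of_finrank_eq
      · rintro _ ⟨u, hu, rfl⟩
        exact h g hg u hu
      · exact LinearEquiv.finrank_map_eq g.toLinearEquiv U
    | one =>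
      ext v
      simp only [Submodule.mem_map]
      exact ⟨by rintro ⟨u, hu, rfl⟩; exact hu, fun hv => ⟨v, hv, rfl⟩⟩
    | mul a b _ _ ha hb =>
      conv_rhs => rw [← ha, ← hb]
      rw [← Submodule.map_comp]
      rfl
    | inv a _ ha =>
      conv_lhs => rw [← ha]
      ext v
      simp only [Submodule.mem_map]
      constructor
      · rintro ⟨_, ⟨u, hu, rfl⟩, rfl⟩
        have : a⁻¹ (a u) = u := by
          rw [LinearIsometryEquiv.inv_def, LinearIsometryEquiv.symm_apply_apply]
        change a⁻¹ (a u) ∈ U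
        rwa [this]
      · intro hv
        refine ⟨a v, ⟨v, hv, rfl⟩, ?_⟩
        change a⁻¹ (a v) = v
        rw [LinearIsometryEquiv.inv_def, LinearIsometryEquiv.symm_apply_apply]
  intro u hu
  rw [← key g hg]
  exact ⟨u, hu, rfl⟩

/-! ### The chamber argument -/

/-- A finite reflection group acts transitively on its systems of positive roots: the element `w`
is chosen so as to maximize `⟪w ρ, ρ₀⟫`. -/
theorem exists_mem_posRoots_eq {P : Subgroup (E ≃ₗᵢ[ℝ] E)} (hfin : (P : Set (E ≃ₗᵢ[ℝ] E)).Finite)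
    {ρ ρ₀ : E} (h : IsRegularVec P ρ) (h₀ : IsRegularVec P ρ₀) :
    ∃ w ∈ P, posRoots P (w ρ) = posRoots P ρ₀ := by
  obtain ⟨w, hw, hmax⟩ := hfin.exists_maximalFor (fun w => inner ℝ (w ρ) ρ₀) _ ⟨1, P.one_mem⟩
  refine ⟨w, hw, ?_⟩
  have hreg : ∀ α ∈ roots P, inner ℝ α (w ρ) ≠ 0 := by
    intro α hα h0
    refine h (w⁻¹ α) ⟨?_, refl_map_mem (P.inv_mem hw) hα.2⟩ ?_
    · rw [LinearIsometryEquiv.norm_map, hα.1]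
    · rw [← LinearIsometryEquiv.inner_map_map w, LinearIsometryEquiv.inv_def,
        LinearIsometryEquiv.apply_symm_apply, h0]
  -- a root that separates `w ρ` from `ρ₀` would give a reflection that increases the product
  have key : ∀ α ∈ roots P, 0 ≤ inner ℝ α (w ρ) * inner ℝ α ρ₀ := by
    intro α hα
    have hle : inner ℝ ((refl α * w) ρ) ρ₀ ≤ inner ℝ (w ρ) ρ₀ := by
      by_contra hlt
      exact hlt (hmax (P.mul_mem hα.2 hw) (le_of_not_ge hlt))
    rw [LinearIsometryEquiv.coe_mul, Function.comp_apply, refl_apply_of_norm_eq_one hα.1,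
      inner_sub_left, inner_smul_left] at hle
    simp only [conj_trivial] at hle
    linarith
  have hsign : ∀ α ∈ roots P, (0 < inner ℝ α (w ρ) ↔ 0 < inner ℝ α ρ₀) := by
    intro α hα
    have h1 := key α hα
    have h2 := hreg α hα
    have h3 := h₀ α hα
    constructor
    · intro h4
      exact lt_of_le_of_ne (nonneg_of_mul_nonneg_right h1 h4) (Ne.symm h3)
    · intro h4
      exact lt_of_le_of_ne (nonneg_of_mul_nonneg_left h1 h4) (Ne.symm h2)
  ext α
  exact ⟨fun hα => ⟨hα.1, (hsign α hα.1).1 hα.2⟩, fun hα => ⟨hα.1, (hsign α hα.1).2 hα.2⟩⟩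

/-- Conjugation of subgroups of the orthogonal group. -/
abbrev conjBy (x : E ≃ₗᵢ[ℝ] E) (P : Subgroup (E ≃ₗᵢ[ℝ] E)) : Subgroup (E ≃ₗᵢ[ℝ] E) :=
  P.map (MulAut.conj x).toMonoidHom

theorem mem_conjBy {x g : E ≃ₗᵢ[ℝ] E} {P : Subgroup (E ≃ₗᵢ[ℝ] E)} :
    g ∈ conjBy x P ↔ x⁻¹ * g * x ∈ P := by
  constructor
  · rintro ⟨k, hk, rfl⟩
    simpa [mul_assoc] using hk
  · intro h
    exact ⟨_, h, by simp [mul_assoc]⟩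

theorem conjBy_conjBy (x y : E ≃ₗᵢ[ℝ] E) (P : Subgroup (E ≃ₗᵢ[ℝ] E)) :
    conjBy x (conjBy y P) = conjBy (x * y) P := by
  ext g
  simp [mul_assoc]

theorem conjBy_eq_self {x : E ≃ₗᵢ[ℝ] E} {P : Subgroup (E ≃ₗᵢ[ℝ] E)} (hx : x ∈ P) :
    conjBy x P = P := by
  ext g
  rw [mem_conjBy, Subgroup.mul_mem_cancel_right _ hx, Subgroup.mul_mem_cancel_left _ (P.inv_mem hx)]

theorem le_normalizer_conj {P : Subgroup (E ≃ₗᵢ[ℝ] E)} {x : E ≃ₗᵢ[ℝ] E} :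
    x ∈ Subgroup.normalizer (P : Set (E ≃ₗᵢ[ℝ] E)) ↔ conjBy x P = P := by
  rw [← inv_mem_iff, Subgroup.mem_normalizer_iff, Subgroup.ext_iff]
  refine forall_congr' fun g => ?_
  rw [mem_conjBy, inv_inv]
  exact ⟨fun h => h.symm, fun h => h.symm⟩

theorem normalizerIn_conjBy {W P : Subgroup (E ≃ₗᵢ[ℝ] E)} {x : E ≃ₗᵢ[ℝ] E} (hx : x ∈ W) :
    normalizerIn W (conjBy x P) = conjBy x (normalizerIn W P) := by
  ext g
  rw [mem_conjBy]
  unfold normalizerIn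
  rw [Subgroup.mem_inf, Subgroup.mem_inf, le_normalizer_conj, le_normalizer_conj,
    Subgroup.mul_mem_cancel_right _ hx, Subgroup.mul_mem_cancel_left _ (W.inv_mem hx)]
  refine and_congr_right fun _ => ?_
  rw [conjBy_conjBy, mul_assoc, ← conjBy_conjBy x⁻¹]
  constructor
  · intro h
    rw [h, conjBy_conjBy]
    simp [conjBy_eq_self P.one_mem]
  · intro h
    conv_rhs => rw [← h]
    rw [conjBy_conjBy, mul_inv_cancel, conjBy_eq_self (Subgroup.one_mem _)]

theorem mem_posRoots_conjBy {P : Subgroup (E ≃ₗᵢ[ℝ] E)} {ρ : E} {x : E ≃ₗᵢ[ℝ] E} {α : E} :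
    x α ∈ posRoots (conjBy x P) (x ρ) ↔ α ∈ posRoots P ρ := by
  simp only [posRoots, roots, Set.mem_ofPred_eq, LinearIsometryEquiv.norm_map,
    LinearIsometryEquiv.inner_map_map, mem_conjBy, refl_map]
  simp [mul_assoc]

theorem howlettComplement_conjBy (P G : Subgroup (E ≃ₗᵢ[ℝ] E)) (ρ : E) (x : E ≃ₗᵢ[ℝ] E) :
    howlettComplement (conjBy x P) (conjBy x G) (x ρ) = conjBy x (howlettComplement P G ρ) := by
  ext g
  rw [mem_conjBy, mem_howlettComplement, mem_howlettComplement, mem_conjBy]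
  refine and_congr_right fun _ => ?_
  have h1 : ∀ β, g (x β) = x ((x⁻¹ * g * x) β) := by
    intro β
    simp [LinearIsometryEquiv.inv_def]
  constructor
  · intro h β
    have := h (x β)
    rwa [h1, mem_posRoots_conjBy, mem_posRoots_conjBy] at this
  · intro h α
    have h2 := h (x⁻¹ α)
    have h3 : x (x⁻¹ α) = α := by simp [LinearIsometryEquiv.inv_def]
    rw [← mem_posRoots_conjBy (x := x), ← h1, h3] at h2
    rw [h2, ← mem_posRoots_conjBy (x := x), h3]

theorem isRegularVec_conjBy {P : Subgroup (E ≃ₗᵢ[ℝ] E)} {ρ : E} {x : E ≃ₗᵢ[ℝ] E} :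
    IsRegularVec (conjBy x P) (x ρ) ↔ IsRegularVec P ρ := by
  have key : ∀ α, x α ∈ roots (conjBy x P) ↔ α ∈ roots P := by
    intro α
    simp only [roots, Set.mem_ofPred_eq, LinearIsometryEquiv.norm_map, mem_conjBy, refl_map]
    simp [mul_assoc]
  constructor
  · intro h α hα h0
    exact h (x α) ((key α).2 hα) (by rw [LinearIsometryEquiv.inner_map_map, h0])
  · intro h α hα h0
    have h1 : x (x⁻¹ α) = α := by simp [LinearIsometryEquiv.inv_def]
    refine h (x⁻¹ α) ((key _).1 (by rwa [h1])) ?_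
    rw [← LinearIsometryEquiv.inner_map_map x, h1, h0]

theorem mem_howlettComplement_of_posRoots_eq {P G : Subgroup (E ≃ₗᵢ[ℝ] E)} {ρ : E} {g : E ≃ₗᵢ[ℝ] E}
    (hg : g ∈ G) (hn : conjBy g P = P) (h : posRoots P (g ρ) = posRoots P ρ) :
    g ∈ howlettComplement P G ρ := by
  refine ⟨hg, fun α => ?_⟩
  have := mem_posRoots_conjBy (x := g) (P := P) (ρ := ρ) (α := α)
  rwa [hn, h] at this

/-- Every Howlett complement of `P` in `G` is conjugate under `P` to a given one. -/
theorem exists_howlettComplement_eq_conjBy {P G : Subgroup (E ≃ₗᵢ[ℝ] E)}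
    (hfin : (P : Set (E ≃ₗᵢ[ℝ] E)).Finite) (hPG : P ≤ G) {ρ ρ₀ : E} (h : IsRegularVec P ρ)
    (h₀ : IsRegularVec P ρ₀) :
    ∃ w ∈ P, howlettComplement P G ρ = conjBy w (howlettComplement P G ρ₀) := by
  obtain ⟨w, hw, hw'⟩ := exists_mem_posRoots_eq hfin h h₀
  refine ⟨w⁻¹, P.inv_mem hw, ?_⟩
  have h1 : howlettComplement P G ρ₀ = howlettComplement P G (w ρ) := by
    ext g
    rw [mem_howlettComplement, mem_howlettComplement, hw']
  have h2 := howlettComplement_conjBy P G ρ w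
  rw [conjBy_eq_self hw, conjBy_eq_self (hPG hw)] at h2
  rw [h1, h2, conjBy_conjBy, inv_mul_cancel, conjBy_eq_self (Subgroup.one_mem _)]

/-- The Howlett complement supplements `P` in its normalizer: an element of the normalizer
permutes the systems of positive roots of `P`, on which `P` is transitive. -/
theorem sup_howlettComplement {P W : Subgroup (E ≃ₗᵢ[ℝ] E)} (hPW : P ≤ W)
    (hfin : (P : Set (E ≃ₗᵢ[ℝ] E)).Finite) {ρ : E} (h : IsRegularVec P ρ) :
    P ⊔ howlettComplement P (normalizerIn W P) ρ = normalizerIn W P := by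
  have hPN : P ≤ normalizerIn W P := le_inf hPW Subgroup.le_normalizer
  apply le_antisymm (sup_le hPN fun g (hg : g ∈ howlettComplement _ _ _) => hg.1)
  intro g hg
  have hn : conjBy g P = P := le_normalizer_conj.1 hg.2
  have hreg : IsRegularVec P (g ρ) := by
    have := (isRegularVec_conjBy (P := P) (ρ := ρ) (x := g)).2 h
    rwa [hn] at this
  obtain ⟨w, hw, hw'⟩ := exists_mem_posRoots_eq hfin hreg h
  have hwg : w * g ∈ howlettComplement P (normalizerIn W P) ρ := by
    refine mem_howlettComplement_of_posRoots_eq (Subgroup.mul_mem _ (hPN hw) hg) ?_ hw'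
    rw [← conjBy_conjBy, hn, conjBy_eq_self hw]
  have : g = w⁻¹ * (w * g) := by group
  rw [this]
  exact Subgroup.mul_mem_sup (P.inv_mem hw) hwg

theorem howlettComplement_normalizes {P W : Subgroup (E ≃ₗᵢ[ℝ] E)} {g k : E ≃ₗᵢ[ℝ] E}
    (hg : g ∈ normalizerIn W P) (hk : k ∈ P) : g * k * g⁻¹ ∈ P :=
  (Subgroup.mem_normalizer_iff.1 hg.2 k).1 hk

theorem IsSemidirect.map {Γ Γ' : Type*} [Group Γ] [Group Γ'] {N K H : Subgroup Γ}
    (h : IsSemidirect N K H) (f : Γ →* Γ') (hf : Function.Injective f) :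
    IsSemidirect (N.map f) (K.map f) (H.map f) := by
  refine ⟨?_, ?_, ?_⟩
  · rintro _ ⟨a, ha, rfl⟩ _ ⟨k, hk, rfl⟩
    exact ⟨a * k * a⁻¹, h.1 a ha k hk, by simp⟩
  · rw [← Subgroup.map_inf _ _ f hf, h.2.1, Subgroup.map_bot]
  · rw [← Subgroup.map_sup, h.2.2]

theorem mem_sup_of_normalizes {Γ : Type*} [Group Γ] {K H : Subgroup Γ}
    (hn : ∀ h ∈ H, ∀ k ∈ K, h * k * h⁻¹ ∈ K) {g : Γ} (hg : g ∈ K ⊔ H) :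
    ∃ k ∈ K, ∃ h ∈ H, g = k * h := by
  have hle : H ≤ Subgroup.normalizer (K : Set Γ) := by
    intro h hh
    refine Subgroup.mem_normalizer_iff.2 fun k => ⟨hn h hh k, fun hk => ?_⟩
    have := hn h⁻¹ (H.inv_mem hh) _ hk
    simpa [mul_assoc] using this
  rw [← SetLike.mem_coe, Subgroup.coe_mul_of_right_le_normalizer_left K H hle] at hg
  obtain ⟨k, hk, h, hh, e⟩ := hg
  exact ⟨k, hk, h, hh, e.symm⟩

theorem mem_sup_of_commute {Γ : Type*} [Group Γ] {K H : Subgroup Γ}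
    (hn : ∀ k ∈ K, ∀ h ∈ H, k * h = h * k) {g : Γ} (hg : g ∈ K ⊔ H) :
    ∃ k ∈ K, ∃ h ∈ H, g = k * h :=
  mem_sup_of_normalizes (fun h hh k hk => by rw [← hn k hk h hh, mul_inv_cancel_right]; exact hk) hg

/-! ### The orthogonal complement of a reflection group -/

/-- A reflection in a product of two reflection groups with orthogonal roots lies in a factor. -/
theorem refl_mem_sup_iff {P Q : Subgroup (E ≃ₗᵢ[ℝ] E)}
    (hPQ : (fixedSpace P)ᗮ ≤ fixedSpace Q) {α : E} (hα : α ≠ 0) :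
    refl α ∈ P ⊔ Q ↔ refl α ∈ P ∨ refl α ∈ Q := by
  constructor
  swap
  · rintro (h | h)
    · exact Subgroup.mem_sup_left h
    · exact Subgroup.mem_sup_right h
  have stab : ∀ (R : Subgroup (E ≃ₗᵢ[ℝ] E)), ∀ g ∈ R, ∀ u ∈ (fixedSpace R)ᗮ,
      g u ∈ (fixedSpace R)ᗮ := by
    intro R g hg u hu
    rw [Submodule.mem_orthogonal] at hu ⊢
    intro v hv
    have : v = g v := (hv g hg).symm
    rw [this, LinearIsometryEquiv.inner_map_map]
    exact hu v hv
  have hQP : (fixedSpace Q)ᗮ ≤ fixedSpace P := by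
    rw [← Submodule.orthogonal_orthogonal (fixedSpace P)]
    exact Submodule.orthogonal_le hPQ
  -- an isometry is determined by its values on `X = Fix P` and on `Xᗮ`
  have dec : ∀ (g k : E ≃ₗᵢ[ℝ] E), (∀ u ∈ fixedSpace P, g u = k u) →
      (∀ u ∈ (fixedSpace P)ᗮ, g u = k u) → g = k := by
    intro g k h1 h2
    ext v
    obtain ⟨a, ha, b, hb, rfl⟩ := (fixedSpace P).exists_add_mem_mem_orthogonal v
    rw [map_add, map_add, h1 a ha, h2 b hb]
  have stabQX : ∀ g ∈ Q, ∀ u ∈ fixedSpace P, g u ∈ fixedSpace P := by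
    intro g hg u hu
    rw [← Submodule.orthogonal_orthogonal (fixedSpace P), Submodule.mem_orthogonal]
    intro v hv
    have : v = g v := (hPQ hv g hg).symm
    rw [this, LinearIsometryEquiv.inner_map_map]
    rw [real_inner_comm]
    exact (Submodule.mem_orthogonal _ _).1 hv u hu
  have comm : ∀ p ∈ P, ∀ q ∈ Q, p * q = q * p := by
    intro p hp q hq
    apply dec
    · intro u hu
      simp only [LinearIsometryEquiv.coe_mul, Function.comp_apply]
      rw [stabQX q hq u hu p hp, hu p hp]
    · intro u hu
      simp only [LinearIsometryEquiv.coe_mul, Function.comp_apply]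
      rw [hPQ hu q hq, hPQ (stab P p hp u hu) q hq]
  intro h
  have hmem : ∃ p ∈ P, ∃ q ∈ Q, refl α = p * q := by
    obtain ⟨p, hp, q, hq, e⟩ := mem_sup_of_commute comm h
    exact ⟨p, hp, q, hq, e⟩
  obtain ⟨p, hp, q, hq, e⟩ := hmem
  -- `refl α = p q` leaves `Xᗮ` invariant, so `α` lies in `Xᗮ` or is orthogonal to it
  by_cases hc : ∃ v ∈ (fixedSpace P)ᗮ, inner ℝ α v ≠ 0
  · obtain ⟨v, hv, hne⟩ := hc
    left
    have h1 : refl α v ∈ (fixedSpace P)ᗮ := by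
      rw [e, LinearIsometryEquiv.coe_mul, Function.comp_apply, hPQ hv q hq]
      exact stab P p hp v hv
    -- `v - refl α v` is a nonzero multiple of `α`
    have hαX : α ∈ (fixedSpace P)ᗮ := by
      rw [refl_apply, Submodule.sub_mem_iff_right _ hv,
        Submodule.smul_mem_iff _ (div_ne_zero (mul_ne_zero two_ne_zero hne) (by simpa using hα))]
        at h1
      exact h1
    have hq1 : q = 1 := by
      apply dec
      · intro u hu
        have h2 : refl α u = u := refl_apply_of_inner_eq_zero (by
          rw [real_inner_comm]; exact (Submodule.mem_orthogonal _ _).1 hαX u hu)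
        rw [e, LinearIsometryEquiv.coe_mul, Function.comp_apply, stabQX q hq u hu p hp] at h2
        exact h2
      · intro u hu
        exact hPQ hu q hq
    rw [e, hq1, mul_one]
    exact hp
  · right
    push Not at hc
    have hp1 : p = 1 := by
      apply dec
      · intro u hu
        exact hu p hp
      · intro u hu
        have h2 : refl α u = u := refl_apply_of_inner_eq_zero (hc u hu)
        rw [e, LinearIsometryEquiv.coe_mul, Function.comp_apply, hPQ hu q hq] at h2
        exact h2
    rw [e, hp1, one_mul]
    exact hq

theorem mem_fixedSpace_orthComplement {W P : Subgroup (E ≃ₗᵢ[ℝ] E)} {α : E} (hα : α ≠ 0)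
    (h : refl α ∈ P) : α ∈ fixedSpace (orthComplement W P) := by
  unfold orthComplement
  rw [mem_fixedSpace_closure]
  rintro _ ⟨_, β, hβ, rfl, hort⟩
  exact refl_apply_of_inner_eq_zero (by rw [real_inner_comm]; exact hort α hα h)

theorem orthComplement_le (W P : Subgroup (E ≃ₗᵢ[ℝ] E)) : orthComplement W P ≤ W := by
  unfold orthComplement
  rw [Subgroup.closure_le]
  exact fun t ht => ht.1

/-- The roots of the orthogonal complement are the roots of `W` orthogonal to those of `P`. -/
theorem refl_mem_orthComplement_iff {W P : Subgroup (E ≃ₗᵢ[ℝ] E)} {β : E} (hβ : β ≠ 0) :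
    refl β ∈ orthComplement W P ↔
      refl β ∈ W ∧ ∀ α : E, α ≠ 0 → refl α ∈ P → inner ℝ α β = 0 := by
  constructor
  · intro h
    refine ⟨orthComplement_le W P h, fun α hα hαP => ?_⟩
    rw [real_inner_comm]
    exact inner_eq_zero_of_refl_apply_eq hβ (mem_fixedSpace_orthComplement hα hαP _ h)
  · rintro ⟨h1, h2⟩
    exact Subgroup.subset_closure ⟨h1, β, hβ, rfl, h2⟩

/-! ### Coxeter groups acting on a subspace -/

theorem coe_refl {U : Submodule ℝ E} (α u : U) : ((refl α u : U) : E) = refl (α : E) (u : E) := by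
  rw [refl_apply, refl_apply]
  simp

/-- Generators that act on `U` as reflections in vectors of `U` leave `U` invariant. -/
theorem stabilizes_closure {I : Type*} {U : Submodule ℝ E} {α : I → U} {g : I → E ≃ₗᵢ[ℝ] E}
    (hg : ∀ i, ∀ u ∈ U, g i u = refl (α i : E) u) :
    Stabilizes (Subgroup.closure (Set.range g)) U := by
  apply map_mem_of_mem_closure
  rintro _ ⟨i, rfl⟩ u hu
  rw [hg i u hu, ← coe_refl (α i) ⟨u, hu⟩]
  exact Subtype.prop _

theorem restrictTo_closure {I : Type*} {U : Submodule ℝ E} {α : I → U} {g : I → E ≃ₗᵢ[ℝ] E}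
    (hg : ∀ i, ∀ u ∈ U, g i u = refl (α i : E) u) :
    restrictTo (Subgroup.closure (Set.range g)) U =
      Subgroup.closure (Set.range fun i => refl (α i)) := by
  apply le_antisymm
  · rintro h ⟨k, hk, hh⟩
    have key : ∃ h' ∈ Subgroup.closure (Set.range fun i => refl (α i)),
        ∀ u : U, ((h' u : U) : E) = k u := by
      clear hh
      induction hk using Subgroup.closure_induction with
      | mem x hx =>
        obtain ⟨i, rfl⟩ := hx
        exact ⟨refl (α i), Subgroup.subset_closure ⟨i, rfl⟩, fun u => by
          rw [coe_refl, hg i u u.2]⟩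
      | one => exact ⟨1, Subgroup.one_mem _, fun u => rfl⟩
      | mul a b _ _ ha hb =>
        obtain ⟨a', ha', ha⟩ := ha
        obtain ⟨b', hb', hb⟩ := hb
        refine ⟨a' * b', Subgroup.mul_mem _ ha' hb', fun u => ?_⟩
        rw [LinearIsometryEquiv.coe_mul, LinearIsometryEquiv.coe_mul, Function.comp_apply,
          Function.comp_apply, ha, hb]
      | inv a _ ha =>
        obtain ⟨a', ha', ha⟩ := ha
        refine ⟨a'⁻¹, Subgroup.inv_mem _ ha', fun u => ?_⟩
        rw [LinearIsometryEquiv.inv_def, LinearIsometryEquiv.inv_def,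
          LinearIsometryEquiv.eq_symm_apply, ← ha, LinearIsometryEquiv.apply_symm_apply]
    obtain ⟨h', hmem, hh'⟩ := key
    have : h = h' := by
      ext u
      rw [hh, hh']
    rwa [this]
  · rw [Subgroup.closure_le]
    rintro _ ⟨i, rfl⟩
    exact ⟨g i, Subgroup.subset_closure ⟨i, rfl⟩, fun u => by rw [coe_refl, hg i u u.2]⟩

/-- A group acts as a reflection group on `U` if its generators act on `U` as reflections. -/
theorem actsAsReflectionGroup_closure {I : Type*} {U : Submodule ℝ E} {α : I → E}
    {g : I → E ≃ₗᵢ[ℝ] E} (hα : ∀ i, α i ∈ U) (h0 : ∀ i, α i ≠ 0)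
    (hg : ∀ i, ∀ u ∈ U, g i u = refl (α i) u) :
    ActsAsReflectionGroup (Subgroup.closure (Set.range g)) U := by
  have hg' : ∀ i, ∀ u ∈ U, g i u = refl (((⟨α i, hα i⟩ : U) : E)) u := hg
  refine ⟨stabilizes_closure (α := fun i => ⟨α i, hα i⟩) hg', ?_⟩
  apply le_antisymm
  · rw [Subgroup.closure_le]
    exact fun t ht => ht.1
  · conv_lhs => rw [restrictTo_closure (α := fun i => ⟨α i, hα i⟩) hg']
    apply Subgroup.closure_mono
    rintro _ ⟨i, rfl⟩
    refine ⟨⟨g i, Subgroup.subset_closure ⟨i, rfl⟩, fun u => ?_⟩, ⟨α i, hα i⟩, ?_, rfl⟩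
    · rw [coe_refl, hg i u u.2]
    · simpa using h0 i

/-- `α` is a system of simple roots with Coxeter matrix `M`. -/
def IsSimpleSystem {I : Type*} (M : CoxeterMatrix I) (α : I → E) : Prop :=
  LinearIndependent ℝ α ∧ ∀ i j, inner ℝ (α i) (α j) = -Real.cos (Real.pi / (M i j : ℝ))

/-- A group that acts faithfully on `U` is of type `M` on `U` if its generators act on `U` as the
reflections in a simple system of type `M`. The generators need not be reflections of the whole
space. -/
theorem actsAsCoxeterGroup_closure {I : Type*} {U : Submodule ℝ E} {α : I → E}
    {g : I → E ≃ₗᵢ[ℝ] E} {M : CoxeterMatrix I} (hα : ∀ i, α i ∈ U) (hM : IsSimpleSystem M α)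
    (hg : ∀ i, ∀ u ∈ U, g i u = refl (α i) u)
    (hf : ∀ k ∈ Subgroup.closure (Set.range g), (∀ u ∈ U, k u = u) → k = 1) :
    ActsAsCoxeterGroup (Subgroup.closure (Set.range g)) U M := by
  have hg' : ∀ i, ∀ u ∈ U, g i u = refl (((⟨α i, hα i⟩ : U) : E)) u := hg
  refine ⟨stabilizes_closure (α := fun i => ⟨α i, hα i⟩) hg', hf,
    fun i => ⟨α i, hα i⟩, ?_, ?_, restrictTo_closure (α := fun i => ⟨α i, hα i⟩) hg'⟩
  · exact LinearIndependent.of_comp U.subtype hM.1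
  · exact hM.2

end General

/-! ### Simple systems of types A, B, D and their orthogonal unions -/

section SimpleSystems

variable {E : Type*} [NormedAddCommGroup E] [InnerProductSpace ℝ E] [FiniteDimensional ℝ E]

/-- Linear independence from a family `d` of test vectors for which the matrix of inner products
is triangular with respect to the rank function `r`. -/
theorem linearIndependent_of_triangular {I : Type*} [Finite I] {α d : I → E} (r : I → ℕ)
    (h1 : ∀ i, inner ℝ (d i) (α i) ≠ 0)
    (h2 : ∀ i j, j ≠ i → r j ≤ r i → inner ℝ (d i) (α j) = 0) : LinearIndependent ℝ α := by
  classical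
  cases nonempty_fintype I
  rw [Fintype.linearIndependent_iff]
  intro c hc
  by_contra! hne
  -- test a linear relation with the `d i` of highest rank among its nonzero coefficients
  obtain ⟨i, hi, hmax⟩ := (Finset.univ.filter fun i => c i ≠ 0).exists_max_image r
    (by obtain ⟨i, hi⟩ := hne; exact ⟨i, by simpa using hi⟩)
  have hci : c i ≠ 0 := by simpa using hi
  have h3 : inner ℝ (d i) (∑ j, c j • α j) = c i * inner ℝ (d i) (α i) := by
    rw [inner_sum, Finset.sum_eq_single i]
    · rw [inner_smul_right]
    · intro j _ hj
      rw [inner_smul_right]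
      by_cases hcj : c j = 0
      · rw [hcj, zero_mul]
      · rw [h2 i j hj (hmax j (by simpa using hcj)), mul_zero]
    · simp
  rw [hc, inner_zero_right] at h3
  exact mul_ne_zero hci (h1 i) h3.symm

/-- The vectors `f 0, …, f (a - 1)` are orthonormal. -/
def OrthonormalBelow (a : ℕ) (f : ℕ → E) : Prop :=
  ∀ i < a, ∀ j < a, inner ℝ (f i) (f j) = if i = j then (1 : ℝ) else 0

/-- The unit vector in the direction of `f (s + 1) - f s`. -/
def stepRoot (f : ℕ → E) (s : ℕ) : E := (√2 : ℝ)⁻¹ • (f (s + 1) - f s)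

/-- The simple roots of type `A_{k-1}`. -/
def simpleA (k : ℕ) (f : ℕ → E) (s : Fin (k - 1)) : E := stepRoot f s

/-- The simple roots of type `B_a`, the short root coming last. -/
def simpleB (a : ℕ) (f : ℕ → E) (r : Fin a) : E :=
  if a - 1 - r.val = 0 then f 0 else stepRoot f (a - 1 - r.val - 1)

/-- The simple roots of type `D_l`, the branch root coming first. -/
def simpleD (l : ℕ) (f : ℕ → E) (r : Fin l) : E :=
  if r.val = 0 then (√2 : ℝ)⁻¹ • (f 1 + f 0) else stepRoot f (r.val - 1)

theorem inner_stepRoot_stepRoot {a : ℕ} {f : ℕ → E} (hf : OrthonormalBelow a f) {s t : ℕ}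
    (hs : s + 1 < a) (ht : t + 1 < a) : inner ℝ (stepRoot f s) (stepRoot f t) =
      if s = t then 1 else if s + 1 = t ∨ t + 1 = s then -(1 / 2 : ℝ) else 0 := by
  have h2 : (√2 : ℝ)⁻¹ * ((√2 : ℝ)⁻¹ * 1) = 1 / 2 := by
    rw [mul_one, ← mul_inv, Real.mul_self_sqrt (by norm_num)]; norm_num
  have hh : ∀ x : ℝ, (√2 : ℝ)⁻¹ * ((√2 : ℝ)⁻¹ * x) = 1 / 2 * x := by
    intro x; rw [← h2]; ring
  unfold stepRoot
  rw [inner_smul_left, inner_smul_right, inner_sub_left, inner_sub_right, inner_sub_right,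
    hf _ hs _ ht, hf _ hs _ (by omega), hf _ (by omega) _ ht, hf _ (by omega) _ (by omega)]
  simp only [conj_trivial]
  rw [hh]
  by_cases h1 : s = t
  · subst h1; simp; norm_num
  · by_cases h3 : s + 1 = t
    · subst h3
      have h6 : ¬ s = s + 1 + 1 := by omega
      simp [h6]
    · by_cases h4 : t + 1 = s
      · subst h4
        have h6 : ¬ t + 1 + 1 = t := by omega
        simp [h6]
      · have h5 : ¬ s = t + 1 := fun h => h4 h.symm
        simp [h1, h3, h4, h5]

theorem cos_entry_one {k : ℕ} (h : k = 1) : -Real.cos (Real.pi / (k : ℝ)) = 1 := by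
  subst h; simp

theorem cos_entry_two {k : ℕ} (h : k = 2) : -Real.cos (Real.pi / (k : ℝ)) = 0 := by
  subst h; simp

theorem cos_entry_three {k : ℕ} (h : k = 3) : -Real.cos (Real.pi / (k : ℝ)) = -(1 / 2) := by
  subst h; simp

theorem cos_entry_four {k : ℕ} (h : k = 4) : -Real.cos (Real.pi / (k : ℝ)) = -(√2 / 2) := by
  subst h; simp

theorem isSimpleSystem_A {k : ℕ} {f : ℕ → E} (hf : OrthonormalBelow k f) :
    IsSimpleSystem (CoxeterMatrix.A (k - 1)) (simpleA k f) := by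
  constructor
  · have key : ∀ i j : Fin (k - 1), inner ℝ (f (i.val + 1)) (simpleA k f j) =
        (√2 : ℝ)⁻¹ * ((if i.val = j.val then 1 else 0) - if i.val + 1 = j.val then 1 else 0) := by
      intro i j
      unfold simpleA stepRoot
      rw [inner_smul_right, inner_sub_right, hf _ (by omega) _ (by omega),
        hf _ (by omega) _ (by omega)]
      simp
    refine linearIndependent_of_triangular (d := fun i => f (i.val + 1)) (fun i => i.val) ?_ ?_
    · intro i
      rw [key]; simp
    · intro i j hij hr
      have h1 : i.val ≠ j.val := fun h => hij (Fin.ext h.symm)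
      have h2 : ¬ i.val + 1 = j.val := by omega
      rw [key]; simp [h1, h2]
  · intro i j
    unfold simpleA
    rw [inner_stepRoot_stepRoot hf (by omega) (by omega)]
    have hM : CoxeterMatrix.A (k - 1) i j = if i.val = j.val then 1
      else (if j.val + 1 = i.val ∨ i.val + 1 = j.val then 3 else 2) := by
      simp only [← Fin.ext_iff]; rfl
    symm
    by_cases h1 : i.val = j.val
    · rw [if_pos h1]
      exact cos_entry_one (by rw [hM, if_pos h1])
    · rw [if_neg h1]
      by_cases h2 : i.val + 1 = j.val ∨ j.val + 1 = i.val
      · rw [if_pos h2]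
        exact cos_entry_three (by rw [hM, if_neg h1, if_pos h2.symm])
      · rw [if_neg h2]
        exact cos_entry_two (by rw [hM, if_neg h1, if_neg fun h => h2 h.symm])

theorem inner_stepRoot {a : ℕ} {f : ℕ → E} (hf : OrthonormalBelow a f) {s t : ℕ}
    (hs : s < a) (ht : t + 1 < a) : inner ℝ (f s) (stepRoot f t) =
      (√2 : ℝ)⁻¹ * ((if s = t + 1 then 1 else 0) - if s = t then 1 else 0) := by
  unfold stepRoot
  rw [inner_smul_right, inner_sub_right, hf _ hs _ ht, hf _ hs _ (by omega)]

theorem isSimpleSystem_B {a : ℕ} {f : ℕ → E} (hf : OrthonormalBelow a f) :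
    IsSimpleSystem (CoxeterMatrix.B a) (simpleB a f) := by
  constructor
  · have key : ∀ i j : Fin a, i.val ≤ j.val → (inner ℝ (f (a - 1 - i.val)) (simpleB a f j) ≠ 0 ↔
        i = j) := by
      intro i j hij
      unfold simpleB
      split_ifs with h0
      · rw [hf _ (by omega) _ (by omega)]
        have : i = j ↔ a - 1 - i.val = 0 := by rw [Fin.ext_iff]; omega
        rw [this]; simp
      · rw [inner_stepRoot hf (by omega) (by omega)]
        by_cases h1 : i = j
        · subst h1
          rw [if_pos (by omega), if_neg (by omega)]
          simp
        · have h2 : i.val ≠ j.val := fun h => h1 (Fin.ext h)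
          rw [if_neg (by omega), if_neg (by omega)]
          simp [h1]
    refine linearIndependent_of_triangular (d := fun i => f (a - 1 - i.val))
      (fun i => a - 1 - i.val) ?_ ?_
    · intro i
      exact (key i i le_rfl).2 rfl
    · intro i j hij hr
      by_contra h
      exact hij ((key i j (by omega)).1 h).symm
  · intro i j
    have hM : CoxeterMatrix.B a i j = if i.val = j.val then 1
      else (if i.val = a - 1 ∧ j.val = a - 2 ∨ j.val = a - 1 ∧ i.val = a - 2 then 4
        else (if j.val + 1 = i.val ∨ i.val + 1 = j.val then 3 else 2)) := by
      simp only [← Fin.ext_iff]; rfl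
    have h2 : (√2 : ℝ)⁻¹ = √2 / 2 := by
      rw [eq_div_iff (by norm_num), inv_mul_eq_div, div_eq_iff (by positivity)]
      exact (Real.mul_self_sqrt (by norm_num)).symm
    unfold simpleB
    by_cases hi : a - 1 - i.val = 0
    · by_cases hj : a - 1 - j.val = 0
      · rw [if_pos hi, if_pos hj, hf _ (by omega) _ (by omega), if_pos rfl]
        exact (cos_entry_one (by rw [hM]; split_ifs <;> omega)).symm
      · rw [if_pos hi, if_neg hj, inner_stepRoot hf (by omega) (by omega), if_neg (by omega)]
        by_cases h3 : j.val = a - 2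
        · rw [if_pos (by omega), h2]
          rw [cos_entry_four (by rw [hM]; split_ifs <;> omega)]
          simp
        · rw [if_neg (by omega)]
          rw [cos_entry_two (by rw [hM]; split_ifs <;> omega)]
          simp
    · by_cases hj : a - 1 - j.val = 0
      · rw [if_neg hi, if_pos hj, real_inner_comm, inner_stepRoot hf (by omega) (by omega),
          if_neg (by omega)]
        by_cases h3 : i.val = a - 2
        · rw [if_pos (by omega), h2]
          rw [cos_entry_four (by rw [hM]; split_ifs <;> omega)]
          simp
        · rw [if_neg (by omega)]
          rw [cos_entry_two (by rw [hM]; split_ifs <;> omega)]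
          simp
      · rw [if_neg hi, if_neg hj, inner_stepRoot_stepRoot hf (by omega) (by omega)]
        by_cases h1 : i.val = j.val
        · rw [if_pos (by omega)]
          exact (cos_entry_one (by rw [hM]; split_ifs <;> omega)).symm
        · rw [if_neg (by omega)]
          by_cases h3 : j.val + 1 = i.val ∨ i.val + 1 = j.val
          · rw [if_pos (by omega)]
            exact (cos_entry_three (by rw [hM]; split_ifs <;> omega)).symm
          · rw [if_neg (by omega)]
            exact (cos_entry_two (by rw [hM]; split_ifs <;> omega)).symm

theorem isSimpleSystem_D {l : ℕ} (hl : 2 ≤ l) {f : ℕ → E} (hf : OrthonormalBelow l f) :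
    IsSimpleSystem (coxD l) (simpleD l f) := by
  have hs2 : (√2 : ℝ)⁻¹ * (√2 : ℝ)⁻¹ = 1 / 2 := by
    rw [← mul_inv, Real.mul_self_sqrt (by norm_num)]; norm_num
  have hplus : ∀ t, t + 1 < l → inner ℝ ((√2 : ℝ)⁻¹ • (f 1 + f 0)) (stepRoot f t) =
      if t = 1 then -(1 / 2 : ℝ) else 0 := by
    intro t ht
    rw [inner_smul_left, inner_add_left, inner_stepRoot hf (by omega) ht,
      inner_stepRoot hf (by omega) ht]
    simp only [conj_trivial]
    rcases t with _ | _ | t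
    · simp
    · have : (√2 : ℝ)⁻¹ * (√2 : ℝ)⁻¹ = 1 / 2 := hs2
      simp
      linarith
    · simp
  have hpp : inner ℝ ((√2 : ℝ)⁻¹ • (f 1 + f 0)) ((√2 : ℝ)⁻¹ • (f 1 + f 0)) = (1 : ℝ) := by
    rw [inner_smul_left, inner_smul_right, inner_add_left, inner_add_right, inner_add_right,
      hf _ (by omega) _ (by omega), hf _ (by omega) _ (by omega), hf _ (by omega) _ (by omega),
      hf _ (by omega) _ (by omega)]
    simp only [conj_trivial]
    rw [← mul_assoc, hs2]
    norm_num
  constructor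
  · -- dual vectors: `f 1 + f 0` and `f 1 - f 0` for the two end nodes, `f s` for the others
    refine linearIndependent_of_triangular
      (d := fun i => if i.val ≤ 1 then simpleD l f i else f i.val) (fun i => i.val) ?_ ?_
    · intro i
      by_cases h1 : i.val ≤ 1
      · rw [if_pos h1]
        unfold simpleD
        split_ifs with h0
        · rw [hpp]; norm_num
        · rw [inner_stepRoot_stepRoot hf (by omega) (by omega), if_pos rfl]; norm_num
      · rw [if_neg h1]
        unfold simpleD
        rw [if_neg (by omega), inner_stepRoot hf (by omega) (by omega), if_pos (by omega),
          if_neg (by omega)]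
        simp
    · intro i j hij hr
      have hne : j.val ≠ i.val := fun h => hij (Fin.ext h)
      by_cases h1 : i.val ≤ 1
      · rw [if_pos h1]
        have hi : i.val = 1 := by omega
        have hj : j.val = 0 := by omega
        unfold simpleD
        rw [if_neg (by omega), if_pos hj, real_inner_comm, hplus _ (by omega), if_neg (by omega)]
      · rw [if_neg h1]
        unfold simpleD
        split_ifs with h0
        · rw [inner_smul_right, inner_add_right, hf _ (by omega) _ (by omega),
            hf _ (by omega) _ (by omega), if_neg (by omega), if_neg (by omega)]
          simp
        · rw [inner_stepRoot hf (by omega) (by omega), if_neg (by omega), if_neg (by omega)]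
          simp
  · intro i j
    have hM : coxD l i j = if i.val = j.val then 1
      else if (1 ≤ i.val ∧ i.val + 1 = j.val) ∨ (1 ≤ j.val ∧ j.val + 1 = i.val) ∨
        (i.val = 0 ∧ j.val = 2) ∨ (j.val = 0 ∧ i.val = 2) then 3
      else 2 := by
      simp only [← Fin.ext_iff]; rfl
    unfold simpleD
    by_cases hi : i.val = 0
    · by_cases hj : j.val = 0
      · rw [if_pos hi, if_pos hj, hpp]
        exact (cos_entry_one (by rw [hM]; split_ifs <;> omega)).symm
      · rw [if_pos hi, if_neg hj, hplus _ (by omega)]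
        by_cases h2 : j.val = 2
        · rw [if_pos (by omega)]
          exact (cos_entry_three (by rw [hM]; split_ifs <;> omega)).symm
        · rw [if_neg (by omega)]
          exact (cos_entry_two (by rw [hM]; split_ifs <;> omega)).symm
    · by_cases hj : j.val = 0
      · rw [if_neg hi, if_pos hj, real_inner_comm, hplus _ (by omega)]
        by_cases h2 : i.val = 2
        · rw [if_pos (by omega)]
          exact (cos_entry_three (by rw [hM]; split_ifs <;> omega)).symm
        · rw [if_neg (by omega)]
          exact (cos_entry_two (by rw [hM]; split_ifs <;> omega)).symm
      · rw [if_neg hi, if_neg hj, inner_stepRoot_stepRoot hf (by omega) (by omega)]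
        by_cases h1 : i.val = j.val
        · rw [if_pos (by omega)]
          exact (cos_entry_one (by rw [hM]; split_ifs <;> omega)).symm
        · rw [if_neg (by omega)]
          by_cases h3 : j.val + 1 = i.val ∨ i.val + 1 = j.val
          · rw [if_pos (by omega)]
            exact (cos_entry_three (by rw [hM]; split_ifs <;> omega)).symm
          · rw [if_neg (by omega)]
            exact (cos_entry_two (by rw [hM]; split_ifs <;> omega)).symm

/-- Mutually orthogonal simple systems form a simple system of the disjoint union of their types. -/
theorem IsSimpleSystem.sum {I J : Type*} {M : CoxeterMatrix I}
    {M' : CoxeterMatrix J} {α : I → E} {β : J → E} (h : IsSimpleSystem M α)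
    (h' : IsSimpleSystem M' β) (ho : ∀ i j, inner ℝ (α i) (β j) = 0) :
    IsSimpleSystem (coxSum M M') (Sum.elim α β) := by
  constructor
  · refine LinearIndependent.sum_type h.1 h'.1 (Submodule.IsOrtho.disjoint ?_)
    rw [Submodule.isOrtho_span]
    rintro _ ⟨i, rfl⟩ _ ⟨j, rfl⟩
    exact ho i j
  · rintro (i | i) (j | j)
    · exact h.2 i j
    · exact (ho i j).trans (cos_entry_two rfl).symm
    · exact ((real_inner_comm _ _).trans (ho j i)).trans (cos_entry_two rfl).symm
    · exact h'.2 i j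

theorem coxSigma_apply_self {ι : Type*} {κ : ι → Type*} (M : ∀ i, CoxeterMatrix (κ i)) (i : ι)
    (a b : κ i) : coxSigma M ⟨i, a⟩ ⟨i, b⟩ = M i a b := by
  change (open Classical in if h : i = i then M i (h ▸ a) b else 2) = M i a b
  rw [dif_pos rfl]

theorem coxSigma_apply_ne {ι : Type*} {κ : ι → Type*} (M : ∀ i, CoxeterMatrix (κ i)) {i j : ι}
    (h : i ≠ j) (a : κ i) (b : κ j) : coxSigma M ⟨i, a⟩ ⟨j, b⟩ = 2 := by
  change (open Classical in if h : i = j then M j (h ▸ a) b else 2) = 2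
  rw [dif_neg h]

/-- The version of `IsSimpleSystem.sum` for families. -/
theorem IsSimpleSystem.sigma {ι : Type*} [Finite ι] {κ : ι → Type*} [∀ i, Finite (κ i)]
    {M : ∀ i, CoxeterMatrix (κ i)} {α : ∀ i, κ i → E} (h : ∀ i, IsSimpleSystem (M i) (α i))
    (ho : ∀ i j, i ≠ j → ∀ a b, inner ℝ (α i a) (α j b) = 0) :
    IsSimpleSystem (coxSigma M) (fun x : Σ i, κ i => α x.1 x.2) := by
  constructor
  · cases nonempty_fintype ι
    have := fun i => Fintype.ofFinite (κ i)
    rw [Fintype.linearIndependent_iff]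
    intro c hc
    rw [Fintype.sum_sigma] at hc
    rintro ⟨i, a⟩
    refine Fintype.linearIndependent_iff.1 (h i).1 (fun a => c ⟨i, a⟩) ?_ a
    -- pair the partial sum over the component `i` with the whole relation
    rw [← inner_self_eq_zero (𝕜 := ℝ)]
    have h2 : inner ℝ (∑ a, c ⟨i, a⟩ • α i a) (∑ j, ∑ a, c ⟨j, a⟩ • α j a) = (0 : ℝ) := by
      rw [hc, inner_zero_right]
    rw [inner_sum, Finset.sum_eq_single i] at h2
    · exact h2
    · intro j _ hj
      rw [sum_inner]
      refine Finset.sum_eq_zero fun a _ => ?_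
      rw [inner_sum]
      refine Finset.sum_eq_zero fun b _ => ?_
      rw [inner_smul_left, inner_smul_right, ho i j (Ne.symm hj), mul_zero, mul_zero]
    · simp
  · rintro ⟨i, a⟩ ⟨j, b⟩
    by_cases hij : i = j
    · subst hij
      rw [coxSigma_apply_self]
      exact (h i).2 a b
    · rw [coxSigma_apply_ne _ hij, ho i j hij a b]
      exact (cos_entry_two rfl).symm

end SimpleSystems

/-! ### The abstract group of signed permutations -/

/-- A signed permutation `i ↦ sgn i • perm i` of an arbitrary index set. -/
@[ext]
structure SgnPerm (ι : Type*) where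
  /-- the underlying permutation -/
  perm : Equiv.Perm ι
  /-- the signs -/
  sgn : ι → ℤˣ

namespace SgnPerm

variable {ι : Type*}

instance : Mul (SgnPerm ι) := ⟨fun g h => ⟨g.perm * h.perm, fun i => g.sgn (h.perm i) * h.sgn i⟩⟩
instance : One (SgnPerm ι) := ⟨⟨1, 1⟩⟩
instance : Inv (SgnPerm ι) := ⟨fun g => ⟨g.perm⁻¹, fun i => g.sgn (g.perm⁻¹ i)⟩⟩

@[simp] theorem mul_perm (g h : SgnPerm ι) : (g * h).perm = g.perm * h.perm := rfl
@[simp] theorem mul_sgn (g h : SgnPerm ι) (i : ι) :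
    (g * h).sgn i = g.sgn (h.perm i) * h.sgn i := rfl
@[simp] theorem one_perm : (1 : SgnPerm ι).perm = 1 := rfl
@[simp] theorem one_sgn : (1 : SgnPerm ι).sgn = 1 := rfl
@[simp] theorem inv_perm (g : SgnPerm ι) : (g⁻¹).perm = g.perm⁻¹ := rfl
@[simp] theorem inv_sgn (g : SgnPerm ι) (i : ι) : (g⁻¹).sgn i = g.sgn (g.perm⁻¹ i) := rfl

instance : Group (SgnPerm ι) where
  mul_assoc a b c := by
    ext i
    · rfl
    · simp [mul_assoc]
  one_mul a := by
    ext i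
    · rfl
    · simp
  mul_one a := by
    ext i
    · rfl
    · simp
  inv_mul_cancel a := by
    ext i
    · simp
    · simp

instance [Finite ι] : Finite (SgnPerm ι) :=
  Finite.of_injective (fun g : SgnPerm ι => (g.perm, g.sgn)) fun g h e => by
    ext1
    · exact (Prod.ext_iff.1 e).1
    · exact (Prod.ext_iff.1 e).2

/-- Permutations as signed permutations without signs. -/
def ofPerm : Equiv.Perm ι →* SgnPerm ι where
  toFun σ := ⟨σ, 1⟩
  map_one' := rfl
  map_mul' σ τ := by ext i <;> simp

/-- Sign changes as signed permutations. -/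
def ofSgn : (ι → ℤˣ) →* SgnPerm ι where
  toFun ε := ⟨1, ε⟩
  map_one' := rfl
  map_mul' σ τ := by ext i <;> simp

@[simp] theorem ofPerm_perm (σ : Equiv.Perm ι) : (ofPerm σ).perm = σ := rfl
@[simp] theorem ofPerm_sgn (σ : Equiv.Perm ι) : (ofPerm σ).sgn = 1 := rfl
@[simp] theorem ofSgn_perm (ε : ι → ℤˣ) : (ofSgn ε).perm = 1 := rfl
@[simp] theorem ofSgn_sgn (ε : ι → ℤˣ) : (ofSgn ε).sgn = ε := rfl

theorem ofPerm_mul_ofSgn (g : SgnPerm ι) : ofPerm g.perm * ofSgn g.sgn = g := by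
  ext i <;> simp

variable [DecidableEq ι]

/-- The sign change at `i`. -/
def fl (i : ι) : SgnPerm ι := ofSgn (Pi.mulSingle i (-1))

/-- The reflection that interchanges `e_x` and `-s e_y`. -/
def swS (x y : ι) (s : ℤˣ) : SgnPerm ι :=
  ⟨Equiv.swap x y, fun i => if i = x ∨ i = y then -s else 1⟩

theorem swS_neg_one (x y : ι) : swS x y (-1) = ofPerm (Equiv.swap x y) := by
  ext i <;> simp [swS]

theorem swS_one {x y : ι} (h : x ≠ y) : swS x y 1 = ofPerm (Equiv.swap x y) * (fl x * fl y) := by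
  ext i
  · simp [swS, fl]
  · by_cases hx : i = x
    · subst hx
      simp [swS, fl, h]
    · by_cases hy : i = y
      · subst hy
        simp [swS, fl, hx]
      · simp [swS, fl, hx, hy]

theorem conj_fl (g : SgnPerm ι) (i : ι) : g * fl i * g⁻¹ = fl (g.perm i) := by
  ext j
  · simp [fl]
  · have h1 : (g * fl i * g⁻¹).sgn j = (Pi.mulSingle i (-1) : ι → ℤˣ) (g.perm⁻¹ j) := by
      change g.sgn (g.perm⁻¹ j) * (Pi.mulSingle i (-1) : ι → ℤˣ) (g.perm⁻¹ j) *
        g.sgn (g.perm⁻¹ j) = _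
      rw [mul_right_comm, Int.units_mul_self, one_mul]
    rw [h1]
    by_cases h : j = g.perm i
    · subst h
      simp [fl]
    · have h' : g.perm⁻¹ j ≠ i := fun e => h (by rw [← e]; simp)
      rw [Pi.mulSingle_eq_of_ne h']
      simp [fl, h]

theorem conj_swap (σ : Equiv.Perm ι) (x y : ι) :
    ofPerm σ * ofPerm (Equiv.swap x y) * (ofPerm σ)⁻¹ = ofPerm (Equiv.swap (σ x) (σ y)) := by
  rw [← map_inv, ← map_mul, ← map_mul, ← Equiv.swap_apply_apply]

/-- Transpositions of elements of the same colour generate all colour preserving permutations. -/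
theorem ofPerm_mem_of_swap_mem [Fintype ι] {γ : Type*} {c : ι → γ} {H : Subgroup (SgnPerm ι)}
    (hH : ∀ i j, i ≠ j → c i = c j → ofPerm (Equiv.swap i j) ∈ H) (σ : Equiv.Perm ι)
    (hσ : ∀ i, c (σ i) = c i) : ofPerm σ ∈ H := by
  induction hk : σ.support.card using Nat.strong_induction_on generalizing σ with
  | _ k ih =>
    by_cases h1 : σ = 1
    · rw [h1, map_one]
      exact H.one_mem
    · obtain ⟨x, hx⟩ : ∃ x, σ x ≠ x := by
        by_contra! h
        exact h1 (Equiv.ext h)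
      have hlt := Equiv.Perm.card_support_swap_mul hx
      have hmem := ih _ (hk ▸ hlt) (Equiv.swap x (σ x) * σ) (fun i => by
        rw [Equiv.Perm.mul_apply]
        by_cases h2 : σ i = x
        · rw [h2, Equiv.swap_apply_left, hσ, ← hσ i, h2]
        · by_cases h3 : σ i = σ x
          · rw [h3, Equiv.swap_apply_right, ← hσ x, ← h3, hσ]
          · rw [Equiv.swap_apply_of_ne_of_ne h2 h3, hσ]) rfl
      have h4 : ofPerm σ = ofPerm (Equiv.swap x (σ x)) * ofPerm (Equiv.swap x (σ x) * σ) := by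
        rw [← map_mul, ← mul_assoc, Equiv.swap_mul_self, one_mul]
      rw [h4]
      exact H.mul_mem (hH _ _ (Ne.symm hx) (hσ x).symm) hmem

theorem ofSgn_mem_of_fl_mem [Fintype ι] {H : Subgroup (SgnPerm ι)} {ε : ι → ℤˣ}
    (hH : ∀ i, ε i ≠ 1 → fl i ∈ H) : ofSgn ε ∈ H := by
  have key : ε ∈ H.comap ofSgn := by
    rw [← Finset.univ_prod_mulSingle ε]
    refine Subgroup.prod_mem _ fun i _ => ?_
    rcases Int.units_eq_one_or (ε i) with h | h
    · rw [h, Pi.mulSingle_one]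
      exact Subgroup.one_mem _
    · rw [h]
      exact hH i (by rw [h]; decide)
  exact key

/-- An even sign change is a product of twofold sign changes: every sign change that occurs is
paired with a fixed one. -/
theorem ofSgn_mem_of_fl_mul_fl_mem [Fintype ι] {H : Subgroup (SgnPerm ι)} {ε : ι → ℤˣ}
    (hprod : ∏ i, ε i = 1)
    (hH : ∀ i j, i ≠ j → ε i ≠ 1 → ε j ≠ 1 → fl i * fl j ∈ H) : ofSgn ε ∈ H := by
  by_cases h1 : ∀ i, ε i = 1
  · rw [show ε = 1 from funext h1, map_one]
    exact H.one_mem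
  · push Not at h1
    obtain ⟨i₀, hi₀⟩ := h1
    have key : ε ∈ H.comap ofSgn := by
      have h2 : ε = ∏ i, (Pi.mulSingle i (ε i) * Pi.mulSingle i₀ (ε i)) := by
        rw [Finset.prod_mul_distrib, Finset.univ_prod_mulSingle]
        have : ∏ i, (Pi.mulSingle i₀ (ε i) : ι → ℤˣ) = Pi.mulSingle i₀ (∏ i, ε i) :=
          (map_prod (MonoidHom.mulSingle (fun _ => ℤˣ) i₀) ε Finset.univ).symm
        rw [this, hprod, Pi.mulSingle_one, mul_one]
      rw [h2]
      refine Subgroup.prod_mem _ fun i _ => ?_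
      rcases Int.units_eq_one_or (ε i) with h | h
      · rw [h, Pi.mulSingle_one, Pi.mulSingle_one]
        exact Subgroup.one_mem _
      · by_cases hi : i = i₀
        · subst hi
          rw [h, ← Pi.mulSingle_mul]
          have : (-1 : ℤˣ) * -1 = 1 := by decide
          rw [this, Pi.mulSingle_one]
          exact Subgroup.one_mem _
        · rw [h]
          exact hH i i₀ hi (by rw [h]; decide) hi₀
    exact key

/-- Adjacent transpositions in a chain generate all transpositions. -/
theorem swap_mem_of_chain {H : Subgroup (SgnPerm ι)} {k : ℕ} {f : Fin k → ι}
    (hf : Function.Injective f)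
    (hH : ∀ s (h : s + 1 < k),
      ofPerm (Equiv.swap (f ⟨s, Nat.lt_of_succ_lt h⟩) (f ⟨s + 1, h⟩)) ∈ H) (s t : Fin k) :
    ofPerm (Equiv.swap (f s) (f t)) ∈ H := by
  have key : ∀ s d (h : s + d < k),
      ofPerm (Equiv.swap (f ⟨s, by omega⟩) (f ⟨s + d, h⟩)) ∈ H := by
    intro s d
    induction d with
    | zero =>
      intro _
      simp only [add_zero, Equiv.swap_self]
      exact H.one_mem
    | succ d ih =>
      intro hd
      by_cases h0 : d = 0
      · subst h0
        exact hH s hd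
      · have h1 := ih (by omega)
        have h2 := hH (s + d) (by omega)
        have h3 := H.mul_mem (H.mul_mem h2 h1) (H.inv_mem h2)
        rw [conj_swap, Equiv.swap_apply_left, Equiv.swap_apply_of_ne_of_ne] at h3
        · exact h3
        · intro e
          have := Fin.ext_iff.1 (hf e)
          simp only at this
          omega
        · intro e
          have := Fin.ext_iff.1 (hf e)
          simp only at this
          omega
  obtain ⟨s, hs⟩ := s
  obtain ⟨t, ht⟩ := t
  rcases le_total s t with h | h
  · obtain ⟨d, rfl⟩ := Nat.exists_eq_add_of_le h
    exact key s d ht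
  · obtain ⟨d, rfl⟩ := Nat.exists_eq_add_of_le h
    rw [Equiv.swap_comm]
    exact key t d hs

end SgnPerm

open SgnPerm

/-! ### Signed permutations as isometries -/

section Isom

variable {n : ℕ}

/-- The action of signed permutations on Euclidean space. -/
def toIsom : SgnPerm (Fin n) →* (Euc n ≃ₗᵢ[ℝ] Euc n) where
  toFun g := signedPerm g.perm g.sgn
  map_one' := signedPerm_one
  map_mul' g h := (signedPerm_mul g.perm h.perm g.sgn h.sgn).symm

theorem toIsom_eVec (g : SgnPerm (Fin n)) (i : Fin n) :
    toIsom g (eVec i) = ((g.sgn i : ℤ) : ℝ) • eVec (g.perm i) := signedPerm_e _ _ _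

theorem toIsom_apply (g : SgnPerm (Fin n)) (v : Euc n) (i : Fin n) :
    toIsom g v (g.perm i) = ((g.sgn i : ℤ) : ℝ) * v i := by
  change signedPerm g.perm g.sgn v (g.perm i) = _
  rw [signedPerm_apply, Equiv.symm_apply_apply]

theorem eVec_apply (i j : Fin n) : (eVec i : Euc n) j = if j = i then 1 else 0 := by
  simp [eVec]

theorem inner_eVec (i : Fin n) (v : Euc n) : inner ℝ (eVec i) v = v i := by
  simp [eVec, EuclideanSpace.inner_single_left]

theorem sum_smul_eVec (v : Euc n) : v = ∑ i, v i • eVec i := by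
  ext j
  simp [eVec_apply, Finset.sum_apply]

theorem isom_ext {g h : Euc n ≃ₗᵢ[ℝ] Euc n} (H : ∀ i, g (eVec i) = h (eVec i)) : g = h := by
  ext1 v
  rw [sum_smul_eVec v, map_sum, map_sum]
  refine Finset.sum_congr rfl fun i _ => ?_
  rw [map_smul, map_smul, H]

theorem eVec_injective {i j : Fin n} {s t : ℤˣ}
    (h : ((s : ℤ) : ℝ) • (eVec i : Euc n) = ((t : ℤ) : ℝ) • eVec j) : i = j ∧ s = t := by
  have h1 := congrArg (fun v : Euc n => v i) h
  simp only [PiLp.smul_apply, eVec_apply, smul_eq_mul, if_true, mul_one] at h1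
  by_cases hij : i = j
  · subst hij
    refine ⟨rfl, ?_⟩
    simp only [if_true, mul_one] at h1
    exact Units.ext (by exact_mod_cast h1)
  · rw [if_neg hij, mul_zero] at h1
    exact absurd h1 (by exact_mod_cast s.ne_zero)

theorem toIsom_injective : Function.Injective (toIsom : SgnPerm (Fin n) → _) := by
  intro g h e
  have key : ∀ i, g.perm i = h.perm i ∧ g.sgn i = h.sgn i := by
    intro i
    apply eVec_injective
    rw [← toIsom_eVec, ← toIsom_eVec, e]
  ext1
  · exact Equiv.ext fun i => (key i).1
  · exact funext fun i => (key i).2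

theorem mem_WB {g : Euc n ≃ₗᵢ[ℝ] Euc n} : g ∈ WB n ↔ ∃ k, g = toIsom k :=
  ⟨fun ⟨σ, ε, h⟩ => ⟨⟨σ, ε⟩, h⟩, fun ⟨k, h⟩ => ⟨k.perm, k.sgn, h⟩⟩

theorem mem_WD {g : Euc n ≃ₗᵢ[ℝ] Euc n} :
    g ∈ WD n ↔ ∃ k : SgnPerm (Fin n), ∏ i, k.sgn i = 1 ∧ g = toIsom k :=
  ⟨fun ⟨σ, ε, h⟩ => ⟨⟨σ, ε⟩, h⟩, fun ⟨k, h⟩ => ⟨k.perm, k.sgn, h⟩⟩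

theorem toIsom_mem_WD {k : SgnPerm (Fin n)} : toIsom k ∈ WD n ↔ ∏ i, k.sgn i = 1 := by
  rw [mem_WD]
  constructor
  · rintro ⟨k', h, e⟩
    rwa [toIsom_injective e]
  · exact fun h => ⟨k, h, rfl⟩

theorem finite_of_le_WD {P : Subgroup (Euc n ≃ₗᵢ[ℝ] Euc n)} (h : P ≤ WD n) :
    (P : Set (Euc n ≃ₗᵢ[ℝ] Euc n)).Finite := by
  refine (Set.finite_range (toIsom : SgnPerm (Fin n) → _)).subset fun g hg => ?_
  obtain ⟨k, _, rfl⟩ := mem_WD.1 (h hg)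
  exact ⟨k, rfl⟩

theorem unit_mul_self (s : ℤˣ) : ((s : ℤ) : ℝ) * ((s : ℤ) : ℝ) = 1 := by
  rcases Int.units_eq_one_or s with h | h <;> simp [h]

theorem refl_eVec (x : Fin n) : refl (eVec x) = toIsom (fl x) := by
  apply isom_ext
  intro i
  have h1 : ‖(eVec x : Euc n)‖ = 1 := by simp [eVec]
  rw [refl_apply_of_norm_eq_one h1, toIsom_eVec, inner_eVec, eVec_apply]
  by_cases h : i = x
  · subst h
    simp [fl, two_smul]
  · have : ¬ x = i := fun e => h e.symm
    simp [fl, h, this]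

theorem refl_eVec_add {x y : Fin n} (h : x ≠ y) (s : ℤˣ) :
    refl (eVec y + ((s : ℤ) : ℝ) • eVec x) = toIsom (swS x y s) := by
  have h' : y ≠ x := h.symm
  have h1 : ‖(eVec y + ((s : ℤ) : ℝ) • eVec x : Euc n)‖ ^ 2 = 2 := by
    rw [← real_inner_self_eq_norm_sq, inner_add_left, inner_smul_left, inner_eVec, inner_eVec]
    simp only [PiLp.add_apply, PiLp.smul_apply, eVec_apply, smul_eq_mul, if_true, if_neg h,
      if_neg h', conj_trivial, mul_zero, mul_one, add_zero, zero_add, unit_mul_self]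
    norm_num
  apply isom_ext
  intro i
  rw [refl_apply, h1, toIsom_eVec, inner_add_left, inner_smul_left, inner_eVec, inner_eVec,
    eVec_apply, eVec_apply]
  by_cases hx : i = x
  · subst hx
    simp only [swS, Equiv.swap_apply_left, true_or, if_true, if_neg h', conj_trivial, mul_one,
      zero_add, Units.val_neg, Int.cast_neg]
    rw [mul_div_assoc, mul_comm, div_mul_cancel₀ _ (two_ne_zero), smul_add, smul_smul,
      unit_mul_self, one_smul, neg_smul]
    abel
  · by_cases hy : i = y
    · subst hy
      simp only [swS, Equiv.swap_apply_right, or_true, if_true, if_neg h, conj_trivial, mul_one,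
        mul_zero, add_zero, Units.val_neg, Int.cast_neg, neg_smul]
      rw [div_self two_ne_zero, one_smul]
      abel
    · have hx' : ¬ x = i := fun e => hx e.symm
      have hy' : ¬ y = i := fun e => hy e.symm
      simp [swS, hx, hy, hx', hy', Equiv.swap_apply_of_ne_of_ne hx hy]

/-! ### Roots of subgroups of `W(D_n)` -/

/-- The unit vector in the direction of `t e_y + s e_x`. -/
def root (x : Fin n) (s : ℤˣ) (y : Fin n) (t : ℤˣ) : Euc n :=
  (√2 : ℝ)⁻¹ • (((t : ℤ) : ℝ) • eVec y + ((s : ℤ) : ℝ) • eVec x)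

theorem root_comm (x : Fin n) (s : ℤˣ) (y : Fin n) (t : ℤˣ) : root x s y t = root y t x s := by
  unfold root
  rw [add_comm]

theorem root_eq_smul (x : Fin n) (s : ℤˣ) (y : Fin n) (t : ℤˣ) :
    root x s y t = ((√2 : ℝ)⁻¹ * ((t : ℤ) : ℝ)) • (eVec y + (((s * t : ℤˣ) : ℤ) : ℝ) • eVec x) := by
  unfold root
  rw [mul_smul, smul_add _ (eVec y), smul_smul ((t : ℤ) : ℝ)]
  congr 4
  rcases Int.units_eq_one_or s with rfl | rfl <;> rcases Int.units_eq_one_or t with rfl | rfl <;>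
    norm_num

theorem refl_root {x y : Fin n} (h : x ≠ y) (s t : ℤˣ) :
    refl (root x s y t) = toIsom (swS x y (s * t)) := by
  rw [root_eq_smul, refl_smul, refl_eVec_add h]
  refine mul_ne_zero (by positivity) ?_
  exact_mod_cast t.ne_zero

theorem toIsom_root (g : SgnPerm (Fin n)) (x : Fin n) (s : ℤˣ) (y : Fin n) (t : ℤˣ) :
    toIsom g (root x s y t) = root (g.perm x) (s * g.sgn x) (g.perm y) (t * g.sgn y) := by
  unfold root
  rw [map_smul, map_add, map_smul, map_smul, toIsom_eVec, toIsom_eVec, smul_smul, smul_smul]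
  push_cast
  rfl

theorem inner_root_left (x : Fin n) (s : ℤˣ) (y : Fin n) (t : ℤˣ) (v : Euc n) :
    inner ℝ (root x s y t) v = (√2 : ℝ)⁻¹ * (((t : ℤ) : ℝ) * v y + ((s : ℤ) : ℝ) * v x) := by
  unfold root
  rw [inner_smul_left, inner_add_left, inner_smul_left, inner_smul_left, inner_eVec, inner_eVec]
  simp

theorem inner_root_eq_zero_iff (x : Fin n) (s : ℤˣ) (y : Fin n) (t : ℤˣ) (v : Euc n) :
    inner ℝ (root x s y t) v = 0 ↔ ((t : ℤ) : ℝ) * v y + ((s : ℤ) : ℝ) * v x = 0 := by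
  rw [inner_root_left, mul_eq_zero]
  have : (√2 : ℝ)⁻¹ ≠ 0 := by positivity
  simp [this]

theorem root_apply (x : Fin n) (s : ℤˣ) (y : Fin n) (t : ℤˣ) (i : Fin n) :
    root x s y t i = (√2 : ℝ)⁻¹ * (((t : ℤ) : ℝ) * (if i = y then 1 else 0) +
      ((s : ℤ) : ℝ) * (if i = x then 1 else 0)) := by
  unfold root
  simp only [PiLp.smul_apply, PiLp.add_apply, smul_eq_mul, eVec_apply]

theorem norm_root {x y : Fin n} (h : x ≠ y) (s t : ℤˣ) : ‖root x s y t‖ = 1 := by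
  have h' : y ≠ x := h.symm
  have h2 : (√2 : ℝ)⁻¹ * (√2 : ℝ)⁻¹ = 1 / 2 := by
    rw [← mul_inv, Real.mul_self_sqrt (by norm_num)]; norm_num
  have h1 : ‖root x s y t‖ ^ 2 = 1 := by
    rw [← real_inner_self_eq_norm_sq, inner_root_left, root_apply, root_apply]
    simp only [if_true, if_neg h, if_neg h', mul_one, mul_zero, add_zero, zero_add]
    have := unit_mul_self s
    have := unit_mul_self t
    calc _ = ((√2 : ℝ)⁻¹ * (√2 : ℝ)⁻¹) * (((t : ℤ) : ℝ) * ((t : ℤ) : ℝ) +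
        ((s : ℤ) : ℝ) * ((s : ℤ) : ℝ)) := by ring
      _ = 1 := by rw [h2, unit_mul_self, unit_mul_self]; norm_num
  exact (pow_eq_one_iff_of_nonneg (norm_nonneg _) two_ne_zero).1 h1

theorem root_ne_zero {x y : Fin n} (h : x ≠ y) (s t : ℤˣ) : root x s y t ≠ 0 := by
  intro e
  have := norm_root h s t
  rw [e, norm_zero] at this
  exact zero_ne_one this

theorem inner_root_stdRho (x : Fin n) (s : ℤˣ) (y : Fin n) (t : ℤˣ) (h : x < y) :
    0 < inner ℝ (root x s y t) (stdRho n) * ((t : ℤ) : ℝ) := by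
  have h1 : (x.val : ℝ) < y.val := by exact_mod_cast h
  have h2 : (0 : ℝ) ≤ x.val := by positivity
  have h3 : (0 : ℝ) < (√2 : ℝ)⁻¹ := by positivity
  rw [inner_root_left, mul_assoc]
  refine mul_pos h3 ?_
  change 0 < (((t : ℤ) : ℝ) * ((y.val : ℝ) + 1) + ((s : ℤ) : ℝ) * ((x.val : ℝ) + 1)) *
    ((t : ℤ) : ℝ)
  rcases Int.units_eq_one_or s with rfl | rfl <;> rcases Int.units_eq_one_or t with rfl | rfl <;>
    push_cast <;> linarith

/-- The unit roots of `W(D_n)` are the vectors `(± e_y ± e_x) / √2`. -/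
theorem exists_eq_root_of_refl_mem_WD {α : Euc n} (hα : ‖α‖ = 1) (h : refl α ∈ WD n) :
    ∃ x y s t, x < y ∧ α = root x s y t := by
  obtain ⟨g, hg, e⟩ := mem_WD.1 h
  obtain ⟨v, hv⟩ : ∃ v, α v ≠ 0 := by
    by_contra! h0
    have : α = 0 := by ext i; exact h0 i
    rw [this, norm_zero] at hα
    exact zero_ne_one hα
  -- compare the coordinates of the images of `e_v` under the reflection and under `g`
  have h1 : ∀ u, (if u = v then (1 : ℝ) else 0) - 2 * α v * α u =
      ((g.sgn v : ℤ) : ℝ) * (if u = g.perm v then 1 else 0) := by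
    intro u
    have h2 := toIsom_eVec g v
    rw [← e, refl_apply_of_norm_eq_one hα, real_inner_comm, inner_eVec] at h2
    have h3 := congrArg (fun w : Euc n => w u) h2
    simpa only [PiLp.sub_apply, PiLp.smul_apply, smul_eq_mul, eVec_apply] using h3
  by_cases hw : g.perm v = v
  · exfalso
    rw [hw] at h1
    -- then `α` is a multiple of `e_v`, and `g` has exactly one sign change
    have h4 : α = α v • eVec v := by
      ext u
      simp only [PiLp.smul_apply, smul_eq_mul, eVec_apply]
      by_cases hu : u = v
      · subst hu; simp
      · have := h1 u
        rw [if_neg hu, mul_zero, zero_sub, neg_eq_zero] at this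
        rw [if_neg hu, mul_zero]
        exact (mul_eq_zero.1 this).resolve_left (mul_ne_zero two_ne_zero hv)
    rw [h4, refl_smul hv, refl_eVec] at e
    rw [← toIsom_injective e] at hg
    simp only [fl, ofSgn_sgn] at hg
    rw [Finset.prod_pi_mulSingle'] at hg
    simp at hg
  · -- `α` is supported on `v` and its image, with coordinates of absolute value `1 / √2`
    have hw' : ¬ v = g.perm v := fun e => hw e.symm
    have h2 := h1 v
    rw [if_pos rfl, if_neg hw', mul_zero] at h2
    have h3 := h1 (g.perm v)
    rw [if_neg hw, if_pos rfl, mul_one, zero_sub] at h3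
    have h4 : ∀ u, u ≠ v → u ≠ g.perm v → α u = 0 := by
      intro u hu1 hu2
      have := h1 u
      rw [if_neg hu1, if_neg hu2, mul_zero, zero_sub, neg_eq_zero] at this
      exact (mul_eq_zero.1 this).resolve_left (mul_ne_zero two_ne_zero hv)
    have h5 : α (g.perm v) = -((g.sgn v : ℤ) : ℝ) * α v := by
      rw [← h3]
      linear_combination α (g.perm v) * h2
    have hs : (√2 : ℝ)⁻¹ * (√2 : ℝ)⁻¹ = 1 / 2 := by
      rw [← mul_inv, Real.mul_self_sqrt (by norm_num)]; norm_num
    obtain ⟨t, ht⟩ : ∃ t : ℤˣ, α v = (√2 : ℝ)⁻¹ * ((t : ℤ) : ℝ) := by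
      have : (α v - (√2 : ℝ)⁻¹) * (α v + (√2 : ℝ)⁻¹) = 0 := by
        linear_combination -(1 / 2) * h2 - hs
      rcases mul_eq_zero.1 this with h | h
      · exact ⟨1, by simp; linarith⟩
      · exact ⟨-1, by simp; linarith⟩
    have key : α = root v t (g.perm v) (-(g.sgn v) * t) := by
      ext u
      rw [root_apply]
      by_cases hu1 : u = v
      · subst hu1
        rw [if_neg hw', if_pos rfl, ht]
        ring
      · by_cases hu2 : u = g.perm v
        · subst hu2
          rw [if_neg hw, if_pos rfl, h5, ht]
          push_cast
          ring
        · rw [if_neg hu1, if_neg hu2, h4 u hu1 hu2]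
          ring
    rcases lt_or_gt_of_ne (Ne.symm hw) with hlt | hlt
    · exact ⟨_, _, _, _, hlt, key⟩
    · exact ⟨_, _, _, _, hlt, key.trans (root_comm _ _ _ _)⟩

theorem isRegularVec_stdRho {P : Subgroup (Euc n ≃ₗᵢ[ℝ] Euc n)} (hP : P ≤ WD n) :
    IsRegularVec P (stdRho n) := by
  intro α hα h0
  obtain ⟨x, y, s, t, hxy, rfl⟩ := exists_eq_root_of_refl_mem_WD hα.1 (hP hα.2)
  have := inner_root_stdRho x s y t hxy
  rw [h0, zero_mul] at this
  exact lt_irrefl _ this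

theorem root_mem_posRoots {P : Subgroup (Euc n ≃ₗᵢ[ℝ] Euc n)} {x y : Fin n} (h : x < y)
    {s t : ℤˣ} : root x s y t ∈ posRoots P (stdRho n) ↔
      t = 1 ∧ toIsom (swS x y s) ∈ P := by
  unfold posRoots roots
  have h1 := inner_root_stdRho x s y t h
  simp only [Set.mem_ofPred_eq]
  rw [refl_root h.ne, and_iff_right (norm_root h.ne s t)]
  rcases Int.units_eq_one_or t with rfl | rfl
  · simp at h1
    simp [h1]
  · simp at h1
    have h2 : ¬ (-1 : ℤˣ) = 1 := by decide
    simp [h1.le]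

theorem mem_posRoots_iff {P : Subgroup (Euc n ≃ₗᵢ[ℝ] Euc n)} (hP : P ≤ WD n) {α : Euc n} :
    α ∈ posRoots P (stdRho n) ↔
      ∃ x y s, x < y ∧ toIsom (swS x y s) ∈ P ∧ α = root x s y 1 := by
  constructor
  · intro hα
    obtain ⟨x, y, s, t, hxy, rfl⟩ := exists_eq_root_of_refl_mem_WD hα.1.1 (hP hα.1.2)
    rw [root_mem_posRoots hxy] at hα
    exact ⟨x, y, s, hxy, hα.2, by rw [hα.1]⟩
  · rintro ⟨x, y, s, hxy, h, rfl⟩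
    exact (root_mem_posRoots hxy).2 ⟨rfl, h⟩

end Isom

/-! ### Core points, block points and block vectors -/

/-- The standing assumptions on `lam`, up to the order of the parts: the parts are positive, and
their sum is less than `n - 1`. -/
class IsLabel (n : ℕ) {p : ℕ} (lam : Fin p → ℕ) : Prop where
  pos : ∀ i, 0 < lam i
  lt : ∑ i, lam i + 1 < n

section Points

variable (n : ℕ) {p : ℕ} (lam : Fin p → ℕ) [hL : IsLabel n lam]

theorem coreRank_add_sum : coreRank n lam + ∑ i, lam i = n := by
  have := hL.lt
  unfold coreRank
  omega

theorem two_le_coreRank : 2 ≤ coreRank n lam := by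
  have := hL.lt
  unfold coreRank
  omega

instance : NeZero (coreRank n lam) := ⟨by have := two_le_coreRank n lam; omega⟩

theorem offset_succ {i j : Fin p} (h : j.val = i.val + 1) :
    offset n lam j = offset n lam i + lam i := by
  unfold offset
  have : Finset.univ.filter (· < j) = insert i (Finset.univ.filter (· < i)) := by
    ext k
    simp only [Finset.mem_filter, Finset.mem_univ, true_and, Finset.mem_insert, Fin.lt_def,
      Fin.ext_iff]
    omega
  rw [this, Finset.sum_insert (by simp)]
  ring

theorem offset_add_le {i j : Fin p} (h : i < j) : offset n lam i + lam i ≤ offset n lam j := by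
  unfold offset
  have : insert i (Finset.univ.filter (· < i)) ⊆ Finset.univ.filter (· < j) := by
    intro k
    simp only [Finset.mem_filter, Finset.mem_univ, true_and, Finset.mem_insert]
    rintro (rfl | hk)
    · exact h
    · exact hk.trans h
  have h2 := Finset.sum_le_sum_of_subset (f := lam) this
  rw [Finset.sum_insert (by simp)] at h2
  omega

theorem coreRank_le_offset (i : Fin p) : coreRank n lam ≤ offset n lam i := Nat.le_add_right _ _

theorem offset_add_le_n (i : Fin p) : offset n lam i + lam i ≤ n := by
  unfold offset
  have h2 := Finset.sum_le_sum_of_subset (f := lam)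
    (Finset.subset_univ (insert i (Finset.univ.filter (· < i))))
  rw [Finset.sum_insert (by simp)] at h2
  have := coreRank_add_sum n lam
  omega

/-- The points of the core. -/
def cpt (v : Fin (coreRank n lam)) : Fin n :=
  ⟨v.val, v.isLt.trans_le (by have := coreRank_add_sum n lam; omega)⟩

/-- The points of the blocks. -/
def bpt (i : Fin p) (t : Fin (lam i)) : Fin n :=
  ⟨offset n lam i + t.val, by have := offset_add_le_n n lam i; omega⟩

@[simp] theorem cpt_val (v : Fin (coreRank n lam)) : (cpt n lam v).val = v.val := rfl
@[simp] theorem bpt_val (i : Fin p) (t : Fin (lam i)) :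
    (bpt n lam i t).val = offset n lam i + t.val := rfl

theorem sigma_fin_ext {i j : Fin p} {t : Fin (lam i)} {s : Fin (lam j)} (h : i = j)
    (h' : t.val = s.val) : (⟨i, t⟩ : Σ i, Fin (lam i)) = ⟨j, s⟩ := by
  subst h
  rw [Fin.ext h']

theorem exists_block {x : ℕ} (hx : coreRank n lam ≤ x) (hxn : x < n) :
    ∃ i : Fin p, offset n lam i ≤ x ∧ x < offset n lam i + lam i := by
  have key : ∀ k ≤ p,
      x < coreRank n lam + ∑ j ∈ Finset.univ.filter (fun j : Fin p => j.val < k), lam j →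
      ∃ i : Fin p, offset n lam i ≤ x ∧ x < offset n lam i + lam i := by
    intro k
    induction k with
    | zero =>
      intro _ h
      simp at h
      omega
    | succ k ih =>
      intro hk h
      have h1 : Finset.univ.filter (fun j : Fin p => j.val < k + 1) =
          insert ⟨k, hk⟩ (Finset.univ.filter (fun j : Fin p => j.val < k)) := by
        ext j
        simp only [Finset.mem_filter, Finset.mem_univ, true_and, Finset.mem_insert, Fin.ext_iff]
        omega
      rw [h1, Finset.sum_insert (by simp)] at h
      have h2 : offset n lam ⟨k, hk⟩ =
          coreRank n lam + ∑ j ∈ Finset.univ.filter (fun j : Fin p => j.val < k), lam j := rfl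
      by_cases h3 : offset n lam ⟨k, hk⟩ ≤ x
      · exact ⟨_, h3, by omega⟩
      · exact ih (by omega) (by omega)
  refine key p le_rfl ?_
  have : Finset.univ.filter (fun j : Fin p => j.val < p) = Finset.univ := by simp
  rw [this, coreRank_add_sum]
  exact hxn

/-- The points `1, …, n`, sorted into core points and block points. -/
def pt : (Fin (coreRank n lam) ⊕ Σ i, Fin (lam i)) ≃ Fin n :=
  Equiv.ofBijective (Sum.elim (cpt n lam) (fun q => bpt n lam q.1 q.2)) (by
    constructor
    · rintro (v | ⟨i, t⟩) (w | ⟨j, s⟩) h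
      · have h1 : (cpt n lam v).val = (cpt n lam w).val := congrArg Fin.val h
        exact congrArg Sum.inl (Fin.ext h1)
      · have h1 : v.val = offset n lam j + s.val := congrArg Fin.val h
        have := coreRank_le_offset n lam j
        omega
      · have h1 : offset n lam i + t.val = w.val := congrArg Fin.val h
        have := coreRank_le_offset n lam i
        omega
      · have h1 : offset n lam i + t.val = offset n lam j + s.val := congrArg Fin.val h
        rcases lt_trichotomy i j with h2 | h2 | h2
        · have := offset_add_le n lam h2
          omega
        · exact congrArg Sum.inr (sigma_fin_ext lam h2 (by subst h2; omega))
        · have := offset_add_le n lam h2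
          omega
    · intro x
      by_cases hx : x.val < coreRank n lam
      · exact ⟨Sum.inl ⟨x.val, hx⟩, rfl⟩
      · obtain ⟨i, h1, h2⟩ := exists_block n lam (not_lt.1 hx) x.isLt
        exact ⟨Sum.inr ⟨i, ⟨x.val - offset n lam i, by omega⟩⟩, Fin.ext (by
          change offset n lam i + (x.val - offset n lam i) = x.val
          omega)⟩)

theorem pt_inl (v : Fin (coreRank n lam)) : pt n lam (Sum.inl v) = cpt n lam v := rfl
theorem pt_inr (q : Σ i, Fin (lam i)) : pt n lam (Sum.inr q) = bpt n lam q.1 q.2 := rfl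

theorem pt_symm_cpt (v : Fin (coreRank n lam)) : (pt n lam).symm (cpt n lam v) = Sum.inl v := by
  rw [← pt_inl, Equiv.symm_apply_apply]

theorem pt_symm_bpt (i : Fin p) (t : Fin (lam i)) :
    (pt n lam).symm (bpt n lam i t) = Sum.inr ⟨i, t⟩ := by
  rw [← pt_inr n lam ⟨i, t⟩, Equiv.symm_apply_apply]

@[elab_as_elim]
theorem pt_cases {C : Fin n → Prop} (h1 : ∀ v, C (cpt n lam v)) (h2 : ∀ i t, C (bpt n lam i t))
    (x : Fin n) : C x := by
  obtain ⟨y, rfl⟩ := (pt n lam).surjective x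
  rcases y with v | ⟨i, t⟩
  · exact h1 v
  · exact h2 i t

/-- The block of a point, and `none` for the points of the core. -/
def col (x : Fin n) : Option (Fin p) :=
  Sum.elim (fun _ => none) (fun q => some q.1) ((pt n lam).symm x)

@[simp] theorem col_cpt (v : Fin (coreRank n lam)) : col n lam (cpt n lam v) = none := by
  unfold col
  rw [pt_symm_cpt]
  rfl

@[simp] theorem col_bpt (i : Fin p) (t : Fin (lam i)) : col n lam (bpt n lam i t) = some i := by
  unfold col
  rw [pt_symm_bpt]
  rfl

theorem col_eq_none {x : Fin n} : col n lam x = none ↔ x.val < coreRank n lam := by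
  induction x using pt_cases n lam with
  | h1 v => simp
  | h2 i t =>
    have := coreRank_le_offset n lam i
    simp
    omega

theorem exists_cpt {x : Fin n} (h : col n lam x = none) : ∃ v, x = cpt n lam v :=
  ⟨⟨x.val, (col_eq_none n lam).1 h⟩, rfl⟩

theorem exists_bpt {x : Fin n} {i : Fin p} (h : col n lam x = some i) : ∃ t, x = bpt n lam i t := by
  induction x using pt_cases n lam with
  | h1 v => simp at h
  | h2 j t =>
    rw [col_bpt, Option.some_inj] at h
    subst h
    exact ⟨t, rfl⟩

theorem inBlock_iff {x : Fin n} {i : Fin p} : InBlock n lam i x ↔ col n lam x = some i := by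
  constructor
  · rintro ⟨h1, h2⟩
    have : x = bpt n lam i ⟨x.val - offset n lam i, by omega⟩ := Fin.ext (by simp; omega)
    rw [this, col_bpt]
  · intro h
    obtain ⟨t, rfl⟩ := exists_bpt n lam h
    exact ⟨by simp, by simp⟩

theorem cpt_injective : Function.Injective (cpt n lam) := fun v w h => by
  have h1 : (cpt n lam v).val = (cpt n lam w).val := congrArg Fin.val h
  exact Fin.ext h1

theorem bpt_injective (i : Fin p) : Function.Injective (bpt n lam i) := fun v w h => by
  have : offset n lam i + v.val = offset n lam i + w.val := congrArg Fin.val h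
  exact Fin.ext (by omega)

theorem prod_pt {M : Type*} [CommMonoid M] (F : Fin n → M) :
    ∏ x, F x = (∏ v, F (cpt n lam v)) * ∏ i, ∏ t, F (bpt n lam i t) := by
  rw [← (pt n lam).prod_comp, Fintype.prod_sum_type, Fintype.prod_sigma]
  rfl

theorem sum_pt {M : Type*} [AddCommMonoid M] (F : Fin n → M) :
    ∑ x, F x = (∑ v, F (cpt n lam v)) + ∑ i, ∑ t, F (bpt n lam i t) := by
  rw [← (pt n lam).sum_comp, Fintype.sum_sum_type, Fintype.sum_sigma]
  rfl

/-- The vector `f_i`, the sum of the basis vectors of the `i`-th block. -/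
def fvec (i : Fin p) : Euc n := WithLp.toLp 2 fun x => if col n lam x = some i then 1 else 0

theorem fvec_apply (i : Fin p) (x : Fin n) :
    fvec n lam i x = if col n lam x = some i then 1 else 0 := rfl

theorem inner_eq_sum (v w : Euc n) : inner ℝ v w = ∑ x, v x * w x := by
  rw [PiLp.inner_apply]
  simp [mul_comm]

theorem inner_fvec (i j : Fin p) :
    inner ℝ (fvec n lam i) (fvec n lam j) = if i = j then (lam i : ℝ) else 0 := by
  rw [inner_eq_sum, sum_pt n lam]
  simp only [fvec_apply, col_cpt, col_bpt, Option.some_inj, reduceCtorEq, if_false, mul_zero,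
    Finset.sum_const_zero, zero_add, Finset.sum_const, Finset.card_univ, Fintype.card_fin,
    nsmul_eq_mul]
  rw [Finset.sum_eq_single i]
  · by_cases h : i = j <;> simp [h]
  · intro k _ hk
    simp [hk]
  · simp

/-! ### The group of block permutations with signs -/

/-- The signed permutations of the blocks that permute blocks of equal size. -/
def lamGroup : Subgroup (SgnPerm (Fin p)) where
  carrier := {g | ∀ i, lam (g.perm i) = lam i}
  mul_mem' {a b} ha hb i := by
    change lam (a.perm (b.perm i)) = lam i
    rw [ha, hb]
  one_mem' _ := rfl
  inv_mem' {a} ha i := by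
    have := ha (a.perm⁻¹ i)
    change lam (a.perm⁻¹ i) = lam i
    rw [← this]
    simp

/-- The identity of `{0, …, k - 1}` for `s = 1`, and the order reversal for `s = -1`. -/
def revSgn (s : ℤˣ) (k t : ℕ) : ℕ := if s = 1 then t else k - 1 - t

theorem revSgn_lt {k t : ℕ} (s : ℤˣ) (h : t < k) : revSgn s k t < k := by
  unfold revSgn
  split_ifs <;> omega

theorem revSgn_mul {k t : ℕ} (s s' : ℤˣ) (h : t < k) :
    revSgn (s * s') k t = revSgn s k (revSgn s' k t) := by
  unfold revSgn
  have h1 : ¬ (-1 : ℤˣ) = 1 := by decide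
  have h2 : (-1 : ℤˣ) * -1 = 1 := by decide
  rcases Int.units_eq_one_or s with rfl | rfl <;> rcases Int.units_eq_one_or s' with rfl | rfl <;>
    simp [h1, h2]
  omega

variable {lam}

/-- The action of block permutations on block points: the sign `-1` at a block reverses it. -/
def blockFun (g : lamGroup lam) (q : Σ i, Fin (lam i)) : Σ i, Fin (lam i) :=
  ⟨g.1.perm q.1, ⟨revSgn (g.1.sgn q.1) (lam q.1) q.2, by
    rw [g.2 q.1]; exact revSgn_lt _ q.2.isLt⟩⟩

theorem blockFun_mul (g h : lamGroup lam) (q : Σ i, Fin (lam i)) :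
    blockFun (g * h) q = blockFun g (blockFun h q) := by
  refine sigma_fin_ext lam rfl ?_
  change revSgn (g.1.sgn (h.1.perm q.1) * h.1.sgn q.1) (lam q.1) q.2 =
    revSgn (g.1.sgn (h.1.perm q.1)) (lam (h.1.perm q.1)) (revSgn (h.1.sgn q.1) (lam q.1) q.2)
  rw [revSgn_mul _ _ q.2.isLt, h.2 q.1]

theorem blockFun_one (q : Σ i, Fin (lam i)) : blockFun (1 : lamGroup lam) q = q := rfl

/-- The permutation of the points induced by a signed permutation of the blocks. -/
def blockPerm : lamGroup lam →* Equiv.Perm (Fin n) where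
  toFun g := (pt n lam).permCongr (Equiv.sumCongr (Equiv.refl _)
    ⟨blockFun g, blockFun g⁻¹, fun q => by rw [← blockFun_mul, inv_mul_cancel, blockFun_one],
      fun q => by rw [← blockFun_mul, mul_inv_cancel, blockFun_one]⟩)
  map_one' := by
    ext x
    obtain ⟨y, rfl⟩ := (pt n lam).surjective x
    rcases y with v | q <;> simp [Equiv.permCongr_apply, blockFun_one]
  map_mul' g h := by
    ext x
    obtain ⟨y, rfl⟩ := (pt n lam).surjective x
    rcases y with v | q <;> simp [Equiv.permCongr_apply, blockFun_mul]

theorem blockPerm_cpt (g : lamGroup lam) (v : Fin (coreRank n lam)) :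
    blockPerm n g (cpt n lam v) = cpt n lam v := by
  rw [← pt_inl]
  simp [blockPerm, Equiv.permCongr_apply]

theorem blockPerm_bpt (g : lamGroup lam) (i : Fin p) (t : Fin (lam i)) :
    blockPerm n g (bpt n lam i t) = bpt n lam (g.1.perm i)
      ⟨revSgn (g.1.sgn i) (lam i) t, by rw [g.2 i]; exact revSgn_lt _ t.isLt⟩ := by
  rw [← pt_inr n lam ⟨i, t⟩]
  simp [blockPerm, Equiv.permCongr_apply]
  rfl

/-- The parity of the sign changes in the blocks. -/
def blockParity : lamGroup lam →* ℤˣ where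
  toFun g := ∏ i, g.1.sgn i ^ lam i
  map_one' := by simp
  map_mul' g h := by
    simp only [Subgroup.coe_mul, mul_sgn, mul_pow, Finset.prod_mul_distrib]
    congr 1
    rw [← Equiv.prod_comp h.1.perm fun i => g.1.sgn i ^ lam i]
    exact Finset.prod_congr rfl fun i _ => by rw [h.2 i]

/-- The signs of the signed permutation of the points induced by a signed permutation of the blocks:
a sign at a block is spread over the block, and the first point of the core makes the total number
of sign changes even. -/
def blockSgn (g : lamGroup lam) (x : Fin n) : ℤˣ :=
  Sum.elim (fun v => if v = 0 then blockParity g else 1) (fun q => g.1.sgn q.1) ((pt n lam).symm x)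

theorem blockSgn_cpt (g : lamGroup lam) (v : Fin (coreRank n lam)) :
    blockSgn n g (cpt n lam v) = if v = 0 then blockParity g else 1 := by
  unfold blockSgn
  rw [pt_symm_cpt]
  rfl

theorem blockSgn_bpt (g : lamGroup lam) (i : Fin p) (t : Fin (lam i)) :
    blockSgn n g (bpt n lam i t) = g.1.sgn i := by
  unfold blockSgn
  rw [pt_symm_bpt]
  rfl

/-- Signed permutations of the blocks as signed permutations with an even number of sign changes:
the isomorphism onto the Howlett complement of the standard parabolic subgroup. -/
def Phi : lamGroup lam →* SgnPerm (Fin n) where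
  toFun g := ⟨blockPerm n g, blockSgn n g⟩
  map_one' := by
    ext1
    · exact map_one _
    · funext x
      change blockSgn n (1 : lamGroup lam) x = 1
      induction x using pt_cases n lam with
      | h1 v => rw [blockSgn_cpt, map_one, ite_self]
      | h2 i t => rw [blockSgn_bpt]; rfl
  map_mul' g h := by
    ext1
    · exact map_mul _ _ _
    · funext x
      change blockSgn n (g * h) x = blockSgn n g (blockPerm n h x) * blockSgn n h x
      induction x using pt_cases n lam with
      | h1 v =>
        rw [blockPerm_cpt, blockSgn_cpt, blockSgn_cpt, blockSgn_cpt, map_mul]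
        split_ifs <;> simp
      | h2 i t =>
        rw [blockPerm_bpt, blockSgn_bpt, blockSgn_bpt, blockSgn_bpt]
        rfl

theorem Phi_perm_cpt (g : lamGroup lam) (v : Fin (coreRank n lam)) :
    (Phi n g).perm (cpt n lam v) = cpt n lam v := blockPerm_cpt n g v

theorem Phi_perm_bpt (g : lamGroup lam) (i : Fin p) (t : Fin (lam i)) :
    (Phi n g).perm (bpt n lam i t) = bpt n lam (g.1.perm i)
      ⟨revSgn (g.1.sgn i) (lam i) t, by rw [g.2 i]; exact revSgn_lt _ t.isLt⟩ :=
  blockPerm_bpt n g i t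

theorem Phi_sgn_cpt (g : lamGroup lam) (v : Fin (coreRank n lam)) :
    (Phi n g).sgn (cpt n lam v) = if v = 0 then blockParity g else 1 := blockSgn_cpt n g v

theorem Phi_sgn_bpt (g : lamGroup lam) (i : Fin p) (t : Fin (lam i)) :
    (Phi n g).sgn (bpt n lam i t) = g.1.sgn i := blockSgn_bpt n g i t

theorem prod_Phi_sgn (g : lamGroup lam) : ∏ x, (Phi n g).sgn x = 1 := by
  rw [prod_pt n lam]
  simp only [Phi_sgn_cpt, Phi_sgn_bpt, Finset.prod_ite_eq', Finset.mem_univ, if_true,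
    Finset.prod_const, Finset.card_univ, Fintype.card_fin]
  exact Int.units_mul_self (blockParity g)

/-- The isometry defined by a signed permutation of the blocks. -/
def blockIsom : lamGroup lam →* (Euc n ≃ₗᵢ[ℝ] Euc n) := toIsom.comp (Phi n)

theorem blockIsom_apply_eq (g : lamGroup lam) : blockIsom n g = toIsom (Phi n g) := rfl

theorem blockIsom_mem_WD (g : lamGroup lam) : blockIsom n g ∈ WD n :=
  toIsom_mem_WD.2 (prod_Phi_sgn n g)

theorem blockIsom_fvec (g : lamGroup lam) (i : Fin p) :
    blockIsom n g (fvec n lam i) = ((g.1.sgn i : ℤ) : ℝ) • fvec n lam (g.1.perm i) := by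
  ext y
  obtain ⟨x, rfl⟩ := (Phi n g).perm.surjective y
  rw [blockIsom_apply_eq, toIsom_apply, PiLp.smul_apply, smul_eq_mul, fvec_apply, fvec_apply]
  induction x using pt_cases n lam with
  | h1 v => rw [Phi_perm_cpt]; simp
  | h2 j t =>
    rw [Phi_perm_bpt, Phi_sgn_bpt, col_bpt, col_bpt]
    by_cases h : j = i
    · subst h; simp
    · simp [h]

theorem fvec_smul_injective {i j : Fin p} {s t : ℤˣ}
    (h : ((s : ℤ) : ℝ) • fvec n lam i = ((t : ℤ) : ℝ) • fvec n lam j) : i = j ∧ s = t := by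
  have h1 := congrArg (fun v : Euc n => v (bpt n lam i ⟨0, hL.pos i⟩)) h
  simp only [PiLp.smul_apply, smul_eq_mul, fvec_apply, col_bpt, if_true, mul_one,
    Option.some_inj] at h1
  by_cases hij : i = j
  · subst hij
    refine ⟨rfl, ?_⟩
    simp only [if_true, mul_one] at h1
    exact Units.ext (by exact_mod_cast h1)
  · rw [if_neg hij, mul_zero] at h1
    exact absurd h1 (by exact_mod_cast s.ne_zero)

theorem blockIsom_fvec_eq_iff (g : lamGroup lam) (i : Fin p) :
    blockIsom n g (fvec n lam i) = fvec n lam i ↔ g.1.perm i = i ∧ g.1.sgn i = 1 := by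
  rw [blockIsom_fvec]
  constructor
  · intro h
    apply fvec_smul_injective n (lam := lam)
    rw [h]
    simp
  · rintro ⟨h1, h2⟩
    rw [h1, h2]
    simp

theorem blockIsom_injective : Function.Injective (blockIsom n : lamGroup lam →* _) := by
  refine (injective_iff_map_eq_one (blockIsom n : lamGroup lam →* _)).2 fun g hg => ?_
  have key : ∀ i, g.1.perm i = i ∧ g.1.sgn i = 1 := by
    intro i
    refine (blockIsom_fvec_eq_iff n g i).1 ?_
    rw [hg]
    rfl
  apply Subtype.ext
  ext1
  · exact Equiv.ext fun i => (key i).1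
  · exact funext fun i => (key i).2

/-! ### The standard parabolic subgroup -/

variable (lam)

/-- The standard parabolic subgroup as a group of signed permutations. -/
def parabolicPerm : Subgroup (SgnPerm (Fin n)) where
  carrier := {g | (∀ x, col n lam (g.perm x) = col n lam x) ∧
    (∀ x, col n lam x ≠ none → g.sgn x = 1) ∧ ∏ x, g.sgn x = 1}
  mul_mem' {a b} ha hb := by
    refine ⟨fun x => ?_, fun x hx => ?_, ?_⟩
    · rw [mul_perm, Equiv.Perm.mul_apply, ha.1, hb.1]
    · rw [mul_sgn, hb.2.1 x hx, ha.2.1 _ (by rwa [hb.1]), one_mul]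
    · simp only [mul_sgn]
      rw [Finset.prod_mul_distrib, Equiv.prod_comp b.perm, ha.2.2, hb.2.2, one_mul]
  one_mem' := ⟨fun _ => rfl, fun _ _ => rfl, by simp⟩
  inv_mem' {a} ha := by
    have h1 : ∀ x, col n lam (a.perm⁻¹ x) = col n lam x := fun x => by
      rw [← ha.1]
      simp
    refine ⟨h1, fun x hx => ha.2.1 _ (by rwa [h1]), ?_⟩
    simp only [inv_sgn]
    rw [Equiv.prod_comp a.perm⁻¹, ha.2.2]

theorem prod_swS {x y : Fin n} (h : x ≠ y) (s : ℤˣ) : ∏ i, (swS x y s).sgn i = 1 := by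
  have h1 : ∀ i, (swS x y s).sgn i =
      (Pi.mulSingle x (-s) : Fin n → ℤˣ) i * (Pi.mulSingle y (-s) : Fin n → ℤˣ) i := by
    intro i
    by_cases hx : i = x
    · subst hx
      simp [swS, h]
    · by_cases hy : i = y
      · subst hy
        simp [swS, hx]
      · simp [swS, hx, hy]
  simp only [h1, Finset.prod_mul_distrib]
  rw [Finset.prod_pi_mulSingle', Finset.prod_pi_mulSingle']
  simp

theorem swS_mem_parabolicPerm {x y : Fin n} (h : x ≠ y) (s : ℤˣ) :
    swS x y s ∈ parabolicPerm n lam ↔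
      col n lam x = col n lam y ∧ (s = -1 ∨ col n lam x = none) := by
  constructor
  · rintro ⟨h1, h2, _⟩
    have h3 := h1 x
    simp only [swS, Equiv.swap_apply_left] at h3
    refine ⟨h3.symm, ?_⟩
    by_cases hc : col n lam x = none
    · exact Or.inr hc
    · have := h2 x hc
      simp only [swS, true_or, if_true] at this
      left
      rw [← neg_neg s, this]
  · rintro ⟨h1, h2⟩
    refine ⟨fun z => ?_, fun z hz => ?_, prod_swS n h s⟩
    · simp only [swS]
      rcases eq_or_ne z x with rfl | hx
      · rw [Equiv.swap_apply_left, h1]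
      · rcases eq_or_ne z y with rfl | hy
        · rw [Equiv.swap_apply_right, h1]
        · rw [Equiv.swap_apply_of_ne_of_ne hx hy]
    · simp only [swS]
      split_ifs with h3
      · have : col n lam x ≠ none := by
          rcases h3 with rfl | rfl
          · exact hz
          · rwa [h1]
        rw [h2.resolve_right this, neg_neg]
      · rfl

theorem eVec_sub_eq (x y : Fin n) :
    (eVec y - eVec x : Euc n) = eVec y + (((-1 : ℤˣ) : ℤ) : ℝ) • eVec x := by
  simp [sub_eq_add_neg]

theorem eVec_add_eq (x y : Fin n) :
    (eVec y + eVec x : Euc n) = eVec y + (((1 : ℤˣ) : ℤ) : ℝ) • eVec x := by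
  simp

/-- The transpositions within the core and within the blocks, and the twofold sign changes in the
core, generate the signed permutations in the standard parabolic subgroup. -/
theorem parabolicPerm_le {H : Subgroup (SgnPerm (Fin n))}
    (h1 : ∀ x y, x ≠ y → col n lam x = col n lam y → ofPerm (Equiv.swap x y) ∈ H)
    (h2 : ∀ x y, x ≠ y → col n lam x = none → col n lam y = none → fl x * fl y ∈ H) :
    parabolicPerm n lam ≤ H := by
  intro g hg
  rw [← ofPerm_mul_ofSgn g]
  refine H.mul_mem (ofPerm_mem_of_swap_mem h1 _ hg.1)
    (ofSgn_mem_of_fl_mul_fl_mem hg.2.2 fun i j hij hi hj => h2 i j hij ?_ ?_)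
  · by_contra hc
    exact hi (hg.2.1 i hc)
  · by_contra hc
    exact hj (hg.2.1 j hc)

theorem stdP_eq_map : stdP n lam = (parabolicPerm n lam).map toIsom := by
  apply le_antisymm
  · unfold stdP
    rw [Subgroup.closure_le]
    rintro t (⟨v, w, hvw, hw, ht⟩ | ⟨i, v, w, hvw, hv, hw, rfl⟩)
    · have hc : col n lam v = none := (col_eq_none n lam).2 (lt_trans hvw hw)
      have hc' : col n lam w = none := (col_eq_none n lam).2 hw
      rcases ht with rfl | rfl
      · rw [eVec_sub_eq, refl_eVec_add hvw.ne]
        exact ⟨_, (swS_mem_parabolicPerm n lam hvw.ne _).2 ⟨hc.trans hc'.symm, Or.inr hc⟩, rfl⟩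
      · rw [eVec_add_eq, refl_eVec_add hvw.ne]
        exact ⟨_, (swS_mem_parabolicPerm n lam hvw.ne _).2 ⟨hc.trans hc'.symm, Or.inr hc⟩, rfl⟩
    · rw [eVec_sub_eq, refl_eVec_add hvw.ne]
      rw [inBlock_iff] at hv hw
      exact ⟨_, (swS_mem_parabolicPerm n lam hvw.ne _).2 ⟨hv.trans hw.symm, Or.inl rfl⟩, rfl⟩
  · rw [Subgroup.map_le_iff_le_comap]
    have hsw : ∀ x y, x ≠ y → col n lam x = col n lam y →
        ofPerm (Equiv.swap x y) ∈ (stdP n lam).comap toIsom := by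
      have key : ∀ x y, x < y → col n lam x = col n lam y →
          ofPerm (Equiv.swap x y) ∈ (stdP n lam).comap toIsom := by
        intro x y hxy hc
        rw [Subgroup.mem_comap, ← swS_neg_one, ← refl_eVec_add hxy.ne, ← eVec_sub_eq]
        apply Subgroup.subset_closure
        rcases hcy : col n lam y with _ | i
        · exact Or.inl ⟨x, y, hxy, (col_eq_none n lam).1 hcy, Or.inl rfl⟩
        · exact Or.inr ⟨i, x, y, hxy, (inBlock_iff n lam).2 (hc.trans hcy),
            (inBlock_iff n lam).2 hcy, rfl⟩
      intro x y hxy hc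
      rcases lt_or_gt_of_ne hxy with h | h
      · exact key x y h hc
      · rw [Equiv.swap_comm]
        exact key y x h hc.symm
    refine parabolicPerm_le n lam hsw ?_
    have key : ∀ x y, x < y → col n lam x = none → col n lam y = none →
        fl x * fl y ∈ (stdP n lam).comap toIsom := by
      intro x y hxy hx hy
      rw [← Subgroup.mul_mem_cancel_left _ (hsw x y hxy.ne (hx.trans hy.symm)), ← swS_one hxy.ne,
        Subgroup.mem_comap, ← refl_eVec_add hxy.ne, ← eVec_add_eq]
      exact Subgroup.subset_closure
        (Or.inl ⟨x, y, hxy, (col_eq_none n lam).1 hy, Or.inr rfl⟩)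
    intro x y hxy hx hy
    rcases lt_or_gt_of_ne hxy with h | h
    · exact key x y h hx hy
    · have : (fl x * fl y : SgnPerm (Fin n)) = fl y * fl x := by
        unfold fl
        rw [← map_mul, ← map_mul, mul_comm]
      rw [this]
      exact key y x h hy hx

theorem toIsom_mem_stdP {g : SgnPerm (Fin n)} :
    toIsom g ∈ stdP n lam ↔ g ∈ parabolicPerm n lam := by
  rw [stdP_eq_map]
  exact Subgroup.mem_map_iff_mem toIsom_injective

theorem stdP_le_WD : stdP n lam ≤ WD n := by
  rw [stdP_eq_map]
  rintro _ ⟨g, hg, rfl⟩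
  exact toIsom_mem_WD.2 hg.2.2

/-- The standard parabolic subgroup is the stabilizer of the block vectors. -/
theorem mem_stdP_iff {g : Euc n ≃ₗᵢ[ℝ] Euc n} :
    g ∈ stdP n lam ↔ g ∈ WD n ∧ ∀ i, g (fvec n lam i) = fvec n lam i := by
  have key : ∀ k : SgnPerm (Fin n), ∀ i, toIsom k (fvec n lam i) = fvec n lam i ↔
      ∀ x, ((k.sgn x : ℤ) : ℝ) * (if col n lam x = some i then 1 else 0) =
        if col n lam (k.perm x) = some i then 1 else 0 := by
    intro k i
    constructor
    · intro h x
      have := toIsom_apply k (fvec n lam i) x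
      rw [h] at this
      exact this.symm
    · intro h
      ext y
      obtain ⟨x, rfl⟩ := k.perm.surjective y
      rw [toIsom_apply]
      exact h x
  constructor
  · intro hg
    refine ⟨stdP_le_WD n lam hg, fun i => ?_⟩
    rw [stdP_eq_map] at hg
    obtain ⟨k, hk, rfl⟩ := hg
    rw [key]
    intro x
    rw [hk.1]
    by_cases h : col n lam x = some i
    · rw [hk.2.1 x (by rw [h]; simp)]
      simp
    · simp [h]
  · rintro ⟨hg, hf⟩
    obtain ⟨k, hk, rfl⟩ := mem_WD.1 hg
    rw [toIsom_mem_stdP]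
    have h1 : ∀ x, col n lam x ≠ none → k.sgn x = 1 ∧ col n lam (k.perm x) = col n lam x := by
      intro x hx
      obtain ⟨i, hi⟩ := Option.ne_none_iff_exists'.1 hx
      have := (key k i).1 (hf i) x
      rw [if_pos hi, mul_one] at this
      split_ifs at this with h2
      · have h3 : ((k.sgn x : ℤ) : ℝ) = ((1 : ℤ) : ℝ) := by rw [this]; simp
        exact ⟨Units.ext (Int.cast_injective h3), by rw [h2, hi]⟩
      · exact absurd this (by exact_mod_cast (k.sgn x).ne_zero)
    refine ⟨fun x => ?_, fun x hx => (h1 x hx).1, hk⟩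
    by_cases hx : col n lam x = none
    · rw [hx]
      by_contra hne
      obtain ⟨i, hi⟩ := Option.ne_none_iff_exists'.1 hne
      have := (key k i).1 (hf i) x
      rw [if_pos hi, hx] at this
      simp at this
    · exact (h1 x hx).2

end Points

/-! ### The Howlett complement of the standard parabolic subgroup -/

section StrictMono

theorem le_of_strictMono_fin {k : ℕ} {f : Fin k → ℕ} (hf : StrictMono f) (t : Fin k) :
    t.val ≤ f t := by
  obtain ⟨t, ht⟩ := t
  induction t with
  | zero => exact Nat.zero_le _
  | succ t ih =>
    have h1 := ih (by omega)
    have h2 : f ⟨t, by omega⟩ < f ⟨t + 1, ht⟩ := hf (by simp [Fin.lt_def])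
    simp only at h1 ⊢
    omega

theorem eq_of_strictMono_fin {k : ℕ} {f : Fin k → ℕ} (hf : StrictMono f) (hk : ∀ t, f t < k)
    (t : Fin k) : f t = t.val := by
  apply le_antisymm _ (le_of_strictMono_fin hf t)
  have hg : StrictMono fun t : Fin k => k - 1 - f t.rev := by
    intro a b hab
    have h1 : f b.rev < f a.rev := hf (Fin.rev_lt_rev.2 hab)
    have h2 := hk a.rev
    simp only
    omega
  have h3 := le_of_strictMono_fin hg t.rev
  simp only [Fin.rev_rev, Fin.val_rev] at h3
  have := hk t
  omega

theorem eq_of_prod_eq {ι M : Type*} [Fintype ι] [CommGroup M] {ε ε' : ι → M} (a : ι)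
    (h : ∀ i, i ≠ a → ε i = ε' i) (hp : ∏ i, ε i = ∏ i, ε' i) : ε a = ε' a := by
  classical
  rw [← Finset.mul_prod_erase _ _ (Finset.mem_univ a),
    ← Finset.mul_prod_erase _ ε' (Finset.mem_univ a)] at hp
  rw [Finset.prod_congr rfl fun i hi => h i (Finset.ne_of_mem_erase hi)] at hp
  exact mul_right_cancel hp

end StrictMono

section Howlett

variable (n : ℕ) {p : ℕ} (lam : Fin p → ℕ) [hL : IsLabel n lam]

theorem root_mem_posRoots_stdP {x y : Fin n} (h : x < y) {s t : ℤˣ} :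
    root x s y t ∈ posRoots (stdP n lam) (stdRho n) ↔
      t = 1 ∧ col n lam x = col n lam y ∧ (s = -1 ∨ col n lam x = none) := by
  rw [root_mem_posRoots h, toIsom_mem_stdP, swS_mem_parabolicPerm n lam h.ne]

theorem mem_posRoots_stdP {α : Euc n} : α ∈ posRoots (stdP n lam) (stdRho n) ↔
    ∃ x y s, x < y ∧ (col n lam x = col n lam y ∧ (s = -1 ∨ col n lam x = none)) ∧
      α = root x s y 1 := by
  rw [mem_posRoots_iff (stdP_le_WD n lam)]
  constructor
  · rintro ⟨x, y, s, h, h2, rfl⟩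
    rw [toIsom_mem_stdP, swS_mem_parabolicPerm n lam h.ne] at h2
    exact ⟨x, y, s, h, h2, rfl⟩
  · rintro ⟨x, y, s, h, h2, rfl⟩
    rw [← swS_mem_parabolicPerm n lam h.ne, ← toIsom_mem_stdP] at h2
    exact ⟨x, y, s, h, h2, rfl⟩

variable {lam}

theorem conj_blockIsom_mem_stdP (g : lamGroup lam) {h : Euc n ≃ₗᵢ[ℝ] Euc n}
    (hh : h ∈ stdP n lam) : blockIsom n g * h * (blockIsom n g)⁻¹ ∈ stdP n lam := by
  rw [mem_stdP_iff] at hh ⊢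
  have hg := blockIsom_mem_WD n g
  refine ⟨Subgroup.mul_mem _ (Subgroup.mul_mem _ hg hh.1) (Subgroup.inv_mem _ hg), fun i => ?_⟩
  rw [LinearIsometryEquiv.coe_mul, LinearIsometryEquiv.coe_mul, Function.comp_apply,
    Function.comp_apply]
  have h1 : h ((blockIsom n g)⁻¹ (fvec n lam i)) = (blockIsom n g)⁻¹ (fvec n lam i) := by
    rw [← map_inv, blockIsom_fvec, map_smul, hh.2]
  rw [h1, LinearIsometryEquiv.inv_def, LinearIsometryEquiv.apply_symm_apply]

theorem blockIsom_mem_normalizerIn (g : lamGroup lam) :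
    blockIsom n g ∈ normalizerIn (WD n) (stdP n lam) := by
  refine ⟨blockIsom_mem_WD n g, Subgroup.mem_normalizer_iff.2 fun h => ?_⟩
  refine ⟨fun hh => conj_blockIsom_mem_stdP n g hh, fun hh => ?_⟩
  have := conj_blockIsom_mem_stdP n g⁻¹ hh
  rw [map_inv] at this
  simpa [mul_assoc] using this

theorem blockIsom_apply_mem_posRoots (g : lamGroup lam) {α : Euc n}
    (h : α ∈ posRoots (stdP n lam) (stdRho n)) :
    blockIsom n g α ∈ posRoots (stdP n lam) (stdRho n) := by
  obtain ⟨x, y, s, hxy, ⟨hc, hs⟩, rfl⟩ := (mem_posRoots_stdP n lam).1 h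
  rw [blockIsom_apply_eq, toIsom_root]
  rcases hx : col n lam x with _ | i
  · obtain ⟨v, rfl⟩ := exists_cpt n lam hx
    obtain ⟨w, rfl⟩ := exists_cpt n lam (hc ▸ hx)
    have hw : w ≠ 0 := by
      rintro rfl
      exact absurd (Fin.lt_def.1 hxy) (by simp)
    rw [Phi_perm_cpt, Phi_perm_cpt, root_mem_posRoots_stdP n lam hxy, Phi_sgn_cpt, Phi_sgn_cpt,
      if_neg hw]
    simp
  · obtain ⟨a, rfl⟩ := exists_bpt n lam hx
    obtain ⟨b, rfl⟩ := exists_bpt n lam (hc ▸ hx)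
    have hab : a.val < b.val := by
      have h := Fin.lt_def.1 hxy
      simp only [bpt_val] at h
      omega
    rw [hx] at hs
    have hs' : s = -1 := by simpa using hs
    subst hs'
    rw [Phi_perm_bpt, Phi_perm_bpt, Phi_sgn_bpt, Phi_sgn_bpt]
    rcases Int.units_eq_one_or (g.1.sgn i) with h1 | h1
    · rw [h1, root_mem_posRoots_stdP n lam]
      · simp
      · refine Fin.lt_def.2 ?_
        simp only [bpt_val, revSgn, if_true]
        omega
    · rw [h1, root_comm, root_mem_posRoots_stdP n lam]
      · simp
      · have h2 : ¬ (-1 : ℤˣ) = 1 := by decide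
        refine Fin.lt_def.2 ?_
        simp only [bpt_val, revSgn, if_neg h2]
        omega

theorem blockIsom_mem_howlett (g : lamGroup lam) :
    blockIsom n g ∈ howlettComplement (stdP n lam)
      (normalizerIn (WD n) (stdP n lam)) (stdRho n) := by
  refine ⟨blockIsom_mem_normalizerIn n g, fun α => ?_⟩
  refine ⟨fun h => ?_, fun h => blockIsom_apply_mem_posRoots n g h⟩
  have := blockIsom_apply_mem_posRoots n g⁻¹ h
  rwa [map_inv, LinearIsometryEquiv.inv_def, LinearIsometryEquiv.symm_apply_apply] at this

variable (lam)

/-- The signed permutation `k` maps positive roots of the standard parabolic subgroup to positive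
roots. -/
def PresPos (k : SgnPerm (Fin n)) : Prop :=
  ∀ x y s, x < y → col n lam x = col n lam y → (s = -1 ∨ col n lam x = none) →
    (k.perm x < k.perm y ∧ k.sgn y = 1 ∧ col n lam (k.perm x) = col n lam (k.perm y) ∧
      (s * k.sgn x = -1 ∨ col n lam (k.perm x) = none)) ∨
    (k.perm y < k.perm x ∧ s * k.sgn x = 1 ∧ col n lam (k.perm x) = col n lam (k.perm y) ∧
      (k.sgn y = -1 ∨ col n lam (k.perm x) = none))

theorem presPos_of_mem_howlett {k : SgnPerm (Fin n)} {G : Subgroup (Euc n ≃ₗᵢ[ℝ] Euc n)}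
    (hk : toIsom k ∈ howlettComplement (stdP n lam) G (stdRho n)) : PresPos n lam k := by
  intro x y s hxy hc hs
  have h1 := (hk.2 (root x s y 1)).2 ((root_mem_posRoots_stdP n lam hxy).2 ⟨rfl, hc, hs⟩)
  rw [toIsom_root, one_mul] at h1
  rcases lt_or_gt_of_ne (k.perm.injective.ne hxy.ne) with h | h
  · rw [root_mem_posRoots_stdP n lam h] at h1
    exact Or.inl ⟨h, h1⟩
  · rw [root_comm, root_mem_posRoots_stdP n lam h] at h1
    exact Or.inr ⟨h, h1.1, h1.2.1.symm, by rw [h1.2.1.symm]; exact h1.2.2⟩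

variable {n lam}

/-- The roots `e_y ± e_x` of the core force `k` to preserve the core and its order, and only the
first point of the core can change its sign. -/
theorem PresPos.core {k : SgnPerm (Fin n)} (hk : PresPos n lam k) {x y : Fin n} (hxy : x < y)
    (hx : col n lam x = none) (hy : col n lam y = none) :
    k.perm x < k.perm y ∧ k.sgn y = 1 ∧ col n lam (k.perm x) = none ∧
      col n lam (k.perm y) = none := by
  have h1 := hk x y 1 hxy (hx.trans hy.symm) (Or.inr hx)
  have h2 := hk x y (-1) hxy (hx.trans hy.symm) (Or.inr hx)
  have h3 : ¬ (-1 : ℤˣ) = 1 := by decide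
  rcases h1 with ⟨h, e1, e2, e3⟩ | ⟨h, e1, e2, e3⟩
  · rcases h2 with ⟨h', e1', e2', e3'⟩ | ⟨h', e1', e2', e3'⟩
    · have hn : col n lam (k.perm x) = none := by
        rcases e3 with e3 | e3
        · rcases e3' with e3' | e3'
          · rw [one_mul] at e3
            rw [e3] at e3'
            exact absurd e3' (by decide)
          · exact e3'
        · exact e3
      exact ⟨h, e1, hn, e2 ▸ hn⟩
    · exact absurd h h'.asymm
  · rcases h2 with ⟨h', e1', e2', e3'⟩ | ⟨h', e1', e2', e3'⟩
    · exact absurd h h'.asymm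
    · rw [one_mul] at e1
      rw [e1] at e1'
      exact absurd e1' (by decide)

theorem PresPos.col_core {k : SgnPerm (Fin n)} (hk : PresPos n lam k)
    (v : Fin (coreRank n lam)) : col n lam (k.perm (cpt n lam v)) = none := by
  have h2 := two_le_coreRank n lam
  by_cases hv : v.val = 0
  · have hlt : cpt n lam v < cpt n lam ⟨1, by omega⟩ :=
      Fin.lt_def.2 (by simp only [cpt_val]; omega)
    exact (hk.core hlt (col_cpt _ _ _) (col_cpt _ _ _)).2.2.1
  · have hlt : cpt n lam ⟨0, by omega⟩ < cpt n lam v :=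
      Fin.lt_def.2 (by simp only [cpt_val]; omega)
    exact (hk.core hlt (col_cpt _ _ _) (col_cpt _ _ _)).2.2.2

theorem PresPos.perm_cpt {k : SgnPerm (Fin n)} (hk : PresPos n lam k)
    (v : Fin (coreRank n lam)) : k.perm (cpt n lam v) = cpt n lam v := by
  have hmono : StrictMono fun v => (k.perm (cpt n lam v)).val := by
    intro v w hvw
    exact (hk.core (show cpt n lam v < cpt n lam w from hvw) (col_cpt _ _ _) (col_cpt _ _ _)).1
  have := eq_of_strictMono_fin hmono (fun v => (col_eq_none n lam).1 (hk.col_core v)) v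
  exact Fin.ext this

theorem PresPos.sgn_cpt {k : SgnPerm (Fin n)} (hk : PresPos n lam k)
    {v : Fin (coreRank n lam)} (hv : v ≠ 0) : k.sgn (cpt n lam v) = 1 := by
  have h0 : 0 < v := Fin.pos_iff_ne_zero.2 hv
  have hlt : cpt n lam 0 < cpt n lam v := Fin.lt_def.2 (Fin.lt_def.1 h0)
  exact (hk.core hlt (col_cpt _ _ _) (col_cpt _ _ _)).2.1

theorem PresPos.col_ne_none {k : SgnPerm (Fin n)} (hk : PresPos n lam k) {x : Fin n}
    (hx : col n lam x ≠ none) : col n lam (k.perm x) ≠ none := by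
  intro h
  obtain ⟨v, hv⟩ := exists_cpt n lam h
  rw [← hk.perm_cpt v] at hv
  rw [k.perm.injective hv] at hx
  exact hx (col_cpt _ _ _)

/-- Within a block, `k` is increasing without sign changes or decreasing with sign changes. -/
theorem PresPos.block {k : SgnPerm (Fin n)} (hk : PresPos n lam k) {x y : Fin n} (hxy : x < y)
    (hc : col n lam x = col n lam y) (hx : col n lam x ≠ none) :
    col n lam (k.perm x) = col n lam (k.perm y) ∧ k.sgn x = k.sgn y ∧
      ((k.perm x < k.perm y ∧ k.sgn x = 1) ∨ (k.perm y < k.perm x ∧ k.sgn x = -1)) := by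
  have hn := hk.col_ne_none hx
  have hneg : ∀ s : ℤˣ, (-1) * s = -1 → s = 1 := by decide
  have hneg' : ∀ s : ℤˣ, (-1) * s = 1 → s = -1 := by decide
  rcases hk x y (-1) hxy hc (Or.inl rfl) with ⟨h, e1, e2, e3⟩ | ⟨h, e1, e2, e3⟩
  · have h1 := hneg _ (e3.resolve_right hn)
    exact ⟨e2, h1.trans e1.symm, Or.inl ⟨h, h1⟩⟩
  · have h1 := hneg' _ e1
    exact ⟨e2, h1.trans (e3.resolve_right hn).symm, Or.inr ⟨h, h1⟩⟩

/-- A block is mapped into a single block, with a common sign. -/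
theorem PresPos.exists_block_map {k : SgnPerm (Fin n)} (hk : PresPos n lam k) (i : Fin p) :
    ∃ j : Fin p, ∃ δ : ℤˣ, ∃ f : Fin (lam i) → Fin (lam j), ∀ t,
      k.perm (bpt n lam i t) = bpt n lam j (f t) ∧ k.sgn (bpt n lam i t) = δ := by
  have hne : ∀ t, col n lam (bpt n lam i t) ≠ none := fun t => by simp
  obtain ⟨j, hj⟩ := Option.ne_none_iff_exists'.1 (hk.col_ne_none (hne ⟨0, hL.pos i⟩))
  have key : ∀ t, col n lam (k.perm (bpt n lam i t)) = some j ∧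
      k.sgn (bpt n lam i t) = k.sgn (bpt n lam i ⟨0, hL.pos i⟩) := by
    intro t
    by_cases h0 : t = ⟨0, hL.pos i⟩
    · rw [h0]
      exact ⟨hj, rfl⟩
    · have hlt : bpt n lam i ⟨0, hL.pos i⟩ < bpt n lam i t := by
        have : t.val ≠ 0 := fun h => h0 (Fin.ext h)
        simp only [Fin.lt_def, bpt_val]
        omega
      obtain ⟨h1, h2, _⟩ := hk.block hlt (by simp) (hne _)
      exact ⟨h1 ▸ hj, h2.symm⟩
  choose f hf using fun t => exists_bpt n lam (key t).1
  exact ⟨j, _, f, fun t => ⟨hf t, (key t).2⟩⟩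

/-- A signed permutation with an even number of sign changes that preserves the positive roots
together with its inverse permutes the blocks, and maps each of them onto its image in the same or
in the opposite order, according to its sign. -/
theorem exists_eq_Phi {k : SgnPerm (Fin n)} (hk : PresPos n lam k) (hk' : PresPos n lam k⁻¹)
    (hprod : ∏ x, k.sgn x = 1) : ∃ g : lamGroup lam, k = Phi n g := by
  choose τ δ f hf using hk.exists_block_map
  choose τ' δ' f' hf' using hk'.exists_block_map
  -- `k` and its inverse embed blocks into blocks, so sizes are preserved
  have hinj : ∀ i, lam i ≤ lam (τ i) := by
    intro i
    have : Function.Injective (f i) := by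
      intro a b hab
      apply bpt_injective n lam i
      apply k.perm.injective
      rw [(hf i a).1, (hf i b).1, hab]
    simpa using Fintype.card_le_of_injective _ this
  have hinj' : ∀ i, lam i ≤ lam (τ' i) := by
    intro i
    have : Function.Injective (f' i) := by
      intro a b hab
      apply bpt_injective n lam i
      apply (k⁻¹).perm.injective
      rw [(hf' i a).1, (hf' i b).1, hab]
    simpa using Fintype.card_le_of_injective _ this
  have hleft : ∀ i, τ' (τ i) = i := by
    intro i
    have h1 := (hf' (τ i) (f i ⟨0, hL.pos i⟩)).1
    rw [← (hf i ⟨0, hL.pos i⟩).1, inv_perm] at h1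
    have h2 := congrArg (col n lam) h1
    simpa using h2.symm
  have hright : ∀ i, τ (τ' i) = i := by
    intro i
    have h1 := (hf (τ' i) (f' i ⟨0, hL.pos i⟩)).1
    rw [← (hf' i ⟨0, hL.pos i⟩).1, inv_perm] at h1
    have h2 := congrArg (col n lam) h1
    simpa using h2.symm
  have hlam : ∀ i, lam (τ i) = lam i := fun i =>
    le_antisymm ((hinj' (τ i)).trans_eq (by rw [hleft])) (hinj i)
  let g : lamGroup lam := ⟨⟨⟨τ, τ', hleft, hright⟩, δ⟩, hlam⟩
  have hpos : ∀ i t, (f i t).val = revSgn (δ i) (lam i) t.val := by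
    intro i t
    have hlt : ∀ t, (f i t).val < lam i := fun t => (f i t).isLt.trans_eq (hlam i)
    have hord : ∀ a b : Fin (lam i), a < b →
        (((f i a).val < (f i b).val ∧ δ i = 1) ∨ ((f i b).val < (f i a).val ∧ δ i = -1)) := by
      intro a b hab
      have h1 : bpt n lam i a < bpt n lam i b := by
        simpa only [Fin.lt_def, bpt_val, add_lt_add_iff_left] using hab
      have h2 := (hk.block h1 (by simp) (by simp)).2.2
      rw [(hf i a).1, (hf i b).1, (hf i a).2] at h2
      simpa only [Fin.lt_def, bpt_val, add_lt_add_iff_left] using h2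
    have h3 : ¬ (-1 : ℤˣ) = 1 := by decide
    rcases Int.units_eq_one_or (δ i) with hδ | hδ
    · -- an increasing map of a block to one of equal size preserves positions
      have hm : StrictMono fun t => (f i t).val := by
        intro a b hab
        rcases hord a b hab with h | h
        · exact h.1
        · exact absurd (h.2.symm.trans hδ) h3
      have := eq_of_strictMono_fin hm hlt t
      simp only [revSgn, hδ, if_true]
      exact this
    · have hm : StrictMono fun t => lam i - 1 - (f i t).val := by
        intro a b hab
        rcases hord a b hab with h | h
        · exact absurd (hδ.symm.trans h.2) h3
        · have := hlt a
          have := h.1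
          simp only
          omega
      have := eq_of_strictMono_fin hm (fun t => by have := hlt t; omega) t
      have := hlt t
      simp only [revSgn, hδ, if_neg h3]
      omega
  -- the sign at the first point is then determined by the parity of the number of sign changes
  have hsgn : ∀ x, x ≠ cpt n lam 0 → k.sgn x = (Phi n g).sgn x := by
    intro x hx
    induction x using pt_cases n lam with
    | h1 v =>
      have hv : v ≠ 0 := fun e => hx (by rw [e])
      rw [hk.sgn_cpt hv, Phi_sgn_cpt, if_neg hv]
    | h2 i t =>
      rw [(hf i t).2, Phi_sgn_bpt]
  refine ⟨g, ?_⟩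
  ext1
  · ext1 x
    induction x using pt_cases n lam with
    | h1 v => rw [hk.perm_cpt, Phi_perm_cpt]
    | h2 i t =>
      rw [(hf i t).1, Phi_perm_bpt]
      exact Fin.ext (congrArg (offset n lam (τ i) + ·) (hpos i t))
  · funext x
    by_cases hx : x = cpt n lam 0
    · rw [hx]
      exact eq_of_prod_eq _ hsgn (by rw [hprod, prod_Phi_sgn])
    · exact hsgn x hx

variable (n lam)

/-- The Howlett complement of the standard parabolic subgroup, for the standard positive roots,
consists of the block permutations with signs. -/
theorem howlettComplement_stdP :
    howlettComplement (stdP n lam) (normalizerIn (WD n) (stdP n lam)) (stdRho n) =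
      (blockIsom n : lamGroup lam →* _).range := by
  apply le_antisymm
  · intro h hh
    obtain ⟨k, hk, rfl⟩ := mem_WD.1 hh.1.1
    have hinv := Subgroup.inv_mem _ hh
    rw [← map_inv] at hinv
    obtain ⟨g, rfl⟩ := exists_eq_Phi (presPos_of_mem_howlett n lam hh)
      (presPos_of_mem_howlett n lam hinv) hk
    exact ⟨g, rfl⟩
  · rintro _ ⟨g, rfl⟩
    exact blockIsom_mem_howlett n g

variable {lam}

/-- `P` fixes the block vectors, on which the block permutations act faithfully. -/
theorem eq_one_of_blockIsom_mem_stdP {g : lamGroup lam} (h : blockIsom n g ∈ stdP n lam) :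
    blockIsom n g = 1 := by
  rw [mem_stdP_iff] at h
  have key : ∀ i, g.1.perm i = i ∧ g.1.sgn i = 1 := fun i =>
    (blockIsom_fvec_eq_iff n g i).1 (h.2 i)
  have : g = 1 := by
    apply Subtype.ext
    ext1
    · exact Equiv.ext fun i => (key i).1
    · exact funext fun i => (key i).2
  rw [this, map_one]

variable (lam)

/-- The Howlett complement of the standard parabolic subgroup is a complement in its normalizer. -/
theorem isSemidirect_stdP :
    IsSemidirect (normalizerIn (WD n) (stdP n lam)) (stdP n lam)
      (howlettComplement (stdP n lam) (normalizerIn (WD n) (stdP n lam)) (stdRho n)) := by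
  refine ⟨fun h hh k hk => howlettComplement_normalizes hh.1 hk, ?_,
    sup_howlettComplement (stdP_le_WD n lam) (finite_of_le_WD (stdP_le_WD n lam))
      (isRegularVec_stdRho (stdP_le_WD n lam))⟩
  rw [howlettComplement_stdP, eq_bot_iff]
  rintro _ ⟨h, ⟨g, rfl⟩⟩
  exact eq_one_of_blockIsom_mem_stdP n h

theorem isParabolic_stdP : IsParabolic (WD n) (stdP n lam) := by
  refine ⟨Set.range (fvec n lam), ?_⟩
  ext g
  rw [mem_stdP_iff, mem_pointStab, Set.forall_mem_range]

/-- Every parabolic subgroup with label `lam` is conjugate to the standard one by an element that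
also conjugates the Howlett complements. -/
theorem exists_conj_of_hasLabel {P : Subgroup (Euc n ≃ₗᵢ[ℝ] Euc n)} (hP : HasLabel n lam P)
    {ρ : Euc n} (hρ : IsRegularVec P ρ) : ∃ x ∈ WD n, P = conjBy x (stdP n lam) ∧
      howlettComplement P (normalizerIn (WD n) P) ρ = conjBy x
        (howlettComplement (stdP n lam) (normalizerIn (WD n) (stdP n lam)) (stdRho n)) := by
  obtain ⟨w, hw, rfl⟩ := hP
  change IsRegularVec (conjBy w (stdP n lam)) ρ at hρ
  have hPW := stdP_le_WD n lam
  have h1 : w (w⁻¹ ρ) = ρ := by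
    rw [LinearIsometryEquiv.inv_def, LinearIsometryEquiv.apply_symm_apply]
  rw [← h1, isRegularVec_conjBy] at hρ
  obtain ⟨u, hu, h2⟩ := exists_howlettComplement_eq_conjBy (G := normalizerIn (WD n) (stdP n lam))
    (finite_of_le_WD hPW) (le_inf hPW Subgroup.le_normalizer) hρ (isRegularVec_stdRho hPW)
  refine ⟨w * u, Subgroup.mul_mem _ hw (hPW hu), ?_, ?_⟩
  · rw [← conjBy_conjBy, conjBy_eq_self hu]
  · change howlettComplement (conjBy w (stdP n lam))
      (normalizerIn (WD n) (conjBy w (stdP n lam))) ρ = _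
    rw [normalizerIn_conjBy hw, ← conjBy_conjBy, ← h2, ← howlettComplement_conjBy, h1]

theorem isParabolic_of_hasLabel {P : Subgroup (Euc n ≃ₗᵢ[ℝ] Euc n)} (hP : HasLabel n lam P) :
    IsParabolic (WD n) P := by
  obtain ⟨w, hw, rfl⟩ := hP
  obtain ⟨X, hX⟩ := isParabolic_stdP n lam
  refine ⟨w '' X, ?_⟩
  ext g
  change g ∈ conjBy w (stdP n lam) ↔ _
  rw [mem_conjBy, hX, mem_pointStab, mem_pointStab, Subgroup.mul_mem_cancel_right _ hw,
    Subgroup.mul_mem_cancel_left _ (Subgroup.inv_mem _ hw), Set.forall_mem_image]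
  refine and_congr_right fun _ => forall₂_congr fun v _ => ?_
  simp only [LinearIsometryEquiv.coe_mul, Function.comp_apply, LinearIsometryEquiv.inv_def]
  rw [LinearIsometryEquiv.symm_apply_eq]

end Howlett

/-! ### Blocks of equal size -/

section EqualSize

variable {p : ℕ} (lam : Fin p → ℕ) [hA : Fact (Antitone lam)]

/-- An initial segment of `Fin p` consists of the elements smaller than its cardinality. -/
theorem lt_card_filter_iff {q : Fin p → Prop} [DecidablePred q] (hq : ∀ i j, i ≤ j → q j → q i)
    (i : Fin p) : i.val < (Finset.univ.filter q).card ↔ q i := by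
  constructor
  · intro h
    by_contra hi
    have : Finset.univ.filter q ⊆ Finset.Iio i := by
      intro j hj
      rw [Finset.mem_filter] at hj
      rw [Finset.mem_Iio]
      by_contra hij
      exact hi (hq i j (not_lt.1 hij) hj.2)
    have := Finset.card_le_card this
    rw [Fin.card_Iio] at this
    omega
  · intro h
    have : Finset.Iic i ⊆ Finset.univ.filter q := by
      intro j hj
      rw [Finset.mem_Iic] at hj
      simpa using hq j i hj h
    have := Finset.card_le_card this
    rw [Fin.card_Iic] at this
    omega

/-- The number of parts larger than `k`. -/
def numLarger (k : ℕ) : ℕ := (Finset.univ.filter fun i => k < lam i).card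

/-- Since the parts are ordered, the blocks of size `k` are consecutive. -/
theorem eq_iff_numLarger (i : Fin p) (k : ℕ) : lam i = k ↔
    numLarger lam k ≤ i.val ∧ i.val < numLarger lam k + mult lam k := by
  have h1 : i.val < numLarger lam k ↔ k < lam i :=
    lt_card_filter_iff (fun i j hij h => lt_of_lt_of_le h (hA.out hij)) i
  have h2 : i.val < (Finset.univ.filter fun i => k ≤ lam i).card ↔ k ≤ lam i :=
    lt_card_filter_iff (fun i j hij h => le_trans h (hA.out hij)) i
  have h3 : (Finset.univ.filter fun i => k ≤ lam i).card = numLarger lam k + mult lam k := by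
    unfold numLarger mult
    rw [← Finset.card_union_of_disjoint]
    · congr 1
      ext i
      simp only [Finset.mem_filter, Finset.mem_univ, true_and, Finset.mem_union]
      omega
    · rw [Finset.disjoint_filter]
      intro i _ h
      omega
  rw [h3] at h2
  omega

theorem numLarger_add_mult_le (k : ℕ) : numLarger lam k + mult lam k ≤ p := by
  unfold numLarger mult
  rw [← Finset.card_union_of_disjoint]
  · exact (Finset.card_le_univ _).trans_eq (Fintype.card_fin p)
  · rw [Finset.disjoint_filter]
    intro i _ h
    omega

/-- The blocks of size `k` in increasing order. -/
def idx (k : ℕ) (r : Fin (mult lam k)) : Fin p :=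
  ⟨numLarger lam k + r.val, by have := numLarger_add_mult_le lam k; omega⟩

theorem idx_val (k : ℕ) (r : Fin (mult lam k)) : (idx lam k r).val = numLarger lam k + r.val := rfl

theorem idx_injective (k : ℕ) : Function.Injective (idx lam k) := fun r s h => by
  have h1 : (idx lam k r).val = (idx lam k s).val := congrArg Fin.val h
  rw [idx_val, idx_val] at h1
  exact Fin.ext (by omega)

theorem lam_idx (k : ℕ) (r : Fin (mult lam k)) : lam (idx lam k r) = k :=
  (eq_iff_numLarger lam _ _).2 ⟨by simp [idx_val], by simp [idx_val]⟩

theorem exists_idx {i : Fin p} {k : ℕ} (h : lam i = k) : ∃ r, i = idx lam k r := by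
  have := (eq_iff_numLarger lam _ _).1 h
  exact ⟨⟨i.val - numLarger lam k, by omega⟩, Fin.ext (by rw [idx_val]; simp only; omega)⟩

/-- The subgroup of the signed block permutations that are trivial on the blocks of size not
in `S`. -/
def lamSub (S : Set ℕ) : Subgroup (lamGroup lam) where
  carrier := {g | ∀ i, lam i ∉ S → g.1.perm i = i ∧ g.1.sgn i = 1}
  mul_mem' {a b} ha hb i hi := by
    obtain ⟨a1, a2⟩ := ha i hi
    obtain ⟨b1, b2⟩ := hb i hi
    constructor
    · change a.1.perm (b.1.perm i) = i
      rw [b1, a1]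
    · change a.1.sgn (b.1.perm i) * b.1.sgn i = 1
      rw [b1, a2, b2, one_mul]
  one_mem' _ _ := ⟨rfl, rfl⟩
  inv_mem' {a} ha i hi := by
    obtain ⟨a1, a2⟩ := ha i hi
    have h1 : a.1.perm⁻¹ i = i := by
      conv_lhs => rw [← a1]
      simp
    refine ⟨h1, ?_⟩
    change a.1.sgn (a.1.perm⁻¹ i) = 1
    rw [h1, a2]

variable {lam}

/-- The interchange of two blocks of equal size. -/
def swB (i j : Fin p) (h : lam i = lam j) : lamGroup lam :=
  ⟨ofPerm (Equiv.swap i j), fun x => by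
    change lam (Equiv.swap i j x) = lam x
    rcases eq_or_ne x i with rfl | hx
    · rw [Equiv.swap_apply_left, h]
    · rcases eq_or_ne x j with rfl | hy
      · rw [Equiv.swap_apply_right, h]
      · rw [Equiv.swap_apply_of_ne_of_ne hx hy]⟩

/-- The sign change at a block. -/
def flB (i : Fin p) : lamGroup lam := ⟨fl i, fun _ => rfl⟩

variable (lam)

theorem swap_mem_of_adjacent {S : Set ℕ} {H : Subgroup (SgnPerm (Fin p))}
    (h1 : ∀ i j : Fin p, j.val = i.val + 1 → lam i = lam j → lam i ∈ S →
      ofPerm (Equiv.swap i j) ∈ H) {i j : Fin p} (hij : lam i = lam j) (hS : lam i ∈ S) :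
    ofPerm (Equiv.swap i j) ∈ H := by
  obtain ⟨r, hr⟩ := exists_idx lam (rfl : lam i = lam i)
  obtain ⟨s, hs⟩ := exists_idx lam hij.symm
  rw [hr, hs]
  refine swap_mem_of_chain (idx_injective lam _) (fun t ht => h1 _ _ ?_ ?_ ?_) r s
  · rw [idx_val, idx_val]
    rfl
  · rw [lam_idx lam, lam_idx lam]
  · rwa [lam_idx lam]

theorem ofPerm_mem_of_adjacent {S : Set ℕ} {H : Subgroup (SgnPerm (Fin p))}
    (h1 : ∀ i j : Fin p, j.val = i.val + 1 → lam i = lam j → lam i ∈ S →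
      ofPerm (Equiv.swap i j) ∈ H) {σ : Equiv.Perm (Fin p)} (hσ : ∀ i, lam (σ i) = lam i)
    (hS : ∀ i, lam i ∉ S → σ i = i) : ofPerm σ ∈ H := by
  classical
  -- colour the blocks so that exactly the allowed permutations preserve the colours
  refine ofPerm_mem_of_swap_mem
    (c := fun i => if lam i ∈ S then (Sum.inl (lam i) : ℕ ⊕ Fin p) else Sum.inr i)
    (fun i j hij hc => ?_) σ (fun i => ?_)
  · by_cases hi : lam i ∈ S
    · by_cases hj : lam j ∈ S
      · simp only [if_pos hi, if_pos hj, Sum.inl.injEq] at hc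
        exact swap_mem_of_adjacent lam h1 hc hi
      · simp [hi, hj] at hc
    · by_cases hj : lam j ∈ S
      · simp [hi, hj] at hc
      · simp only [if_neg hi, if_neg hj, Sum.inr.injEq] at hc
        exact absurd hc hij
  · simp only [hσ]
    split_ifs with h
    · rfl
    · rw [hS i h]

/-- The signed permutations of the blocks of sizes in `S` are generated by the interchanges of
neighbouring blocks and one sign change for each size. -/
theorem lamSub_le {S : Set ℕ} {K : Subgroup (lamGroup lam)}
    (h1 : ∀ i j : Fin p, j.val = i.val + 1 → ∀ h : lam i = lam j, lam i ∈ S → swB i j h ∈ K)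
    (h2 : ∀ k ∈ S, ∀ h : 0 < mult lam k, flB (idx lam k ⟨0, h⟩) ∈ K) : lamSub lam S ≤ K := by
  have hadj : ∀ i j : Fin p, j.val = i.val + 1 → lam i = lam j → lam i ∈ S →
      ofPerm (Equiv.swap i j) ∈ K.map (lamGroup lam).subtype :=
    fun i j hij h hS => ⟨_, h1 i j hij h hS, rfl⟩
  have hfl : ∀ i, lam i ∈ S → fl i ∈ K.map (lamGroup lam).subtype := by
    intro i hi
    obtain ⟨r, hr⟩ := exists_idx lam (rfl : lam i = lam i)
    have h3 : 0 < mult lam (lam i) := lt_of_le_of_lt (Nat.zero_le _) r.isLt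
    have h4 : fl (idx lam (lam i) ⟨0, h3⟩) ∈ K.map (lamGroup lam).subtype := ⟨_, h2 _ hi h3, rfl⟩
    have h5 : ofPerm (Equiv.swap (idx lam (lam i) ⟨0, h3⟩) i) ∈ K.map (lamGroup lam).subtype :=
      swap_mem_of_adjacent lam hadj (lam_idx lam _ _) (by rwa [lam_idx lam])
    have h6 := Subgroup.mul_mem _ (Subgroup.mul_mem _ h5 h4) (Subgroup.inv_mem _ h5)
    rw [conj_fl] at h6
    simpa using h6
  intro g hg
  have hmem : g.1 ∈ K.map (lamGroup lam).subtype := by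
    rw [← ofPerm_mul_ofSgn g.1]
    refine Subgroup.mul_mem _ (ofPerm_mem_of_adjacent lam hadj g.2 fun i hi => (hg i hi).1)
      (ofSgn_mem_of_fl_mem fun i hi => hfl i ?_)
    by_contra hc
    exact hi (hg i hc).2
  obtain ⟨g', hg', e⟩ := hmem
  have : g' = g := Subtype.ext e
  exact this ▸ hg'

/-! ### The product decomposition of the group of block permutations -/

/-- The blocks of size `k`, numbered. -/
def idxEquiv (k : ℕ) : Fin (mult lam k) ≃ {i : Fin p // lam i = k} :=
  Equiv.ofBijective (fun r => ⟨idx lam k r, lam_idx lam k r⟩) ⟨fun r s h =>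
    idx_injective lam k (congrArg Subtype.val h), fun ⟨i, hi⟩ => by
      obtain ⟨r, rfl⟩ := exists_idx lam hi
      exact ⟨r, rfl⟩⟩

theorem idx_idxEquiv_symm {k : ℕ} (i : Fin p) (h : lam i = k) :
    idx lam k ((idxEquiv lam k).symm ⟨i, h⟩) = i :=
  congrArg Subtype.val ((idxEquiv lam k).apply_symm_apply ⟨i, h⟩)

theorem idxEquiv_symm_idx {k : ℕ} (r : Fin (mult lam k)) (h : lam (idx lam k r) = k) :
    (idxEquiv lam k).symm ⟨idx lam k r, h⟩ = r :=
  (idxEquiv lam k).symm_apply_apply r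

/-- The action of a block permutation on the blocks of size `k`. -/
def resFun (g : lamGroup lam) (k : ℕ) (r : Fin (mult lam k)) : Fin (mult lam k) :=
  (idxEquiv lam k).symm ⟨g.1.perm (idx lam k r), by rw [g.2, lam_idx lam]⟩

theorem idx_resFun (g : lamGroup lam) (k : ℕ) (r : Fin (mult lam k)) :
    idx lam k (resFun lam g k r) = g.1.perm (idx lam k r) := idx_idxEquiv_symm lam _ _

theorem resFun_mul (g h : lamGroup lam) (k : ℕ) (r : Fin (mult lam k)) :
    resFun lam (g * h) k r = resFun lam g k (resFun lam h k r) := by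
  apply idx_injective
  rw [idx_resFun, idx_resFun, idx_resFun]
  rfl

theorem resFun_one (k : ℕ) (r : Fin (mult lam k)) : resFun lam 1 k r = r := by
  apply idx_injective
  rw [idx_resFun]
  rfl

/-- The restriction of signed block permutations to the blocks of size `k`. -/
def resHom (k : ℕ) : lamGroup lam →* SgnPerm (Fin (mult lam k)) where
  toFun g := ⟨⟨resFun lam g k, resFun lam g⁻¹ k,
    fun r => by rw [← resFun_mul, inv_mul_cancel, resFun_one],
    fun r => by rw [← resFun_mul, mul_inv_cancel, resFun_one]⟩, fun r => g.1.sgn (idx lam k r)⟩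
  map_one' := by
    ext r
    · exact congrArg Fin.val (resFun_one lam k r)
    · rfl
  map_mul' g h := by
    ext r
    · exact congrArg Fin.val (resFun_mul lam g h k r)
    · change _ = ((g.1.sgn (idx lam k (resFun lam h k r)) * h.1.sgn (idx lam k r) : ℤˣ) : ℤ)
      rw [idx_resFun]
      rfl

theorem resHom_perm (g : lamGroup lam) (k : ℕ) (r : Fin (mult lam k)) :
    idx lam k ((resHom lam k g).perm r) = g.1.perm (idx lam k r) := idx_resFun lam g k r

theorem resHom_sgn (g : lamGroup lam) (k : ℕ) (r : Fin (mult lam k)) :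
    (resHom lam k g).sgn r = g.1.sgn (idx lam k r) := rfl

section Glue

variable {S : Finset ℕ} (G : ∀ k : S, SgnPerm (Fin (mult lam k)))

open Classical in
/-- Signed permutations of the blocks of each size, glued to a map on the blocks. -/
def gluePerm (i : Fin p) : Fin p :=
  if h : lam i ∈ S then
    idx lam (lam i) ((G ⟨lam i, h⟩).perm ((idxEquiv lam (lam i)).symm ⟨i, rfl⟩))
  else i

open Classical in
/-- The signs of signed permutations of the blocks of each size, glued. -/
def glueSgn (i : Fin p) : ℤˣ :=
  if h : lam i ∈ S then (G ⟨lam i, h⟩).sgn ((idxEquiv lam (lam i)).symm ⟨i, rfl⟩) else 1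

theorem gluePerm_idx (k : S) (r : Fin (mult lam k)) :
    gluePerm lam G (idx lam k r) = idx lam k ((G k).perm r) := by
  have key : ∀ (i : Fin p) (k : ℕ) (hk : lam i = k) (h : k ∈ S),
      gluePerm lam G i = idx lam k ((G ⟨k, h⟩).perm ((idxEquiv lam k).symm ⟨i, hk⟩)) := by
    intro i k hk h
    subst hk
    unfold gluePerm
    rw [dif_pos h]
  rw [key _ k.1 (lam_idx lam k r) k.2, idxEquiv_symm_idx]

theorem glueSgn_idx (k : S) (r : Fin (mult lam k)) :
    glueSgn lam G (idx lam k r) = (G k).sgn r := by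
  have key : ∀ (i : Fin p) (k : ℕ) (hk : lam i = k) (h : k ∈ S),
      glueSgn lam G i = (G ⟨k, h⟩).sgn ((idxEquiv lam k).symm ⟨i, hk⟩) := by
    intro i k hk h
    subst hk
    unfold glueSgn
    rw [dif_pos h]
  rw [key _ k.1 (lam_idx lam k r) k.2, idxEquiv_symm_idx]

theorem gluePerm_of_notMem {i : Fin p} (h : lam i ∉ S) : gluePerm lam G i = i := by
  unfold gluePerm
  rw [dif_neg h]

theorem glueSgn_of_notMem {i : Fin p} (h : lam i ∉ S) : glueSgn lam G i = 1 := by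
  unfold glueSgn
  rw [dif_neg h]

theorem gluePerm_gluePerm {G G' : ∀ k : S, SgnPerm (Fin (mult lam k))} (h : G * G' = 1)
    (i : Fin p) : gluePerm lam G (gluePerm lam G' i) = i := by
  by_cases hi : lam i ∈ S
  · obtain ⟨r, hr⟩ := exists_idx lam (rfl : lam i = lam i)
    have h1 : i = idx lam (⟨lam i, hi⟩ : S) r := hr
    rw [h1, gluePerm_idx, gluePerm_idx]
    congr 1
    have h2 := congrArg SgnPerm.perm (congrFun h ⟨lam i, hi⟩)
    exact Equiv.congr_fun h2 r
  · rw [gluePerm_of_notMem lam G' hi, gluePerm_of_notMem lam G hi]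

theorem lam_gluePerm (i : Fin p) : lam (gluePerm lam G i) = lam i := by
  by_cases hi : lam i ∈ S
  · obtain ⟨r, hr⟩ := exists_idx lam (rfl : lam i = lam i)
    have h1 : i = idx lam (⟨lam i, hi⟩ : S) r := hr
    rw [h1, gluePerm_idx, lam_idx lam, lam_idx lam]
  · rw [gluePerm_of_notMem lam G hi]

/-- Signed permutations of the blocks of each size, glued. -/
def glue : lamGroup lam :=
  ⟨⟨⟨gluePerm lam G, gluePerm lam G⁻¹, gluePerm_gluePerm lam (inv_mul_cancel G),
    gluePerm_gluePerm lam (mul_inv_cancel G)⟩, glueSgn lam G⟩, lam_gluePerm lam G⟩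

end Glue

/-- The signed permutations of the blocks of sizes in `S` as a direct product over the sizes. -/
def lamSubEquiv (S : Finset ℕ) :
    lamSub lam (S : Set ℕ) ≃* ∀ k : S, SgnPerm (Fin (mult lam k)) :=
  MulEquiv.ofBijective
    ((MonoidHom.pi fun k : S => resHom lam k).comp (lamSub lam (S : Set ℕ)).subtype) (by
    constructor
    · rw [injective_iff_map_eq_one]
      intro g hg
      have key : ∀ i, g.1.1.perm i = i ∧ g.1.1.sgn i = 1 := by
        intro i
        by_cases hi : lam i ∈ (S : Set ℕ)
        · obtain ⟨r, hr⟩ := exists_idx lam (rfl : lam i = lam i)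
          have h1 : resHom lam (lam i) g.1 = 1 := congrFun hg ⟨lam i, hi⟩
          constructor
          · have := resHom_perm lam g.1 (lam i) r
            rw [h1, ← hr] at this
            rw [← this]
            exact hr.symm
          · have := resHom_sgn lam g.1 (lam i) r
            rw [h1, ← hr] at this
            exact this.symm
        · exact g.2 i hi
      apply Subtype.ext
      apply Subtype.ext
      ext1
      · exact Equiv.ext fun i => (key i).1
      · exact funext fun i => (key i).2
    · intro G
      refine ⟨⟨glue lam G, fun i hi => ⟨gluePerm_of_notMem lam G hi,
        glueSgn_of_notMem lam G hi⟩⟩, ?_⟩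
      funext k
      change resHom lam k (glue lam G) = G k
      ext1
      · ext1 r
        apply idx_injective
        rw [resHom_perm]
        exact gluePerm_idx lam G k r
      · funext r
        exact glueSgn_idx lam G k r)

/-- `W(B_a)` as the abstract group of signed permutations. -/
def sgnPermEquivWB (a : ℕ) : SgnPerm (Fin a) ≃* WB a :=
  (MonoidHom.ofInjective (toIsom_injective (n := a))).trans (MulEquiv.subgroupCongr (by
    ext g
    rw [mem_WB]
    exact ⟨fun ⟨k, h⟩ => ⟨k, h.symm⟩, fun ⟨k, h⟩ => ⟨k, h.symm⟩⟩))

theorem nonempty_map_lamSub_mulEquiv (n : ℕ) [IsLabel n lam] (S : Finset ℕ) :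
    Nonempty ((lamSub lam (S : Set ℕ)).map (blockIsom n) ≃* ProdWB lam S) :=
  ⟨((Subgroup.equivMapOfInjective _ _ (blockIsom_injective n)).symm.trans
    (lamSubEquiv lam S)).trans (MulEquiv.piCongrRight fun _ => sgnPermEquivWB _)⟩

theorem lamSub_eq_top {S : Set ℕ} (h : ∀ i, lam i ∈ S) : lamSub lam S = ⊤ := by
  rw [eq_top_iff]
  exact fun g _ i hi => absurd (h i) hi

end EqualSize

section Generators

variable (n : ℕ) {p : ℕ} (lam : Fin p → ℕ) [hL : IsLabel n lam]

/-! ### The generators as block permutations -/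

/-- A signed permutation is induced by a block permutation if it acts in this way on core points
and block points. The positions are compared as natural numbers, so that no casts between blocks
arise. -/
theorem eq_Phi_of {k : SgnPerm (Fin n)} {g : lamGroup lam}
    (h1 : ∀ v, (k.perm (cpt n lam v)).val = v.val)
    (h2 : ∀ v, k.sgn (cpt n lam v) = if v = 0 then blockParity g else 1)
    (h3 : ∀ i t, (k.perm (bpt n lam i t)).val =
      offset n lam (g.1.perm i) + revSgn (g.1.sgn i) (lam i) t)
    (h4 : ∀ i t, k.sgn (bpt n lam i t) = g.1.sgn i) : k = Phi n g := by
  ext1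
  · ext1 x
    induction x using pt_cases n lam with
    | h1 v => rw [Phi_perm_cpt]; exact Fin.ext (h1 v)
    | h2 i t => rw [Phi_perm_bpt]; exact Fin.ext (h3 i t)
  · funext x
    induction x using pt_cases n lam with
    | h1 v => rw [Phi_sgn_cpt, h2]
    | h2 i t => rw [Phi_sgn_bpt, h4]

/-- The parity of the sign change at a block of size `λ_i`: for odd `λ_i` the first point of the
core has to change its sign, too. -/
theorem blockParity_flB (i : Fin p) : blockParity (flB i : lamGroup lam) = (-1) ^ lam i := by
  change ∏ j, (Pi.mulSingle i (-1) : Fin p → ℤˣ) j ^ lam j = _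
  rw [Finset.prod_eq_single i]
  · rw [Pi.mulSingle_eq_same]
  · intro j _ hj
    rw [Pi.mulSingle_eq_of_ne hj, one_pow]
  · simp

theorem blockParity_swB (i j : Fin p) (h : lam i = lam j) : blockParity (swB i j h) = 1 := by
  change ∏ k, (1 : Fin p → ℤˣ) k ^ lam k = _
  simp

theorem permOfInvolutive_val {f : ℕ → ℕ} (hf : Function.Involutive f) (v : Fin n)
    (h : f v.val < n) : (permOfInvolutive n f hf v).val = f v.val := by
  change ((if h : f v.val < n then ⟨f v.val, h⟩ else v : Fin n)).val = _
  rw [dif_pos h]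

/-- The permutation of the points that underlies `x_i`. -/
def xSgn (i : Fin p) : SgnPerm (Fin n) :=
  ⟨permOfInvolutive n _ (swapFun_involutive (offset n lam i) (lam i)), 1⟩

theorem toIsom_xSgn (i : Fin p) : toIsom (xSgn n lam i) = xElt n lam i := rfl

theorem xSgn_perm_val (i : Fin p) (v : Fin n) (h : swapFun (offset n lam i) (lam i) v.val < n) :
    ((xSgn n lam i).perm v).val = swapFun (offset n lam i) (lam i) v.val :=
  permOfInvolutive_val n (swapFun_involutive (offset n lam i) (lam i)) v h

theorem swapFun_offset {i j : Fin p} (hij : j.val = i.val + 1) (h : lam i = lam j) (k : Fin p)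
    (t : Fin (lam k)) : swapFun (offset n lam i) (lam i) (offset n lam k + t.val) =
      offset n lam (Equiv.swap i j k) + t.val := by
  have ho := offset_succ n lam hij
  unfold swapFun
  have := t.isLt
  rcases lt_trichotomy k i with hk | hk | hk
  · have h3 := offset_add_le n lam hk
    rw [Equiv.swap_apply_of_ne_of_ne hk.ne (by rintro rfl; rw [Fin.lt_def] at hk; omega),
      if_neg (by omega), if_neg (by omega)]
  · subst hk
    rw [Equiv.swap_apply_left, if_pos (by omega)]
    omega
  · by_cases hkj : k = j
    · subst hkj
      rw [Equiv.swap_apply_right, if_neg (by omega), if_pos (by omega)]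
      omega
    · have h3 : j < k := by
        rw [Fin.lt_def] at hk ⊢
        have : k.val ≠ j.val := fun e => hkj (Fin.ext e)
        omega
      have h4 := offset_add_le n lam h3
      rw [Equiv.swap_apply_of_ne_of_ne hk.ne' hkj, if_neg (by omega), if_neg (by omega)]

theorem xElt_eq {i j : Fin p} (hij : j.val = i.val + 1) (h : lam i = lam j) :
    xElt n lam i = blockIsom n (swB i j h) := by
  rw [← toIsom_xSgn, blockIsom_apply_eq]
  congr 1
  refine eq_Phi_of n lam (fun v => ?_) (fun v => ?_) (fun k t => ?_) fun k t => rfl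
  · have h1 := coreRank_le_offset n lam i
    have h2 : swapFun (offset n lam i) (lam i) (cpt n lam v).val = v.val := by
      unfold swapFun
      rw [cpt_val, if_neg (by omega), if_neg (by omega)]
    have h3 : v.val < n := (cpt n lam v).isLt
    rw [xSgn_perm_val, h2]
    rwa [h2]
  · rw [blockParity_swB, ite_self]
    rfl
  · have h2 : swapFun (offset n lam i) (lam i) (bpt n lam k t).val = _ :=
      swapFun_offset n lam hij h k t
    have h4 : lam (Equiv.swap i j k) = lam k := (swB i j h).2 k
    have h5 := (bpt n lam (Equiv.swap i j k) ⟨t.val, by rw [h4]; exact t.isLt⟩).isLt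
    rw [bpt_val] at h5
    rw [xSgn_perm_val, h2]
    · rfl
    · rwa [h2]

theorem revFun_offset (i k : Fin p) (t : Fin (lam k)) :
    revFun (offset n lam i) (lam i) (offset n lam k + t.val) =
      offset n lam k + revSgn ((fl i).sgn k) (lam k) t.val := by
  have := t.isLt
  unfold revFun revSgn
  have h1 : ¬ (-1 : ℤˣ) = 1 := by decide
  rcases lt_trichotomy k i with hk | hk | hk
  · have h3 := offset_add_le n lam hk
    rw [if_neg (by omega)]
    simp [fl, hk.ne]
  · subst hk
    rw [if_pos (by omega)]
    simp only [fl, ofSgn_sgn, Pi.mulSingle_eq_same, if_neg h1]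
    omega
  · have h3 := offset_add_le n lam hk
    rw [if_neg (by omega)]
    simp [fl, hk.ne']

/-- The signed permutation of the points that underlies `y_i`. -/
def ySgn (i : Fin p) : SgnPerm (Fin n) :=
  ⟨permOfInvolutive n _ (revFun_involutive (offset n lam i) (lam i)),
    fun v => if InBlock n lam i v then -1 else 1⟩

theorem toIsom_ySgn (i : Fin p) : toIsom (ySgn n lam i) = yElt n lam i := rfl

theorem ySgn_perm_cpt (i : Fin p) (v : Fin (coreRank n lam)) :
    (ySgn n lam i).perm (cpt n lam v) = cpt n lam v := by
  have h1 := coreRank_le_offset n lam i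
  have h2 : revFun (offset n lam i) (lam i) v.val = v.val := by
    unfold revFun
    rw [if_neg (by omega)]
  apply Fin.ext
  change (permOfInvolutive n _ (revFun_involutive (offset n lam i) (lam i)) _).val = _
  rw [permOfInvolutive_val]
  · exact h2
  · rw [cpt_val, h2]
    exact (cpt n lam v).isLt

theorem ySgn_perm_bpt (i k : Fin p) (t : Fin (lam k)) :
    ((ySgn n lam i).perm (bpt n lam k t)).val =
      offset n lam k + revSgn ((fl i).sgn k) (lam k) t.val := by
  change (permOfInvolutive n _ (revFun_involutive (offset n lam i) (lam i)) _).val = _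
  have h2 := revFun_offset n lam i k t
  rw [permOfInvolutive_val]
  · exact h2
  · rw [bpt_val, h2]
    exact (bpt n lam k ⟨_, revSgn_lt _ t.isLt⟩).isLt

theorem ySgn_sgn_bpt (i k : Fin p) (t : Fin (lam k)) :
    (ySgn n lam i).sgn (bpt n lam k t) = (fl i).sgn k := by
  change (if InBlock n lam i _ then (-1 : ℤˣ) else 1) = _
  simp only [inBlock_iff, col_bpt, Option.some_inj]
  by_cases h : k = i
  · subst h; simp [fl]
  · simp [fl, h]

theorem ySgn_sgn_cpt (i : Fin p) (v : Fin (coreRank n lam)) :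
    (ySgn n lam i).sgn (cpt n lam v) = 1 := by
  change (if InBlock n lam i _ then (-1 : ℤˣ) else 1) = _
  simp [inBlock_iff]

theorem ySgn_mul_fl_eq_Phi {i : Fin p} (h : Odd (lam i)) :
    ySgn n lam i * fl (cpt n lam 0) = Phi n (flB i : lamGroup lam) := by
  refine eq_Phi_of n lam (fun v => ?_) (fun v => ?_) (fun k t => ?_) fun k t => ?_
  · exact congrArg Fin.val (ySgn_perm_cpt n lam i v)
  · rw [blockParity_flB, h.neg_one_pow, mul_sgn]
    change (ySgn n lam i).sgn (cpt n lam v) * _ = _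
    rw [ySgn_sgn_cpt, one_mul]
    by_cases hv : v = 0
    · subst hv; simp [fl]
    · have : cpt n lam v ≠ cpt n lam 0 := fun e => hv (cpt_injective n lam e)
      simp [fl, hv, this]
  · exact ySgn_perm_bpt n lam i k t
  · have : bpt n lam k t ≠ cpt n lam 0 := fun e => by
      have := congrArg (col n lam) e
      simp at this
    change (ySgn n lam i).sgn (bpt n lam k t) * _ = _
    rw [ySgn_sgn_bpt]
    simp [fl, this]
    rfl

theorem yElt_eq {i : Fin p} (h : Even (lam i)) :
    yElt n lam i = blockIsom n (flB i : lamGroup lam) := by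
  refine congrArg toIsom (a₁ := ySgn n lam i) (eq_Phi_of n lam (fun v => ?_) (fun v => ?_)
    (fun k t => ?_) fun k t => ?_)
  · exact congrArg Fin.val (ySgn_perm_cpt n lam i v)
  · rw [blockParity_flB, h.neg_one_pow, ite_self, ySgn_sgn_cpt]
  · exact ySgn_perm_bpt n lam i k t
  · exact ySgn_sgn_bpt n lam i k t

/-- The signed permutation of the points that underlies `z_i`. -/
def zSgn (i : Fin p) : SgnPerm (Fin n) :=
  ⟨permOfInvolutive n _ (revFun_involutive (offset n lam i) (lam i)),
    fun v => if v.val = 0 ∨ InBlock n lam i v then -1 else 1⟩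

theorem toIsom_zSgn (i : Fin p) : toIsom (zSgn n lam i) = zElt n lam i := rfl

theorem zElt_eq {i : Fin p} (h : Odd (lam i)) :
    zElt n lam i = blockIsom n (flB i : lamGroup lam) := by
  rw [blockIsom_apply_eq, ← ySgn_mul_fl_eq_Phi n lam h, ← toIsom_zSgn]
  congr 1
  ext1
  · rfl
  · funext x
    change (if x.val = 0 ∨ InBlock n lam i x then (-1 : ℤˣ) else 1) =
      (ySgn n lam i).sgn x * _
    simp only [inBlock_iff]
    induction x using pt_cases n lam with
    | h1 v =>
      rw [ySgn_sgn_cpt, one_mul]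
      by_cases hv : v = 0
      · subst hv; simp [fl]
      · have h1 : cpt n lam v ≠ cpt n lam 0 := fun e => hv (cpt_injective n lam e)
        have h2 : v.val ≠ 0 := fun e => hv (Fin.ext e)
        simp [fl, h1, h2]
    | h2 k t =>
      have h1 : bpt n lam k t ≠ cpt n lam 0 := fun e => by
        have := congrArg (col n lam) e
        simp at this
      have h2 : (bpt n lam k t).val ≠ 0 := by
        have := coreRank_le_offset n lam k
        have := two_le_coreRank n lam
        simp only [bpt_val]
        omega
      rw [ySgn_sgn_bpt]
      by_cases hk : k = i
      · subst hk; simp [fl, h1]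
      · simp only [h2, col_bpt, Option.some_inj, hk, or_self, if_false, fl, ofSgn_sgn,
          Pi.mulSingle_eq_of_ne hk, Pi.mulSingle_eq_of_ne h1, mul_one]

/-- For odd blocks, the `y_i` have an odd number of sign changes, but products of two of them are
block permutations. -/
theorem yElt_mul_yElt_eq {i j : Fin p} (hi : Odd (lam i)) (hj : Odd (lam j)) :
    yElt n lam i * yElt n lam j = blockIsom n (flB i * flB j : lamGroup lam) := by
  have h3 : (fl (cpt n lam 0) * fl (cpt n lam 0) : SgnPerm (Fin n)) = 1 := by
    unfold fl
    rw [← map_mul, ← Pi.mulSingle_mul]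
    have : (-1 : ℤˣ) * -1 = 1 := by decide
    rw [this, Pi.mulSingle_one, map_one]
  rw [blockIsom_apply_eq, map_mul, ← ySgn_mul_fl_eq_Phi n lam hi, ← ySgn_mul_fl_eq_Phi n lam hj,
    ← toIsom_ySgn, ← toIsom_ySgn, ← map_mul]
  congr 1
  have := (mul_inv_eq_iff_eq_mul.1 ((conj_fl (ySgn n lam j) (cpt n lam 0)).trans
    (by rw [ySgn_perm_cpt])))
  rw [this, mul_assoc, ← mul_assoc (fl (cpt n lam 0)) (fl (cpt n lam 0)), h3, one_mul]

/-! ### The fixed space of the standard parabolic subgroup -/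

/-- A vector orthogonal to the roots of the standard parabolic subgroup vanishes on the core and
is constant on blocks. -/
theorem flat_of_inner_eq_zero {v : Euc n}
    (H : ∀ x y s, x ≠ y → col n lam x = col n lam y → (s = -1 ∨ col n lam x = none) →
      inner ℝ (root x s y 1) v = 0) :
    (∀ x, col n lam x = none → v x = 0) ∧ ∀ x y, col n lam x = col n lam y → v x = v y := by
  have h1 : ∀ x y, col n lam x = col n lam y → v x = v y := by
    intro x y hc
    by_cases hxy : x = y
    · rw [hxy]
    · have := (inner_root_eq_zero_iff _ _ _ _ _).1 (H x y (-1) hxy hc (Or.inl rfl))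
      push_cast at this
      linarith
  refine ⟨fun x hx => ?_, h1⟩
  obtain ⟨y, hy, hxy⟩ : ∃ y, col n lam y = none ∧ x ≠ y := by
    have h2 := two_le_coreRank n lam
    by_cases h0 : x.val = 0
    · refine ⟨cpt n lam ⟨1, by omega⟩, col_cpt _ _ _, fun e => ?_⟩
      rw [e] at h0
      simp at h0
    · refine ⟨cpt n lam ⟨0, by omega⟩, col_cpt _ _ _, fun e => ?_⟩
      rw [e] at h0
      simp at h0
  have := (inner_root_eq_zero_iff _ _ _ _ _).1 (H x y 1 hxy (hx.trans hy.symm) (Or.inr hx))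
  have h2 := h1 x y (hx.trans hy.symm)
  push_cast at this
  linarith

theorem mem_fixedSpace_stdP {v : Euc n} : v ∈ fixedSpace (stdP n lam) ↔
    (∀ x, col n lam x = none → v x = 0) ∧ ∀ x y, col n lam x = col n lam y → v x = v y := by
  constructor
  · intro h
    refine flat_of_inner_eq_zero n lam fun x y s hxy hc hs => ?_
    apply inner_eq_zero_of_refl_apply_eq (root_ne_zero hxy _ _)
    apply h
    rw [refl_root hxy, mul_one, toIsom_mem_stdP, swS_mem_parabolicPerm n lam hxy]
    exact ⟨hc, hs⟩
  · rintro ⟨h1, h2⟩ g hg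
    rw [stdP_eq_map] at hg
    obtain ⟨k, hk, rfl⟩ := hg
    ext y
    obtain ⟨x, rfl⟩ := k.perm.surjective y
    rw [toIsom_apply]
    by_cases hx : col n lam x = none
    · rw [h1 x hx, h1 _ (by rw [hk.1, hx]), mul_zero]
    · rw [hk.2.1 x hx, h2 _ _ (hk.1 x)]
      simp

/-- The fixed space of the standard parabolic subgroup is the orthogonal complement of its roots. -/
theorem orthogonal_roots_iff {v : Euc n} :
    (∀ α : Euc n, α ≠ 0 → refl α ∈ stdP n lam → inner ℝ α v = 0) ↔
      v ∈ fixedSpace (stdP n lam) := by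
  constructor
  · intro h
    rw [mem_fixedSpace_stdP]
    refine flat_of_inner_eq_zero n lam fun x y s hxy hc hs => ?_
    apply h _ (root_ne_zero hxy _ _)
    rw [refl_root hxy, mul_one, toIsom_mem_stdP, swS_mem_parabolicPerm n lam hxy]
    exact ⟨hc, hs⟩
  · intro h α hα hm
    exact inner_eq_zero_of_refl_apply_eq hα (h _ hm)

theorem fvec_mem_fixedSpace (i : Fin p) : fvec n lam i ∈ fixedSpace (stdP n lam) := fun _ hg =>
  ((mem_stdP_iff n lam).1 hg).2 i

theorem eq_sum_fvec {v : Euc n} (hv : v ∈ fixedSpace (stdP n lam)) :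
    v = ∑ i, v (bpt n lam i ⟨0, hL.pos i⟩) • fvec n lam i := by
  obtain ⟨h1, h2⟩ := (mem_fixedSpace_stdP n lam).1 hv
  ext x
  rw [WithLp.ofLp_sum, Finset.sum_apply]
  simp only [PiLp.smul_apply, smul_eq_mul, fvec_apply]
  induction x using pt_cases n lam with
  | h1 v => simp [h1]
  | h2 j t =>
    rw [Finset.sum_eq_single j]
    · simp only [col_bpt, if_true, mul_one]
      exact h2 _ _ (by simp)
    · intro i _ hi
      simp [Ne.symm hi]
    · simp

theorem fixedSpace_stdP : fixedSpace (stdP n lam) = Submodule.span ℝ (Set.range (fvec n lam)) := by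
  apply le_antisymm
  · intro v hv
    rw [eq_sum_fvec n lam hv]
    exact Submodule.sum_mem _ fun i _ => Submodule.smul_mem _ _ (Submodule.subset_span ⟨i, rfl⟩)
  · rw [Submodule.span_le]
    rintro _ ⟨i, rfl⟩
    exact fvec_mem_fixedSpace n lam i

/-! ### The orthogonal complement of the standard parabolic subgroup -/

/-- The orthogonal complement of the standard parabolic subgroup. -/
abbrev stdQ : Subgroup (Euc n ≃ₗᵢ[ℝ] Euc n) := orthComplement (WD n) (stdP n lam)

/-- The roots of `Q` are the roots of `W(D_n)` that are constant on blocks and vanish on the core: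
they are supported on two blocks of size one or on one block of size two. -/
theorem toIsom_swS_mem_stdQ {x y : Fin n} (h : x ≠ y) {s : ℤˣ} :
    toIsom (swS x y s) ∈ stdQ n lam ↔
      (∃ i j, i ≠ j ∧ lam i = 1 ∧ lam j = 1 ∧ col n lam x = some i ∧ col n lam y = some j) ∨
      (∃ i, lam i = 2 ∧ col n lam x = some i ∧ col n lam y = some i ∧ s = 1) := by
  have h' : y ≠ x := h.symm
  have h0 : (√2 : ℝ)⁻¹ ≠ 0 := by positivity
  have hs0 : ((s : ℤ) : ℝ) ≠ 0 := by exact_mod_cast s.ne_zero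
  have hx1 : root x s y 1 x = (√2 : ℝ)⁻¹ * ((s : ℤ) : ℝ) := by rw [root_apply]; simp [h]
  have hy1 : root x s y 1 y = (√2 : ℝ)⁻¹ := by rw [root_apply]; simp [h']
  have hz1 : ∀ z, z ≠ x → z ≠ y → root x s y 1 z = 0 := by
    intro z hzx hzy
    rw [root_apply]; simp [hzx, hzy]
  have e : toIsom (swS x y s) = refl (root x s y 1) := by rw [refl_root h, mul_one]
  rw [e, refl_mem_orthComplement_iff (root_ne_zero h _ _), orthogonal_roots_iff, ← e,
    toIsom_mem_WD, and_iff_right (prod_swS n h s), mem_fixedSpace_stdP]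
  constructor
  · rintro ⟨h1, h2⟩
    have hcx : col n lam x ≠ none := fun hc => by
      have := h1 x hc
      rw [hx1] at this
      exact mul_ne_zero h0 hs0 this
    have hcy : col n lam y ≠ none := fun hc => by
      have := h1 y hc
      rw [hy1] at this
      exact h0 this
    obtain ⟨i, hi⟩ := Option.ne_none_iff_exists'.1 hcx
    obtain ⟨j, hj⟩ := Option.ne_none_iff_exists'.1 hcy
    -- constancy on blocks leaves no room for further points in the blocks of `x` and `y`
    have hzi : ∀ z, col n lam z = some i → z = x ∨ z = y := by
      intro z hz
      by_contra! hne
      have := h2 z x (hz.trans hi.symm)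
      rw [hx1, hz1 z hne.1 hne.2] at this
      exact mul_ne_zero h0 hs0 this.symm
    have hzj : ∀ z, col n lam z = some j → z = x ∨ z = y := by
      intro z hz
      by_contra! hne
      have := h2 z y (hz.trans hj.symm)
      rw [hy1, hz1 z hne.1 hne.2] at this
      exact h0 this.symm
    by_cases hij : i = j
    · subst hij
      refine Or.inr ⟨i, ?_, hi, hj, ?_⟩
      · have hle : Fintype.card (Fin (lam i)) ≤ Fintype.card ({x, y} : Finset (Fin n)) := by
          refine Fintype.card_le_of_injective
            (fun t => (⟨bpt n lam i t, ?_⟩ : ({x, y} : Finset (Fin n)))) ?_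
          · simpa using hzi (bpt n lam i t) (by simp)
          · intro a b hab
            exact bpt_injective n lam i (congrArg Subtype.val hab)
        simp only [Fintype.card_fin, Fintype.card_coe, Finset.card_pair h] at hle
        obtain ⟨a, ha⟩ := exists_bpt n lam hi
        obtain ⟨b, hb⟩ := exists_bpt n lam hj
        have hab : a.val ≠ b.val := fun e => h (by rw [ha, hb, Fin.ext e])
        omega
      · have := h2 x y (hi.trans hj.symm)
        rw [hx1, hy1] at this
        have h3 : ((s : ℤ) : ℝ) = 1 := mul_left_cancel₀ h0 (this.trans (mul_one _).symm)
        rcases Int.units_eq_one_or s with rfl | rfl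
        · rfl
        · norm_num at h3
    · have key : ∀ (i : Fin p) (x : Fin n), col n lam x = some i →
          (∀ z, col n lam z = some i → z = x) → lam i = 1 := by
        intro i x hx hz
        obtain ⟨a, ha⟩ := exists_bpt n lam hx
        have hle : Fintype.card (Fin (lam i)) ≤ 1 := by
          rw [Fintype.card_le_one_iff]
          intro a b
          apply bpt_injective n lam i
          rw [hz _ (col_bpt n lam i a), hz _ (col_bpt n lam i b)]
        rw [Fintype.card_fin] at hle
        have := hL.pos i
        omega
      refine Or.inl ⟨i, j, hij, key i x hi fun z hz => ?_, key j y hj fun z hz => ?_, hi, hj⟩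
      · rcases hzi z hz with rfl | rfl
        · rfl
        · rw [hj] at hz
          exact absurd (Option.some_inj.1 hz).symm hij
      · rcases hzj z hz with rfl | rfl
        · rw [hi] at hz
          exact absurd (Option.some_inj.1 hz) hij
        · rfl
  · have one : ∀ (i : Fin p) (x z : Fin n), lam i = 1 → col n lam x = some i →
        col n lam z = some i → z = x := by
      intro i x z hi hx hz
      obtain ⟨a, rfl⟩ := exists_bpt n lam hx
      obtain ⟨b, rfl⟩ := exists_bpt n lam hz
      congr 1
      exact Fin.ext (by omega)
    rintro (⟨i, j, hij, hi1, hj1, hi, hj⟩ | ⟨i, hi2, hi, hj, rfl⟩)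
    · refine ⟨fun z hz => hz1 z ?_ ?_, fun z w hzw => ?_⟩
      · rintro rfl
        rw [hi] at hz
        exact absurd hz (by simp)
      · rintro rfl
        rw [hj] at hz
        exact absurd hz (by simp)
      · by_cases hzi : col n lam z = some i
        · rw [one i x z hi1 hi hzi, one i x w hi1 hi (hzw ▸ hzi)]
        · by_cases hzj : col n lam z = some j
          · rw [one j y z hj1 hj hzj, one j y w hj1 hj (hzw ▸ hzj)]
          · rw [hz1 z, hz1 w]
            · rintro rfl; exact hzi (hzw.trans hi)
            · rintro rfl; exact hzj (hzw.trans hj)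
            · rintro rfl; exact hzi hi
            · rintro rfl; exact hzj hj
    · have hmem : ∀ z, col n lam z = some i → root x 1 y 1 z = (√2 : ℝ)⁻¹ := by
        intro z hz
        rcases eq_or_ne z x with rfl | hzx
        · rw [hx1]; simp
        · rcases eq_or_ne z y with rfl | hzy
          · exact hy1
          · exfalso
            obtain ⟨a, rfl⟩ := exists_bpt n lam hi
            obtain ⟨b, rfl⟩ := exists_bpt n lam hj
            obtain ⟨c, rfl⟩ := exists_bpt n lam hz
            have h1 : a.val ≠ b.val := fun e => h (by rw [Fin.ext e])
            have h2 : c.val ≠ a.val := fun e => hzx (by rw [Fin.ext e])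
            have h3 : c.val ≠ b.val := fun e => hzy (by rw [Fin.ext e])
            omega
      refine ⟨fun z hz => hz1 z ?_ ?_, fun z w hzw => ?_⟩
      · rintro rfl
        rw [hi] at hz
        exact absurd hz (by simp)
      · rintro rfl
        rw [hj] at hz
        exact absurd hz (by simp)
      · by_cases hzi : col n lam z = some i
        · rw [hmem z hzi, hmem w (hzw ▸ hzi)]
        · rw [hz1 z, hz1 w]
          · rintro rfl; exact hzi (hzw.trans hi)
          · rintro rfl; exact hzi (hzw.trans hj)
          · rintro rfl; exact hzi hi
          · rintro rfl; exact hzi hj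

theorem revSgn_one' (s : ℤˣ) {t : ℕ} (h : t < 1) : revSgn s 1 t = t := by
  unfold revSgn
  split_ifs <;> omega

/-- On a block of size two, the reflection in `e_y + e_x` is the sign change of the block. -/
theorem swS_eq_Phi_flB {x y : Fin n} (h : x ≠ y) {i : Fin p} (h2 : lam i = 2)
    (hx : col n lam x = some i) (hy : col n lam y = some i) :
    swS x y 1 = Phi n (flB i : lamGroup lam) := by
  have hne : ∀ z, col n lam z ≠ some i → z ≠ x ∧ z ≠ y :=
    fun z hz => ⟨by rintro rfl; exact hz hx, by rintro rfl; exact hz hy⟩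
  refine eq_Phi_of n lam (fun v => ?_) (fun v => ?_) (fun k t => ?_) fun k t => ?_
  · obtain ⟨h3, h4⟩ := hne (cpt n lam v) (by simp)
    simp only [swS, Equiv.swap_apply_of_ne_of_ne h3 h4, cpt_val]
  · obtain ⟨h3, h4⟩ := hne (cpt n lam v) (by simp)
    rw [blockParity_flB, h2]
    simp [swS, h3, h4]
  · change (Equiv.swap x y (bpt n lam k t)).val =
      offset n lam k + revSgn ((fl i).sgn k) (lam k) t
    by_cases hk : k = i
    · subst hk
      obtain ⟨a, rfl⟩ := exists_bpt n lam hx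
      obtain ⟨b, rfl⟩ := exists_bpt n lam hy
      have h1 : a.val ≠ b.val := fun e => h (by rw [Fin.ext e])
      have h3 : ¬ (-1 : ℤˣ) = 1 := by decide
      simp only [fl, ofSgn_sgn, Pi.mulSingle_eq_same, revSgn, if_neg h3]
      by_cases hta : t = a
      · subst hta
        rw [Equiv.swap_apply_left, bpt_val]
        omega
      · have htb : t = b := by
          have : t.val ≠ a.val := fun e => hta (Fin.ext e)
          exact Fin.ext (by omega)
        subst htb
        rw [Equiv.swap_apply_right, bpt_val]
        omega
    · obtain ⟨h3, h4⟩ := hne (bpt n lam k t) (by simp [hk])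
      rw [Equiv.swap_apply_of_ne_of_ne h3 h4]
      simp [fl, hk, revSgn]
  · change (if bpt n lam k t = x ∨ bpt n lam k t = y then -(1 : ℤˣ) else 1) = (fl i).sgn k
    by_cases hk : k = i
    · subst hk
      obtain ⟨a, rfl⟩ := exists_bpt n lam hx
      obtain ⟨b, rfl⟩ := exists_bpt n lam hy
      have h1 : a.val ≠ b.val := fun e => h (by rw [Fin.ext e])
      rw [if_pos]
      · simp [fl]
      · by_cases hta : t = a
        · exact Or.inl (by rw [hta])
        · have : t.val ≠ a.val := fun e => hta (Fin.ext e)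
          exact Or.inr (congrArg _ (Fin.ext (by omega)))
    · obtain ⟨h3, h4⟩ := hne (bpt n lam k t) (by simp [hk])
      simp [fl, hk, h3, h4]

/-- On blocks of size one, interchanging points is interchanging blocks. -/
theorem ofPerm_swap_eq_Phi_swB {x y : Fin n} {i j : Fin p} (h : lam i = lam j)
    (hi : lam i = 1) (hx : col n lam x = some i) (hy : col n lam y = some j) :
    ofPerm (Equiv.swap x y) = Phi n (swB i j h) := by
  obtain ⟨a, rfl⟩ := exists_bpt n lam hx
  obtain ⟨b, rfl⟩ := exists_bpt n lam hy
  have h0 : ∀ (k : Fin p) (t : Fin (lam k)) (a : Fin (lam i)),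
      bpt n lam k t = bpt n lam i a ↔ k = i := by
    intro k t a
    constructor
    · intro e
      simpa using congrArg (col n lam) e
    · rintro rfl
      exact congrArg _ (Fin.ext (by omega))
  have h0' : ∀ (k : Fin p) (t : Fin (lam k)) (b : Fin (lam j)),
      bpt n lam k t = bpt n lam j b ↔ k = j := by
    intro k t b
    constructor
    · intro e
      simpa using congrArg (col n lam) e
    · rintro rfl
      exact congrArg _ (Fin.ext (by omega))
  refine eq_Phi_of n lam (fun v => ?_) (fun v => ?_) (fun k t => ?_) fun k t => rfl
  · change (Equiv.swap (bpt n lam i a) (bpt n lam j b) (cpt n lam v)).val = v.val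
    rw [Equiv.swap_apply_of_ne_of_ne, cpt_val] <;>
    · intro e
      simpa using congrArg (col n lam) e
  · rw [blockParity_swB, ite_self]; rfl
  · change (Equiv.swap (bpt n lam i a) (bpt n lam j b) (bpt n lam k t)).val =
      offset n lam (Equiv.swap i j k) + revSgn 1 (lam k) t
    simp only [revSgn, if_true]
    by_cases hk : k = i
    · subst hk
      rw [(h0 k t a).2 rfl, Equiv.swap_apply_left, Equiv.swap_apply_left, bpt_val]
      omega
    · by_cases hk' : k = j
      · subst hk'
        rw [(h0' k t b).2 rfl, Equiv.swap_apply_right, Equiv.swap_apply_right, bpt_val]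
        omega
      · rw [Equiv.swap_apply_of_ne_of_ne hk hk', Equiv.swap_apply_of_ne_of_ne, bpt_val]
        · rwa [Ne, h0]
        · rwa [Ne, h0']

theorem fl_mul_fl_eq_Phi {x y : Fin n} {i j : Fin p} (hi : lam i = 1) (hj : lam j = 1)
    (hx : col n lam x = some i) (hy : col n lam y = some j) :
    fl x * fl y = Phi n (flB i * flB j : lamGroup lam) := by
  obtain ⟨a, rfl⟩ := exists_bpt n lam hx
  obtain ⟨b, rfl⟩ := exists_bpt n lam hy
  have h0 : ∀ (i : Fin p), lam i = 1 → ∀ (a : Fin (lam i)) (k : Fin p) (t : Fin (lam k)),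
      (Pi.mulSingle (bpt n lam i a) (-1) : Fin n → ℤˣ) (bpt n lam k t) =
        (Pi.mulSingle i (-1) : Fin p → ℤˣ) k := by
    intro i hi a k t
    by_cases hk : k = i
    · subst hk
      have : t = a := Fin.ext (by omega)
      rw [this]; simp
    · have : bpt n lam k t ≠ bpt n lam i a := fun e => hk (by simpa using congrArg (col n lam) e)
      rw [Pi.mulSingle_eq_of_ne this, Pi.mulSingle_eq_of_ne hk]
  have hc : ∀ v (i : Fin p) (a : Fin (lam i)), cpt n lam v ≠ bpt n lam i a := fun v i a e => by
    simpa using congrArg (col n lam) e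
  refine eq_Phi_of n lam (fun v => rfl) (fun v => ?_) (fun k t => ?_) fun k t => ?_
  · rw [map_mul, blockParity_flB, blockParity_flB, hi, hj]
    simp [fl, hc]
  · change (bpt n lam k t).val = offset n lam k + revSgn _ (lam k) t
    rw [bpt_val]
    congr 1
    change t.val = revSgn ((fl i).sgn k * (fl j).sgn k) (lam k) t
    by_cases hk : lam k = 1
    · generalize lam k = q at t hk ⊢
      subst hk
      rw [revSgn_one' _ t.isLt]
    · have h1 : k ≠ i := by rintro rfl; exact hk hi
      have h2 : k ≠ j := by rintro rfl; exact hk hj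
      simp [fl, h1, h2, revSgn]
  · change (fl _).sgn (bpt n lam k t) * (fl _).sgn (bpt n lam k t) = (fl i).sgn k * (fl j).sgn k
    simp only [fl, ofSgn_sgn, h0 i hi, h0 j hj]

/-- A subgroup contains the orthogonal complement of the standard parabolic subgroup as soon as it
contains the interchanges of blocks of size one, their twofold sign changes, and the sign changes
of blocks of size two. -/
theorem stdQ_le {K : Subgroup (Euc n ≃ₗᵢ[ℝ] Euc n)}
    (h1 : ∀ i j (h : lam i = lam j), lam i = 1 → blockIsom n (swB i j h : lamGroup lam) ∈ K)
    (h2 : ∀ i j, i ≠ j → lam i = 1 → lam j = 1 → blockIsom n (flB i * flB j : lamGroup lam) ∈ K)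
    (h3 : ∀ i, lam i = 2 → blockIsom n (flB i : lamGroup lam) ∈ K) : stdQ n lam ≤ K := by
  intro g hg
  unfold stdQ at hg
  have hle : orthComplement (WD n) (stdP n lam) ≤ K := by
    conv_lhs => unfold orthComplement
    rw [Subgroup.closure_le]
    rintro t ⟨ht, β, hβ, rfl, hort⟩
    have hn : ‖β‖ ≠ 0 := by simpa using hβ
    have hu : ‖(‖β‖⁻¹ • β)‖ = 1 := by
      rw [norm_smul, norm_inv, norm_norm, inv_mul_cancel₀ hn]
    have hm : refl β ∈ stdQ n lam := (refl_mem_orthComplement_iff hβ).2 ⟨ht, hort⟩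
    rw [← refl_smul (inv_ne_zero hn) β] at ht hm ⊢
    obtain ⟨x, y, s, t, hxy, e⟩ := exists_eq_root_of_refl_mem_WD hu ht
    rw [e, refl_root hxy.ne] at hm ⊢
    generalize s * t = s at hm ⊢
    rcases (toIsom_swS_mem_stdQ n lam hxy.ne).1 hm with
      ⟨i, j, hij, hi, hj, hx, hy⟩ | ⟨i, hi, hx, hy, rfl⟩
    · have h4 := h1 i j (hi.trans hj.symm) hi
      rcases Int.units_eq_one_or s with rfl | rfl
      · rw [swS_one hxy.ne, ofPerm_swap_eq_Phi_swB n lam (hi.trans hj.symm) hi hx hy,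
          fl_mul_fl_eq_Phi n lam hi hj hx hy, map_mul]
        exact K.mul_mem h4 (h2 i j hij hi hj)
      · rw [swS_neg_one, ofPerm_swap_eq_Phi_swB n lam (hi.trans hj.symm) hi hx hy]
        exact h4
    · rw [swS_eq_Phi_flB n lam hxy.ne hi hx hy]
      exact h3 i hi
  exact hle hg

theorem swB_mem_stdQ {i j : Fin p} (hij : i ≠ j) (h : lam i = lam j) (hi : lam i = 1) :
    blockIsom n (swB i j h) ∈ stdQ n lam := by
  rw [blockIsom_apply_eq, ← ofPerm_swap_eq_Phi_swB n lam h hi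
    (col_bpt n lam i ⟨0, hL.pos i⟩) (col_bpt n lam j ⟨0, hL.pos j⟩), ← swS_neg_one,
    toIsom_swS_mem_stdQ]
  · exact Or.inl ⟨i, j, hij, hi, h ▸ hi, col_bpt _ _ _ _, col_bpt _ _ _ _⟩
  · intro e
    exact hij (by simpa using congrArg (col n lam) e)

theorem swB_mul_flB_mul_flB_mem_stdQ {i j : Fin p} (hij : i ≠ j) (h : lam i = lam j)
    (hi : lam i = 1) : blockIsom n (swB i j h * (flB i * flB j)) ∈ stdQ n lam := by
  have hne : bpt n lam i ⟨0, hL.pos i⟩ ≠ bpt n lam j ⟨0, hL.pos j⟩ := fun e =>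
    hij (by simpa using congrArg (col n lam) e)
  rw [blockIsom_apply_eq, map_mul, ← ofPerm_swap_eq_Phi_swB n lam h hi
    (col_bpt n lam i ⟨0, hL.pos i⟩) (col_bpt n lam j ⟨0, hL.pos j⟩),
    ← fl_mul_fl_eq_Phi n lam hi (h ▸ hi)
    (col_bpt n lam i ⟨0, hL.pos i⟩) (col_bpt n lam j ⟨0, hL.pos j⟩), ← swS_one hne,
    toIsom_swS_mem_stdQ n lam hne]
  exact Or.inl ⟨i, j, hij, hi, h ▸ hi, col_bpt _ _ _ _, col_bpt _ _ _ _⟩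

theorem flB_mem_stdQ {i : Fin p} (hi : lam i = 2) :
    blockIsom n (flB i : lamGroup lam) ∈ stdQ n lam := by
  have hne : bpt n lam i ⟨0, by omega⟩ ≠ bpt n lam i ⟨1, by omega⟩ := fun e => by
    have := bpt_injective n lam i e
    simp at this
  rw [blockIsom_apply_eq, ← swS_eq_Phi_flB n lam hne hi (col_bpt _ _ _ _) (col_bpt _ _ _ _),
    toIsom_swS_mem_stdQ n lam hne]
  exact Or.inr ⟨i, hi, col_bpt _ _ _ _, col_bpt _ _ _ _, rfl⟩

end Generators

section OrthComplement

variable {E : Type*} [NormedAddCommGroup E] [InnerProductSpace ℝ E] [FiniteDimensional ℝ E]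

/-! ### Products with the orthogonal complement -/

theorem fix_span_iff {T : Set E} {g : E ≃ₗᵢ[ℝ] E} :
    (∀ v ∈ Submodule.span ℝ T, g v = v) ↔ ∀ v ∈ T, g v = v := by
  refine ⟨fun h v hv => h v (Submodule.subset_span hv), fun h v hv => ?_⟩
  induction hv using Submodule.span_induction with
  | mem x hx => exact h x hx
  | zero => exact map_zero g
  | add x y _ _ hx hy => rw [map_add, hx, hy]
  | smul c x _ hx => rw [map_smul, hx]

/-- The positive roots of `P` are the positive roots of `PQ` that belong to `P`, and elements of
the normalizer preserve the roots of `P`. -/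
theorem howlettComplement_sup_le (W P Q : Subgroup (E ≃ₗᵢ[ℝ] E)) (ρ : E) :
    howlettComplement (P ⊔ Q) (normalizerIn W P) ρ ≤ howlettComplement P (normalizerIn W P) ρ := by
  have key : ∀ {g : E ≃ₗᵢ[ℝ] E}, g ∈ howlettComplement (P ⊔ Q) (normalizerIn W P) ρ →
      ∀ α ∈ posRoots P ρ, g α ∈ posRoots P ρ := by
    intro g hg α hα
    have h1 : α ∈ posRoots (P ⊔ Q) ρ := ⟨⟨hα.1.1, Subgroup.mem_sup_left hα.1.2⟩, hα.2⟩
    have h2 := (hg.2 α).2 h1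
    refine ⟨⟨h2.1.1, ?_⟩, h2.2⟩
    rw [refl_map]
    exact howlettComplement_normalizes hg.1 hα.1.2
  refine fun g hg => ⟨hg.1, fun α => ⟨fun h => ?_, key hg α⟩⟩
  have := key (Subgroup.inv_mem _ hg) _ h
  rwa [LinearIsometryEquiv.inv_def, LinearIsometryEquiv.symm_apply_apply] at this

theorem normalizerIn_orthComplement {W P : Subgroup (E ≃ₗᵢ[ℝ] E)} {g k : E ≃ₗᵢ[ℝ] E}
    (hg : g ∈ normalizerIn W P) (hk : k ∈ orthComplement W P) :
    g * k * g⁻¹ ∈ orthComplement W P := by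
  have key : orthComplement W P ≤ (orthComplement W P).comap (MulAut.conj g).toMonoidHom := by
    conv_lhs => unfold orthComplement
    rw [Subgroup.closure_le]
    rintro _ ⟨ht, β, hβ, rfl, hort⟩
    change g * refl β * g⁻¹ ∈ orthComplement W P
    rw [← refl_map, refl_mem_orthComplement_iff (by simpa using hβ)]
    refine ⟨refl_map_mem hg.1 ht, fun α hα hαP => ?_⟩
    have h1 := hort (g⁻¹ α) (by simpa using hα) (by
      rw [refl_map]
      exact howlettComplement_normalizes (Subgroup.inv_mem _ hg) hαP)
    rwa [← LinearIsometryEquiv.inner_map_map g, LinearIsometryEquiv.inv_def,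
      LinearIsometryEquiv.apply_symm_apply] at h1
  exact key hk

theorem commute_of_orthogonal_fixedSpace_le {P Q : Subgroup (E ≃ₗᵢ[ℝ] E)}
    (h1 : (fixedSpace P)ᗮ ≤ fixedSpace Q) {a b : E ≃ₗᵢ[ℝ] E} (ha : a ∈ P) (hb : b ∈ Q) :
    a * b = b * a := by
  have h2 : (fixedSpace Q)ᗮ ≤ fixedSpace P := by
    rw [← Submodule.orthogonal_orthogonal (fixedSpace P)]
    exact Submodule.orthogonal_le h1
  have hst : ∀ {R : Subgroup (E ≃ₗᵢ[ℝ] E)} {g : E ≃ₗᵢ[ℝ] E}, g ∈ R →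
      ∀ v ∈ (fixedSpace R)ᗮ, g v ∈ (fixedSpace R)ᗮ := by
    intro R g hg v hv
    rw [Submodule.mem_orthogonal] at hv ⊢
    intro u hu
    rw [← hu g hg, LinearIsometryEquiv.inner_map_map]
    exact hv u hu
  have hst' : ∀ v ∈ fixedSpace P, b v ∈ fixedSpace P := by
    intro v hv
    obtain ⟨u, hu, w, hw, rfl⟩ := (fixedSpace Q).exists_add_mem_mem_orthogonal v
    rw [map_add, hu b hb]
    have h3 : u ∈ fixedSpace P := by
      have := Submodule.sub_mem _ hv (h2 hw)
      rwa [add_sub_cancel_right] at this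
    exact Submodule.add_mem _ h3 (h2 (hst hb w hw))
  ext v
  obtain ⟨u, hu, w, hw, rfl⟩ := (fixedSpace P).exists_add_mem_mem_orthogonal v
  simp only [map_add, LinearIsometryEquiv.coe_mul, Function.comp_apply]
  rw [hu a ha, hst' u hu a ha, h1 hw b hb, h1 (hst ha w hw) b hb]

end OrthComplement

section Groups

variable (n : ℕ) {p : ℕ} (lam : Fin p → ℕ) [hL : IsLabel n lam] [hA : Fact (Antitone lam)]

/-! ### Positive roots of the orthogonal complement -/

variable {n lam} in
theorem col_eq_some_iff_of_one {i : Fin p} (hi : lam i = 1) {x z : Fin n}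
    (hx : col n lam x = some i) : col n lam z = some i ↔ z = x := by
  refine ⟨fun hz => ?_, fun h => h ▸ hx⟩
  obtain ⟨a, rfl⟩ := exists_bpt n lam hx
  obtain ⟨b, rfl⟩ := exists_bpt n lam hz
  exact congrArg _ (Fin.ext (by omega))

variable {n lam} in
theorem col_eq_some_iff_of_two {i : Fin p} (hi : lam i = 2) {x y z : Fin n} (h : x ≠ y)
    (hx : col n lam x = some i) (hy : col n lam y = some i) :
    col n lam z = some i ↔ z = x ∨ z = y := by
  refine ⟨fun hz => ?_, ?_⟩
  · obtain ⟨a, rfl⟩ := exists_bpt n lam hx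
    obtain ⟨b, rfl⟩ := exists_bpt n lam hy
    obtain ⟨c, rfl⟩ := exists_bpt n lam hz
    have h1 : a.val ≠ b.val := fun e => h (by rw [Fin.ext e])
    by_cases hc : c.val = a.val
    · exact Or.inl (congrArg _ (Fin.ext hc))
    · exact Or.inr (congrArg _ (Fin.ext (by omega)))
  · rintro (rfl | rfl)
    · exact hx
    · exact hy

theorem fvec_eq_eVec {i : Fin p} (hi : lam i = 1) {x : Fin n} (hx : col n lam x = some i) :
    fvec n lam i = eVec x := by
  ext z
  rw [fvec_apply, eVec_apply]
  simp only [col_eq_some_iff_of_one hi hx]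

theorem fvec_eq_eVec_add {i : Fin p} (hi : lam i = 2) {x y : Fin n} (h : x ≠ y)
    (hx : col n lam x = some i) (hy : col n lam y = some i) :
    fvec n lam i = eVec y + eVec x := by
  ext z
  rw [fvec_apply, PiLp.add_apply, eVec_apply, eVec_apply]
  simp only [col_eq_some_iff_of_two hi h hx hy]
  by_cases hzx : z = x
  · subst hzx; simp [h]
  · simp [hzx]

theorem lt_of_col {i j : Fin p} {x y : Fin n} (hx : col n lam x = some i)
    (hy : col n lam y = some j) (hxy : x < y) : i ≤ j := by
  by_contra! hij
  have h1 := offset_add_le n lam hij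
  obtain ⟨a, rfl⟩ := exists_bpt n lam hx
  obtain ⟨b, rfl⟩ := exists_bpt n lam hy
  rw [Fin.lt_def, bpt_val, bpt_val] at hxy
  omega

theorem stdQ_le_WD : stdQ n lam ≤ WD n := orthComplement_le _ _

/-- The positive roots of `Q` in terms of block vectors. -/
theorem mem_posRoots_stdQ {α : Euc n} : α ∈ posRoots (stdQ n lam) (stdRho n) ↔
    (∃ (i j : Fin p) (s : ℤˣ), i < j ∧ lam i = 1 ∧ lam j = 1 ∧
      α = (√2 : ℝ)⁻¹ • (fvec n lam j + ((s : ℤ) : ℝ) • fvec n lam i)) ∨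
    ∃ i, lam i = 2 ∧ α = (√2 : ℝ)⁻¹ • fvec n lam i := by
  rw [mem_posRoots_iff (stdQ_le_WD n lam)]
  constructor
  · rintro ⟨x, y, s, hxy, hm, rfl⟩
    rcases (toIsom_swS_mem_stdQ n lam hxy.ne).1 hm with
      ⟨i, j, hij, hi, hj, hx, hy⟩ | ⟨i, hi, hx, hy, rfl⟩
    · refine Or.inl ⟨i, j, s, lt_of_le_of_ne (lt_of_col n lam hx hy hxy) hij, hi, hj, ?_⟩
      rw [fvec_eq_eVec n lam hi hx, fvec_eq_eVec n lam hj hy]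
      simp [root]
    · refine Or.inr ⟨i, hi, ?_⟩
      rw [fvec_eq_eVec_add n lam hi hxy.ne hx hy]
      simp [root]
  · rintro (⟨i, j, s, hij, hi, hj, rfl⟩ | ⟨i, hi, rfl⟩)
    · have hx := col_bpt n lam i ⟨0, hL.pos i⟩
      have hy := col_bpt n lam j ⟨0, hL.pos j⟩
      have hxy : bpt n lam i ⟨0, hL.pos i⟩ < bpt n lam j ⟨0, hL.pos j⟩ := by
        have := offset_add_le n lam hij
        have := hL.pos i
        rw [Fin.lt_def, bpt_val, bpt_val]
        simp only
        omega
      refine ⟨_, _, s, hxy, (toIsom_swS_mem_stdQ n lam hxy.ne).2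
        (Or.inl ⟨i, j, hij.ne, hi, hj, hx, hy⟩), ?_⟩
      rw [fvec_eq_eVec n lam hi hx, fvec_eq_eVec n lam hj hy]
      simp [root]
    · have hx := col_bpt n lam i ⟨0, by omega⟩
      have hy := col_bpt n lam i ⟨1, by omega⟩
      have hxy : bpt n lam i ⟨0, by omega⟩ < bpt n lam i ⟨1, by omega⟩ := by
        rw [Fin.lt_def, bpt_val, bpt_val]
        simp
      refine ⟨_, _, 1, hxy, (toIsom_swS_mem_stdQ n lam hxy.ne).2
        (Or.inr ⟨i, hi, hx, hy, rfl⟩), ?_⟩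
      rw [fvec_eq_eVec_add n lam hi hxy.ne hx hy]
      simp [root]

theorem inner_fvec_stdRho_pos (i : Fin p) : 0 < inner ℝ (fvec n lam i) (stdRho n) := by
  rw [inner_eq_sum]
  refine Finset.sum_pos' (fun x _ => ?_) ⟨bpt n lam i ⟨0, hL.pos i⟩, Finset.mem_univ _, ?_⟩
  · rw [fvec_apply]
    change 0 ≤ _ * ((x.val : ℝ) + 1)
    split_ifs
    · positivity
    · rw [zero_mul]
  · rw [fvec_apply, col_bpt, if_pos rfl]
    change 0 < _ * (((_ : Fin n).val : ℝ) + 1)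
    positivity

theorem inner_fvec_stdRho_of_one {i : Fin p} (hi : lam i = 1) :
    inner ℝ (fvec n lam i) (stdRho n) = (offset n lam i : ℝ) + 1 := by
  rw [fvec_eq_eVec n lam hi (col_bpt n lam i ⟨0, hL.pos i⟩), inner_eVec]
  change (((bpt n lam i ⟨0, hL.pos i⟩).val : ℝ) + 1) = _
  rw [bpt_val]
  simp

/-! ### The orthogonal decomposition of the fixed space -/

/-- The block sizes that do not occur in the roots of the orthogonal complement. -/
def sizesA : Set ℕ := {k | k ≠ 2 ∧ (k = 1 → mult lam 1 ≤ 1)}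

variable {lam} in
theorem exists_ne_of_one_lt_mult {i : Fin p} (hi : lam i = 1) (h : 1 < mult lam 1) :
    ∃ j, j ≠ i ∧ lam j = 1 := by
  obtain ⟨a, ha, b, hb, hab⟩ := Finset.one_lt_card.1 h
  rw [Finset.mem_filter] at ha hb
  rcases eq_or_ne a i with rfl | hai
  · exact ⟨b, hab.symm, hb.2⟩
  · exact ⟨a, hai, ha.2⟩

variable {lam} in
theorem notMem_sizesA {i : Fin p} :
    lam i ∉ sizesA lam ↔ lam i = 2 ∨ (lam i = 1 ∧ 1 < mult lam 1) := by
  unfold sizesA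
  simp only [Set.mem_ofPred_eq, not_and, Classical.not_imp, not_le]
  constructor
  · intro h
    by_cases h2 : lam i = 2
    · exact Or.inl h2
    · exact Or.inr (h h2)
  · rintro (h | h) h2
    · exact absurd h h2
    · exact h

variable {lam} in
theorem one_lt_mult {i j : Fin p} (hij : i ≠ j) (hi : lam i = 1) (hj : lam j = 1) :
    1 < mult lam 1 := by
  unfold mult
  rw [Finset.one_lt_card]
  exact ⟨i, by simpa using hi, j, by simpa using hj, hij⟩

theorem orthogonal_fixedSpace_stdP_le : (fixedSpace (stdP n lam))ᗮ ≤ fixedSpace (stdQ n lam) := by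
  have h1 : Submodule.span ℝ {β : Euc n | β ≠ 0 ∧ refl β ∈ stdP n lam} ≤
      fixedSpace (stdQ n lam) := by
    rw [Submodule.span_le]
    exact fun β hβ => mem_fixedSpace_orthComplement hβ.1 hβ.2
  refine le_trans ?_ h1
  rw [← Submodule.orthogonal_orthogonal (Submodule.span ℝ _)]
  refine Submodule.orthogonal_le fun v hv => ?_
  rw [← orthogonal_roots_iff]
  intro α hα hαP
  exact (Submodule.mem_orthogonal _ _).1 hv α (Submodule.subset_span ⟨hα, hαP⟩)

/-- `Yᗮ` is spanned by the vectors of the blocks that occur in the roots of `Q`: if there are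
several blocks of size one, then the roots `f_j ± f_i` span the same space as the `f_i`. -/
theorem orthogonal_fixedSpace_stdQ : (fixedSpace (stdQ n lam))ᗮ =
    Submodule.span ℝ (fvec n lam '' {i | lam i ∉ sizesA lam}) := by
  set U := Submodule.span ℝ (fvec n lam '' {i | lam i ∉ sizesA lam}) with hU
  have hf : ∀ i, lam i ∉ sizesA lam → fvec n lam i ∈ U := fun i hi =>
    Submodule.subset_span ⟨i, hi, rfl⟩
  apply le_antisymm
  · rw [← Submodule.orthogonal_orthogonal U]
    refine Submodule.orthogonal_le fun v hv => ?_
    unfold stdQ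
    conv => enter [1, 1]; unfold orthComplement
    rw [mem_fixedSpace_closure]
    rintro _ ⟨ht, β, hβ, rfl, hort⟩
    have hn : ‖β‖ ≠ 0 := by simpa using hβ
    have hm : refl β ∈ stdQ n lam := (refl_mem_orthComplement_iff hβ).2 ⟨ht, hort⟩
    apply refl_apply_of_inner_eq_zero
    -- a multiple of `β` is a positive root
    have key : ∃ c : ℝ, c ≠ 0 ∧ c • β ∈ posRoots (stdQ n lam) (stdRho n) := by
      have h0 : ‖β‖⁻¹ ≠ 0 := inv_ne_zero hn
      have hu : ‖(‖β‖⁻¹ • β)‖ = 1 := by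
        rw [norm_smul, norm_inv, norm_norm, inv_mul_cancel₀ hn]
      have hr : (‖β‖⁻¹ • β) ∈ roots (stdQ n lam) := ⟨hu, by rwa [refl_smul h0]⟩
      rcases lt_or_gt_of_ne (isRegularVec_stdRho (stdQ_le_WD n lam) _ hr) with h | h
      · refine ⟨-‖β‖⁻¹, neg_ne_zero.2 h0, ⟨?_, by rwa [refl_smul (neg_ne_zero.2 h0)]⟩, ?_⟩
        · rw [neg_smul, norm_neg, hu]
        · rw [neg_smul, inner_neg_left]
          linarith
      · exact ⟨_, h0, hr, h⟩
    obtain ⟨c, hc, hroot⟩ := key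
    have hβU : c • β ∈ U := by
      rcases (mem_posRoots_stdQ n lam).1 hroot with ⟨i, j, s, hij, hi, hj, e⟩ | ⟨i, hi, e⟩
      · have h1 := one_lt_mult hij.ne hi hj
        rw [e]
        exact Submodule.smul_mem _ _ (Submodule.add_mem _
          (hf j (notMem_sizesA.2 (Or.inr ⟨hj, h1⟩))) (Submodule.smul_mem _ _
          (hf i (notMem_sizesA.2 (Or.inr ⟨hi, h1⟩)))))
      · rw [e]
        exact Submodule.smul_mem _ _ (hf i (notMem_sizesA.2 (Or.inl hi)))
    have h1 := (Submodule.mem_orthogonal _ _).1 hv _ hβU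
    rw [inner_smul_left] at h1
    exact (mul_eq_zero.1 h1).resolve_left (by simpa using hc)
  · rw [hU, Submodule.span_le]
    rintro _ ⟨i, hi, rfl⟩
    change fvec n lam i ∈ (fixedSpace (stdQ n lam))ᗮ
    rw [Submodule.mem_orthogonal]
    intro v hv
    rw [real_inner_comm]
    have key : ∀ α ∈ posRoots (stdQ n lam) (stdRho n), inner ℝ α v = 0 := by
      intro α hα
      refine inner_eq_zero_of_refl_apply_eq (fun h => ?_) (hv _ hα.1.2)
      have := hα.2
      simp [h] at this
    have h0 : (√2 : ℝ)⁻¹ ≠ 0 := by positivity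
    rcases notMem_sizesA.1 hi with h | ⟨h, h1⟩
    · have := key _ ((mem_posRoots_stdQ n lam).2 (Or.inr ⟨i, h, rfl⟩))
      rw [inner_smul_left] at this
      exact (mul_eq_zero.1 this).resolve_left (by simp)
    · obtain ⟨j, hj, hj1⟩ := exists_ne_of_one_lt_mult h h1
      have h2 : ∀ a b : Fin p, a < b → lam a = 1 → lam b = 1 →
          inner ℝ (fvec n lam a) v = 0 ∧ inner ℝ (fvec n lam b) v = 0 := by
        intro a b hab ha hb
        have e1 := key _ ((mem_posRoots_stdQ n lam).2 (Or.inl ⟨a, b, 1, hab, ha, hb, rfl⟩))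
        have e2 := key _ ((mem_posRoots_stdQ n lam).2 (Or.inl ⟨a, b, -1, hab, ha, hb, rfl⟩))
        rw [inner_smul_left] at e1 e2
        replace e1 := (mul_eq_zero.1 e1).resolve_left (by simp)
        replace e2 := (mul_eq_zero.1 e2).resolve_left (by simp)
        rw [inner_add_left, inner_smul_left] at e1 e2
        push_cast at e1 e2
        simp only [map_one, map_neg, one_mul, neg_mul] at e1 e2
        constructor <;> linarith
      rcases lt_or_gt_of_ne hj with h3 | h3
      · exact (h2 j i h3 hj1 h).2
      · exact (h2 i j h3 h hj1).1

/-- `X ∩ Y` is spanned by the vectors of the remaining blocks. -/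
theorem fixedSpace_inf_fixedSpace : fixedSpace (stdP n lam) ⊓ fixedSpace (stdQ n lam) =
    Submodule.span ℝ (fvec n lam '' {i | lam i ∈ sizesA lam}) := by
  have hQ : ∀ v, v ∈ fixedSpace (stdQ n lam) ↔
      ∀ i, lam i ∉ sizesA lam → inner ℝ (fvec n lam i) v = 0 := by
    intro v
    rw [← Submodule.orthogonal_orthogonal (fixedSpace (stdQ n lam)), orthogonal_fixedSpace_stdQ,
      Submodule.mem_orthogonal]
    constructor
    · exact fun h i hi => h _ (Submodule.subset_span ⟨i, hi, rfl⟩)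
    · intro h u hu
      induction hu using Submodule.span_induction with
      | mem x hx =>
        obtain ⟨i, hi, rfl⟩ := hx
        exact h i hi
      | zero => exact inner_zero_left _
      | add x y _ _ hx hy => rw [inner_add_left, hx, hy, add_zero]
      | smul c x _ hx => rw [inner_smul_left, hx, mul_zero]
  apply le_antisymm
  · rintro v ⟨h1, h2⟩
    have h3 := eq_sum_fvec n lam h1
    rw [h3]
    refine Submodule.sum_mem _ fun i _ => ?_
    by_cases hi : lam i ∈ sizesA lam
    · exact Submodule.smul_mem _ _ (Submodule.subset_span ⟨i, hi, rfl⟩)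
    · have h4 := (hQ v).1 h2 i hi
      rw [h3, inner_sum, Finset.sum_eq_single i, inner_smul_right, inner_fvec, if_pos rfl,
        mul_eq_zero] at h4
      · have h5 : (lam i : ℝ) ≠ 0 := by
          have := hL.pos i
          positivity
        rw [h4.resolve_right h5, zero_smul]
        exact Submodule.zero_mem _
      · intro j _ hj
        rw [inner_smul_right, inner_fvec, if_neg hj.symm, mul_zero]
      · simp
  · rw [Submodule.span_le]
    rintro _ ⟨i, hi, rfl⟩
    refine ⟨fvec_mem_fixedSpace n lam i, (hQ _).2 fun j hj => ?_⟩
    rw [inner_fvec, if_neg]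
    rintro rfl
    exact hj hi

end Groups

section Decomposition

variable (n : ℕ) {p : ℕ} (lam : Fin p → ℕ) [hL : IsLabel n lam] [hA : Fact (Antitone lam)]

/-! ### The groups `D`, `A` and `B` as groups of block permutations -/

/-- The block `i` is the first of several blocks of size one. -/
def IsMarked (i : Fin p) : Prop := 1 < mult lam 1 ∧ lam i = 1 ∧ i.val = numLarger lam 1

variable {lam} in
theorem IsMarked.eq {i j : Fin p} (hi : IsMarked lam i) (hj : IsMarked lam j) : i = j :=
  Fin.ext (hi.2.2.trans hj.2.2.symm)

theorem isMarked_idx (h : 1 < mult lam 1) : IsMarked lam (idx lam 1 ⟨0, by omega⟩) :=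
  ⟨h, lam_idx lam _ _, rfl⟩

variable {lam} in
theorem IsMarked.le {i j : Fin p} (hi : IsMarked lam i) (hj : lam j = 1) : i ≤ j := by
  have := ((eq_iff_numLarger lam _ _).1 hj).1
  rw [Fin.le_def, hi.2.2]
  exact this

/-- The signed block permutations that give rise to the Howlett complement of `PQ`. -/
def subD : Subgroup (lamGroup lam) where
  carrier := {g | ∀ i, lam i ∉ sizesA lam →
    (lam i ≠ 2 → g.1.perm i = i) ∧ (¬ IsMarked lam i → g.1.sgn i = 1)}
  mul_mem' {a b} ha hb i hi := by
    obtain ⟨b1, b2⟩ := hb i hi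
    refine ⟨fun h => ?_, fun h => ?_⟩
    · change a.1.perm (b.1.perm i) = i
      rw [b1 h, (ha i hi).1 h]
    · change a.1.sgn (b.1.perm i) * b.1.sgn i = 1
      rw [b2 h, mul_one]
      by_cases h2 : lam i = 2
      · have h3 : lam (b.1.perm i) = 2 := (b.2 i).trans h2
        refine (ha _ (by rwa [b.2 i])).2 fun hm => ?_
        rw [hm.2.1] at h3
        omega
      · rw [b1 h2]
        exact (ha i hi).2 h
  one_mem' _ _ := ⟨fun _ => rfl, fun _ => rfl⟩
  inv_mem' {a} ha i hi := by
    have h3 : lam (a.1.perm⁻¹ i) = lam i := (a⁻¹).2 i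
    refine ⟨fun h => ?_, fun h => ?_⟩
    · change a.1.perm⁻¹ i = i
      rw [Equiv.Perm.inv_eq_iff_eq]
      exact ((ha i hi).1 h).symm
    · change a.1.sgn (a.1.perm⁻¹ i) = 1
      by_cases h2 : lam i = 2
      · refine (ha _ (by rwa [h3])).2 fun hm => ?_
        rw [hm.2.1] at h3
        omega
      · have : a.1.perm⁻¹ i = i := by
          rw [Equiv.Perm.inv_eq_iff_eq]
          exact ((ha i hi).1 h2).symm
        rw [this]
        exact (ha i hi).2 h

variable {lam}

theorem blockIsom_smul_fvec (g : lamGroup lam) (c : ℝ) (i : Fin p) :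
    blockIsom n g (c • fvec n lam i) =
      c • ((g.1.sgn i : ℤ) : ℝ) • fvec n lam (g.1.perm i) := by
  rw [map_smul, blockIsom_fvec]

/-- The elements of `subD` preserve the positive roots of `Q`; these contain `f_j ± f_i` for `i <
j` in the blocks of size one, so a sign change at the first of these blocks is permitted. -/
theorem blockIsom_mem_posRoots_stdQ {g : lamGroup lam} (hg : g ∈ subD lam) {α : Euc n}
    (hα : α ∈ posRoots (stdQ n lam) (stdRho n)) :
    blockIsom n g α ∈ posRoots (stdQ n lam) (stdRho n) := by
  rw [mem_posRoots_stdQ] at hα ⊢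
  rcases hα with ⟨i, j, s, hij, hi, hj, rfl⟩ | ⟨i, hi, rfl⟩
  · have h1 := one_lt_mult hij.ne hi hj
    have hi' := hg i (notMem_sizesA.2 (Or.inr ⟨hi, h1⟩))
    have hj' := hg j (notMem_sizesA.2 (Or.inr ⟨hj, h1⟩))
    have hm : ¬ IsMarked lam j := fun hm => absurd (hm.le hi) (not_le.2 hij)
    refine Or.inl ⟨i, j, s * g.1.sgn i, hij, hi, hj, ?_⟩
    rw [map_smul, map_add, map_smul, blockIsom_fvec, blockIsom_fvec, hi'.1 (by omega),
      hj'.1 (by omega), hj'.2 hm, smul_smul]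
    simp
  · have hi' := hg i (notMem_sizesA.2 (Or.inl hi))
    have hm : ¬ IsMarked lam i := fun hm => by
      have := hm.2.1
      omega
    refine Or.inr ⟨g.1.perm i, (g.2 i).trans hi, ?_⟩
    rw [blockIsom_smul_fvec, hi'.2 hm]
    simp

/-- Conversely, block permutations that preserve the positive roots of `Q` belong to `subD`. -/
theorem mem_subD_of_posRoots {g : lamGroup lam}
    (h : ∀ α ∈ posRoots (stdQ n lam) (stdRho n), 0 < inner ℝ (blockIsom n g α) (stdRho n)) :
    g ∈ subD lam := by
  have h0 : 0 < (√2 : ℝ)⁻¹ := by positivity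
  -- the root `f_i` of a block of size two keeps its sign
  have htwo : ∀ i, lam i = 2 → g.1.sgn i = 1 := by
    intro i hi
    have h1 := h _ ((mem_posRoots_stdQ n lam).2 (Or.inr ⟨i, hi, rfl⟩))
    rw [blockIsom_smul_fvec, inner_smul_left, inner_smul_left] at h1
    have h2 := inner_fvec_stdRho_pos n lam (g.1.perm i)
    rcases Int.units_eq_one_or (g.1.sgn i) with e | e
    · exact e
    · rw [e] at h1
      push_cast at h1
      simp only [map_neg, map_one] at h1
      change 0 < (√2 : ℝ)⁻¹ * (-1 * _) at h1
      nlinarith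
  -- in a pair of blocks of size one, the later one keeps its sign and stays the later one
  have hone : ∀ i j, i < j → lam i = 1 → lam j = 1 →
      g.1.sgn j = 1 ∧ g.1.perm i < g.1.perm j := by
    intro i j hij hi hj
    have h1 := h _ ((mem_posRoots_stdQ n lam).2 (Or.inl ⟨i, j, 1, hij, hi, hj, rfl⟩))
    have h2 := h _ ((mem_posRoots_stdQ n lam).2 (Or.inl ⟨i, j, -1, hij, hi, hj, rfl⟩))
    have hi' : lam (g.1.perm i) = 1 := (g.2 i).trans hi
    have hj' : lam (g.1.perm j) = 1 := (g.2 j).trans hj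
    rw [map_smul, map_add, map_smul, blockIsom_fvec, blockIsom_fvec, inner_smul_left,
      inner_add_left, inner_smul_left, inner_smul_left, inner_smul_left,
      inner_fvec_stdRho_of_one n lam hi', inner_fvec_stdRho_of_one n lam hj'] at h1 h2
    replace h1 := pos_of_mul_pos_right h1 h0.le
    replace h2 := pos_of_mul_pos_right h2 h0.le
    have hoi : (0 : ℝ) ≤ offset n lam (g.1.perm i) := by positivity
    have hoj : (0 : ℝ) ≤ offset n lam (g.1.perm j) := by positivity
    push_cast at h1 h2
    simp only [map_one, map_neg, conj_trivial] at h1 h2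
    have hsj : g.1.sgn j = 1 := by
      rcases Int.units_eq_one_or (g.1.sgn j) with e | e
      · exact e
      · rw [e] at h1 h2
        rcases Int.units_eq_one_or (g.1.sgn i) with e' | e' <;> rw [e'] at h1 h2 <;>
          push_cast at h1 h2 <;> linarith
    refine ⟨hsj, ?_⟩
    have hlt : (offset n lam (g.1.perm i) : ℝ) < offset n lam (g.1.perm j) := by
      rw [hsj] at h1 h2
      rcases Int.units_eq_one_or (g.1.sgn i) with e' | e' <;> rw [e'] at h1 h2 <;>
        push_cast at h1 h2 <;> linarith
    by_contra! hle
    rcases hle.lt_or_eq with h3 | h3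
    · have := offset_add_le n lam h3
      have h4 : offset n lam (g.1.perm i) < offset n lam (g.1.perm j) := by exact_mod_cast hlt
      omega
    · rw [h3] at hlt
      exact lt_irrefl _ hlt
  -- hence the blocks of size one keep their places
  have hperm : ∀ r, (resHom lam 1 g).perm r = r := by
    intro r
    have hmono : StrictMono fun r => ((resHom lam 1 g).perm r).val := by
      intro r s hrs
      have h3 := (hone (idx lam 1 r) (idx lam 1 s) (by
        rw [Fin.lt_def, idx_val, idx_val]
        exact Nat.add_lt_add_left hrs _) (lam_idx lam _ _) (lam_idx lam _ _)).2
      rw [← resHom_perm, ← resHom_perm, Fin.lt_def, idx_val, idx_val] at h3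
      exact Nat.lt_of_add_lt_add_left h3
    exact Fin.ext (eq_of_strictMono_fin hmono (fun t => Fin.isLt _) r)
  intro i hi
  rcases notMem_sizesA.1 hi with h2 | ⟨h1, hm1⟩
  · exact ⟨fun h => absurd h2 h, fun _ => htwo i h2⟩
  · obtain ⟨r, rfl⟩ := exists_idx lam h1
    refine ⟨fun _ => by rw [← resHom_perm, hperm], fun hm => ?_⟩
    have hr : 0 < r.val := by
      by_contra hr
      have : r = ⟨0, by omega⟩ := Fin.ext (by simp only; omega)
      exact hm (this ▸ isMarked_idx lam hm1)
    refine (hone (idx lam 1 ⟨0, by omega⟩) _ ?_ (lam_idx lam _ _) h1).1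
    rw [Fin.lt_def, idx_val, idx_val]
    exact Nat.add_lt_add_left hr _

variable (lam)

theorem mem_posRoots_sup {α : Euc n} :
    α ∈ posRoots (stdP n lam ⊔ stdQ n lam) (stdRho n) ↔
      α ∈ posRoots (stdP n lam) (stdRho n) ∨ α ∈ posRoots (stdQ n lam) (stdRho n) := by
  by_cases h0 : α = 0
  · simp [h0, posRoots]
  · simp only [posRoots, roots, Set.mem_ofPred_eq,
      refl_mem_sup_iff (orthogonal_fixedSpace_stdP_le n lam) h0]
    tauto

/-- `D` consists of the block permutations that preserve the positive roots of `Q`. -/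
theorem groupD_stdP :
    groupD (WD n) (stdP n lam) (stdRho n) = (subD lam).map (blockIsom n) := by
  apply le_antisymm
  · intro d hd
    have h1 := howlettComplement_sup_le _ _ _ _ hd
    rw [howlettComplement_stdP] at h1
    obtain ⟨g, rfl⟩ := h1
    refine ⟨g, mem_subD_of_posRoots n fun α hα => ?_, rfl⟩
    exact ((hd.2 α).2 ((mem_posRoots_sup n lam).2 (Or.inr hα))).2
  · rintro _ ⟨g, hg, rfl⟩
    have key : ∀ g ∈ subD lam, ∀ α ∈ posRoots (stdP n lam ⊔ stdQ n lam) (stdRho n),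
        blockIsom n g α ∈ posRoots (stdP n lam ⊔ stdQ n lam) (stdRho n) := by
      intro g hg α hα
      rw [mem_posRoots_sup] at hα ⊢
      exact hα.imp (((blockIsom_mem_howlett n g).2 α).2) (blockIsom_mem_posRoots_stdQ n hg)
    refine ⟨blockIsom_mem_normalizerIn n g, fun α => ⟨fun h => ?_, key g hg α⟩⟩
    have := key g⁻¹ (Subgroup.inv_mem _ hg) _ h
    rwa [map_inv, LinearIsometryEquiv.inv_def, LinearIsometryEquiv.symm_apply_apply] at this

/-- `A` consists of the signed permutations of the blocks that do not occur in the roots of `Q`. -/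
theorem groupA_stdP : groupA (WD n) (stdP n lam) (stdRho n) =
    (lamSub lam (sizesA lam)).map (blockIsom n) := by
  ext a
  unfold groupA
  rw [mem_pointStab, groupD_stdP]
  change _ ∧ (∀ v ∈ (fixedSpace (stdQ n lam))ᗮ, a v = v) ↔ _
  rw [orthogonal_fixedSpace_stdQ, fix_span_iff, Set.forall_mem_image]
  constructor
  · rintro ⟨⟨g, hg, rfl⟩, h⟩
    exact ⟨g, fun i hi => (blockIsom_fvec_eq_iff n g i).1 (h hi), rfl⟩
  · rintro ⟨g, hg, rfl⟩
    refine ⟨⟨g, fun i hi => ⟨fun _ => (hg i hi).1, fun _ => (hg i hi).2⟩, rfl⟩, fun i hi => ?_⟩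
    exact (blockIsom_fvec_eq_iff n g i).2 (hg i hi)

/-- The signed block permutations that give rise to `B`: permutations of the blocks of size two,
and a sign change at the first of several blocks of size one. -/
def subB : Subgroup (lamGroup lam) := subD lam ⊓ lamSub lam (sizesA lam)ᶜ

variable {lam} in
theorem mem_subB {g : lamGroup lam} : g ∈ subB lam ↔
    ∀ i, (lam i ≠ 2 → g.1.perm i = i) ∧ (¬ IsMarked lam i → g.1.sgn i = 1) := by
  constructor
  · rintro ⟨h1, h2⟩ i
    by_cases hi : lam i ∈ sizesA lam
    · have := h2 i (by simpa using hi)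
      exact ⟨fun _ => this.1, fun _ => this.2⟩
    · exact h1 i hi
  · intro h
    refine ⟨fun i _ => h i, fun i hi => ?_⟩
    have hi' : lam i ∈ sizesA lam := by simpa using hi
    refine ⟨(h i).1 hi'.1, (h i).2 fun hm => ?_⟩
    have := hi'.2 hm.2.1
    have := hm.1
    omega

/-- `B` consists of the permutations of the blocks of size two and of a sign change at the first
of several blocks of size one. -/
theorem groupB_stdP : groupB (WD n) (stdP n lam) (stdRho n) =
    (subB lam).map (blockIsom n) := by
  ext b
  unfold groupB
  rw [mem_pointStab, groupD_stdP]
  change _ ∧ (∀ v ∈ fixedSpace (stdP n lam) ⊓ fixedSpace (stdQ n lam), b v = v) ↔ _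
  rw [fixedSpace_inf_fixedSpace, fix_span_iff, Set.forall_mem_image]
  constructor
  · rintro ⟨⟨g, hg, rfl⟩, h⟩
    exact ⟨g, ⟨hg, fun i hi => (blockIsom_fvec_eq_iff n g i).1 (h (by simpa using hi))⟩, rfl⟩
  · rintro ⟨g, hg, rfl⟩
    refine ⟨⟨g, hg.1, rfl⟩, fun i hi => ?_⟩
    exact (blockIsom_fvec_eq_iff n g i).2 (hg.2 i (by simpa using hi))

/-! ### The orthogonal complement as a group of block permutations -/

/-- The action of signed permutations on the index set. -/
def permHom (ι : Type*) : SgnPerm ι →* Equiv.Perm ι where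
  toFun := SgnPerm.perm
  map_one' := rfl
  map_mul' _ _ := rfl

/-- A group of signed block permutations that contains the orthogonal complement. -/
def subQ : Subgroup (lamGroup lam) :=
  lamSub lam (sizesA lam)ᶜ ⊓ (blockParity.ker ⊓ ((permHom _).comp (resHom lam 2)).ker)

variable {lam} in
theorem swB_mem_lamSub {S : Set ℕ} {i j : Fin p} (h : lam i = lam j) (hi : lam i ∈ S) :
    (swB i j h : lamGroup lam) ∈ lamSub lam S := fun k hk => by
  refine ⟨?_, rfl⟩
  change Equiv.swap i j k = k
  rw [Equiv.swap_apply_of_ne_of_ne]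
  · rintro rfl; exact hk hi
  · rintro rfl; exact hk (h ▸ hi)

variable {lam} in
theorem flB_mem_lamSub {S : Set ℕ} {i : Fin p} (hi : lam i ∈ S) :
    (flB i : lamGroup lam) ∈ lamSub lam S := fun k hk => by
  refine ⟨rfl, ?_⟩
  change (Pi.mulSingle i (-1) : Fin p → ℤˣ) k = 1
  rw [Pi.mulSingle_eq_of_ne]
  rintro rfl; exact hk hi

theorem stdQ_le_map : stdQ n lam ≤ (subQ lam).map (blockIsom n) := by
  have hker : ∀ g : lamGroup lam, (∀ i, lam i = 2 → g.1.perm i = i) →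
      g ∈ ((permHom _).comp (resHom lam 2)).ker := by
    intro g hg
    rw [MonoidHom.mem_ker]
    ext1 r
    apply idx_injective lam 2
    exact (resHom_perm lam g 2 r).trans (hg _ (lam_idx lam 2 r))
  refine stdQ_le n lam (fun i j h hi => ?_) (fun i j hij hi hj => ?_) fun i hi => ?_
  · rcases eq_or_ne i j with rfl | hij
    · have : (swB i i h : lamGroup lam) = 1 := by
        apply Subtype.ext
        change ofPerm (Equiv.swap i i) = 1
        rw [Equiv.swap_self]
        rfl
      rw [this, map_one]
      exact Subgroup.one_mem _
    · have h1 := one_lt_mult hij hi (h ▸ hi)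
      refine ⟨_, ⟨swB_mem_lamSub h (notMem_sizesA.2 (Or.inr ⟨hi, h1⟩)), blockParity_swB lam i j h,
        hker _ fun k hk => ?_⟩, rfl⟩
      change Equiv.swap i j k = k
      rw [Equiv.swap_apply_of_ne_of_ne] <;>
      · rintro rfl
        omega
  · have h1 := one_lt_mult hij hi hj
    refine ⟨_, ⟨Subgroup.mul_mem _ (flB_mem_lamSub (notMem_sizesA.2 (Or.inr ⟨hi, h1⟩)))
      (flB_mem_lamSub (notMem_sizesA.2 (Or.inr ⟨hj, h1⟩))), ?_, hker _ fun _ _ => rfl⟩, rfl⟩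
    change blockParity (flB i * flB j) = 1
    rw [map_mul, blockParity_flB, blockParity_flB, hi, hj]
    decide
  · refine ⟨_, ⟨flB_mem_lamSub (notMem_sizesA.2 (Or.inl hi)), ?_, hker _ fun _ _ => rfl⟩, rfl⟩
    change blockParity (flB i) = 1
    rw [blockParity_flB, hi]
    decide

/-- A block permutation in `subB` that does not move the blocks of size two is a sign change at
the first block of size one, or trivial; in the former case its parity is odd. -/
theorem subQ_inf_subB : subQ lam ⊓ subB lam = ⊥ := by
  rw [eq_bot_iff]
  rintro g ⟨⟨-, h1, h2⟩, h3⟩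
  replace h3 := mem_subB.1 h3
  have hperm : ∀ i, g.1.perm i = i := by
    intro i
    by_cases hi : lam i = 2
    · obtain ⟨r, rfl⟩ := exists_idx lam hi
      rw [← resHom_perm]
      exact congrArg _ (Equiv.congr_fun h2 r)
    · exact (h3 i).1 hi
  have hsgn : ∀ i, g.1.sgn i = 1 := by
    intro i
    by_cases hi : IsMarked lam i
    · have h4 : ∏ j, g.1.sgn j ^ lam j = 1 := h1
      rw [Finset.prod_eq_single i, hi.2.1, pow_one] at h4
      · exact h4
      · intro j _ hj
        rw [(h3 j).2 fun hm => hj (hm.eq hi), one_pow]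
      · simp
    · exact (h3 i).2 hi
  refine Subtype.ext ?_
  ext1
  · exact Equiv.ext hperm
  · exact funext hsgn

theorem lamSub_inf_compl (S : Set ℕ) : lamSub lam S ⊓ lamSub lam Sᶜ = ⊥ := by
  rw [eq_bot_iff]
  rintro g ⟨h1, h2⟩
  have key : ∀ i, g.1.perm i = i ∧ g.1.sgn i = 1 := by
    intro i
    by_cases hi : lam i ∈ S
    · exact h2 i (by simpa using hi)
    · exact h1 i hi
  refine Subtype.ext ?_
  ext1
  · exact Equiv.ext fun i => (key i).1
  · exact funext fun i => (key i).2

variable {lam} in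
theorem commute_of_mem_lamSub {S : Set ℕ} {a b : lamGroup lam} (ha : a ∈ lamSub lam S)
    (hb : b ∈ lamSub lam Sᶜ) : a * b = b * a := by
  have key : ∀ i, a.1.perm (b.1.perm i) = b.1.perm (a.1.perm i) ∧
      a.1.sgn (b.1.perm i) * b.1.sgn i = b.1.sgn (a.1.perm i) * a.1.sgn i := by
    intro i
    by_cases hi : lam i ∈ S
    · have h1 := hb i (by simpa using hi)
      have h2 := hb (a.1.perm i) (by rw [a.2 i]; simpa using hi)
      rw [h1.1, h1.2, h2.1, h2.2, mul_one, one_mul]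
      exact ⟨rfl, rfl⟩
    · have h1 := ha i hi
      have h2 := ha (b.1.perm i) (by rwa [b.2 i])
      rw [h1.1, h1.2, h2.1, h2.2, mul_one, one_mul]
      exact ⟨rfl, rfl⟩
  refine Subtype.ext ?_
  ext1
  · exact Equiv.ext fun i => (key i).1
  · exact funext fun i => (key i).2

theorem lamSub_sup_compl (S : Set ℕ) : lamSub lam S ⊔ lamSub lam Sᶜ = ⊤ := by
  rw [eq_top_iff, ← lamSub_eq_top lam (S := Set.univ) fun _ => Set.mem_univ _]
  refine lamSub_le lam (fun i j _ h _ => ?_) fun k _ h => ?_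
  · by_cases hi : lam i ∈ S
    · exact Subgroup.mem_sup_left (swB_mem_lamSub h hi)
    · exact Subgroup.mem_sup_right (swB_mem_lamSub h hi)
  · by_cases hi : k ∈ S
    · exact Subgroup.mem_sup_left (flB_mem_lamSub (by rwa [lam_idx lam]))
    · exact Subgroup.mem_sup_right (flB_mem_lamSub (by rwa [lam_idx lam]))

theorem flB_idx_mem_subB (h : 1 < mult lam 1) :
    (flB (idx lam 1 ⟨0, by omega⟩) : lamGroup lam) ∈ subB lam := by
  rw [mem_subB]
  refine fun i => ⟨fun _ => rfl, fun hm => ?_⟩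
  change (Pi.mulSingle _ (-1) : Fin p → ℤˣ) i = 1
  rw [Pi.mulSingle_eq_of_ne]
  rintro rfl
  exact hm (isMarked_idx lam h)

theorem swB_mem_subB {i j : Fin p} (h : lam i = lam j) (hi : lam i = 2) :
    (swB i j h : lamGroup lam) ∈ subB lam := by
  rw [mem_subB]
  refine fun k => ⟨fun hk => ?_, fun _ => rfl⟩
  change Equiv.swap i j k = k
  rw [Equiv.swap_apply_of_ne_of_ne]
  · rintro rfl; exact hk hi
  · rintro rfl; exact hk (h ▸ hi)

/-- `QB` consists of all signed permutations of the blocks that occur in the roots of `Q`. -/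
theorem stdQ_sup_map_subB : stdQ n lam ⊔ (subB lam).map (blockIsom n) =
    (lamSub lam (sizesA lam)ᶜ).map (blockIsom n) := by
  apply le_antisymm
  · exact sup_le ((stdQ_le_map n lam).trans (Subgroup.map_mono inf_le_left))
      (Subgroup.map_mono inf_le_right)
  · rw [Subgroup.map_le_iff_le_comap]
    refine lamSub_le lam (fun i j hij h hi => ?_) fun k hk h => ?_
    · have hne : i ≠ j := by
        rintro rfl
        omega
      rcases notMem_sizesA.1 hi with h2 | ⟨h1, -⟩
      · exact Subgroup.mem_sup_right ⟨_, swB_mem_subB lam h h2, rfl⟩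
      · exact Subgroup.mem_sup_left (swB_mem_stdQ n lam hne h h1)
    · have hk' : lam (idx lam k ⟨0, h⟩) ∉ sizesA lam := by rwa [lam_idx lam]
      rcases notMem_sizesA.1 hk' with h2 | ⟨h1, hm⟩
      · exact Subgroup.mem_sup_left (flB_mem_stdQ n lam h2)
      · rw [lam_idx lam] at h1
        subst h1
        exact Subgroup.mem_sup_right ⟨_, flB_idx_mem_subB lam hm, rfl⟩

end Decomposition

section Decomposition

variable (n : ℕ) {p : ℕ} (lam : Fin p → ℕ) [hL : IsLabel n lam] [hA : Fact (Antitone lam)]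

/-! ### The decomposition of the normalizer -/

theorem stdP_inf_map (K : Subgroup (lamGroup lam)) : stdP n lam ⊓ K.map (blockIsom n) = ⊥ := by
  rw [eq_bot_iff]
  rintro _ ⟨h, ⟨g, -, rfl⟩⟩
  exact eq_one_of_blockIsom_mem_stdP n h

theorem isSemidirect_stdP_map (K : Subgroup (lamGroup lam)) :
    IsSemidirect (stdP n lam ⊔ K.map (blockIsom n)) (stdP n lam) (K.map (blockIsom n)) := by
  refine ⟨?_, stdP_inf_map n lam K, rfl⟩
  rintro _ ⟨g, -, rfl⟩ k hk
  exact howlettComplement_normalizes (blockIsom_mem_normalizerIn n g) hk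

theorem stdQ_inf_map_subB : stdQ n lam ⊓ (subB lam).map (blockIsom n) = ⊥ := by
  rw [eq_bot_iff, ← Subgroup.map_bot (blockIsom n : lamGroup lam →* _), ← subQ_inf_subB lam,
    Subgroup.map_inf _ _ _ (blockIsom_injective n)]
  exact inf_le_inf_right _ (stdQ_le_map n lam)

theorem isSemidirect_stdQ_map_subB :
    IsSemidirect (stdQ n lam ⊔ (subB lam).map (blockIsom n)) (stdQ n lam)
      ((subB lam).map (blockIsom n)) := by
  refine ⟨?_, stdQ_inf_map_subB n lam, rfl⟩
  rintro _ ⟨g, -, rfl⟩ k hk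
  exact normalizerIn_orthComplement (blockIsom_mem_normalizerIn n g) hk

variable {n lam} in
theorem commute_map_lamSub {S : Set ℕ} {a b : Euc n ≃ₗᵢ[ℝ] Euc n}
    (ha : a ∈ (lamSub lam S).map (blockIsom n)) (hb : b ∈ (lamSub lam Sᶜ).map (blockIsom n)) :
    a * b = b * a := by
  obtain ⟨g, hg, rfl⟩ := ha
  obtain ⟨h, hh, rfl⟩ := hb
  rw [← map_mul, ← map_mul, commute_of_mem_lamSub hg hh]

theorem map_lamSub_inf_compl (S : Set ℕ) :
    (lamSub lam S).map (blockIsom n) ⊓ (lamSub lam Sᶜ).map (blockIsom n) = ⊥ := by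
  rw [← Subgroup.map_inf _ _ _ (blockIsom_injective n), lamSub_inf_compl, Subgroup.map_bot]

theorem stdQ_le_map_lamSub : stdQ n lam ≤ (lamSub lam (sizesA lam)ᶜ).map (blockIsom n) :=
  (stdQ_le_map n lam).trans (Subgroup.map_mono inf_le_left)

theorem isDirect_stdQ :
    IsDirect (stdP n lam ⊔ (lamSub lam (sizesA lam)).map (blockIsom n) ⊔ stdQ n lam)
      (stdP n lam ⊔ (lamSub lam (sizesA lam)).map (blockIsom n)) (stdQ n lam) := by
  refine ⟨fun q hq k hk => ?_, ?_, rfl⟩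
  · obtain ⟨a, ha, b, hb, rfl⟩ := mem_sup_of_normalizes (isSemidirect_stdP_map n lam _).1 hk
    rw [← mul_assoc, ← commute_of_orthogonal_fixedSpace_le (orthogonal_fixedSpace_stdP_le n lam)
      ha hq, mul_assoc, mul_assoc, commute_map_lamSub hb (stdQ_le_map_lamSub n lam hq)]
  · rw [eq_bot_iff]
    rintro q ⟨hk, hq⟩
    obtain ⟨a, ha, b, hb, rfl⟩ := mem_sup_of_normalizes (isSemidirect_stdP_map n lam _).1 hk
    have hq' := stdQ_le_map_lamSub n lam hq
    have h1 : a ∈ stdP n lam ⊓ (⊤ : Subgroup (lamGroup lam)).map (blockIsom n) := by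
      refine ⟨ha, ?_⟩
      have := Subgroup.mul_mem _ (Subgroup.map_mono le_top hq')
        (Subgroup.inv_mem _ (Subgroup.map_mono le_top hb))
      rwa [mul_inv_cancel_right] at this
    rw [stdP_inf_map, Subgroup.mem_bot] at h1
    rw [h1, one_mul] at hq' ⊢
    rw [← map_lamSub_inf_compl n lam (sizesA lam)]
    exact ⟨hb, hq'⟩

/-- The normalizer is `((P ⋊ A) × Q) ⋊ B`: its Howlett complement is `A × QB`. -/
theorem isSemidirect_normalizerIn :
    IsSemidirect (normalizerIn (WD n) (stdP n lam))
      (stdP n lam ⊔ (lamSub lam (sizesA lam)).map (blockIsom n) ⊔ stdQ n lam)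
      ((subB lam).map (blockIsom n)) := by
  have hBC : (subB lam).map (blockIsom n) ≤ (lamSub lam (sizesA lam)ᶜ).map (blockIsom n) :=
    Subgroup.map_mono inf_le_right
  refine ⟨fun b hb k hk => ?_, ?_, ?_⟩
  · have hbN : b ∈ normalizerIn (WD n) (stdP n lam) := by
      obtain ⟨g, -, rfl⟩ := hb
      exact blockIsom_mem_normalizerIn n g
    have key : stdP n lam ⊔ (lamSub lam (sizesA lam)).map (blockIsom n) ⊔ stdQ n lam ≤
        (stdP n lam ⊔ (lamSub lam (sizesA lam)).map (blockIsom n) ⊔ stdQ n lam).comap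
          (MulAut.conj b).toMonoidHom := by
      refine sup_le (sup_le (fun a ha => ?_) fun a ha => ?_) fun a ha => ?_
      · exact Subgroup.mem_sup_left (Subgroup.mem_sup_left (howlettComplement_normalizes hbN ha))
      · refine Subgroup.mem_sup_left (Subgroup.mem_sup_right ?_)
        change b * a * b⁻¹ ∈ _
        rwa [← commute_map_lamSub ha (hBC hb), mul_inv_cancel_right]
      · exact Subgroup.mem_sup_right (normalizerIn_orthComplement hbN ha)
    exact key hk
  · rw [eq_bot_iff]
    rintro b ⟨hk, hb⟩
    obtain ⟨c, hc, q, hq, rfl⟩ := mem_sup_of_commute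
      (fun k hk h hh => ((isDirect_stdQ n lam).1 h hh k hk).symm) hk
    have hb' := Subgroup.mul_mem _ (hBC hb) (Subgroup.inv_mem _ (stdQ_le_map_lamSub n lam hq))
    rw [mul_inv_cancel_right] at hb'
    obtain ⟨x, hx, a, ha, rfl⟩ := mem_sup_of_normalizes (isSemidirect_stdP_map n lam _).1 hc
    have h1 : x ∈ stdP n lam ⊓ (⊤ : Subgroup (lamGroup lam)).map (blockIsom n) := by
      refine ⟨hx, ?_⟩
      have := Subgroup.mul_mem _ (Subgroup.map_mono le_top hb')
        (Subgroup.inv_mem _ (Subgroup.map_mono le_top ha))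
      rwa [mul_inv_cancel_right] at this
    rw [stdP_inf_map, Subgroup.mem_bot] at h1
    rw [h1, one_mul] at hb' hb ⊢
    have h2 : a ∈ (⊥ : Subgroup (Euc n ≃ₗᵢ[ℝ] Euc n)) := by
      rw [← map_lamSub_inf_compl n lam (sizesA lam)]
      exact ⟨ha, hb'⟩
    rw [Subgroup.mem_bot] at h2
    rw [h2, one_mul] at hb ⊢
    rw [← stdQ_inf_map_subB n lam]
    exact ⟨hq, hb⟩
  · rw [sup_assoc, stdQ_sup_map_subB, sup_assoc, ← Subgroup.map_sup, lamSub_sup_compl,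
      ← (isSemidirect_stdP n lam).2.2, howlettComplement_stdP, MonoidHom.range_eq_map]

/-! ### Generators -/

/-- Transpositions and one twofold sign change generate all twofold sign changes. -/
theorem fl_mul_fl_mem {ι : Type*} [DecidableEq ι] {H : Subgroup (SgnPerm ι)} {C : Set ι} {a b : ι}
    (hab : a ≠ b) (hb : b ∈ C)
    (hsw : ∀ x y, x ∈ C → y ∈ C → ofPerm (Equiv.swap x y) ∈ H) (hfl : fl a * fl b ∈ H)
    {x y : ι} (hx : x ∈ C) (hy : y ∈ C) : fl x * fl y ∈ H := by
  have hsq : ∀ i : ι, (fl i * fl i : SgnPerm ι) = 1 := by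
    intro i
    unfold fl
    rw [← map_mul, ← Pi.mulSingle_mul]
    have : (-1 : ℤˣ) * -1 = 1 := by decide
    rw [this, Pi.mulSingle_one, map_one]
  have h1 : ∀ x ∈ C, fl a * fl x ∈ H := by
    intro x hx
    rcases eq_or_ne a x with rfl | hax
    · rw [hsq]
      exact H.one_mem
    · -- conjugate by the transposition of `b` and `x`
      have h4 := hsw b x hb hx
      have h5 := H.mul_mem (H.mul_mem h4 hfl) (H.inv_mem h4)
      have e1 := conj_fl (ofPerm (Equiv.swap b x)) a
      have e2 := conj_fl (ofPerm (Equiv.swap b x)) b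
      rw [ofPerm_perm, Equiv.swap_apply_of_ne_of_ne hab hax] at e1
      rw [ofPerm_perm, Equiv.swap_apply_left] at e2
      convert h5 using 1
      refine (congrArg₂ (· * ·) e1.symm e2.symm).trans ?_
      simp only [mul_assoc, inv_mul_cancel_left]
  have h4 := H.mul_mem (H.inv_mem (h1 x hx)) (h1 y hy)
  convert h4 using 1
  rw [mul_inv_rev, inv_eq_of_mul_eq_one_left (hsq _), inv_eq_of_mul_eq_one_left (hsq _), mul_assoc,
    ← mul_assoc (fl a), hsq, one_mul]

variable {lam} in
theorem swB_mem_of_adjacent {k : ℕ} {K : Subgroup (lamGroup lam)}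
    (hx : ∀ i j : Fin p, j.val = i.val + 1 → ∀ h : lam i = lam j, lam i = k → swB i j h ∈ K)
    {i j : Fin p} (h : lam i = lam j) (hi : lam i = k) : swB i j h ∈ K := by
  obtain ⟨g, hg, e⟩ := swap_mem_of_adjacent lam (S := {k}) (H := K.map (lamGroup lam).subtype)
    (fun a b hab h' ha => ⟨_, hx a b hab h' ha, rfl⟩) h hi
  have : g = swB i j h := Subtype.ext e
  exact this ▸ hg

/-- A version of `stdQ_le` that needs the interchanges of neighbouring blocks and the sign changes
at the first two blocks of size one only. -/
theorem stdQ_le_of_adjacent {K : Subgroup (Euc n ≃ₗᵢ[ℝ] Euc n)}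
    (hx : ∀ i j : Fin p, j.val = i.val + 1 → ∀ h : lam i = lam j, lam i = 1 →
      blockIsom n (swB i j h : lamGroup lam) ∈ K)
    (h2 : ∀ h : 1 < mult lam 1,
      blockIsom n (flB (idx lam 1 ⟨0, by omega⟩) * flB (idx lam 1 ⟨1, h⟩) : lamGroup lam) ∈ K)
    (h3 : ∀ i, lam i = 2 → blockIsom n (flB i : lamGroup lam) ∈ K) : stdQ n lam ≤ K := by
  have hsw : ∀ i j (h : lam i = lam j), lam i = 1 →
      blockIsom n (swB i j h : lamGroup lam) ∈ K := fun i j h hi =>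
    swB_mem_of_adjacent (K := K.comap (blockIsom n)) hx h hi
  refine stdQ_le n lam hsw (fun i j hij hi hj => ?_) h3
  have hm := one_lt_mult hij hi hj
  have hne : idx lam 1 ⟨0, by omega⟩ ≠ idx lam 1 ⟨1, hm⟩ := fun e => by
    have := congrArg Fin.val (idx_injective lam 1 e)
    simp at this
  obtain ⟨g, hg, e⟩ := fl_mul_fl_mem (C := {i | lam i = 1})
    (H := (K.comap (blockIsom n)).map (lamGroup lam).subtype) hne (lam_idx lam _ _)
    (fun x y hx hy => ⟨_, hsw x y (hx.trans hy.symm) hx, rfl⟩)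
    ⟨_, h2 hm, rfl⟩ hi hj
  have : g = flB i * flB j := Subtype.ext e
  exact this ▸ hg

/-- `Q` is generated by the `x_i` and `x_i y_i y_{i+1}` for the blocks of size one and the `y_j`
for the blocks of size two. If there is at most one block of size one, then the former families
are empty. -/
theorem stdQ_eq_closure :
    stdQ n lam = Subgroup.closure (xs n lam {1} ∪ xyys n lam {1} ∪ ys n lam {2}) := by
  apply le_antisymm
  · set K := Subgroup.closure (xs n lam {1} ∪ xyys n lam {1} ∪ ys n lam {2}) with hK
    have hx : ∀ i j : Fin p, j.val = i.val + 1 → ∀ h : lam i = lam j, lam i = 1 →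
        blockIsom n (swB i j h : lamGroup lam) ∈ K := fun i j hij h hi => by
      rw [← xElt_eq n lam hij h]
      exact Subgroup.subset_closure (Or.inl (Or.inl ⟨i, j, hij, h, hi, rfl⟩))
    refine stdQ_le_of_adjacent n lam hx (fun hm => ?_) fun i hi => ?_
    · have hi := lam_idx lam 1 ⟨0, by omega⟩
      have hj := lam_idx lam 1 ⟨1, hm⟩
      have h := hi.trans hj.symm
      have h1 : xElt n lam _ * yElt n lam _ * yElt n lam _ ∈ K :=
        Subgroup.subset_closure (Or.inl (Or.inr ⟨_, _, rfl, h, hi, rfl⟩))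
      rw [mul_assoc, yElt_mul_yElt_eq n lam (by rw [hi]; exact odd_one)
        (by rw [hj]; exact odd_one), xElt_eq n lam rfl h] at h1
      exact (Subgroup.mul_mem_cancel_left _ (hx _ _ rfl h hi)).1 h1
    · rw [← yElt_eq n lam (by rw [hi]; exact even_two)]
      exact Subgroup.subset_closure (Or.inr ⟨i, by rw [hi]; exact even_two, hi, rfl⟩)
  · rw [Subgroup.closure_le]
    rintro _ ((⟨i, j, hij, h, hi, rfl⟩ | ⟨i, j, hij, h, hi, rfl⟩) | ⟨j, he, hj, rfl⟩)
    · have hne : i ≠ j := by rintro rfl; omega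
      rw [xElt_eq n lam hij h]
      exact swB_mem_stdQ n lam hne h hi
    · have hne : i ≠ j := by rintro rfl; omega
      have hi' : lam i = 1 := hi
      have hj' : lam j = 1 := h ▸ hi'
      rw [mul_assoc, yElt_mul_yElt_eq n lam (by rw [hi']; exact odd_one)
        (by rw [hj']; exact odd_one), xElt_eq n lam hij h, ← map_mul]
      exact swB_mul_flB_mul_flB_mem_stdQ n lam hne h hi
    · rw [yElt_eq n lam he]
      exact flB_mem_stdQ n lam hj

/-- Generators of the group of signed permutations of the blocks of sizes in `S`. The sizes `S₁`
of the interchanges have to be right only for blocks with a neighbour of equal size. -/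
theorem map_lamSub_eq_closure {S S₁ S₂ : Set ℕ}
    (h1 : ∀ i j : Fin p, j.val = i.val + 1 → lam i = lam j → (lam i ∈ S₁ ↔ lam i ∈ S))
    (h2 : ∀ i, lam i ∈ S₂ ↔ lam i ∈ S) : (lamSub lam S).map (blockIsom n) =
      Subgroup.closure (xs n lam S₁ ∪ ys n lam S₂ ∪ zs n lam S₂) := by
  apply le_antisymm
  · rw [Subgroup.map_le_iff_le_comap]
    refine lamSub_le lam (fun i j hij h hi => ?_) fun k hk h => ?_
    · rw [Subgroup.mem_comap, ← xElt_eq n lam hij h]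
      exact Subgroup.subset_closure (Or.inl (Or.inl ⟨i, j, hij, h, (h1 i j hij h).2 hi, rfl⟩))
    · have hk' : lam (idx lam k ⟨0, h⟩) ∈ S₂ := (h2 _).2 (by rwa [lam_idx lam])
      rw [Subgroup.mem_comap]
      rcases Nat.even_or_odd (lam (idx lam k ⟨0, h⟩)) with he | ho
      · rw [← yElt_eq n lam he]
        exact Subgroup.subset_closure (Or.inl (Or.inr ⟨_, he, hk', rfl⟩))
      · rw [← zElt_eq n lam ho]
        exact Subgroup.subset_closure (Or.inr ⟨_, ho, hk', rfl⟩)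
  · rw [Subgroup.closure_le]
    rintro _ ((⟨i, j, hij, h, hi, rfl⟩ | ⟨j, he, hj, rfl⟩) | ⟨j, ho, hj, rfl⟩)
    · rw [xElt_eq n lam hij h]
      exact ⟨_, swB_mem_lamSub h ((h1 i j hij h).1 hi), rfl⟩
    · rw [yElt_eq n lam he]
      exact ⟨_, flB_mem_lamSub ((h2 j).1 hj), rfl⟩
    · rw [zElt_eq n lam ho]
      exact ⟨_, flB_mem_lamSub ((h2 j).1 hj), rfl⟩

/-- The sign change at the first of several blocks of size one, if there are several. -/
def markedFl : lamGroup lam :=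
  if h : 1 < mult lam 1 then flB (idx lam 1 ⟨0, by omega⟩) else 1

/-- The smallest index of a block of size one is the first place of `idx lam 1`. -/
theorem z0_eq : z0 n lam = blockIsom n (markedFl lam) := by
  unfold z0 markedFl
  split_ifs with h
  · have hmin : (Finset.univ.filter fun i => lam i = 1).min'
        (Finset.card_pos.mp (lt_trans Nat.zero_lt_one h)) = idx lam 1 ⟨0, by omega⟩ := by
      apply le_antisymm
      · exact Finset.min'_le _ _ (by simp [lam_idx lam])
      · refine Finset.le_min' _ _ _ fun j hj => ?_
        exact (isMarked_idx lam h).le (by simpa using hj)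
    rw [hmin, zElt_eq n lam (by rw [lam_idx lam]; exact odd_one)]
  · rw [map_one]

theorem markedFl_mem_subB : markedFl lam ∈ subB lam := by
  unfold markedFl
  split_ifs with h
  · exact flB_idx_mem_subB lam h
  · exact Subgroup.one_mem _

theorem subB_le {K : Subgroup (lamGroup lam)}
    (h1 : ∀ i j : Fin p, j.val = i.val + 1 → ∀ h : lam i = lam j, lam i = 2 → swB i j h ∈ K)
    (h2 : markedFl lam ∈ K) : subB lam ≤ K := by
  intro g hg
  rw [mem_subB] at hg
  have hmem : g.1 ∈ K.map (lamGroup lam).subtype := by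
    rw [← ofPerm_mul_ofSgn g.1]
    refine Subgroup.mul_mem _ (ofPerm_mem_of_adjacent lam (S := {2})
      (H := K.map (lamGroup lam).subtype)
      (fun i j hij h hi => ⟨_, h1 i j hij h hi, rfl⟩) g.2 fun i hi => (hg i).1 hi)
      (ofSgn_mem_of_fl_mem fun i hi => ?_)
    have hm : IsMarked lam i := by
      by_contra hm
      exact hi ((hg i).2 hm)
    refine ⟨_, h2, ?_⟩
    have h3 := hm.eq (isMarked_idx lam hm.1)
    have h4 : markedFl lam = flB i := by
      unfold markedFl
      rw [dif_pos hm.1]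
      exact congrArg flB h3.symm
    rw [h4]
    rfl
  obtain ⟨g', hg', e⟩ := hmem
  have : g' = g := Subtype.ext e
  exact this ▸ hg'

theorem map_subB_eq_closure :
    (subB lam).map (blockIsom n) = Subgroup.closure (xs n lam {2} ∪ {z0 n lam}) := by
  apply le_antisymm
  · rw [Subgroup.map_le_iff_le_comap]
    refine subB_le lam (fun i j hij h hi => ?_) ?_
    · rw [Subgroup.mem_comap, ← xElt_eq n lam hij h]
      exact Subgroup.subset_closure (Or.inl ⟨i, j, hij, h, hi, rfl⟩)
    · rw [Subgroup.mem_comap, ← z0_eq]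
      exact Subgroup.subset_closure (Or.inr rfl)
  · rw [Subgroup.closure_le]
    rintro _ (⟨i, j, hij, h, hi, rfl⟩ | rfl)
    · rw [xElt_eq n lam hij h]
      exact ⟨_, swB_mem_subB lam h hi, rfl⟩
    · rw [z0_eq]
      exact ⟨_, markedFl_mem_subB lam, rfl⟩

/-! ### The isomorphism type of `B` -/

theorem lam_extendDomain (k : ℕ) (σ : Equiv.Perm (Fin (mult lam k))) (i : Fin p) :
    lam (σ.extendDomain (idxEquiv lam k) i) = lam i := by
  by_cases hi : lam i = k
  · rw [Equiv.Perm.extendDomain_apply_subtype (p := fun i => lam i = k) _ _ hi, hi]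
    exact lam_idx lam k _
  · rw [Equiv.Perm.extendDomain_apply_not_subtype (p := fun i => lam i = k) _ _ hi]

/-- The permutations of the blocks of size `k`. -/
def permB (k : ℕ) : Equiv.Perm (Fin (mult lam k)) →* lamGroup lam where
  toFun σ := ⟨ofPerm (σ.extendDomain (idxEquiv lam k)), lam_extendDomain lam k σ⟩
  map_one' := Subtype.ext (by
    change ofPerm (Equiv.Perm.extendDomain 1 (idxEquiv lam k)) = 1
    rw [Equiv.Perm.extendDomain_one, map_one])
  map_mul' σ τ := Subtype.ext (by
    change ofPerm (Equiv.Perm.extendDomain (σ * τ) (idxEquiv lam k)) =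
      ofPerm (σ.extendDomain _) * ofPerm (τ.extendDomain _)
    rw [← map_mul, Equiv.Perm.extendDomain_mul])

theorem permB_perm_idx (k : ℕ) (σ : Equiv.Perm (Fin (mult lam k))) (r : Fin (mult lam k)) :
    (permB lam k σ).1.perm (idx lam k r) = idx lam k (σ r) :=
  Equiv.Perm.extendDomain_apply_image σ (idxEquiv lam k) r

theorem permB_perm_of_ne (k : ℕ) (σ : Equiv.Perm (Fin (mult lam k))) {i : Fin p}
    (hi : lam i ≠ k) : (permB lam k σ).1.perm i = i :=
  Equiv.Perm.extendDomain_apply_not_subtype σ (idxEquiv lam k) hi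

theorem markedFl_zpow_perm (a : lamGroup lam) (ha : a ∈ Subgroup.zpowers (markedFl lam)) :
    a.1.perm = 1 := by
  have key : Subgroup.zpowers (markedFl lam) ≤
      ((permHom _).comp (lamGroup lam).subtype).ker := by
    rw [Subgroup.zpowers_le, MonoidHom.mem_ker]
    unfold markedFl
    split_ifs <;> rfl
  exact key ha

theorem permB_mem_lamSub (σ : Equiv.Perm (Fin (mult lam 2))) : permB lam 2 σ ∈ lamSub lam {2} :=
  fun _ hi => ⟨permB_perm_of_ne lam 2 σ hi, rfl⟩

theorem commute_markedFl_permB (a : Subgroup.zpowers (markedFl lam))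
    (σ : Equiv.Perm (Fin (mult lam 2))) :
      Commute ((Subgroup.zpowers (markedFl lam)).subtype a) (permB lam 2 σ) := by
  have key : Subgroup.zpowers (markedFl lam) ≤ lamSub lam ({2}ᶜ) := by
    rw [Subgroup.zpowers_le]
    unfold markedFl
    split_ifs
    · apply flB_mem_lamSub
      rw [lam_idx lam]
      decide
    · exact Subgroup.one_mem _
  exact (commute_of_mem_lamSub (permB_mem_lamSub lam σ) (key a.2)).symm

/-- `B` as the product of the group generated by a sign change and a symmetric group. -/
def prodHom : Subgroup.zpowers (markedFl lam) × Equiv.Perm (Fin (mult lam 2)) →* lamGroup lam :=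
  MonoidHom.noncommCoprod (Subgroup.zpowers (markedFl lam)).subtype (permB lam 2)
    (commute_markedFl_permB lam)

theorem prodHom_injective : Function.Injective (prodHom lam) := by
  rw [injective_iff_map_eq_one]
  rintro ⟨a, σ⟩ h
  have h1 : a.1 * permB lam 2 σ = 1 := h
  have hσ : σ = 1 := by
    ext1 r
    apply idx_injective lam 2
    have h2 : (a.1 * permB lam 2 σ).1.perm (idx lam 2 r) = idx lam 2 r := by rw [h1]; rfl
    change a.1.1.perm ((permB lam 2 σ).1.perm (idx lam 2 r)) = _ at h2
    rw [markedFl_zpow_perm lam a.1 a.2, permB_perm_idx] at h2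
    exact h2
  rw [hσ, map_one, mul_one] at h1
  exact Prod.ext (Subtype.ext h1) hσ

theorem prodHom_range : (prodHom lam).range = subB lam := by
  unfold prodHom
  rw [MonoidHom.noncommCoprod_range, Subgroup.range_subtype]
  apply le_antisymm
  · refine sup_le ?_ ?_
    · rw [Subgroup.zpowers_le]
      exact markedFl_mem_subB lam
    · rintro _ ⟨σ, rfl⟩
      rw [mem_subB]
      exact fun i => ⟨fun hi => permB_perm_of_ne lam 2 σ hi, fun _ => rfl⟩
  · refine subB_le lam (fun i j hij h hi => ?_) (Subgroup.mem_sup_left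
      (Subgroup.mem_zpowers _))
    refine Subgroup.mem_sup_right ?_
    obtain ⟨r, rfl⟩ := exists_idx lam hi
    obtain ⟨s, rfl⟩ := exists_idx lam (h ▸ hi : lam j = 2)
    refine ⟨Equiv.swap r s, Subtype.ext ?_⟩
    change ofPerm _ = ofPerm _
    congr 1
    ext1 k
    by_cases hk : lam k = 2
    · obtain ⟨t, rfl⟩ := exists_idx lam hk
      refine (permB_perm_idx lam 2 _ t).trans ?_
      exact ((idx_injective lam 2).swap_apply r s t).symm
    · refine (permB_perm_of_ne lam 2 _ hk).trans ?_
      rw [Equiv.swap_apply_of_ne_of_ne] <;>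
      · rintro rfl
        exact hk (lam_idx lam _ _)

theorem nonempty_map_subB_mulEquiv :
    Nonempty ((subB lam).map (blockIsom n) ≃*
      Subgroup.zpowers (z0 n lam) × Equiv.Perm (Fin (mult lam 2))) := by
  have e1 : Subgroup.zpowers (markedFl lam) × Equiv.Perm (Fin (mult lam 2)) ≃* subB lam :=
    (MonoidHom.ofInjective (prodHom_injective lam)).trans
      (MulEquiv.subgroupCongr (prodHom_range lam))
  have e2 : Subgroup.zpowers (markedFl lam) ≃* Subgroup.zpowers (z0 n lam) :=
    (Subgroup.equivMapOfInjective _ _ (blockIsom_injective n)).trans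
      (MulEquiv.subgroupCongr (by rw [MonoidHom.map_zpowers, ← z0_eq]))
  exact ⟨((Subgroup.equivMapOfInjective _ _ (blockIsom_injective n)).symm.trans e1.symm).trans
    (MulEquiv.prodCongr e2 (MulEquiv.refl _))⟩

theorem nonempty_map_subB_mulEquiv_perm (h : mult lam 1 ≤ 1) :
    Nonempty ((subB lam).map (blockIsom n) ≃* Equiv.Perm (Fin (mult lam 2))) := by
  obtain ⟨e⟩ := nonempty_map_subB_mulEquiv n lam
  have hz : z0 n lam = 1 := by
    unfold z0
    rw [dif_neg (not_lt.2 h)]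
  have : Unique (Subgroup.zpowers (z0 n lam)) := by
    rw [hz, Subgroup.zpowers_one_eq_bot]
    infer_instance
  exact ⟨e.trans MulEquiv.uniqueProd⟩

end Decomposition

section General

variable {E : Type*} [NormedAddCommGroup E] [InnerProductSpace ℝ E] [FiniteDimensional ℝ E]

/-! ### Simple systems and reflection groups -/

theorem refl_sub_apply_left {a b : E} (h : ‖a‖ = ‖b‖) : refl (b - a) a = b := by
  have h1 := Submodule.reflection_sub h
  have h2 : refl (b - a) = refl (a - b) := by
    rw [← neg_sub, ← neg_one_smul ℝ, refl_smul (by norm_num)]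
  rw [h2]
  exact h1

/-- A single unit vector is a simple system of type `A_1`, and the empty family one of type `A_0`.
-/
theorem isSimpleSystem_of_subsingleton {I : Type*} [Subsingleton I] (M : CoxeterMatrix I)
    {α : I → E} (h : ∀ i, ‖α i‖ = 1) : IsSimpleSystem M α := by
  constructor
  · rcases isEmpty_or_nonempty I with hI | ⟨⟨i⟩⟩
    · exact linearIndependent_empty_type
    · have : Unique I := ⟨⟨i⟩, fun j => Subsingleton.elim j i⟩
      rw [linearIndependent_unique_iff]
      intro h0
      have h1 := h default
      rw [h0, norm_zero] at h1
      exact zero_ne_one h1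
  · intro i j
    rw [Subsingleton.elim j i, real_inner_self_eq_norm_sq, h i, cos_entry_one (M.diagonal i)]
    norm_num

theorem ActsAsCoxeterGroup.actsAsReflectionGroup {I : Type*} {G : Subgroup (E ≃ₗᵢ[ℝ] E)}
    {U : Submodule ℝ E} {M : CoxeterMatrix I} (h : ActsAsCoxeterGroup G U M) :
    ActsAsReflectionGroup G U := by
  obtain ⟨h1, -, α, hα, -, h2⟩ := h
  refine ⟨h1, le_antisymm ((Subgroup.closure_le _).2 fun t ht => ht.1) ?_⟩
  conv_lhs => rw [h2]
  rw [Subgroup.closure_le]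
  rintro _ ⟨i, rfl⟩
  refine Subgroup.subset_closure ⟨?_, α i, hα.ne_zero i, rfl⟩
  rw [h2]
  exact Subgroup.subset_closure ⟨i, rfl⟩

theorem actsAsReflectionGroup_of_forall {T : Set (E ≃ₗᵢ[ℝ] E)} {U : Submodule ℝ E}
    (h : ∀ g ∈ T, ∃ α ∈ U, α ≠ 0 ∧ ∀ u ∈ U, g u = refl α u) :
    ActsAsReflectionGroup (Subgroup.closure T) U := by
  choose! α h1 h2 h3 using h
  have := actsAsReflectionGroup_closure (U := U) (α := fun g : T => α g)
    (g := fun g : T => (g : E ≃ₗᵢ[ℝ] E)) (fun g => h1 g g.2) (fun g => h2 g g.2)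
    fun g => h3 g g.2
  rwa [Subtype.range_coe] at this

theorem linearIsometry_eqOn_span {T : Set E} {f g : E ≃ₗᵢ[ℝ] E} (h : ∀ v ∈ T, f v = g v) {v : E}
    (hv : v ∈ Submodule.span ℝ T) : f v = g v := by
  induction hv using Submodule.span_induction with
  | mem x hx => exact h x hx
  | zero => rw [map_zero, map_zero]
  | add x y _ _ hx hy => rw [map_add, map_add, hx, hy]
  | smul c x _ hx => rw [map_smul, map_smul, hx]

end General

section BlockVectors

variable (n : ℕ) {p : ℕ} (lam : Fin p → ℕ) [hL : IsLabel n lam] [hA : Fact (Antitone lam)]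

/-! ### Block permutations as reflections of the fixed space -/

/-- The block vector of the block `i`, normalized. -/
def uvec (i : Fin p) : Euc n := (√(lam i) : ℝ)⁻¹ • fvec n lam i

theorem inv_sqrt_ne_zero {k : ℕ} (h : 0 < k) : (√(k : ℝ))⁻¹ ≠ 0 := by
  have : (0 : ℝ) < k := by exact_mod_cast h
  have := Real.sqrt_pos.2 this
  positivity

theorem inner_uvec (i j : Fin p) :
    inner ℝ (uvec n lam i) (uvec n lam j) = if i = j then (1 : ℝ) else 0 := by
  unfold uvec
  rw [inner_smul_left, inner_smul_right, inner_fvec]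
  split_ifs with h
  · subst h
    have h0 : (0 : ℝ) ≤ lam i := by positivity
    have h1 : (√(lam i) : ℝ) ≠ 0 := fun e => inv_sqrt_ne_zero (hL.pos i) (by rw [e, inv_zero])
    have h2 := Real.mul_self_sqrt h0
    rw [conj_trivial]
    field_simp
    rw [sq, h2]
  · simp

theorem refl_uvec (i : Fin p) : refl (uvec n lam i) = refl (fvec n lam i) :=
  refl_smul (inv_sqrt_ne_zero (hL.pos i)) _

theorem refl_uvec_sub {i j : Fin p} (h : lam i = lam j) :
    refl (uvec n lam j - uvec n lam i) = refl (fvec n lam j - fvec n lam i) := by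
  unfold uvec
  rw [h, ← smul_sub, refl_smul (inv_sqrt_ne_zero (hL.pos j))]

theorem norm_fvec (i : Fin p) : ‖fvec n lam i‖ = √(lam i) := by
  rw [norm_eq_sqrt_real_inner, inner_fvec, if_pos rfl]

/-- On `X`, the interchange of two blocks is the reflection in the difference of their vectors. -/
theorem blockIsom_swB_apply {i j : Fin p} (h : lam i = lam j) {u : Euc n}
    (hu : u ∈ fixedSpace (stdP n lam)) :
    blockIsom n (swB i j h : lamGroup lam) u = refl (uvec n lam j - uvec n lam i) u := by
  rw [fixedSpace_stdP] at hu
  refine linearIsometry_eqOn_span ?_ hu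
  rintro _ ⟨k, rfl⟩
  have hn : ‖fvec n lam i‖ = ‖fvec n lam j‖ := by rw [norm_fvec, norm_fvec, h]
  rw [refl_uvec_sub n lam h, blockIsom_fvec]
  change (((1 : ℤˣ) : ℤ) : ℝ) • fvec n lam (Equiv.swap i j k) = _
  rw [Units.val_one, Int.cast_one, one_smul]
  by_cases hki : k = i
  · subst hki
    rw [Equiv.swap_apply_left, refl_sub_apply_left hn]
  · by_cases hkj : k = j
    · subst hkj
      rw [Equiv.swap_apply_right, ← neg_sub, ← neg_one_smul ℝ, refl_smul (by norm_num),
        refl_sub_apply_left hn.symm]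
    · rw [Equiv.swap_apply_of_ne_of_ne hki hkj, refl_apply_of_inner_eq_zero]
      rw [inner_sub_left, inner_fvec, inner_fvec, if_neg (Ne.symm hki), if_neg (Ne.symm hkj),
        sub_zero]

/-- On `X`, the sign change at a block is the reflection in its vector. -/
theorem blockIsom_flB_apply (i : Fin p) {u : Euc n} (hu : u ∈ fixedSpace (stdP n lam)) :
    blockIsom n (flB i : lamGroup lam) u = refl (uvec n lam i) u := by
  rw [fixedSpace_stdP] at hu
  refine linearIsometry_eqOn_span ?_ hu
  rintro _ ⟨k, rfl⟩
  rw [refl_uvec, blockIsom_fvec]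
  change (((Pi.mulSingle i (-1) : Fin p → ℤˣ) k : ℤ) : ℝ) • fvec n lam k = _
  by_cases hki : k = i
  · subst hki
    rw [refl_apply_self]
    simp
  · rw [refl_apply_of_inner_eq_zero, Pi.mulSingle_eq_of_ne hki]
    · simp
    · rw [inner_fvec, if_neg (Ne.symm hki)]

/-- The orthonormal family of the normalized block vectors of the blocks of size `k`. -/
def uvecs (k s : ℕ) : Euc n := if h : s < mult lam k then uvec n lam (idx lam k ⟨s, h⟩) else 0

theorem uvecs_eq {k s : ℕ} (h : s < mult lam k) :
    uvecs n lam k s = uvec n lam (idx lam k ⟨s, h⟩) := dif_pos h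

theorem orthonormalBelow_uvecs (k : ℕ) : OrthonormalBelow (mult lam k) (uvecs n lam k) := by
  intro i hi j hj
  rw [uvecs_eq n lam hi, uvecs_eq n lam hj, inner_uvec]
  have : idx lam k ⟨i, hi⟩ = idx lam k ⟨j, hj⟩ ↔ i = j :=
    (idx_injective lam k).eq_iff.trans Fin.mk_eq_mk
  simp only [this]

variable {lam} in
theorem inner_uvecs_of_ne {k k' : ℕ} (h : k ≠ k') (s t : ℕ) :
    inner ℝ (uvecs n lam k s) (uvecs n lam k' t) = 0 := by
  unfold uvecs
  split_ifs with h1 h2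
  · rw [inner_uvec, if_neg]
    intro e
    have := congrArg lam e
    rw [lam_idx lam, lam_idx lam] at this
    exact h this
  · exact inner_zero_right _
  · exact inner_zero_left _
  · exact inner_zero_left _

theorem uvecs_mem {k : ℕ} {T : Set (Fin p)} (h : ∀ i, lam i = k → i ∈ T) (s : ℕ) :
    uvecs n lam k s ∈ Submodule.span ℝ (fvec n lam '' T) := by
  unfold uvecs
  split_ifs with h1
  · exact Submodule.smul_mem _ _ (Submodule.subset_span ⟨_, h _ (lam_idx lam _ _), rfl⟩)
  · exact Submodule.zero_mem _

theorem span_fvec_le (T : Set (Fin p)) :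
    Submodule.span ℝ (fvec n lam '' T) ≤ fixedSpace (stdP n lam) := by
  rw [fixedSpace_stdP]
  exact Submodule.span_mono (Set.image_subset_range _ _)

/-! ### The simple generators of the groups of type `B` -/

variable {lam} in
theorem swB_congr {i i' j j' : Fin p} (hi : i = i') (hj : j = j') (h : lam i = lam j)
    (h' : lam i' = lam j') : (swB i j h : lamGroup lam) = swB i' j' h' := by
  subst hi hj
  rfl

/-- The simple generators of the group of signed permutations of the blocks of size `k`, in the
order of the simple roots `simpleB`. -/
def genB (k : ℕ) (r : Fin (mult lam k)) : lamGroup lam :=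
  if h : mult lam k - 1 - r.val = 0 then flB (idx lam k ⟨0, by omega⟩)
  else swB (idx lam k ⟨mult lam k - 1 - r.val - 1, by omega⟩)
    (idx lam k ⟨mult lam k - 1 - r.val - 1 + 1, by omega⟩)
    ((lam_idx lam _ _).trans (lam_idx lam _ _).symm)

theorem exists_genB_eq_flB {k : ℕ} (h : 0 < mult lam k) :
    ∃ r, genB lam k r = flB (idx lam k ⟨0, h⟩) := by
  refine ⟨⟨mult lam k - 1, by omega⟩, ?_⟩
  unfold genB
  rw [dif_pos (by simp)]

theorem exists_genB_eq_swB {k : ℕ} {i j : Fin p} (hij : j.val = i.val + 1) (h : lam i = lam j)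
    (hi : lam i = k) : ∃ r, genB lam k r = swB i j h := by
  obtain ⟨a, rfl⟩ := exists_idx lam hi
  obtain ⟨b, rfl⟩ := exists_idx lam (h ▸ hi : lam j = k)
  rw [idx_val, idx_val] at hij
  have ha := a.isLt
  have hb := b.isLt
  refine ⟨⟨mult lam k - 1 - b.val, by omega⟩, ?_⟩
  unfold genB
  rw [dif_neg (by simp only; omega)]
  apply swB_congr <;>
  · congr 1
    apply Fin.ext
    simp only
    omega

theorem genB_mem_lamSub {S : Set ℕ} {k : ℕ} (hk : k ∈ S) (r : Fin (mult lam k)) :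
    genB lam k r ∈ lamSub lam S := by
  unfold genB
  split_ifs
  · exact flB_mem_lamSub (by rwa [lam_idx lam])
  · exact swB_mem_lamSub _ (by rwa [lam_idx lam])

theorem blockIsom_genB_apply (k : ℕ) (r : Fin (mult lam k)) {u : Euc n}
    (hu : u ∈ fixedSpace (stdP n lam)) :
    blockIsom n (genB lam k r) u = refl (simpleB (mult lam k) (uvecs n lam k) r) u := by
  have hr := r.isLt
  unfold genB simpleB
  split_ifs with h
  · rw [blockIsom_flB_apply n lam _ hu, uvecs_eq]
  · rw [blockIsom_swB_apply n lam _ hu, stepRoot, refl_smul (by positivity), uvecs_eq, uvecs_eq]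

theorem closure_genB {I : Type*} {S : Set ℕ} {f : I → lamGroup lam}
    (h1 : ∀ i, f i ∈ lamSub lam S) (h2 : ∀ k ∈ S, ∀ r : Fin (mult lam k), ∃ i, f i = genB lam k r) :
    Subgroup.closure (Set.range fun i => blockIsom n (f i)) =
      (lamSub lam S).map (blockIsom n) := by
  apply le_antisymm
  · rw [Subgroup.closure_le]
    rintro _ ⟨i, rfl⟩
    exact ⟨_, h1 i, rfl⟩
  · rw [Subgroup.map_le_iff_le_comap]
    refine lamSub_le lam (fun i j hij h hi => ?_) fun k hk h => ?_
    · obtain ⟨r, hr⟩ := exists_genB_eq_swB lam hij h rfl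
      obtain ⟨x, hx⟩ := h2 _ hi r
      rw [Subgroup.mem_comap, ← hr, ← hx]
      exact Subgroup.subset_closure ⟨x, rfl⟩
    · obtain ⟨r, hr⟩ := exists_genB_eq_flB lam h
      obtain ⟨x, hx⟩ := h2 _ hk r
      rw [Subgroup.mem_comap, ← hr, ← hx]
      exact Subgroup.subset_closure ⟨x, rfl⟩

variable {n lam} in
/-- The group of signed permutations of the blocks of sizes in `S` acts faithfully on the span of
their vectors. -/
theorem eq_one_of_mem_map_lamSub {S : Set ℕ} {g : Euc n ≃ₗᵢ[ℝ] Euc n}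
    (hg : g ∈ (lamSub lam S).map (blockIsom n))
    (h : ∀ u ∈ Submodule.span ℝ (fvec n lam '' {i | lam i ∈ S}), g u = u) : g = 1 := by
  obtain ⟨k, hk, rfl⟩ := hg
  have key : ∀ i, k.1.perm i = i ∧ k.1.sgn i = 1 := by
    intro i
    by_cases hi : lam i ∈ S
    · exact (blockIsom_fvec_eq_iff n k i).1 (h _ (Submodule.subset_span ⟨i, hi, rfl⟩))
    · exact hk i hi
  have : k = 1 := by
    apply Subtype.ext
    ext1
    · exact Equiv.ext fun i => (key i).1
    · exact funext fun i => (key i).2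
  rw [this, map_one]

end BlockVectors

section Membership

variable {E : Type*} [NormedAddCommGroup E] [InnerProductSpace ℝ E] [FiniteDimensional ℝ E]

theorem stepRoot_mem {V : Submodule ℝ E} {a : ℕ} {f : ℕ → E} (h : ∀ s < a, f s ∈ V) {s : ℕ}
    (hs : s + 1 < a) : stepRoot f s ∈ V :=
  V.smul_mem _ (V.sub_mem (h _ hs) (h _ (by omega)))

theorem simpleB_mem {V : Submodule ℝ E} {a : ℕ} {f : ℕ → E} (h : ∀ s < a, f s ∈ V)
    (r : Fin a) : simpleB a f r ∈ V := by
  unfold simpleB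
  split_ifs
  · exact h _ (by omega)
  · exact stepRoot_mem h (by omega)

theorem simpleD_mem {V : Submodule ℝ E} {l : ℕ} (hl : 2 ≤ l) {f : ℕ → E} (h : ∀ s < l, f s ∈ V)
    (r : Fin l) : simpleD l f r ∈ V := by
  unfold simpleD
  split_ifs
  · exact V.smul_mem _ (V.add_mem (h _ (by omega)) (h _ (by omega)))
  · exact stepRoot_mem h (by omega)

theorem inner_simpleB_simpleB {a b : ℕ} {f g : ℕ → E}
    (h : ∀ s < a, ∀ t < b, inner ℝ (f s) (g t) = 0) (r : Fin a) (r' : Fin b) :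
    inner ℝ (simpleB a f r) (simpleB b g r') = 0 := by
  rw [← Submodule.mem_orthogonal_singleton_iff_inner_left]
  refine simpleB_mem (fun s hs => ?_) r
  rw [Submodule.mem_orthogonal_singleton_iff_inner_left,
    ← Submodule.mem_orthogonal_singleton_iff_inner_right]
  refine simpleB_mem (fun t ht => ?_) r'
  rw [Submodule.mem_orthogonal_singleton_iff_inner_right]
  exact h s hs t ht

end Membership

section TypeB

variable (n : ℕ) {p : ℕ} (lam : Fin p → ℕ) [hL : IsLabel n lam] [hA : Fact (Antitone lam)]

/-- The group of signed permutations of the blocks of sizes in `S` is of type `∏ B_{a_k}` on the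
span of their vectors. -/
theorem actsAsCoxeterGroup_typeB (S : Finset ℕ) :
    ActsAsCoxeterGroup ((lamSub lam (S : Set ℕ)).map (blockIsom n))
      (Submodule.span ℝ (fvec n lam '' {i | lam i ∈ S})) (typeB lam S) := by
  have hcl := closure_genB n lam (S := (S : Set ℕ))
    (f := fun x : Σ k : S, Fin (mult lam k) => genB lam x.1 x.2)
    (fun x => genB_mem_lamSub lam x.1.2 x.2) (fun k hk r => ⟨⟨⟨k, hk⟩, r⟩, rfl⟩)
  rw [← hcl]
  refine actsAsCoxeterGroup_closure
    (α := fun x : Σ k : S, Fin (mult lam k) =>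
      simpleB (mult lam x.1) (uvecs n lam x.1) x.2) (fun x => ?_) ?_ (fun x u hu => ?_)
      fun g hg h => ?_
  · exact simpleB_mem (fun s _ => uvecs_mem n lam (fun i hi => by
      change lam i ∈ S
      rw [hi]
      exact x.1.2) s) x.2
  · refine IsSimpleSystem.sigma (α := fun k : S => simpleB (mult lam k) (uvecs n lam k))
      (fun k => isSimpleSystem_B (orthonormalBelow_uvecs n lam k)) fun k k' h r r' => ?_
    exact inner_simpleB_simpleB
      (fun s _ t _ => inner_uvecs_of_ne n (fun e => h (Subtype.ext e)) s t) r r'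
  · exact blockIsom_genB_apply n lam _ _ (span_fvec_le n lam _ hu)
  · rw [hcl] at hg
    exact eq_one_of_mem_map_lamSub hg h

theorem actsAsCoxeterGroup_B (k : ℕ) :
    ActsAsCoxeterGroup ((lamSub lam {k}).map (blockIsom n))
      (Submodule.span ℝ (fvec n lam '' {i | lam i ∈ ({k} : Set ℕ)}))
      (CoxeterMatrix.B (mult lam k)) := by
  have hcl := closure_genB n lam (S := {k}) (f := genB lam k)
    (fun r => genB_mem_lamSub lam (Set.mem_singleton k) r) (by
      rintro _ rfl r
      exact ⟨r, rfl⟩)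
  rw [← hcl]
  refine actsAsCoxeterGroup_closure (α := simpleB (mult lam k) (uvecs n lam k)) (fun r => ?_)
    (isSimpleSystem_B (orthonormalBelow_uvecs n lam k)) (fun x u hu => ?_) fun g hg h => ?_
  · exact simpleB_mem (fun s _ => uvecs_mem n lam (fun i hi => hi) s) r
  · exact blockIsom_genB_apply n lam _ _ (span_fvec_le n lam _ hu)
  · rw [hcl] at hg
    exact eq_one_of_mem_map_lamSub hg h

theorem actsAsCoxeterGroup_B_B {k k' : ℕ} (hk : k ≠ k') :
    ActsAsCoxeterGroup ((lamSub lam {k, k'}).map (blockIsom n))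
      (Submodule.span ℝ (fvec n lam '' {i | lam i ∈ ({k, k'} : Set ℕ)}))
      (coxSum (CoxeterMatrix.B (mult lam k)) (CoxeterMatrix.B (mult lam k'))) := by
  have hcl := closure_genB n lam (S := {k, k'}) (f := Sum.elim (genB lam k) (genB lam k'))
    (by
      rintro (r | r)
      · exact genB_mem_lamSub lam (Or.inl rfl) r
      · exact genB_mem_lamSub lam (Or.inr rfl) r) (by
      rintro _ (rfl | rfl) r
      · exact ⟨Sum.inl r, rfl⟩
      · exact ⟨Sum.inr r, rfl⟩)
  rw [← hcl]
  refine actsAsCoxeterGroup_closure (α := Sum.elim (simpleB (mult lam k) (uvecs n lam k))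
    (simpleB (mult lam k') (uvecs n lam k'))) ?_ (IsSimpleSystem.sum
      (isSimpleSystem_B (orthonormalBelow_uvecs n lam k))
      (isSimpleSystem_B (orthonormalBelow_uvecs n lam k')) fun r r' => ?_) ?_ fun g hg h => ?_
  · rintro (r | r)
    · exact simpleB_mem (fun s _ => uvecs_mem n lam (fun i hi => Or.inl hi) s) r
    · exact simpleB_mem (fun s _ => uvecs_mem n lam (fun i hi => Or.inr hi) s) r
  · exact inner_simpleB_simpleB (fun s _ t _ => inner_uvecs_of_ne n hk s t) r r'
  · rintro (r | r) u hu <;> exact blockIsom_genB_apply n lam _ _ (span_fvec_le n lam _ hu)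
  · rw [hcl] at hg
    exact eq_one_of_mem_map_lamSub hg h

end TypeB

section CoxeterTypes

variable (n : ℕ) {p : ℕ} (lam : Fin p → ℕ) [hL : IsLabel n lam] [hA : Fact (Antitone lam)]

/-! ### The Coxeter type of the orthogonal complement -/

theorem uvec_of_one {i : Fin p} (hi : lam i = 1) : uvec n lam i = fvec n lam i := by
  unfold uvec
  rw [hi]
  simp

theorem blockIsom_swB_eq_refl {i j : Fin p} (hij : i ≠ j) (h : lam i = lam j) (hi : lam i = 1) :
    blockIsom n (swB i j h : lamGroup lam) = refl (uvec n lam j - uvec n lam i) := by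
  have hx := col_bpt n lam i ⟨0, hL.pos i⟩
  have hy := col_bpt n lam j ⟨0, hL.pos j⟩
  have hne : bpt n lam i ⟨0, hL.pos i⟩ ≠ bpt n lam j ⟨0, hL.pos j⟩ := fun e =>
    hij (by simpa using congrArg (col n lam) e)
  rw [refl_uvec_sub n lam h, fvec_eq_eVec n lam hi hx, fvec_eq_eVec n lam (h ▸ hi) hy, eVec_sub_eq,
    refl_eVec_add hne, swS_neg_one, ofPerm_swap_eq_Phi_swB n lam h hi hx hy, blockIsom_apply_eq]

theorem blockIsom_swB_mul_eq_refl {i j : Fin p} (hij : i ≠ j) (h : lam i = lam j)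
    (hi : lam i = 1) : blockIsom n (swB i j h * (flB i * flB j) : lamGroup lam) =
      refl (uvec n lam j + uvec n lam i) := by
  have hx := col_bpt n lam i ⟨0, hL.pos i⟩
  have hy := col_bpt n lam j ⟨0, hL.pos j⟩
  have hne : bpt n lam i ⟨0, hL.pos i⟩ ≠ bpt n lam j ⟨0, hL.pos j⟩ := fun e =>
    hij (by simpa using congrArg (col n lam) e)
  rw [uvec_of_one n lam hi, uvec_of_one n lam (h ▸ hi), fvec_eq_eVec n lam hi hx,
    fvec_eq_eVec n lam (h ▸ hi) hy, eVec_add_eq, refl_eVec_add hne, swS_one hne,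
    ofPerm_swap_eq_Phi_swB n lam h hi hx hy, fl_mul_fl_eq_Phi n lam hi (h ▸ hi) hx hy, ← map_mul,
    blockIsom_apply_eq]

theorem blockIsom_flB_eq_refl {i : Fin p} (hi : lam i = 2) :
    blockIsom n (flB i : lamGroup lam) = refl (uvec n lam i) := by
  have hx := col_bpt n lam i ⟨0, by omega⟩
  have hy := col_bpt n lam i ⟨1, by omega⟩
  have hne : bpt n lam i ⟨0, by omega⟩ ≠ bpt n lam i ⟨1, by omega⟩ := fun e => by
    have := bpt_injective n lam i e
    simp at this
  rw [refl_uvec, fvec_eq_eVec_add n lam hi hne hx hy, eVec_add_eq, refl_eVec_add hne,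
    swS_eq_Phi_flB n lam hne hi hx hy, blockIsom_apply_eq]

/-- The simple roots of type `A_1^{a_2}`, from the blocks of size two. -/
def simpleTwo (x : Σ q : (Σ k : ({2} : Finset ℕ), Fin (mult lam k)), Fin ((q.1 : ℕ) - 1)) :
    Euc n := uvec n lam (idx lam x.1.1 x.1.2)

theorem isSimpleSystem_simpleTwo : IsSimpleSystem (typeA lam {2}) (simpleTwo n lam) := by
  refine IsSimpleSystem.sigma
    (α := fun (q : Σ k : ({2} : Finset ℕ), Fin (mult lam k)) (_ : Fin ((q.1 : ℕ) - 1)) =>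
      uvec n lam (idx lam q.1 q.2)) (fun q => ?_) fun q q' h _ _ => ?_
  · have : Subsingleton (Fin ((q.1 : ℕ) - 1)) := by
      rw [Finset.mem_singleton.1 q.1.2]
      exact inferInstanceAs (Subsingleton (Fin 1))
    refine isSimpleSystem_of_subsingleton _ fun _ => ?_
    rw [norm_eq_sqrt_real_inner, inner_uvec, if_pos rfl, Real.sqrt_one]
  · rw [inner_uvec, if_neg]
    intro e
    obtain ⟨⟨k, hk⟩, r⟩ := q
    obtain ⟨⟨k', hk'⟩, r'⟩ := q'
    obtain rfl := Finset.mem_singleton.1 hk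
    obtain rfl := Finset.mem_singleton.1 hk'
    exact h (congrArg (Sigma.mk _) (idx_injective lam 2 e))

theorem simpleTwo_mem (x : Σ q : (Σ k : ({2} : Finset ℕ), Fin (mult lam k)), Fin ((q.1 : ℕ) - 1)) :
    refl (simpleTwo n lam x) ∈ stdQ n lam := by
  have h : lam (idx lam x.1.1 x.1.2) = 2 :=
    (lam_idx lam _ _).trans (Finset.mem_singleton.1 x.1.1.2)
  unfold simpleTwo
  rw [← blockIsom_flB_eq_refl n lam h]
  exact flB_mem_stdQ n lam h

theorem exists_simpleTwo_eq {i : Fin p} (hi : lam i = 2) :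
    ∃ x, simpleTwo n lam x = uvec n lam i := by
  obtain ⟨r, rfl⟩ := exists_idx lam hi
  exact ⟨⟨⟨⟨2, Finset.mem_singleton_self 2⟩, r⟩, ⟨0, by simp⟩⟩, rfl⟩

theorem isCoxeterGroupOfType_stdQ_of_le (h : mult lam 1 ≤ 1) :
    IsCoxeterGroupOfType (stdQ n lam) (typeA lam {2}) := by
  refine ⟨simpleTwo n lam, (isSimpleSystem_simpleTwo n lam).1, (isSimpleSystem_simpleTwo n lam).2,
    le_antisymm ?_ ?_⟩
  · refine stdQ_le_of_adjacent n lam (fun i j hij h' hi => ?_) (fun h' => absurd h' (not_lt.2 h))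
      fun i hi => ?_
    · have hne : i ≠ j := by rintro rfl; omega
      exact absurd (one_lt_mult hne hi (h' ▸ hi)) (not_lt.2 h)
    · obtain ⟨x, hx⟩ := exists_simpleTwo_eq n lam hi
      rw [blockIsom_flB_eq_refl n lam hi, ← hx]
      exact Subgroup.subset_closure ⟨x, rfl⟩
  · rw [Subgroup.closure_le]
    rintro _ ⟨x, rfl⟩
    exact simpleTwo_mem n lam x

/-- If there are several blocks of size one, then they contribute a component of type `D_{a_1}`. -/
theorem isCoxeterGroupOfType_stdQ_of_lt (h : 1 < mult lam 1) :
    IsCoxeterGroupOfType (stdQ n lam) (coxSum (coxD (mult lam 1)) (typeA lam {2})) := by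
  have hss : IsSimpleSystem (coxSum (coxD (mult lam 1)) (typeA lam {2}))
      (Sum.elim (simpleD (mult lam 1) (uvecs n lam 1)) (simpleTwo n lam)) := by
    refine IsSimpleSystem.sum (isSimpleSystem_D h (orthonormalBelow_uvecs n lam 1))
      (isSimpleSystem_simpleTwo n lam) fun r x => ?_
    rw [← Submodule.mem_orthogonal_singleton_iff_inner_left]
    refine simpleD_mem h (fun s hs => ?_) r
    rw [Submodule.mem_orthogonal_singleton_iff_inner_left, uvecs_eq n lam hs]
    unfold simpleTwo
    rw [inner_uvec, if_neg]
    intro e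
    have h1 := congrArg lam e
    have h2 := Finset.mem_singleton.1 x.1.1.2
    rw [lam_idx lam, lam_idx lam] at h1
    omega
  have hswB : ∀ s (hs : s + 1 < mult lam 1),
      refl (stepRoot (uvecs n lam 1) s) = blockIsom n (swB (idx lam 1 ⟨s, by omega⟩)
        (idx lam 1 ⟨s + 1, hs⟩) ((lam_idx lam _ _).trans (lam_idx lam _ _).symm)) := by
    intro s hs
    rw [stepRoot, refl_smul (by positivity), uvecs_eq, uvecs_eq, blockIsom_swB_eq_refl]
    · intro e
      have := congrArg Fin.val (idx_injective lam 1 e)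
      simp at this
    · exact lam_idx lam _ _
  have hne : idx lam 1 ⟨0, by omega⟩ ≠ idx lam 1 ⟨1, h⟩ := fun e => by
    have := congrArg Fin.val (idx_injective lam 1 e)
    simp at this
  have hplus : refl ((√2 : ℝ)⁻¹ • (uvecs n lam 1 1 + uvecs n lam 1 0)) =
      blockIsom n (swB (idx lam 1 ⟨0, by omega⟩) (idx lam 1 ⟨1, h⟩)
        ((lam_idx lam _ _).trans (lam_idx lam _ _).symm) *
        (flB (idx lam 1 ⟨0, by omega⟩) * flB (idx lam 1 ⟨1, h⟩))) := by
    rw [refl_smul (by positivity), uvecs_eq n lam h, uvecs_eq n lam (by omega : 0 < mult lam 1),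
      blockIsom_swB_mul_eq_refl n lam hne _ (lam_idx lam _ _)]
  refine ⟨_, hss.1, hss.2, le_antisymm ?_ ?_⟩
  · set K := Subgroup.closure (Set.range fun i =>
      refl (Sum.elim (simpleD (mult lam 1) (uvecs n lam 1)) (simpleTwo n lam) i)) with hK
    have hD : ∀ r, refl (simpleD (mult lam 1) (uvecs n lam 1) r) ∈ K := fun r =>
      Subgroup.subset_closure ⟨Sum.inl r, rfl⟩
    have hsw : ∀ i j : Fin p, j.val = i.val + 1 → ∀ h' : lam i = lam j, lam i = 1 →
        blockIsom n (swB i j h' : lamGroup lam) ∈ K := by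
      intro i j hij h' hi
      obtain ⟨a, rfl⟩ := exists_idx lam hi
      obtain ⟨b, rfl⟩ := exists_idx lam (h' ▸ hi : lam j = 1)
      rw [idx_val, idx_val] at hij
      have hb := b.isLt
      have h1 := hD ⟨a.val + 1, by omega⟩
      unfold simpleD at h1
      rw [if_neg (by simp), Nat.add_sub_cancel, hswB _ (by omega)] at h1
      convert h1 using 2
      apply swB_congr
      · rfl
      · congr 1
        apply Fin.ext
        simp only
        omega
    refine stdQ_le_of_adjacent n lam hsw (fun _ => ?_) fun i hi => ?_
    · have h1 := hD ⟨0, by omega⟩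
      unfold simpleD at h1
      rw [if_pos rfl, hplus, map_mul] at h1
      exact (Subgroup.mul_mem_cancel_left _ (hsw _ _ rfl _ (lam_idx lam _ _))).1 h1
    · obtain ⟨x, hx⟩ := exists_simpleTwo_eq n lam hi
      rw [blockIsom_flB_eq_refl n lam hi, ← hx]
      exact Subgroup.subset_closure ⟨Sum.inr x, rfl⟩
  · rw [Subgroup.closure_le]
    rintro _ ⟨r | x, rfl⟩
    · have hr := r.isLt
      simp only [Sum.elim_inl]
      unfold simpleD
      split_ifs with h0
      · rw [hplus]
        exact swB_mul_flB_mul_flB_mem_stdQ n lam hne _ (lam_idx lam _ _)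
      · rw [hswB _ (by omega)]
        refine swB_mem_stdQ n lam (fun e => ?_) _ (lam_idx lam _ _)
        have := congrArg Fin.val (idx_injective lam 1 e)
        simp at this
    · exact simpleTwo_mem n lam x

/-! ### The action on the orthogonal complement of the fixed space -/

/-- The standard basis vectors of the core. -/
def coreVec (v : ℕ) : Euc n := if h : v < coreRank n lam then eVec (cpt n lam ⟨v, h⟩) else 0

/-- The standard basis vectors of the block `i`. -/
def blockVec (i : Fin p) (t : ℕ) : Euc n := if h : t < lam i then eVec (bpt n lam i ⟨t, h⟩) else 0

/-- The differences of the two standard basis vectors of each block of size two, normalized. -/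
def diffs (s : ℕ) : Euc n :=
  if h : s < mult lam 2 then stepRoot (blockVec n lam (idx lam 2 ⟨s, h⟩)) 0 else 0

theorem coreVec_eq {v : ℕ} (h : v < coreRank n lam) : coreVec n lam v = eVec (cpt n lam ⟨v, h⟩) :=
  dif_pos h

theorem blockVec_eq {i : Fin p} {t : ℕ} (h : t < lam i) :
    blockVec n lam i t = eVec (bpt n lam i ⟨t, h⟩) := dif_pos h

theorem diffs_eq {s : ℕ} (h : s < mult lam 2) :
    diffs n lam s = stepRoot (blockVec n lam (idx lam 2 ⟨s, h⟩)) 0 := dif_pos h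

theorem orthonormalBelow_coreVec : OrthonormalBelow (coreRank n lam) (coreVec n lam) := by
  intro v hv w hw
  rw [coreVec_eq n lam hv, coreVec_eq n lam hw, inner_eVec, eVec_apply]
  have : cpt n lam ⟨v, hv⟩ = cpt n lam ⟨w, hw⟩ ↔ v = w :=
    (cpt_injective n lam).eq_iff.trans Fin.mk_eq_mk
  simp only [this]

theorem orthonormalBelow_blockVec (i : Fin p) :
    OrthonormalBelow (lam i) (blockVec n lam i) := by
  intro v hv w hw
  rw [blockVec_eq n lam hv, blockVec_eq n lam hw, inner_eVec, eVec_apply]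
  have : bpt n lam i ⟨v, hv⟩ = bpt n lam i ⟨w, hw⟩ ↔ v = w :=
    (bpt_injective n lam i).eq_iff.trans Fin.mk_eq_mk
  simp only [this]

/-- The vectors supported on the core or blocks in `c`; the core is encoded as `none`. -/
def supp (c : Set (Option (Fin p))) : Submodule ℝ (Euc n) where
  carrier := {v | ∀ x, col n lam x ∉ c → v x = 0}
  add_mem' {a b} ha hb x hx := by rw [PiLp.add_apply, ha x hx, hb x hx, add_zero]
  zero_mem' _ _ := rfl
  smul_mem' c v hv x hx := by rw [PiLp.smul_apply, hv x hx, smul_zero]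

variable {n lam} in
theorem inner_eq_zero_of_supp {c c' : Set (Option (Fin p))} (h : Disjoint c c') {v w : Euc n}
    (hv : v ∈ supp n lam c) (hw : w ∈ supp n lam c') : inner ℝ v w = 0 := by
  rw [inner_eq_sum]
  refine Finset.sum_eq_zero fun x _ => ?_
  by_cases hx : col n lam x ∈ c
  · rw [hw x (Set.disjoint_left.1 h hx), mul_zero]
  · rw [hv x hx, zero_mul]

theorem eVec_mem_supp {c : Set (Option (Fin p))} {x : Fin n} (h : col n lam x ∈ c) :
    eVec x ∈ supp n lam c := by
  intro y hy
  rw [eVec_apply, if_neg]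
  rintro rfl
  exact hy h

theorem coreVec_mem_supp {v : ℕ} (h : v < coreRank n lam) :
    coreVec n lam v ∈ supp n lam {none} := by
  rw [coreVec_eq n lam h]
  exact eVec_mem_supp n lam (col_cpt _ _ _)

theorem stepRoot_blockVec_mem_supp {c : Set (Option (Fin p))} {i : Fin p} (hi : some i ∈ c) {t : ℕ}
    (h : t + 1 < lam i) : stepRoot (blockVec n lam i) t ∈ supp n lam c :=
  stepRoot_mem (fun s hs => by
    rw [blockVec_eq n lam hs]
    exact eVec_mem_supp n lam (by rwa [col_bpt])) h

theorem inner_stepRoot_blockVec_of_ne {i j : Fin p} (hij : i ≠ j) {s t : ℕ} (hs : s + 1 < lam i)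
    (ht : t + 1 < lam j) :
    inner ℝ (stepRoot (blockVec n lam i) s) (stepRoot (blockVec n lam j) t) = 0 :=
  inner_eq_zero_of_supp (c := {some i}) (c' := {some j}) (by simpa using hij)
    (stepRoot_blockVec_mem_supp n lam (Set.mem_singleton _) hs)
    (stepRoot_blockVec_mem_supp n lam (Set.mem_singleton _) ht)

theorem inner_self_stepRoot_blockVec {i : Fin p} {s : ℕ} (hs : s + 1 < lam i) :
    inner ℝ (stepRoot (blockVec n lam i) s) (stepRoot (blockVec n lam i) s) = 1 := by
  rw [inner_stepRoot_stepRoot (orthonormalBelow_blockVec n lam i) hs hs, if_pos rfl]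

theorem orthonormalBelow_diffs : OrthonormalBelow (mult lam 2) (diffs n lam) := by
  intro s hs t ht
  have h1 := lam_idx lam 2 ⟨s, hs⟩
  have h2 := lam_idx lam 2 ⟨t, ht⟩
  rw [diffs_eq n lam hs, diffs_eq n lam ht]
  split_ifs with hst
  · subst hst
    exact inner_self_stepRoot_blockVec n lam (by omega)
  · refine inner_stepRoot_blockVec_of_ne n lam (fun e => hst ?_) (by omega) (by omega)
    exact congrArg Fin.val (idx_injective lam 2 e)

theorem orthogonal_fixedSpace_stdP : (fixedSpace (stdP n lam))ᗮ = Submodule.span ℝ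
    ({u | ∃ v, v < coreRank n lam ∧ u = coreVec n lam v} ∪
     {u | ∃ i t, t + 1 < lam i ∧ u = stepRoot (blockVec n lam i) t}) := by
  apply le_antisymm
  · rw [← Submodule.orthogonal_orthogonal (Submodule.span ℝ _)]
    refine Submodule.orthogonal_le fun w hw => ?_
    have hw' := fun u hu => (Submodule.mem_orthogonal _ w).1 hw u (Submodule.subset_span hu)
    rw [mem_fixedSpace_stdP]
    have hcore : ∀ v, w (cpt n lam v) = 0 := by
      intro v
      have := hw' _ (Or.inl ⟨v.val, v.isLt, rfl⟩)
      rwa [coreVec_eq n lam v.isLt, inner_eVec] at this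
    have hstep : ∀ i t (h : t + 1 < lam i),
        w (bpt n lam i ⟨t + 1, h⟩) = w (bpt n lam i ⟨t, by omega⟩) := by
      intro i t h
      have := hw' _ (Or.inr ⟨i, t, h, rfl⟩)
      rw [stepRoot, inner_smul_left, blockVec_eq n lam h,
        blockVec_eq n lam (by omega : t < lam i), inner_sub_left, inner_eVec, inner_eVec] at this
      have := (mul_eq_zero.1 this).resolve_left (by simp)
      linarith
    have hblock : ∀ i t (h : t < lam i),
        w (bpt n lam i ⟨t, h⟩) = w (bpt n lam i ⟨0, hL.pos i⟩) := by
      intro i t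
      induction t with
      | zero => exact fun h => rfl
      | succ t ih => exact fun h => (hstep i t h).trans (ih (by omega))
    constructor
    · intro x hx
      obtain ⟨v, rfl⟩ := exists_cpt n lam hx
      exact hcore v
    · intro x y hxy
      rcases hx : col n lam x with _ | i
      · obtain ⟨v, rfl⟩ := exists_cpt n lam hx
        obtain ⟨v', rfl⟩ := exists_cpt n lam (hxy ▸ hx)
        rw [hcore, hcore]
      · obtain ⟨a, rfl⟩ := exists_bpt n lam hx
        obtain ⟨b, rfl⟩ := exists_bpt n lam (hxy ▸ hx)
        exact (hblock i a a.isLt).trans (hblock i b b.isLt).symm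
  · rw [Submodule.span_le]
    intro u hu
    change u ∈ (fixedSpace (stdP n lam))ᗮ
    rw [Submodule.mem_orthogonal]
    intro w hw
    rw [mem_fixedSpace_stdP] at hw
    rw [real_inner_comm]
    rcases hu with ⟨v, hv, rfl⟩ | ⟨i, t, ht, rfl⟩
    · rw [coreVec_eq n lam hv, inner_eVec, hw.1 _ (col_cpt _ _ _)]
    · rw [stepRoot, inner_smul_left, blockVec_eq n lam ht,
        blockVec_eq n lam (by omega : t < lam i), inner_sub_left, inner_eVec, inner_eVec,
        hw.2 _ (bpt n lam i ⟨t, by omega⟩) (by simp), sub_self, mul_zero]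

theorem coreVec_mem_orthogonal {v : ℕ} (h : v < coreRank n lam) :
    coreVec n lam v ∈ (fixedSpace (stdP n lam))ᗮ := by
  rw [orthogonal_fixedSpace_stdP]
  exact Submodule.subset_span (Or.inl ⟨v, h, rfl⟩)

theorem stepRoot_blockVec_mem_orthogonal {i : Fin p} {t : ℕ} (h : t + 1 < lam i) :
    stepRoot (blockVec n lam i) t ∈ (fixedSpace (stdP n lam))ᗮ := by
  rw [orthogonal_fixedSpace_stdP]
  exact Submodule.subset_span (Or.inr ⟨i, t, h, rfl⟩)

theorem blockIsom_coreVec (g : lamGroup lam) {v : ℕ} (h : v < coreRank n lam) :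
    blockIsom n g (coreVec n lam v) =
      (((if v = 0 then blockParity g else 1 : ℤˣ) : ℤ) : ℝ) • coreVec n lam v := by
  rw [coreVec_eq n lam h, blockIsom_apply_eq, toIsom_eVec, Phi_perm_cpt, Phi_sgn_cpt]
  congr 4
  exact propext Fin.ext_iff

theorem blockIsom_blockVec {g : lamGroup lam} {i : Fin p} (hi : g.1.sgn i = 1) (t : ℕ) :
    blockIsom n g (blockVec n lam i t) = blockVec n lam (g.1.perm i) t := by
  by_cases h : t < lam i
  · have h' : t < lam (g.1.perm i) := by rwa [g.2 i]
    rw [blockVec_eq n lam h, blockVec_eq n lam h', blockIsom_apply_eq, toIsom_eVec, Phi_perm_bpt,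
      Phi_sgn_bpt, hi, Units.val_one, Int.cast_one, one_smul]
    congr 2
  · have h' : ¬ t < lam (g.1.perm i) := by rwa [g.2 i]
    unfold blockVec
    rw [dif_neg h, dif_neg h', map_zero]

theorem blockIsom_stepRoot {g : lamGroup lam} {i : Fin p} (hi : g.1.sgn i = 1) (t : ℕ) :
    blockIsom n g (stepRoot (blockVec n lam i) t) = stepRoot (blockVec n lam (g.1.perm i)) t := by
  unfold stepRoot
  rw [map_smul, map_sub, blockIsom_blockVec n lam hi, blockIsom_blockVec n lam hi]

/-- On `Xᗮ`, the interchange of two blocks of size two acts as a reflection, since each of the two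
blocks contributes only a line to `Xᗮ`. -/
theorem blockIsom_swB_apply_orthogonal {i j : Fin p} (hij : i ≠ j) (h : lam i = lam j)
    (hi : lam i = 2) {u : Euc n} (hu : u ∈ (fixedSpace (stdP n lam))ᗮ) :
    blockIsom n (swB i j h : lamGroup lam) u =
      refl (stepRoot (blockVec n lam j) 0 - stepRoot (blockVec n lam i) 0) u := by
  have hj : lam j = 2 := h ▸ hi
  rw [orthogonal_fixedSpace_stdP] at hu
  refine linearIsometry_eqOn_span ?_ hu
  have hn : ‖stepRoot (blockVec n lam i) 0‖ = ‖stepRoot (blockVec n lam j) 0‖ := by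
    rw [norm_eq_sqrt_real_inner, norm_eq_sqrt_real_inner,
      inner_self_stepRoot_blockVec n lam (by omega), inner_self_stepRoot_blockVec n lam (by omega)]
  rintro _ (⟨v, hv, rfl⟩ | ⟨k, t, ht, rfl⟩)
  · rw [blockIsom_coreVec n lam _ hv, blockParity_swB, ite_self, Units.val_one, Int.cast_one,
      one_smul, refl_apply_of_inner_eq_zero]
    refine inner_eq_zero_of_supp (c := {some i, some j}) (c' := {none}) (by simp)
      (Submodule.sub_mem _ ?_ ?_) (coreVec_mem_supp n lam hv)
    · exact stepRoot_blockVec_mem_supp n lam (Or.inr rfl) (by omega)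
    · exact stepRoot_blockVec_mem_supp n lam (Or.inl rfl) (by omega)
  · rw [blockIsom_stepRoot n lam rfl]
    change stepRoot (blockVec n lam (Equiv.swap i j k)) t = _
    by_cases hki : k = i
    · subst hki
      obtain rfl : t = 0 := by omega
      rw [Equiv.swap_apply_left, refl_sub_apply_left hn]
    · by_cases hkj : k = j
      · subst hkj
        obtain rfl : t = 0 := by omega
        rw [Equiv.swap_apply_right, ← neg_sub, ← neg_one_smul ℝ, refl_smul (by norm_num),
          refl_sub_apply_left hn.symm]
      · rw [Equiv.swap_apply_of_ne_of_ne hki hkj, refl_apply_of_inner_eq_zero]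
        rw [inner_sub_left, inner_stepRoot_blockVec_of_ne n lam (Ne.symm hkj) (by omega) ht,
          inner_stepRoot_blockVec_of_ne n lam (Ne.symm hki) (by omega) ht, sub_zero]

/-- On `Xᗮ`, the sign change at a block of size one acts as the sign change of the first
coordinate, since the block does not contribute to `Xᗮ`, whereas the parity forces a sign change
in the core. -/
theorem blockIsom_markedFl_apply_orthogonal (hm : 1 < mult lam 1) {u : Euc n}
    (hu : u ∈ (fixedSpace (stdP n lam))ᗮ) :
    blockIsom n (markedFl lam) u = refl (coreVec n lam 0) u := by
  have hl := two_le_coreRank n lam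
  have he : markedFl lam = flB (idx lam 1 ⟨0, by omega⟩) := by
    unfold markedFl
    rw [dif_pos hm]
  rw [he]
  rw [orthogonal_fixedSpace_stdP] at hu
  refine linearIsometry_eqOn_span ?_ hu
  rintro _ (⟨v, hv, rfl⟩ | ⟨k, t, ht, rfl⟩)
  · rw [blockIsom_coreVec n lam _ hv, blockParity_flB, lam_idx lam]
    by_cases h0 : v = 0
    · subst h0
      rw [refl_apply_self]
      simp
    · rw [if_neg h0, refl_apply_of_inner_eq_zero]
      · simp
      · rw [orthonormalBelow_coreVec n lam 0 (by omega) v hv, if_neg (Ne.symm h0)]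
  · have hk : k ≠ idx lam 1 ⟨0, by omega⟩ := by
      intro e
      rw [e, lam_idx lam] at ht
      omega
    rw [blockIsom_stepRoot n lam (Pi.mulSingle_eq_of_ne hk _), refl_apply_of_inner_eq_zero]
    · rfl
    · exact inner_eq_zero_of_supp (c := {none}) (c' := {some k}) (by simp)
        (coreVec_mem_supp n lam (by omega))
        (stepRoot_blockVec_mem_supp n lam (Set.mem_singleton _) ht)

end CoxeterTypes

section ParabolicExtension

variable (n : ℕ) {p : ℕ} (lam : Fin p → ℕ) [hL : IsLabel n lam] [hA : Fact (Antitone lam)]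

/-! ### Reflections of the standard parabolic subgroup -/

theorem refl_stepRoot_coreVec {s : ℕ} (h : s + 1 < coreRank n lam) :
    refl (stepRoot (coreVec n lam) s) =
      toIsom (ofPerm (Equiv.swap (cpt n lam ⟨s, by omega⟩) (cpt n lam ⟨s + 1, h⟩))) := by
  rw [stepRoot, refl_smul (by positivity), coreVec_eq n lam h,
    coreVec_eq n lam (by omega : s < coreRank n lam), eVec_sub_eq, refl_eVec_add, swS_neg_one]
  intro e
  have := congrArg Fin.val (cpt_injective n lam e)
  simp at this

theorem refl_coreVec_add : refl ((√2 : ℝ)⁻¹ • (coreVec n lam 1 + coreVec n lam 0)) =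
    toIsom (swS (cpt n lam 0) (cpt n lam ⟨1, two_le_coreRank n lam⟩) 1) := by
  have hl := two_le_coreRank n lam
  rw [refl_smul (by positivity), coreVec_eq n lam (by omega : 1 < coreRank n lam),
    coreVec_eq n lam (by omega : 0 < coreRank n lam), eVec_add_eq, refl_eVec_add]
  · rfl
  · intro e
    have := congrArg Fin.val (cpt_injective n lam e)
    simp at this

theorem refl_stepRoot_blockVec {i : Fin p} {t : ℕ} (h : t + 1 < lam i) :
    refl (stepRoot (blockVec n lam i) t) =
      toIsom (ofPerm (Equiv.swap (bpt n lam i ⟨t, by omega⟩) (bpt n lam i ⟨t + 1, h⟩))) := by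
  rw [stepRoot, refl_smul (by positivity), blockVec_eq n lam h,
    blockVec_eq n lam (by omega : t < lam i), eVec_sub_eq, refl_eVec_add, swS_neg_one]
  intro e
  have := congrArg Fin.val (bpt_injective n lam i e)
  simp at this

theorem ofPerm_swap_mem_stdP {x y : Fin n} (h : x ≠ y) (hc : col n lam x = col n lam y) :
    toIsom (ofPerm (Equiv.swap x y)) ∈ stdP n lam := by
  rw [← swS_neg_one, toIsom_mem_stdP, swS_mem_parabolicPerm n lam h]
  exact ⟨hc, Or.inl rfl⟩

theorem refl_stepRoot_coreVec_mem {s : ℕ} (h : s + 1 < coreRank n lam) :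
    refl (stepRoot (coreVec n lam) s) ∈ stdP n lam := by
  rw [refl_stepRoot_coreVec n lam h]
  refine ofPerm_swap_mem_stdP n lam (fun e => ?_) (by simp)
  have := congrArg Fin.val (cpt_injective n lam e)
  simp at this

theorem refl_coreVec_add_mem :
    refl ((√2 : ℝ)⁻¹ • (coreVec n lam 1 + coreVec n lam 0)) ∈ stdP n lam := by
  rw [refl_coreVec_add, toIsom_mem_stdP, swS_mem_parabolicPerm n lam]
  · exact ⟨by simp, Or.inr (by simp)⟩
  · intro e
    have := congrArg Fin.val (cpt_injective n lam e)
    simp at this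

theorem refl_stepRoot_blockVec_mem {i : Fin p} {t : ℕ} (h : t + 1 < lam i) :
    refl (stepRoot (blockVec n lam i) t) ∈ stdP n lam := by
  rw [refl_stepRoot_blockVec n lam h]
  refine ofPerm_swap_mem_stdP n lam (fun e => ?_) (by simp)
  have := congrArg Fin.val (bpt_injective n lam i e)
  simp at this

/-- The reflections in the simple roots, except that the blocks of size two contribute one
reflection and the interchanges of neighbouring blocks, generate `PB`. -/
theorem stdP_sup_map_subB_le {K : Subgroup (Euc n ≃ₗᵢ[ℝ] Euc n)}
    (hc : ∀ s, s + 1 < coreRank n lam → refl (stepRoot (coreVec n lam) s) ∈ K)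
    (hp : refl ((√2 : ℝ)⁻¹ • (coreVec n lam 1 + coreVec n lam 0)) ∈ K)
    (hb : ∀ i t, 3 ≤ lam i → t + 1 < lam i → refl (stepRoot (blockVec n lam i) t) ∈ K)
    (hd : ∀ h : 0 < mult lam 2, refl (stepRoot (blockVec n lam (idx lam 2 ⟨0, h⟩)) 0) ∈ K)
    (hx : ∀ i j : Fin p, j.val = i.val + 1 → ∀ h : lam i = lam j, lam i = 2 →
      blockIsom n (swB i j h : lamGroup lam) ∈ K)
    (hm : blockIsom n (markedFl lam) ∈ K) :
    stdP n lam ⊔ (subB lam).map (blockIsom n) ≤ K := by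
  refine sup_le ?_ ?_
  · rw [stdP_eq_map, Subgroup.map_le_iff_le_comap]
    have hstep : ∀ i t, t + 1 < lam i → refl (stepRoot (blockVec n lam i) t) ∈ K := by
      intro i t ht
      by_cases h3 : 3 ≤ lam i
      · exact hb i t h3 ht
      · have hi : lam i = 2 := by omega
        obtain rfl : t = 0 := by omega
        obtain ⟨r, rfl⟩ := exists_idx lam hi
        have h0 : 0 < mult lam 2 := lt_of_le_of_lt (Nat.zero_le _) r.isLt
        have h1 : blockIsom n (swB (idx lam 2 ⟨0, h0⟩) (idx lam 2 r)
            ((lam_idx lam _ _).trans hi.symm)) ∈ K :=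
          swB_mem_of_adjacent (K := K.comap (blockIsom n)) hx _ (lam_idx lam _ _)
        -- the reflection of the first block of size two is carried to the others by interchanges
        have h2 := refl_map_mem h1 (hd h0)
        rw [blockIsom_stepRoot n lam rfl] at h2
        change refl (stepRoot (blockVec n lam (Equiv.swap _ _ _)) 0) ∈ K at h2
        rwa [Equiv.swap_apply_left] at h2
    -- adjacent transpositions generate the symmetric groups on the core and on the blocks
    have hcore : ∀ v w, ofPerm (Equiv.swap (cpt n lam v) (cpt n lam w)) ∈ K.comap toIsom := by
      refine swap_mem_of_chain (cpt_injective n lam) fun s hs => ?_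
      rw [Subgroup.mem_comap, ← refl_stepRoot_coreVec n lam hs]
      exact hc s hs
    have hblock : ∀ i v w, ofPerm (Equiv.swap (bpt n lam i v) (bpt n lam i w)) ∈
        K.comap toIsom := by
      intro i
      refine swap_mem_of_chain (bpt_injective n lam i) fun s hs => ?_
      rw [Subgroup.mem_comap, ← refl_stepRoot_blockVec n lam hs]
      exact hstep i s hs
    refine parabolicPerm_le n lam (fun x y _ hxy => ?_) fun x y _ hx' hy' => ?_
    · rcases hcx : col n lam x with _ | i
      · obtain ⟨v, rfl⟩ := exists_cpt n lam hcx
        obtain ⟨w, rfl⟩ := exists_cpt n lam (hxy ▸ hcx)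
        exact hcore v w
      · obtain ⟨v, rfl⟩ := exists_bpt n lam hcx
        obtain ⟨w, rfl⟩ := exists_bpt n lam (hxy ▸ hcx)
        exact hblock i v w
    · have hne : cpt n lam 0 ≠ cpt n lam ⟨1, two_le_coreRank n lam⟩ := fun e => by
        have := congrArg Fin.val (cpt_injective n lam e)
        simp at this
      refine fl_mul_fl_mem (C := {x | col n lam x = none}) hne (col_cpt _ _ _)
        (fun x y hx hy => ?_) ?_ hx' hy'
      · obtain ⟨v, rfl⟩ := exists_cpt n lam hx
        obtain ⟨w, rfl⟩ := exists_cpt n lam hy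
        exact hcore v w
      · rw [refl_coreVec_add, swS_one hne, map_mul] at hp
        have h1 := hcore 0 ⟨1, two_le_coreRank n lam⟩
        rw [Subgroup.mem_comap] at h1 ⊢
        exact (K.mul_mem_cancel_left h1).1 hp
  · rw [Subgroup.map_le_iff_le_comap]
    exact subB_le lam hx hm

/-- `PB` acts faithfully on the orthogonal complement of the fixed space of `P`. -/
theorem eq_one_of_mem_stdP_sup {g : Euc n ≃ₗᵢ[ℝ] Euc n}
    (hg : g ∈ stdP n lam ⊔ (subB lam).map (blockIsom n))
    (h : ∀ u ∈ (fixedSpace (stdP n lam))ᗮ, g u = u) : g = 1 := by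
  obtain ⟨x, hx, _, ⟨b, hb, rfl⟩, rfl⟩ :=
    mem_sup_of_normalizes (isSemidirect_stdP_map n lam _).1 hg
  -- an element acting trivially on the roots of `P` lies in the Howlett complement
  have hN : x * blockIsom n b ∈ normalizerIn (WD n) (stdP n lam) :=
    Subgroup.mul_mem _ ⟨stdP_le_WD n lam hx, Subgroup.le_normalizer hx⟩
      (blockIsom_mem_normalizerIn n b)
  have hfix : ∀ α ∈ posRoots (stdP n lam) (stdRho n), (x * blockIsom n b) α = α := by
    intro α hα
    apply h
    rw [Submodule.mem_orthogonal]
    intro u hu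
    rw [real_inner_comm]
    refine inner_eq_zero_of_refl_apply_eq (fun h0 => ?_) (hu _ hα.1.2)
    have := hα.1.1
    rw [h0, norm_zero] at this
    exact zero_ne_one this
  have hH : x * blockIsom n b ∈
      howlettComplement (stdP n lam) (normalizerIn (WD n) (stdP n lam)) (stdRho n) := by
    refine ⟨hN, fun α => ⟨fun hα => ?_, fun hα => ?_⟩⟩
    · have := (x * blockIsom n b).injective (hfix _ hα)
      rwa [this] at hα
    · rwa [hfix α hα]
  rw [howlettComplement_stdP] at hH
  have hx1 : x ∈ stdP n lam ⊓ (⊤ : Subgroup (lamGroup lam)).map (blockIsom n) := by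
    refine ⟨hx, ?_⟩
    rw [← MonoidHom.range_eq_map]
    have hbr : blockIsom n b ∈
        (blockIsom n : lamGroup lam →* (Euc n ≃ₗᵢ[ℝ] Euc n)).range := ⟨b, rfl⟩
    exact (Subgroup.mul_mem_cancel_right _ hbr).1 hH
  rw [stdP_inf_map, Subgroup.mem_bot] at hx1
  rw [hx1, one_mul] at h ⊢
  have hl := two_le_coreRank n lam
  have hB := mem_subB.1 hb
  -- `b` fixes `e_1`, so its parity is even, and it fixes the roots of the blocks of size two
  have hb1 : b ∈ subQ lam ⊓ subB lam := by
    refine ⟨⟨hb.2, ?_, ?_⟩, hb⟩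
    · have h1 := h _ (coreVec_mem_orthogonal n lam (by omega : 0 < coreRank n lam))
      rw [blockIsom_coreVec n lam b (by omega), if_pos rfl] at h1
      have h2 : ((blockParity b : ℤ) : ℝ) = 1 := by
        have h3 := congrArg (fun v : Euc n => v (cpt n lam ⟨0, by omega⟩)) h1
        simpa [coreVec_eq n lam (by omega : 0 < coreRank n lam), eVec_apply] using h3
      rcases Int.units_eq_one_or (blockParity b) with e | e
      · exact e
      · rw [e] at h2
        norm_num at h2
    · change (permHom _).comp (resHom lam 2) b = 1
      ext1 r
      apply idx_injective lam 2
      refine (resHom_perm lam b 2 r).trans ?_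
      have hr := lam_idx lam 2 r
      have hm : ¬ IsMarked lam (idx lam 2 r) := fun hm => by
        have := hm.2.1
        omega
      have h1 := h _ (stepRoot_blockVec_mem_orthogonal n lam (by omega : 0 + 1 < lam (idx lam 2 r)))
      rw [blockIsom_stepRoot n lam ((hB _).2 hm)] at h1
      change b.1.perm (idx lam 2 r) = idx lam 2 r
      by_contra hne
      have h2 := inner_stepRoot_blockVec_of_ne n lam (s := 0) (t := 0) hne
        (by rw [b.2, hr]; norm_num) (by rw [hr]; norm_num)
      rw [h1, inner_self_stepRoot_blockVec n lam (by omega)] at h2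
      exact one_ne_zero h2
  rw [subQ_inf_subB, Subgroup.mem_bot] at hb1
  rw [hb1, map_one]

/-! ### The Coxeter type of `PB` -/

/-- The elements of `PB` that act like the simple reflections of type `B_{a_2}` on the orthogonal
complement of the fixed space of `P`. -/
def genTwo (r : Fin (mult lam 2)) : Euc n ≃ₗᵢ[ℝ] Euc n :=
  if h : mult lam 2 - 1 - r.val = 0 then refl (diffs n lam 0)
  else blockIsom n (swB (idx lam 2 ⟨mult lam 2 - 1 - r.val - 1, by omega⟩)
    (idx lam 2 ⟨mult lam 2 - 1 - r.val - 1 + 1, by omega⟩)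
    ((lam_idx lam _ _).trans (lam_idx lam _ _).symm))

theorem genTwo_apply (r : Fin (mult lam 2)) {u : Euc n} (hu : u ∈ (fixedSpace (stdP n lam))ᗮ) :
    genTwo n lam r u = refl (simpleB (mult lam 2) (diffs n lam) r) u := by
  have hr := r.isLt
  unfold genTwo simpleB
  split_ifs with h
  · rfl
  · have hs : stepRoot (diffs n lam) (mult lam 2 - 1 - r.val - 1) = (√2 : ℝ)⁻¹ •
        (diffs n lam (mult lam 2 - 1 - r.val - 1 + 1) -
          diffs n lam (mult lam 2 - 1 - r.val - 1)) := rfl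
    rw [hs, refl_smul (by positivity),
      diffs_eq n lam (by omega : mult lam 2 - 1 - r.val - 1 + 1 < _),
      diffs_eq n lam (by omega : mult lam 2 - 1 - r.val - 1 < _),
      blockIsom_swB_apply_orthogonal n lam _ _ (lam_idx lam _ _) hu]
    intro e
    have := congrArg Fin.val (idx_injective lam 2 e)
    simp at this

theorem genTwo_mem (r : Fin (mult lam 2)) :
    genTwo n lam r ∈ stdP n lam ⊔ (subB lam).map (blockIsom n) := by
  have hr := r.isLt
  unfold genTwo
  split_ifs with h
  · rw [diffs_eq n lam (by omega : 0 < mult lam 2)]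
    exact Subgroup.mem_sup_left (refl_stepRoot_blockVec_mem n lam (by rw [lam_idx lam]; norm_num))
  · exact Subgroup.mem_sup_right ⟨_, swB_mem_subB lam _ (lam_idx lam _ _), rfl⟩

theorem exists_genTwo_eq_refl (h : 0 < mult lam 2) :
    ∃ r, genTwo n lam r = refl (stepRoot (blockVec n lam (idx lam 2 ⟨0, h⟩)) 0) := by
  refine ⟨⟨mult lam 2 - 1, by omega⟩, ?_⟩
  unfold genTwo
  rw [dif_pos (by simp), diffs_eq n lam h]

theorem exists_genTwo_eq_blockIsom {i j : Fin p} (hij : j.val = i.val + 1) (h : lam i = lam j)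
    (hi : lam i = 2) : ∃ r, genTwo n lam r = blockIsom n (swB i j h) := by
  obtain ⟨a, rfl⟩ := exists_idx lam hi
  obtain ⟨b, rfl⟩ := exists_idx lam (h ▸ hi : lam j = 2)
  rw [idx_val, idx_val] at hij
  have ha := a.isLt
  have hb := b.isLt
  refine ⟨⟨mult lam 2 - 1 - b.val, by omega⟩, ?_⟩
  unfold genTwo
  rw [dif_neg (by simp only; omega)]
  congr 1
  apply swB_congr <;>
  · congr 1
    apply Fin.ext
    simp only
    omega

theorem diffs_mem {V : Submodule ℝ (Euc n)}
    (h : ∀ i, lam i = 2 → stepRoot (blockVec n lam i) 0 ∈ V) :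
    ∀ s < mult lam 2, diffs n lam s ∈ V := by
  intro s hs
  rw [diffs_eq n lam hs]
  exact h _ (lam_idx lam _ _)

/-- The simple roots of the types `A_{k-1}`, from the blocks of sizes `k ∈ S`. -/
def simpleBlocks (S : Finset ℕ)
    (x : Σ q : (Σ k : S, Fin (mult lam k)), Fin ((q.1 : ℕ) - 1)) : Euc n :=
  simpleA x.1.1 (blockVec n lam (idx lam x.1.1 x.1.2)) x.2

theorem lt_of_fin_sub_one {k i : ℕ} (h : i = k) (t : Fin (k - 1)) : t.val + 1 < i := by
  have := t.isLt
  omega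

theorem isSimpleSystem_simpleBlocks (S : Finset ℕ) :
    IsSimpleSystem (typeA lam S) (simpleBlocks n lam S) := by
  refine IsSimpleSystem.sigma
    (α := fun (q : Σ k : S, Fin (mult lam k)) => simpleA q.1 (blockVec n lam (idx lam q.1 q.2)))
    (fun q => ?_) fun q q' h t t' => ?_
  · have := orthonormalBelow_blockVec n lam (idx lam q.1 q.2)
    rw [lam_idx lam] at this
    exact isSimpleSystem_A this
  · refine inner_stepRoot_blockVec_of_ne n lam (fun e => h ?_)
      (lt_of_fin_sub_one (lam_idx lam _ _) t) (lt_of_fin_sub_one (lam_idx lam _ _) t')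
    obtain ⟨⟨k, hk⟩, r⟩ := q
    obtain ⟨⟨k', hk'⟩, r'⟩ := q'
    have h1 := congrArg lam e
    rw [lam_idx lam, lam_idx lam] at h1
    obtain rfl : k = k' := h1
    exact congrArg (Sigma.mk _) (idx_injective lam k e)

theorem simpleBlocks_mem {S : Finset ℕ} {V : Submodule ℝ (Euc n)}
    (h : ∀ i t, lam i ∈ S → t + 1 < lam i → stepRoot (blockVec n lam i) t ∈ V)
    (x : Σ q : (Σ k : S, Fin (mult lam k)), Fin ((q.1 : ℕ) - 1)) : simpleBlocks n lam S x ∈ V :=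
  h _ _ (by rw [lam_idx lam]; exact x.1.1.2) (lt_of_fin_sub_one (lam_idx lam _ _) x.2)

theorem refl_simpleBlocks_mem {S : Finset ℕ}
    (x : Σ q : (Σ k : S, Fin (mult lam k)), Fin ((q.1 : ℕ) - 1)) :
    refl (simpleBlocks n lam S x) ∈ stdP n lam :=
  refl_stepRoot_blockVec_mem n lam (lt_of_fin_sub_one (lam_idx lam _ _) x.2)

theorem exists_simpleBlocks_eq {S : Finset ℕ} {i : Fin p} (hi : lam i ∈ S) {t : ℕ}
    (ht : t + 1 < lam i) : ∃ x, simpleBlocks n lam S x = stepRoot (blockVec n lam i) t := by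
  obtain ⟨r, hr⟩ := exists_idx lam (rfl : lam i = lam i)
  refine ⟨⟨⟨⟨lam i, hi⟩, r⟩, ⟨t, by simp only; omega⟩⟩, ?_⟩
  change stepRoot (blockVec n lam (idx lam (lam i) r)) t = _
  rw [← hr]

/-- The simple systems of the blocks of size at least two, in which the blocks of size two form a
diagram of type `B_{a_2}`. -/
theorem isSimpleSystem_diffs_simpleBlocks (m : ℕ) :
    IsSimpleSystem (coxSum (CoxeterMatrix.B (mult lam 2)) (typeA lam (Finset.Icc 3 m)))
      (Sum.elim (simpleB (mult lam 2) (diffs n lam)) (simpleBlocks n lam (Finset.Icc 3 m))) := by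
  refine IsSimpleSystem.sum (isSimpleSystem_B (orthonormalBelow_diffs n lam))
    (isSimpleSystem_simpleBlocks n lam _) fun r x => ?_
  refine inner_eq_zero_of_supp (n := n) (lam := lam) (c := {c | ∃ i, lam i = 2 ∧ c = some i})
    (c' := {c | ∃ i, 3 ≤ lam i ∧ c = some i}) ?_ ?_ ?_
  · rw [Set.disjoint_left]
    rintro _ ⟨i, hi, rfl⟩ ⟨j, hj, e⟩
    obtain rfl := Option.some_inj.1 e
    omega
  · exact simpleB_mem (diffs_mem n lam fun i hi =>
      stepRoot_blockVec_mem_supp n lam (c := {c | ∃ i, lam i = 2 ∧ c = some i}) ⟨i, hi, rfl⟩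
        (by omega)) r
  · exact simpleBlocks_mem n lam (fun i t hi ht =>
      stepRoot_blockVec_mem_supp n lam (c := {c | ∃ i, 3 ≤ lam i ∧ c = some i})
        ⟨i, (Finset.mem_Icc.1 hi).1, rfl⟩ ht) x

theorem diffs_simpleBlocks_mem_supp {m : ℕ}
    (x : Fin (mult lam 2) ⊕
      (Σ q : (Σ k : (Finset.Icc 3 m : Finset ℕ), Fin (mult lam k)), Fin ((q.1 : ℕ) - 1))) :
    Sum.elim (simpleB (mult lam 2) (diffs n lam)) (simpleBlocks n lam (Finset.Icc 3 m)) x ∈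
      supp n lam {none}ᶜ := by
  rcases x with r | x
  · exact simpleB_mem (diffs_mem n lam fun i hi =>
      stepRoot_blockVec_mem_supp n lam (by simp) (by omega)) r
  · exact simpleBlocks_mem n lam (fun i t hi ht =>
      stepRoot_blockVec_mem_supp n lam (by simp) ht) x

theorem diffs_simpleBlocks_mem_orthogonal {m : ℕ}
    (x : Fin (mult lam 2) ⊕
      (Σ q : (Σ k : (Finset.Icc 3 m : Finset ℕ), Fin (mult lam k)), Fin ((q.1 : ℕ) - 1))) :
    Sum.elim (simpleB (mult lam 2) (diffs n lam)) (simpleBlocks n lam (Finset.Icc 3 m)) x ∈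
      (fixedSpace (stdP n lam))ᗮ := by
  rcases x with r | x
  · exact simpleB_mem (diffs_mem n lam fun i hi =>
      stepRoot_blockVec_mem_orthogonal n lam (by omega)) r
  · exact simpleBlocks_mem n lam (fun i t hi ht => stepRoot_blockVec_mem_orthogonal n lam ht) x

/-- The type of `PB` in terms of the type `M` of the group generated by the contribution of the
core. -/
theorem actsAsCoxeterGroup_stdP_sup {I : Type*} {M : CoxeterMatrix I} {α : I → Euc n}
    {g : I → Euc n ≃ₗᵢ[ℝ] Euc n} {m : ℕ} (hlam : ∀ i, lam i ≤ m) (hM : IsSimpleSystem M α)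
    (hα : ∀ i, α i ∈ (fixedSpace (stdP n lam))ᗮ) (hα' : ∀ i, α i ∈ supp n lam {none})
    (hg : ∀ i, g i ∈ stdP n lam ⊔ (subB lam).map (blockIsom n))
    (hg' : ∀ i, ∀ u ∈ (fixedSpace (stdP n lam))ᗮ, g i u = refl (α i) u)
    (hc : ∀ s, s + 1 < coreRank n lam →
      refl (stepRoot (coreVec n lam) s) ∈ Subgroup.closure (Set.range g))
    (hp : refl ((√2 : ℝ)⁻¹ • (coreVec n lam 1 + coreVec n lam 0)) ∈
      Subgroup.closure (Set.range g))
    (hm : blockIsom n (markedFl lam) ∈ Subgroup.closure (Set.range g)) :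
    ActsAsCoxeterGroup (stdP n lam ⊔ (subB lam).map (blockIsom n)) (fixedSpace (stdP n lam))ᗮ
      (coxSum M (coxSum (CoxeterMatrix.B (mult lam 2)) (typeA lam (Finset.Icc 3 m)))) := by
  set G := Sum.elim g (Sum.elim (genTwo n lam)
    (fun x => refl (simpleBlocks n lam (Finset.Icc 3 m) x))) with hG
  have hle : Subgroup.closure (Set.range g) ≤ Subgroup.closure (Set.range G) := by
    apply Subgroup.closure_mono
    rintro _ ⟨i, rfl⟩
    exact ⟨Sum.inl i, rfl⟩
  have hcl : stdP n lam ⊔ (subB lam).map (blockIsom n) = Subgroup.closure (Set.range G) := by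
    apply le_antisymm
    · refine stdP_sup_map_subB_le n lam (fun s hs => hle (hc s hs)) (hle hp)
        (fun i t h3 ht => ?_) (fun h => ?_) (fun i j hij h hi => ?_) (hle hm)
      · obtain ⟨x, hx⟩ := exists_simpleBlocks_eq n lam
          (Finset.mem_Icc.2 ⟨h3, hlam i⟩ : lam i ∈ Finset.Icc 3 m) ht
        rw [← hx]
        exact Subgroup.subset_closure ⟨Sum.inr (Sum.inr x), rfl⟩
      · obtain ⟨r, hr⟩ := exists_genTwo_eq_refl n lam h
        rw [← hr]
        exact Subgroup.subset_closure ⟨Sum.inr (Sum.inl r), rfl⟩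
      · obtain ⟨r, hr⟩ := exists_genTwo_eq_blockIsom n lam hij h hi
        rw [← hr]
        exact Subgroup.subset_closure ⟨Sum.inr (Sum.inl r), rfl⟩
    · rw [Subgroup.closure_le]
      rintro _ ⟨i | r | x, rfl⟩
      · exact hg i
      · exact genTwo_mem n lam r
      · exact Subgroup.mem_sup_left (refl_simpleBlocks_mem n lam x)
  have hfaith := fun k => eq_one_of_mem_stdP_sup n lam (g := k)
  rw [hcl] at hfaith ⊢
  refine actsAsCoxeterGroup_closure (α := Sum.elim α (Sum.elim (simpleB (mult lam 2)
    (diffs n lam)) (simpleBlocks n lam (Finset.Icc 3 m)))) ?_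
    (hM.sum (isSimpleSystem_diffs_simpleBlocks n lam m) fun i x => ?_) ?_ hfaith
  · rintro (i | x)
    · exact hα i
    · exact diffs_simpleBlocks_mem_orthogonal n lam x
  · exact inner_eq_zero_of_supp disjoint_compl_right (hα' i) (diffs_simpleBlocks_mem_supp n lam x)
  · rintro (i | r | x) u hu
    · exact hg' i u hu
    · exact genTwo_apply n lam r hu
    · rfl

/-- If there is at most one block of size one, then the core contributes type `D_l`. -/
theorem actsAsCoxeterGroup_stdP_sup_of_le {m : ℕ} (hlam : ∀ i, lam i ≤ m) (h : mult lam 1 ≤ 1) :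
    ActsAsCoxeterGroup (stdP n lam ⊔ (subB lam).map (blockIsom n)) (fixedSpace (stdP n lam))ᗮ
      (coxSum (coxD (coreRank n lam))
        (coxSum (CoxeterMatrix.B (mult lam 2)) (typeA lam (Finset.Icc 3 m)))) := by
  have hl := two_le_coreRank n lam
  have hmem : ∀ r, refl (simpleD (coreRank n lam) (coreVec n lam) r) ∈ Subgroup.closure
      (Set.range fun r => refl (simpleD (coreRank n lam) (coreVec n lam) r)) :=
    fun r => Subgroup.subset_closure ⟨r, rfl⟩
  refine actsAsCoxeterGroup_stdP_sup n lam hlam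
    (isSimpleSystem_D hl (orthonormalBelow_coreVec n lam))
    (g := fun r => refl (simpleD (coreRank n lam) (coreVec n lam) r))
    (simpleD_mem hl fun s hs => coreVec_mem_orthogonal n lam hs)
    (simpleD_mem hl fun s hs => coreVec_mem_supp n lam hs) (fun r => Subgroup.mem_sup_left ?_)
    (fun _ _ _ => rfl) (fun s hs => ?_) ?_ ?_
  · have hr := r.isLt
    unfold simpleD
    split_ifs with h0
    · exact refl_coreVec_add_mem n lam
    · exact refl_stepRoot_coreVec_mem n lam (by omega)
  · have := hmem ⟨s + 1, hs⟩
    conv at this =>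
      enter [2]
      unfold simpleD
    simpa using this
  · have := hmem ⟨0, by omega⟩
    conv at this =>
      enter [2]
      unfold simpleD
    simpa using this
  · unfold markedFl
    rw [dif_neg (not_lt.2 h), map_one]
    exact Subgroup.one_mem _

/-- The generators of `PB` that act like the simple reflections of type `B_l` with respect to the
core. -/
def genCore (r : Fin (coreRank n lam)) : Euc n ≃ₗᵢ[ℝ] Euc n :=
  if coreRank n lam - 1 - r.val = 0 then blockIsom n (markedFl lam)
  else refl (stepRoot (coreVec n lam) (coreRank n lam - 1 - r.val - 1))

/-- If there are several blocks of size one, then `z_0` extends the contribution of the core to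
type `B_l`. -/
theorem actsAsCoxeterGroup_stdP_sup_of_lt {m : ℕ} (hlam : ∀ i, lam i ≤ m) (h : 1 < mult lam 1) :
    ActsAsCoxeterGroup (stdP n lam ⊔ (subB lam).map (blockIsom n)) (fixedSpace (stdP n lam))ᗮ
      (coxSum (CoxeterMatrix.B (coreRank n lam))
        (coxSum (CoxeterMatrix.B (mult lam 2)) (typeA lam (Finset.Icc 3 m)))) := by
  have hl := two_le_coreRank n lam
  have hz : blockIsom n (markedFl lam) ∈ Subgroup.closure (Set.range (genCore n lam)) := by
    refine Subgroup.subset_closure ⟨⟨coreRank n lam - 1, by omega⟩, ?_⟩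
    unfold genCore
    rw [if_pos (by simp)]
  have hstep : ∀ s, s + 1 < coreRank n lam →
      refl (stepRoot (coreVec n lam) s) ∈ Subgroup.closure (Set.range (genCore n lam)) := by
    intro s hs
    refine Subgroup.subset_closure ⟨⟨coreRank n lam - 1 - (s + 1), by omega⟩, ?_⟩
    unfold genCore
    rw [if_neg (by simp only; omega)]
    congr 2
    simp only
    omega
  refine actsAsCoxeterGroup_stdP_sup n lam hlam
    (isSimpleSystem_B (orthonormalBelow_coreVec n lam)) (g := genCore n lam)
    (simpleB_mem fun s hs => coreVec_mem_orthogonal n lam hs)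
    (simpleB_mem fun s hs => coreVec_mem_supp n lam hs) (fun r => ?_)
    (fun r u hu => ?_) hstep ?_ hz
  · have hr := r.isLt
    unfold genCore
    split_ifs with h0
    · exact Subgroup.mem_sup_right ⟨_, markedFl_mem_subB lam, rfl⟩
    · exact Subgroup.mem_sup_left (refl_stepRoot_coreVec_mem n lam (by omega))
  · unfold genCore simpleB
    split_ifs with h0
    · exact blockIsom_markedFl_apply_orthogonal n lam h hu
    · rfl
  · -- the sign change of the first coordinate turns `e_2 - e_1` into `e_2 + e_1`
    have h1 := refl_map_mem hz (hstep 0 (by omega))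
    rw [blockIsom_markedFl_apply_orthogonal n lam h
      (stepRoot_mem (fun s hs => coreVec_mem_orthogonal n lam hs) (by omega : 0 + 1 < _)), stepRoot,
      map_smul, map_sub, refl_apply_self, sub_neg_eq_add, refl_apply_of_inner_eq_zero] at h1
    · exact h1
    · rw [orthonormalBelow_coreVec n lam 0 (by omega) 1 (by omega), if_neg (by norm_num)]

/-! ### `B` as a reflection group -/

theorem stepRoot_sub_ne_zero {i j : Fin p} (hij : i ≠ j) (hi : lam i = 2) (hj : lam j = 2) :
    stepRoot (blockVec n lam j) 0 - stepRoot (blockVec n lam i) 0 ≠ 0 := by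
  intro h
  have h1 := inner_stepRoot_blockVec_of_ne n lam hij (s := 0) (t := 0) (by omega) (by omega)
  rw [sub_eq_zero.1 h, inner_self_stepRoot_blockVec n lam (by omega)] at h1
  exact one_ne_zero h1

/-- `B` acts as a reflection group on `U` if its generators do; if there is at most one block of
size one, then `z_0 = 1` is discarded. -/
theorem actsAsReflectionGroup_of_xElt_z0 {U : Submodule ℝ (Euc n)}
    (hx : ∀ i j : Fin p, i ≠ j → ∀ h : lam i = lam j, lam i = 2 →
      ∃ α ∈ U, α ≠ 0 ∧ ∀ u ∈ U, blockIsom n (swB i j h : lamGroup lam) u = refl α u)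
    (hz : 1 < mult lam 1 → ∃ α ∈ U, α ≠ 0 ∧ ∀ u ∈ U, blockIsom n (markedFl lam) u = refl α u) :
    ActsAsReflectionGroup ((subB lam).map (blockIsom n)) U := by
  have hx' : ∀ g ∈ xs n lam {2}, ∃ α ∈ U, α ≠ 0 ∧ ∀ u ∈ U, g u = refl α u := by
    rintro _ ⟨i, j, hij, h, hi, rfl⟩
    have hne : i ≠ j := by rintro rfl; omega
    rw [xElt_eq n lam hij h]
    exact hx i j hne h hi
  rw [map_subB_eq_closure]
  by_cases hm : 1 < mult lam 1
  · refine actsAsReflectionGroup_of_forall ?_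
    rintro g (hg | rfl)
    · exact hx' g hg
    · rw [z0_eq]
      exact hz hm
  · have h1 : z0 n lam = 1 := by
      unfold z0
      rw [dif_neg hm]
    rw [h1, Set.union_singleton, Subgroup.closure_insert_one]
    exact actsAsReflectionGroup_of_forall hx'

theorem uvec_ne_zero (i : Fin p) : uvec n lam i ≠ 0 := by
  intro h
  have := inner_uvec n lam i i
  rw [h, inner_zero_left, if_pos rfl] at this
  exact zero_ne_one this

theorem actsAsReflectionGroup_subB_orthogonal_stdQ :
    ActsAsReflectionGroup ((subB lam).map (blockIsom n)) (fixedSpace (stdQ n lam))ᗮ := by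
  rw [orthogonal_fixedSpace_stdQ]
  have hmem : ∀ i, lam i ∉ sizesA lam → uvec n lam i ∈
      Submodule.span ℝ (fvec n lam '' {i | lam i ∉ sizesA lam}) := fun i hi =>
    Submodule.smul_mem _ _ (Submodule.subset_span ⟨i, hi, rfl⟩)
  refine actsAsReflectionGroup_of_xElt_z0 n lam (fun i j hij h hi => ?_) fun hm => ?_
  · refine ⟨uvec n lam j - uvec n lam i, Submodule.sub_mem _
      (hmem j (notMem_sizesA.2 (Or.inl (h ▸ hi)))) (hmem i (notMem_sizesA.2 (Or.inl hi))),
      fun h0 => ?_, fun u hu => blockIsom_swB_apply n lam h (span_fvec_le n lam _ hu)⟩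
    have h1 := inner_uvec n lam i j
    rw [if_neg hij, ← sub_eq_zero.1 h0, inner_uvec, if_pos rfl] at h1
    exact one_ne_zero h1
  · have he : markedFl lam = flB (idx lam 1 ⟨0, by omega⟩) := by
      unfold markedFl
      rw [dif_pos hm]
    rw [he]
    exact ⟨_, hmem _ (notMem_sizesA.2 (Or.inr ⟨lam_idx lam _ _, hm⟩)), uvec_ne_zero n lam _,
      fun u hu => blockIsom_flB_apply n lam _ (span_fvec_le n lam _ hu)⟩

theorem actsAsReflectionGroup_subB_orthogonal_stdP :
    ActsAsReflectionGroup ((subB lam).map (blockIsom n)) (fixedSpace (stdP n lam))ᗮ := by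
  have hl := two_le_coreRank n lam
  refine actsAsReflectionGroup_of_xElt_z0 n lam (fun i j hij h hi => ?_) fun hm => ?_
  · have hj : lam j = 2 := h ▸ hi
    exact ⟨_, Submodule.sub_mem _ (stepRoot_blockVec_mem_orthogonal n lam (by omega))
      (stepRoot_blockVec_mem_orthogonal n lam (by omega)), stepRoot_sub_ne_zero n lam hij hi hj,
      fun u hu => blockIsom_swB_apply_orthogonal n lam hij h hi hu⟩
  · refine ⟨_, coreVec_mem_orthogonal n lam (by omega : 0 < coreRank n lam), fun h0 => ?_,
      fun u hu => blockIsom_markedFl_apply_orthogonal n lam hm hu⟩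
    have h1 := orthonormalBelow_coreVec n lam 0 (by omega) 0 (by omega)
    rw [h0, inner_zero_left, if_pos rfl] at h1
    exact zero_ne_one h1

end ParabolicExtension

section Assembly

variable (n : ℕ) {p : ℕ} (lam : Fin p → ℕ) [hL : IsLabel n lam] [hA : Fact (Antitone lam)]

/-! ### Howlett complements of parabolic subgroups with a given label -/

variable {lam} in
theorem lamSub_congr {S T : Set ℕ} (h : ∀ i, lam i ∈ S ↔ lam i ∈ T) :
    lamSub lam S = lamSub lam T := by
  ext g
  change (∀ i, lam i ∉ S → _) ↔ ∀ i, lam i ∉ T → _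
  exact forall_congr' fun i => by rw [h i]

/-- The Howlett complement of a parabolic subgroup with label `lam` is a complement, and is
isomorphic to the group of all signed permutations of the blocks. -/
theorem howlettComplement_of_hasLabel {P : Subgroup (Euc n ≃ₗᵢ[ℝ] Euc n)}
    (hP : HasLabel n lam P) {ρ : Euc n} (hρ : IsRegularVec P ρ) {S : Finset ℕ}
    (hS : ∀ i, lam i ∈ S) :
    IsSemidirect (normalizerIn (WD n) P) P (howlettComplement P (normalizerIn (WD n) P) ρ) ∧
      Nonempty (howlettComplement P (normalizerIn (WD n) P) ρ ≃* ProdWB lam S) := by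
  obtain ⟨x, hx, hPx, hH⟩ := exists_conj_of_hasLabel n lam hP hρ
  have hinj : Function.Injective (MulAut.conj x).toMonoidHom := (MulAut.conj x).injective
  constructor
  · rw [hH, hPx, normalizerIn_conjBy hx]
    exact (isSemidirect_stdP n lam).map _ hinj
  · rw [hH]
    obtain ⟨e⟩ := nonempty_map_lamSub_mulEquiv lam n S
    have h1 : (lamSub lam (S : Set ℕ)).map (blockIsom n) =
        howlettComplement (stdP n lam) (normalizerIn (WD n) (stdP n lam)) (stdRho n) := by
      rw [howlettComplement_stdP, lamSub_eq_top lam hS, MonoidHom.range_eq_map]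
    rw [h1] at e
    exact ⟨(Subgroup.equivMapOfInjective _ _ hinj).symm.trans e⟩

/-! ### The two cases `a_1 ≤ 1` and `a_1 > 1` -/

variable {lam} in
theorem mem_sizesA_iff_of_le (h : mult lam 1 ≤ 1) (i : Fin p) : lam i ∈ sizesA lam ↔ lam i ≠ 2 :=
  ⟨fun hi => hi.1, fun hi => ⟨hi, fun _ => h⟩⟩

variable {lam} in
theorem mem_sizesA_iff_of_lt (hpos : ∀ i, 0 < lam i) (h : 1 < mult lam 1) (i : Fin p) :
    lam i ∈ sizesA lam ↔ 2 < lam i := by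
  have := hpos i
  constructor
  · rintro ⟨h1, h2⟩
    have h3 : lam i ≠ 1 := fun e => absurd (h2 e) (not_le.2 h)
    omega
  · intro hi
    exact ⟨by omega, by omega⟩

variable {lam} in
theorem lam_ne_one_of_adjacent (h : mult lam 1 ≤ 1) {i j : Fin p} (hij : j.val = i.val + 1)
    (hlam : lam i = lam j) : lam i ≠ 1 := by
  intro hi
  have hne : i ≠ j := by
    rintro rfl
    omega
  exact absurd (one_lt_mult hne hi (hlam ▸ hi)) (not_lt.2 h)

theorem stdQ_eq_closure_of_le (h : mult lam 1 ≤ 1) :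
    stdQ n lam = Subgroup.closure (ys n lam {2}) := by
  have hx : xs n lam {1} = ∅ := by
    rw [Set.eq_empty_iff_forall_notMem]
    rintro _ ⟨i, j, hij, hlam, hi, -⟩
    exact lam_ne_one_of_adjacent h hij hlam hi
  have hxy : xyys n lam {1} = ∅ := by
    rw [Set.eq_empty_iff_forall_notMem]
    rintro _ ⟨i, j, hij, hlam, hi, -⟩
    exact lam_ne_one_of_adjacent h hij hlam hi
  rw [stdQ_eq_closure, hx, hxy, Set.empty_union, Set.empty_union]

theorem map_subB_eq_closure_of_le (h : mult lam 1 ≤ 1) :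
    (subB lam).map (blockIsom n) = Subgroup.closure (xs n lam {2}) := by
  have hz : z0 n lam = 1 := by
    unfold z0
    rw [dif_neg (not_lt.2 h)]
  rw [map_subB_eq_closure, hz, Set.union_singleton, Subgroup.closure_insert_one]

theorem nonempty_map_sizesA_mulEquiv {S : Finset ℕ} (h : ∀ i, lam i ∈ sizesA lam ↔ lam i ∈ S) :
    Nonempty ((lamSub lam (sizesA lam)).map (blockIsom n) ≃* ProdWB lam S) := by
  rw [lamSub_congr (T := (S : Set ℕ)) h]
  exact nonempty_map_lamSub_mulEquiv lam n S

theorem actsAsCoxeterGroup_sizesA {S : Finset ℕ} (h : ∀ i, lam i ∈ sizesA lam ↔ lam i ∈ S) :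
    ActsAsCoxeterGroup ((lamSub lam (sizesA lam)).map (blockIsom n))
      (fixedSpace (stdP n lam) ⊓ fixedSpace (stdQ n lam)) (typeB lam S) := by
  have hset : {i | lam i ∈ sizesA lam} = {i | lam i ∈ S} := Set.ext h
  rw [lamSub_congr (T := (S : Set ℕ)) h, fixedSpace_inf_fixedSpace, hset]
  exact actsAsCoxeterGroup_typeB n lam S

theorem actsAsCoxeterGroup_stdQ_sup_of_le (h : mult lam 1 ≤ 1) :
    ActsAsCoxeterGroup (stdQ n lam ⊔ (subB lam).map (blockIsom n)) (fixedSpace (stdQ n lam))ᗮ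
      (CoxeterMatrix.B (mult lam 2)) := by
  have hiff : ∀ i, lam i ∈ (sizesA lam)ᶜ ↔ lam i ∈ ({2} : Set ℕ) := fun i => by
    rw [Set.mem_compl_iff, mem_sizesA_iff_of_le h, not_not, Set.mem_singleton_iff]
  have hset : {i | lam i ∉ sizesA lam} = {i | lam i ∈ ({2} : Set ℕ)} := Set.ext hiff
  rw [stdQ_sup_map_subB, lamSub_congr hiff, orthogonal_fixedSpace_stdQ, hset]
  exact actsAsCoxeterGroup_B n lam 2

theorem actsAsCoxeterGroup_stdQ_sup_of_lt (h : 1 < mult lam 1) :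
    ActsAsCoxeterGroup (stdQ n lam ⊔ (subB lam).map (blockIsom n)) (fixedSpace (stdQ n lam))ᗮ
      (coxSum (CoxeterMatrix.B (mult lam 1)) (CoxeterMatrix.B (mult lam 2))) := by
  have hiff : ∀ i, lam i ∈ (sizesA lam)ᶜ ↔ lam i ∈ ({1, 2} : Set ℕ) := fun i => by
    have := hL.pos i
    rw [Set.mem_compl_iff, mem_sizesA_iff_of_lt hL.pos h, Set.mem_insert_iff,
      Set.mem_singleton_iff]
    omega
  have hset : {i | lam i ∉ sizesA lam} = {i | lam i ∈ ({1, 2} : Set ℕ)} := Set.ext hiff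
  rw [stdQ_sup_map_subB, lamSub_congr hiff, orthogonal_fixedSpace_stdQ, hset]
  exact actsAsCoxeterGroup_B_B n lam (by norm_num)

end Assembly

end ReflGrp

end

theorem mainTheorem10 (n p m : ℕ) (lam : Fin p → ℕ) (hanti : Antitone lam)
    (hpos : ∀ i, 0 < lam i) (hsum : ∑ i, lam i = m) (hm : m + 1 < n) :
    (∀ P : Subgroup (Euc n ≃ₗᵢ[ℝ] Euc n), HasLabel n lam P →
      IsParabolic (WD n) P ∧
      ∀ ρ : Euc n, IsRegularVec P ρ →
        IsSemidirect (normalizerIn (WD n) P) P (howlettComplement P (normalizerIn (WD n) P) ρ) ∧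
        Nonempty (howlettComplement P (normalizerIn (WD n) P) ρ ≃*
          ProdWB lam (Finset.Icc 1 m))) ∧
    (∀ W P N Q A B : Subgroup (Euc n ≃ₗᵢ[ℝ] Euc n), ∀ X Y : Submodule ℝ (Euc n),
     ∀ (a : ℕ → ℕ) (l : ℕ),
     W = WD n → P = stdP n lam → N = normalizerIn W P → Q = orthComplement W P →
     A = groupA W P (stdRho n) → B = groupB W P (stdRho n) →
     X = fixedSpace P → Y = fixedSpace Q → a = mult lam → l = n - m →
     IsRegularVec (P ⊔ Q) (stdRho n) ∧
     IsSemidirect (P ⊔ A) P A ∧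
     IsDirect (P ⊔ A ⊔ Q) (P ⊔ A) Q ∧
     IsSemidirect N (P ⊔ A ⊔ Q) B ∧
     IsSemidirect (Q ⊔ B) Q B ∧
     IsSemidirect (P ⊔ B) P B ∧
     (a 1 ≤ 1 →
       Q = Subgroup.closure (ys n lam {2}) ∧
       IsCoxeterGroupOfType Q (typeA lam {2}) ∧
       A = Subgroup.closure (xs n lam {k | 2 < k} ∪ ys n lam {k | k ≠ 2} ∪ zs n lam {k | k ≠ 2}) ∧
       Nonempty (A ≃* ProdWB lam ((Finset.Icc 1 m).erase 2)) ∧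
       ActsAsCoxeterGroup A (X ⊓ Y) (typeB lam ((Finset.Icc 1 m).erase 2)) ∧
       B = Subgroup.closure (xs n lam {2}) ∧
       Nonempty (B ≃* Equiv.Perm (Fin (a 2))) ∧
       ActsAsCoxeterGroup (Q ⊔ B) Yᗮ (CoxeterMatrix.B (a 2)) ∧
       ActsAsCoxeterGroup (P ⊔ B) Xᗮ
         (coxSum (coxD l) (coxSum (CoxeterMatrix.B (a 2)) (typeA lam (Finset.Icc 3 m))))) ∧
     (1 < a 1 →
       Q = Subgroup.closure (xs n lam {1} ∪ xyys n lam {1} ∪ ys n lam {2}) ∧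
       IsCoxeterGroupOfType Q (coxSum (coxD (a 1)) (typeA lam {2})) ∧
       A = Subgroup.closure (xs n lam {k | 2 < k} ∪ ys n lam {k | 2 < k} ∪ zs n lam {k | 2 < k}) ∧
       Nonempty (A ≃* ProdWB lam (Finset.Icc 3 m)) ∧
       ActsAsCoxeterGroup A (X ⊓ Y) (typeB lam (Finset.Icc 3 m)) ∧
       B = Subgroup.closure (xs n lam {2} ∪ {z0 n lam}) ∧
       Nonempty (B ≃* Subgroup.zpowers (z0 n lam) × Equiv.Perm (Fin (a 2))) ∧
       ActsAsCoxeterGroup (Q ⊔ B) Yᗮ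
         (coxSum (CoxeterMatrix.B (a 1)) (CoxeterMatrix.B (a 2))) ∧
       ActsAsCoxeterGroup (P ⊔ B) Xᗮ
         (coxSum (CoxeterMatrix.B l)
           (coxSum (CoxeterMatrix.B (a 2)) (typeA lam (Finset.Icc 3 m))))) ∧
     ActsAsReflectionGroup A (X ⊓ Y) ∧
     ActsAsReflectionGroup B Yᗮ ∧
     ActsAsReflectionGroup B Xᗮ) := by
  subst hsum
  have : IsLabel n lam := ⟨hpos, hm⟩
  have : Fact (Antitone lam) := ⟨hanti⟩
  have hle : ∀ i, lam i ≤ ∑ i, lam i := fun i =>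
    Finset.single_le_sum (fun _ _ => Nat.zero_le _) (Finset.mem_univ i)
  refine ⟨fun P hP => ⟨isParabolic_of_hasLabel n lam hP, fun ρ hρ =>
    howlettComplement_of_hasLabel n lam hP hρ fun i => Finset.mem_Icc.2 ⟨hpos i, hle i⟩⟩, ?_⟩
  rintro W P N Q A B X Y a l rfl rfl rfl rfl rfl rfl rfl rfl rfl rfl
  change IsRegularVec (_ ⊔ stdQ n lam) _ ∧ _
  have hcase_le : mult lam 1 ≤ 1 → ∀ i,
      lam i ∈ sizesA lam ↔ lam i ∈ (Finset.Icc 1 (∑ i, lam i)).erase 2 := fun h i => by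
    rw [mem_sizesA_iff_of_le h, Finset.mem_erase, Finset.mem_Icc]
    exact ⟨fun hi => ⟨hi, hpos i, hle i⟩, fun hi => hi.1⟩
  have hcase_lt : 1 < mult lam 1 → ∀ i,
      lam i ∈ sizesA lam ↔ lam i ∈ Finset.Icc 3 (∑ i, lam i) := fun h i => by
    rw [mem_sizesA_iff_of_lt hpos h, Finset.mem_Icc]
    exact ⟨fun hi => ⟨hi, hle i⟩, fun hi => hi.1⟩
  rw [groupA_stdP, groupB_stdP]
  refine ⟨isRegularVec_stdRho (sup_le (stdP_le_WD n lam) (stdQ_le_WD n lam)),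
    isSemidirect_stdP_map n lam _, isDirect_stdQ n lam, isSemidirect_normalizerIn n lam,
    isSemidirect_stdQ_map_subB n lam, isSemidirect_stdP_map n lam _,
    fun h => ⟨stdQ_eq_closure_of_le n lam h, isCoxeterGroupOfType_stdQ_of_le n lam h,
      map_lamSub_eq_closure n lam (fun i j hij hlam => ?_)
        (fun i => (mem_sizesA_iff_of_le h i).symm),
      nonempty_map_sizesA_mulEquiv n lam (hcase_le h),
      actsAsCoxeterGroup_sizesA n lam (hcase_le h), map_subB_eq_closure_of_le n lam h,
      nonempty_map_subB_mulEquiv_perm n lam h, actsAsCoxeterGroup_stdQ_sup_of_le n lam h,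
      actsAsCoxeterGroup_stdP_sup_of_le n lam hle h⟩,
    fun h => ⟨stdQ_eq_closure n lam, isCoxeterGroupOfType_stdQ_of_lt n lam h,
      map_lamSub_eq_closure n lam (fun i _ _ _ => (mem_sizesA_iff_of_lt hpos h i).symm)
        (fun i => (mem_sizesA_iff_of_lt hpos h i).symm),
      nonempty_map_sizesA_mulEquiv n lam (hcase_lt h),
      actsAsCoxeterGroup_sizesA n lam (hcase_lt h), map_subB_eq_closure n lam,
      nonempty_map_subB_mulEquiv n lam, actsAsCoxeterGroup_stdQ_sup_of_lt n lam h,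
      actsAsCoxeterGroup_stdP_sup_of_lt n lam hle h⟩,
    ?_, actsAsReflectionGroup_subB_orthogonal_stdQ n lam,
    actsAsReflectionGroup_subB_orthogonal_stdP n lam⟩
  · have h1 := lam_ne_one_of_adjacent h hij hlam
    have h2 := hpos i
    rw [mem_sizesA_iff_of_le h]
    change 2 < lam i ↔ _
    omega
  · rcases le_or_gt (mult lam 1) 1 with h | h
    · exact (actsAsCoxeterGroup_sizesA n lam (hcase_le h)).actsAsReflectionGroup
    · exact (actsAsCoxeterGroup_sizesA n lam (hcase_lt h)).actsAsReflectionGroup
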